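/- **Setting.** A weight term over set variables $Z_1,\dots,Z_\ell$ is $t=a+\sum_{i,j}a_{ij}\,w_i(Z_j)$, interpreted in a vertex-colored graph $G$ with weight functions $w_i^G:V(G)\to\mathbb N$ by $t^G(\bar W)=a+\sum_{i,j}a_{ij}\sum_{v\in W_j}w_i^G(v)$. A number is $\gamma$-granular if it is $a/\gamma$ with $a\in\mathbb N$; a term is $\gamma$-granular if all its coefficients are. A signature $\sigma$ is a finite set of symbols among the edge relation, colors, and $\mathrm{card}_{a,r}$ ($a<r$, $r\ge 2$; meaning $|X|\equiv a \bmod r$); its size $|\sigma|$ is the number of its symbols, where $\mathrm{card}_{a,r}$ counts $r$ times. $\mathrm{CMSO}_1(\sigma,q,\bar Z)$ is the finite set of normalized (disjunctive normal form at every quantifier depth, without repetitions) $\mathrm{CMSO}_1$-formulas over $\sigma$ of quantifier rank at most $q$ with free set variables $\bar Z$. For $\alpha>1$ and positive $N,\gamma\in\mathbb N$ let $$\tilde{\mathbb N}_{\alpha,N,\gamma}=\bigl([0,N]\cap\{\lceil\alpha^j\rceil/\gamma,\ \lfloor\alpha^j\rfloor/\gamma : j\in\mathbb N\}\bigr)\cup\{0,N\}.$$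 Let $\tau_1,\tau_2$ be finite families of $\gamma$-granular weight terms over $\bar X$ and over $\bar X\bar Y$. The approximate table $\tilde T=\tilde T_{\alpha,N,\gamma}(\sigma,q,\bar X,\bar Y,\tau_1,\tau_2)$ is the set of all formulas $$\omega(\bar X)=\bigwedge_{t\in\tau_1}\bigl(t\le g_{t,\le}\wedge t\ge g_{t,\ge}\bigr)\ \wedge\bigwedge_{t\in\tau_2}\ \bigwedge_{\psi\in\mathrm{CMSO}_1(\sigma,q,\bar X\bar Y)}\forall\bar Y\,\Bigl(\psi\vee\bigl(t\le g_{t,\psi,\le}\wedge t\ge g_{t,\psi,\ge}\bigr)\Bigr)$$ whose thresholds $g$ all lie in $\tilde{\mathbb N}_{\alpha,N,\gamma}$. A tuple $\bar W$ $\alpha$-oversatisfies (respectively $\alpha$-undersatisfies) $\omega$ in $G$ if it satisfies the formula obtained from $\omega$ by replacing each comparison $t\le g$ by $\alpha t\le\frac1\alpha g$ and each $t\ge g$ by $\frac1\alpha t\ge\alpha g$ (respectively $t\le g$ by $\frac1\alpha t\le\alpha g$ and $t\ge g$ by $\alpha t\ge\frac1\alpha g$). For a weight term $\hat t(\bar X)$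 with integer coefficients, $\mathrm{oversatisfy}(G,\omega,\hat t,\alpha)$ is the maximum of $\hat t^G(\bar W)$ over all $\bar W\in\mathcal P(V(G))^{|\bar X|}$ that $\alpha$-oversatisfy $\omega$ in $G$, and $-\infty$ if there are none. A $k$-expression builds a graph from single vertices, each with at most one of $k$ labels, by disjoint unions, relabelings $i\to j$, and insertions of all edges between two distinct labels; its depth is the maximal number of nested operations (a single vertex has depth $0$), and its size $|\chi|$ is its number of nodes, single vertices included. **Theorem.** There are an algorithm and a computable function $f:\mathbb N^4\to\mathbb N$ such that the following holds. Let the input consist of * an approximate table $\tilde T=\tilde T_{1+\frac1b,N,\gamma}(\sigma,q,\bar X,\bar Y,\tau_1,\tau_2)$ with positive $b,N,\gamma\in\mathbb N$ and $\gamma$-granular $\tau_1,\tau_2$ (given by these parameters), * an optimization target $\hat t(\bar X)$ with integer coefficients, and * a graph $G$ with a $k$-expression $\chi$ of $G$ of depth $d$, where at most $|\bar X\bar Y|$ weight functions are used. Then the algorithm outputs (as an explicit table of values) a function $\mathrm{witness}_G:\tilde T\to\mathcal P(V(G))^{|\bar X|}\cup\{\bot\}$ such that for all $\omega\in\tilde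 T$, with $\hat t(\bot):=-\infty$, * $\mathrm{oversatisfy}\bigl(G,\omega,\hat t,(1+\frac1b)^d\bigr)\le\hat t(\mathrm{witness}_G(\omega))$, and * if $\mathrm{witness}_G(\omega)\ne\bot$, then $\mathrm{witness}_G(\omega)$ $(1+\frac1b)^d$-undersatisfies $\omega$ in $G$. Its running time, counted in elementary steps with unit cost for one arithmetic operation or comparison on integers, is at most $$|\chi|\cdot f(|\sigma|,k,q,|\bar X\bar Y|)\cdot\bigl|\tilde{\mathbb N}_{1+\frac1b,\,N,\,\gamma\cdot(b(b+1))^{4d^2+4d}}\bigr|^{\,3|\tau_1|+|\tau_2|\cdot f(|\sigma|,k,q,|\bar X\bar Y|)} .$$ -/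

import Mathlib

noncomputable section

namespace ApproxMSO

/-! ### Weight terms and graphs -/

/-- A weight term `a + ∑ i j, a_ij * w_i(X_j)` with `p` weight symbols `w_i`, `l` set variables
`X_j` and coefficients in `R`. -/
structure WTerm (R : Type) (p l : ℕ) where
  const : R
  coeff : Fin p → Fin l → R

/-- The term all of whose coefficients vanish except for the constant one. -/
def WTerm.ofConst {p l : ℕ} (a : ℝ) : WTerm ℝ p l := ⟨a, fun _ _ => 0⟩

/-- The multiplication of a weight term by a number scales all coefficients. -/
def WTerm.scale {p l : ℕ} (α : ℝ) (t : WTerm ℝ p l) : WTerm ℝ p l :=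
  ⟨α * t.const, fun i j => α * t.coeff i j⟩

/-- A number has granularity `γ` if it is of the form `a / γ` with `a` a natural number. -/
def Granular (γ : ℕ) (x : ℝ) : Prop := ∃ a : ℕ, x = a / γ

/-- A weight term has granularity `γ` if all its coefficients have. -/
def WTerm.IsGranular {p l : ℕ} (γ : ℕ) (t : WTerm ℝ p l) : Prop :=
  Granular γ t.const ∧ ∀ i j, Granular γ (t.coeff i j)

/-- A vertex-colored vertex-weighted graph on the vertex set `Fin n`, with `p` weight functions.
Colors are named by natural numbers; a formula only sees the colors it mentions. -/
structure WGraph (p n : ℕ) where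
  graph : SimpleGraph (Fin n)
  color : ℕ → Finset (Fin n)
  weight : Fin p → Fin n → ℕ

/-- The interpretation `t^G(W_1, …, W_l) = a + ∑ i j, a_ij * w_i^G(W_j)`. -/
def WTerm.eval {R : Type} [Semiring R] {p l n : ℕ} (t : WTerm R p l) (G : WGraph p n)
    (W : Fin l → Finset (Fin n)) : R :=
  t.const + ∑ i, ∑ j, t.coeff i j * ((∑ v ∈ W j, G.weight i v : ℕ) : R)

/-! ### Formulas -/

/-- Weight comparisons `≤, <, ≥, >`. -/
inductive Cmp
  | le | lt | ge | gt

def Cmp.holds : Cmp → ℝ → ℝ → Prop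
  | .le, x, y => x ≤ y
  | .lt, x, y => x < y
  | .ge, x, y => x ≥ y
  | .gt, x, y => x > y

/-- Formulas of counting monadic second order logic (quantification over vertices and vertex
sets) extended by comparisons between weight terms. `Formula p n m` has the free vertex variables
`x_0, …, x_{n-1}` and the free set variables `X_0, …, X_{m-1}`; a quantifier binds the last
variable of its sort. -/
inductive Formula (p : ℕ) : ℕ → ℕ → Type
  | verum {n m : ℕ} : Formula p n m
  | falsum {n m : ℕ} : Formula p n m
  | mem {n m : ℕ} (x : Fin n) (X : Fin m) : Formula p n m
  | eq {n m : ℕ} (x y : Fin n) : Formula p n m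
  | edge {n m : ℕ} (x y : Fin n) : Formula p n m
  | color {n m : ℕ} (c : ℕ) (x : Fin n) : Formula p n m
  | card {n m : ℕ} (a r : ℕ) (X : Fin m) : Formula p n m
  | cmp {n m : ℕ} (o : Cmp) (t t' : WTerm ℝ p m) : Formula p n m
  | not {n m : ℕ} (φ : Formula p n m) : Formula p n m
  | and {n m : ℕ} (φ ψ : Formula p n m) : Formula p n m
  | or {n m : ℕ} (φ ψ : Formula p n m) : Formula p n m
  | exV {n m : ℕ} (φ : Formula p (n + 1) m) : Formula p n m
  | allV {n m : ℕ} (φ : Formula p (n + 1) m) : Formula p n m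
  | exS {n m : ℕ} (φ : Formula p n (m + 1)) : Formula p n m
  | allS {n m : ℕ} (φ : Formula p n (m + 1)) : Formula p n m

namespace Formula

/-- Truth of a formula in `G` under an assignment of its free vertex and set variables. -/
def Sat {p N : ℕ} (G : WGraph p N) : {n m : ℕ} → Formula p n m →
    (Fin n → Fin N) → (Fin m → Finset (Fin N)) → Prop
  | _, _, .verum, _, _ => True
  | _, _, .falsum, _, _ => False
  | _, _, .mem x X, xs, Xs => xs x ∈ Xs X
  | _, _, .eq x y, xs, _ => xs x = xs y
  | _, _, .edge x y, xs, _ => G.graph.Adj (xs x) (xs y)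
  | _, _, .color c x, xs, _ => xs x ∈ G.color c
  | _, _, .card a r X, _, Xs => (Xs X).card ≡ a [MOD r]
  | _, _, .cmp o t t', _, Xs => o.holds (t.eval G Xs) (t'.eval G Xs)
  | _, _, .not φ, xs, Xs => ¬ Sat G φ xs Xs
  | _, _, .and φ ψ, xs, Xs => Sat G φ xs Xs ∧ Sat G ψ xs Xs
  | _, _, .or φ ψ, xs, Xs => Sat G φ xs Xs ∨ Sat G ψ xs Xs
  | _, _, .exV φ, xs, Xs => ∃ v : Fin N, Sat G φ (Fin.snoc xs v) Xs
  | _, _, .allV φ, xs, Xs => ∀ v : Fin N, Sat G φ (Fin.snoc xs v) Xs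
  | _, _, .exS φ, xs, Xs => ∃ U : Finset (Fin N), Sat G φ xs (Fin.snoc Xs U)
  | _, _, .allS φ, xs, Xs => ∀ U : Finset (Fin N), Sat G φ xs (Fin.snoc Xs U)

/-- `G ⊨ φ(W_1, …, W_m)` for a formula whose free variables are set variables. -/
def Models {p N m : ℕ} (G : WGraph p N) (φ : Formula p 0 m) (W : Fin m → Finset (Fin N)) : Prop :=
  φ.Sat G Fin.elim0 W

/-- The `α`-loosening: the smaller side of each comparison is multiplied by `1/α`, the larger one
by `α`. -/
def loosen {p : ℕ} (α : ℝ) : {n m : ℕ} → Formula p n m → Formula p n m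
  | _, _, .cmp .le t t' => .cmp .le (t.scale (1 / α)) (t'.scale α)
  | _, _, .cmp .lt t t' => .cmp .lt (t.scale (1 / α)) (t'.scale α)
  | _, _, .cmp .ge t t' => .cmp .ge (t.scale α) (t'.scale (1 / α))
  | _, _, .cmp .gt t t' => .cmp .gt (t.scale α) (t'.scale (1 / α))
  | _, _, .not φ => .not (loosen α φ)
  | _, _, .and φ ψ => .and (loosen α φ) (loosen α ψ)
  | _, _, .or φ ψ => .or (loosen α φ) (loosen α ψ)
  | _, _, .exV φ => .exV (loosen α φ)
  | _, _, .allV φ => .allV (loosen α φ)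
  | _, _, .exS φ => .exS (loosen α φ)
  | _, _, .allS φ => .allS (loosen α φ)
  | _, _, φ => φ

/-- The `α`-tightening: the smaller side of each comparison is multiplied by `α`, the larger one
by `1/α`. -/
def tighten {p : ℕ} (α : ℝ) : {n m : ℕ} → Formula p n m → Formula p n m
  | _, _, .cmp .le t t' => .cmp .le (t.scale α) (t'.scale (1 / α))
  | _, _, .cmp .lt t t' => .cmp .lt (t.scale α) (t'.scale (1 / α))
  | _, _, .cmp .ge t t' => .cmp .ge (t.scale (1 / α)) (t'.scale α)
  | _, _, .cmp .gt t t' => .cmp .gt (t.scale (1 / α)) (t'.scale α)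
  | _, _, .not φ => .not (tighten α φ)
  | _, _, .and φ ψ => .and (tighten α φ) (tighten α ψ)
  | _, _, .or φ ψ => .or (tighten α φ) (tighten α ψ)
  | _, _, .exV φ => .exV (tighten α φ)
  | _, _, .allV φ => .allV (tighten α φ)
  | _, _, .exS φ => .exS (tighten α φ)
  | _, _, .allS φ => .allS (tighten α φ)
  | _, _, φ => φ

/-- `G` `α`-undersatisfies `φ(W)`. -/
def Undersat {p N m : ℕ} (G : WGraph p N) (α : ℝ) (φ : Formula p 0 m)
    (W : Fin m → Finset (Fin N)) : Prop :=
  (φ.loosen α).Models G W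

/-- `G` `α`-oversatisfies `φ(W)`. -/
def Oversat {p N m : ℕ} (G : WGraph p N) (α : ℝ) (φ : Formula p 0 m)
    (W : Fin m → Finset (Fin N)) : Prop :=
  (φ.tighten α).Models G W

/-- Finite conjunctions and disjunctions. -/
def conj {p n m : ℕ} (L : List (Formula p n m)) : Formula p n m := L.foldr .and .verum

def disj {p n m : ℕ} (L : List (Formula p n m)) : Formula p n m := L.foldr .or .falsum

/-- Universal quantification `∀ Y_0 ⋯ ∀ Y_{y-1}` over the last `y` set variables. -/
def allSets {p n m : ℕ} : (y : ℕ) → Formula p n (m + y) → Formula p n m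
  | 0, φ => φ
  | y + 1, φ => allSets y (.allS φ)

end Formula

open Classical in
/-- The oversatisfied maximum: the maximum of the target over all tuples for which `φ` is
`α`-oversatisfied, and `⊥` (that is, `-∞`) if there is none. -/
def oversatisfy {p N m : ℕ} (G : WGraph p N) (φ : Formula p 0 m) (target : WTerm ℤ p m) (α : ℝ) :
    WithBot ℤ :=
  (Finset.univ.filter fun W : Fin m → Finset (Fin N) => φ.Oversat G α W).sup
    fun W => ((target.eval G W : ℤ) : WithBot ℤ)

/-- The value of the target at a witness, with value `⊥` (that is, `-∞`) if there is no witness. -/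
def targetValue {p N m : ℕ} (G : WGraph p N) (target : WTerm ℤ p m) :
    Option (Fin m → Finset (Fin N)) → WithBot ℤ
  | none => ⊥
  | some W => ((target.eval G W : ℤ) : WithBot ℤ)

/-! ### Signatures and the finite set of normalized formulas -/

/-- Atomic relation symbols other than containment and equality. -/
inductive Rel
  | edge
  | color (c : ℕ)
  | card (a r : ℕ)
  deriving DecidableEq

/-- The contribution of a symbol to the size of a signature; moduli are counted in unary. -/
def Rel.size : Rel → ℕ
  | .edge => 1
  | .color _ => 1
  | .card _ r => r

/-- A finite signature, listed without repetition. -/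
structure Signature where
  rels : List Rel
  nodup : rels.Nodup
  valid : ∀ a r : ℕ, Rel.card a r ∈ rels → a < r ∧ 2 ≤ r

def Signature.size (σ : Signature) : ℕ := (σ.rels.map Rel.size).sum

namespace Formula

/-- The formula contains no weight comparison and only relation symbols of `σ`. -/
def IsCMSO {p : ℕ} (σ : Signature) : {n m : ℕ} → Formula p n m → Prop
  | _, _, .verum => True
  | _, _, .falsum => True
  | _, _, .mem _ _ => True
  | _, _, .eq _ _ => True
  | _, _, .edge _ _ => Rel.edge ∈ σ.rels
  | _, _, .color c _ => Rel.color c ∈ σ.rels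
  | _, _, .card a r _ => Rel.card a r ∈ σ.rels
  | _, _, .cmp _ _ _ => False
  | _, _, .not φ => IsCMSO σ φ
  | _, _, .and φ ψ => IsCMSO σ φ ∧ IsCMSO σ ψ
  | _, _, .or φ ψ => IsCMSO σ φ ∧ IsCMSO σ ψ
  | _, _, .exV φ => IsCMSO σ φ
  | _, _, .allV φ => IsCMSO σ φ
  | _, _, .exS φ => IsCMSO σ φ
  | _, _, .allS φ => IsCMSO σ φ

/-- Quantifier rank. -/
def qrank {p : ℕ} : {n m : ℕ} → Formula p n m → ℕ
  | _, _, .not φ => qrank φ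
  | _, _, .and φ ψ => max (qrank φ) (qrank ψ)
  | _, _, .or φ ψ => max (qrank φ) (qrank ψ)
  | _, _, .exV φ => qrank φ + 1
  | _, _, .allV φ => qrank φ + 1
  | _, _, .exS φ => qrank φ + 1
  | _, _, .allS φ => qrank φ + 1
  | _, _, _ => 0

/-- All atomic formulas built from one symbol of a signature. -/
def relAtoms {p : ℕ} (n m : ℕ) : Rel → List (Formula p n m)
  | .edge => (List.finRange n).flatMap fun x => (List.finRange n).map fun y => .edge x y
  | .color c => (List.finRange n).map fun x => .color c x
  | .card a r => (List.finRange m).map fun X => .card a r X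

/-- All atomic formulas over `σ` with the given free variables. -/
def atoms {p : ℕ} (σ : Signature) (n m : ℕ) : List (Formula p n m) :=
  ((List.finRange n).flatMap fun x => (List.finRange m).map fun X => .mem x X) ++
  ((List.finRange n).flatMap fun x => (List.finRange n).map fun y => .eq x y) ++
  σ.rels.flatMap (relAtoms n m)

/-- All formulas in disjunctive normal form over the building blocks `L`, without repetitions in
the conjunctions and disjunctions. -/
def dnfs {p n m : ℕ} (L : List (Formula p n m)) : List (Formula p n m) :=
  (((L.flatMap fun a => [a, .not a]).sublists.map conj).sublists).map disj

/-- The finite set of normalized `CMSO₁`-formulas over `σ` of quantifier rank at most `q`, with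
free vertex variables `x_0, …, x_{n-1}` and free set variables `X_0, …, X_{m-1}`: at each
quantifier depth, disjunctive normal forms over the atoms and the quantified normalized formulas
of smaller rank. -/
def cmso {p : ℕ} (σ : Signature) : ℕ → (n m : ℕ) → List (Formula p n m)
  | 0, n, m => dnfs (atoms σ n m)
  | q + 1, n, m => dnfs (atoms σ n m ++ (cmso σ q (n + 1) m).map .exV ++
      (cmso σ q (n + 1) m).map .allV ++ (cmso σ q n (m + 1)).map .exS ++
      (cmso σ q n (m + 1)).map .allS)

/-! The normalization is correct: it stays within, and up to equivalence exhausts, the formulas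
over `σ` of quantifier rank at most `q`. -/

theorem sat_conj {p N n m : ℕ} (G : WGraph p N) (L : List (Formula p n m)) (xs Xs) :
    (conj L).Sat G xs Xs ↔ ∀ φ ∈ L, φ.Sat G xs Xs := by
  induction L with
  | nil => simp [conj, Sat]
  | cons a L ih => simp only [conj, List.foldr_cons, Sat] at ih ⊢; simp [ih]

theorem sat_disj {p N n m : ℕ} (G : WGraph p N) (L : List (Formula p n m)) (xs Xs) :
    (disj L).Sat G xs Xs ↔ ∃ φ ∈ L, φ.Sat G xs Xs := by
  induction L with
  | nil => simp [disj, Sat]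
  | cons a L ih => simp only [disj, List.foldr_cons, Sat] at ih ⊢; simp [ih]

theorem good_dnfs {p n m q : ℕ} {σ : Signature} {L : List (Formula p n m)}
    (h : ∀ φ ∈ L, φ.IsCMSO σ ∧ φ.qrank ≤ q) : ∀ φ ∈ dnfs L, φ.IsCMSO σ ∧ φ.qrank ≤ q := by
  have hc : ∀ M : List (Formula p n m), (∀ φ ∈ M, φ.IsCMSO σ ∧ φ.qrank ≤ q) →
      (conj M).IsCMSO σ ∧ (conj M).qrank ≤ q := by
    intro M hM
    induction M with
    | nil => simp [conj, IsCMSO, qrank]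
    | cons a M ih =>
      have := ih fun φ hφ => hM φ (by simp [hφ])
      have h2 := hM a (by simp)
      simp only [conj, List.foldr_cons, IsCMSO, qrank] at this ⊢
      exact ⟨⟨h2.1, this.1⟩, max_le h2.2 this.2⟩
  have hd : ∀ M : List (Formula p n m), (∀ φ ∈ M, φ.IsCMSO σ ∧ φ.qrank ≤ q) →
      (disj M).IsCMSO σ ∧ (disj M).qrank ≤ q := by
    intro M hM
    induction M with
    | nil => simp [disj, IsCMSO, qrank]
    | cons a M ih =>
      have := ih fun φ hφ => hM φ (by simp [hφ])
      have h2 := hM a (by simp)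
      simp only [disj, List.foldr_cons, IsCMSO, qrank] at this ⊢
      exact ⟨⟨h2.1, this.1⟩, max_le h2.2 this.2⟩
  intro φ hφ
  simp only [dnfs, List.mem_map, List.mem_sublists] at hφ
  obtain ⟨M, hM, rfl⟩ := hφ
  refine hd M fun ψ hψ => ?_
  have := hM.subset hψ
  simp only [List.mem_map, List.mem_sublists] at this
  obtain ⟨K, hK, rfl⟩ := this
  refine hc K fun θ hθ => ?_
  have := hK.subset hθ
  simp only [List.mem_flatMap] at this
  obtain ⟨a, ha, h3⟩ := this
  simp only [List.mem_cons, List.not_mem_nil, or_false] at h3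
  rcases h3 with rfl | rfl
  · exact h _ ha
  · simpa [IsCMSO, qrank] using h _ ha

theorem good_atoms {p : ℕ} (σ : Signature) (n m : ℕ) :
    ∀ φ ∈ (atoms σ n m : List (Formula p n m)), φ.IsCMSO σ ∧ φ.qrank = 0 := by
  intro φ hφ
  simp only [atoms, List.mem_append, List.mem_flatMap, List.mem_map] at hφ
  rcases hφ with (⟨_, _, _, _, rfl⟩ | ⟨_, _, _, _, rfl⟩) | ⟨r, hr, h⟩
  · simp [IsCMSO, qrank]
  · simp [IsCMSO, qrank]
  · cases r <;> simp only [relAtoms, List.mem_flatMap, List.mem_map] at h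
    · obtain ⟨_, _, _, _, rfl⟩ := h; simpa [IsCMSO, qrank] using hr
    · obtain ⟨_, _, rfl⟩ := h; simpa [IsCMSO, qrank] using hr
    · obtain ⟨_, _, rfl⟩ := h; simpa [IsCMSO, qrank] using hr

/-- All normalized formulas lie in `CMSO₁(σ, q, X)`. -/
theorem cmso_sound {p : ℕ} (σ : Signature) (q : ℕ) : ∀ (n m : ℕ),
    ∀ φ ∈ (cmso σ q n m : List (Formula p n m)), φ.IsCMSO σ ∧ φ.qrank ≤ q := by
  induction q with
  | zero =>
    intro n m; exact good_dnfs fun φ h => ⟨(good_atoms σ n m φ h).1, (good_atoms σ n m φ h).2.le⟩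
  | succ q ih =>
    intro n m
    refine good_dnfs fun φ h => ?_
    simp only [List.mem_append, List.mem_map] at h
    rcases h with (((h | ⟨ψ, h, rfl⟩) | ⟨ψ, h, rfl⟩) | ⟨ψ, h, rfl⟩) | ⟨ψ, h, rfl⟩
    · exact ⟨(good_atoms σ n m φ h).1, (good_atoms σ n m φ h).2.trans_le (by omega)⟩
    all_goals
      have := ih _ _ ψ h
      exact ⟨this.1, Nat.succ_le_succ this.2⟩

/-- Logical equivalence. -/
def Equiv {p n m : ℕ} (φ ψ : Formula p n m) : Prop :=
  ∀ (N : ℕ) (G : WGraph p N) xs Xs, φ.Sat G xs Xs ↔ ψ.Sat G xs Xs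

/-- The truth of `φ` only depends on the truth values of the formulas in `L`. -/
def Det {p n m : ℕ} (L : List (Formula p n m)) (φ : Formula p n m) : Prop :=
  ∀ (N N' : ℕ) (G : WGraph p N) (G' : WGraph p N') xs Xs xs' Xs',
    (∀ a ∈ L, a.Sat G xs Xs ↔ a.Sat G' xs' Xs') → (φ.Sat G xs Xs ↔ φ.Sat G' xs' Xs')

open Classical in
theorem dnfs_complete {p n m : ℕ} {L : List (Formula p n m)} {φ : Formula p n m} (h : Det L φ) :
    ∃ ψ ∈ dnfs L, φ.Equiv ψ := by
  let pick : (Formula p n m → Prop) → List (Formula p n m) :=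
    fun s => L.flatMap fun a => if s a then [a] else [.not a]
  let P : Formula p n m → Prop := fun c => ∃ (N : ℕ) (G : WGraph p N) (xs : _) (Xs : _),
    φ.Sat G xs Xs ∧ c = conj (pick fun a => a.Sat G xs Xs)
  refine ⟨disj (((L.flatMap fun a => [a, .not a]).sublists.map conj).filter (decide <| P ·)), ?_, ?_⟩
  · exact List.mem_map_of_mem (List.mem_sublists.2 List.filter_sublist)
  · intro N G xs Xs
    have hp : ∀ s, (pick s).Sublist (L.flatMap fun a => [a, .not a]) := by
      intro s
      show List.Sublist (L.flatMap _) _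
      clear h P
      induction L with
      | nil => simp
      | cons a L ih =>
        simp only [List.flatMap_cons]
        refine List.Sublist.append ?_ ih
        split_ifs <;> simp
    rw [sat_disj]
    constructor
    · intro hs
      refine ⟨conj (pick fun a => a.Sat G xs Xs), ?_, ?_⟩
      · simp only [List.mem_filter, decide_eq_true_eq]
        exact ⟨List.mem_map_of_mem (List.mem_sublists.2 (hp _)), N, G, xs, Xs, hs, rfl⟩
      · rw [sat_conj]
        intro ψ hψ
        simp only [pick, List.mem_flatMap] at hψ
        obtain ⟨a, _, h2⟩ := hψ
        split_ifs at h2 with h3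
        · simp at h2; subst h2; exact h3
        · simp at h2; subst h2; exact h3
    · rintro ⟨c, hc, hs⟩
      simp only [List.mem_filter, decide_eq_true_eq] at hc
      obtain ⟨-, N', G', xs', Xs', h1, rfl⟩ := hc
      refine (h N' N G' G xs' Xs' xs Xs fun a ha => ?_).1 h1
      rw [sat_conj] at hs
      by_cases h3 : a.Sat G' xs' Xs'
      · have := hs a (by simp only [pick, List.mem_flatMap]; exact ⟨a, ha, by simp [h3]⟩)
        tauto
      · have := hs (.not a) (by simp only [pick, List.mem_flatMap]; exact ⟨a, ha, by simp [h3]⟩)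
        simp only [Sat] at this
        tauto

theorem determined_of_mem {p n m : ℕ} {L : List (Formula p n m)} {φ ψ : Formula p n m} (h : ψ ∈ L)
    (he : φ.Equiv ψ) : Det L φ := by
  intro N N' G G' xs Xs xs' Xs' ha
  rw [he N G, he N' G']; exact ha _ h

/-- The building blocks of the normalized formulas of quantifier rank at most `q`. -/
def blocks {p : ℕ} (σ : Signature) : ℕ → (n m : ℕ) → List (Formula p n m)
  | 0, n, m => atoms σ n m
  | q + 1, n, m => (atoms σ n m ++ (cmso σ q (n + 1) m).map .exV ++
      (cmso σ q (n + 1) m).map .allV ++ (cmso σ q n (m + 1)).map .exS ++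
      (cmso σ q n (m + 1)).map .allS)

theorem cmso_eq {p : ℕ} (σ : Signature) (q n m : ℕ) :
    (cmso σ q n m : List (Formula p n m)) = dnfs (blocks σ q n m) := by
  cases q <;> rfl

theorem atoms_sub {p : ℕ} (σ : Signature) (q n m : ℕ) (φ : Formula p n m) (h : φ ∈ atoms σ n m) :
   φ ∈ blocks σ q n m := by
  cases q <;> simp [blocks, h]

theorem determined {p : ℕ} (σ : Signature) {n m : ℕ} (φ : Formula p n m) : ∀ q,
   φ.IsCMSO σ → φ.qrank ≤ q → Det (blocks σ q n m) φ := by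
  induction φ with
  | verum => intro q _ _ N N' G G' xs Xs xs' Xs' ha; simp [Sat]
  | falsum => intro q _ _ N N' G G' xs Xs xs' Xs' ha; simp [Sat]
  | mem x X => intro q _ _; exact determined_of_mem (atoms_sub _ _ _ _ _ (by simp [atoms])) fun _ _ _ _ => Iff.rfl
  | eq x X => intro q _ _; exact determined_of_mem (atoms_sub _ _ _ _ _ (by simp [atoms])) fun _ _ _ _ => Iff.rfl
  | edge x X => intro q h _; exact determined_of_mem (atoms_sub _ _ _ _ _ (by simp only [atoms, List.mem_append, List.mem_flatMap]; exact Or.inr ⟨_, h, by simp [relAtoms]⟩)) fun _ _ _ _ => Iff.rfl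
  | color x X => intro q h _; exact determined_of_mem (atoms_sub _ _ _ _ _ (by simp only [atoms, List.mem_append, List.mem_flatMap]; exact Or.inr ⟨_, h, by simp [relAtoms]⟩)) fun _ _ _ _ => Iff.rfl
  | card x r X => intro q h _; exact determined_of_mem (atoms_sub _ _ _ _ _ (by simp only [atoms, List.mem_append, List.mem_flatMap]; exact Or.inr ⟨_, h, by simp [relAtoms]⟩)) fun _ _ _ _ => Iff.rfl
  | cmp o t t' => intro q h; exact h.elim
  | not φ ih => intro q h hq N N' G G' xs Xs xs' Xs' ha; simp only [Sat]; rw [ih q h hq N N' G G' xs Xs xs' Xs' ha]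
  | and φ ψ i1 i2 =>
    intro q h hq N N' G G' xs Xs xs' Xs' ha; simp only [Sat]
    simp only [qrank] at hq
    rw [i1 q h.1 (by omega) N N' G G' xs Xs xs' Xs' ha, i2 q h.2 (by omega) N N' G G' xs Xs xs' Xs' ha]
  | or φ ψ i1 i2 =>
    intro q h hq N N' G G' xs Xs xs' Xs' ha; simp only [Sat]
    simp only [qrank] at hq
    rw [i1 q h.1 (by omega) N N' G G' xs Xs xs' Xs' ha, i2 q h.2 (by omega) N N' G G' xs Xs xs' Xs' ha]
  | exV φ ih =>
    intro q h hq
    simp only [qrank] at hq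
    obtain ⟨q, rfl⟩ : ∃ r, q = r + 1 := ⟨q - 1, by omega⟩
    obtain ⟨ψ, h1, h2⟩ := dnfs_complete (ih q h (by omega))
    rw [← cmso_eq] at h1
    refine determined_of_mem (ψ := .exV ψ) (by simp [blocks, h1]) fun N G xs Xs => ?_
    simp only [Sat]; exact exists_congr fun v => h2 _ _ _ _
  | allV φ ih =>
    intro q h hq
    simp only [qrank] at hq
    obtain ⟨q, rfl⟩ : ∃ r, q = r + 1 := ⟨q - 1, by omega⟩
    obtain ⟨ψ, h1, h2⟩ := dnfs_complete (ih q h (by omega))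
    rw [← cmso_eq] at h1
    refine determined_of_mem (ψ := .allV ψ) (by simp [blocks, h1]) fun N G xs Xs => ?_
    simp only [Sat]; exact forall_congr' fun v => h2 _ _ _ _
  | exS φ ih =>
    intro q h hq
    simp only [qrank] at hq
    obtain ⟨q, rfl⟩ : ∃ r, q = r + 1 := ⟨q - 1, by omega⟩
    obtain ⟨ψ, h1, h2⟩ := dnfs_complete (ih q h (by omega))
    rw [← cmso_eq] at h1
    refine determined_of_mem (ψ := .exS ψ) (by simp [blocks, h1]) fun N G xs Xs => ?_
    simp only [Sat]; exact exists_congr fun v => h2 _ _ _ _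
  | allS φ ih =>
    intro q h hq
    simp only [qrank] at hq
    obtain ⟨q, rfl⟩ : ∃ r, q = r + 1 := ⟨q - 1, by omega⟩
    obtain ⟨ψ, h1, h2⟩ := dnfs_complete (ih q h (by omega))
    rw [← cmso_eq] at h1
    refine determined_of_mem (ψ := .allS ψ) (by simp [blocks, h1]) fun N G xs Xs => ?_
    simp only [Sat]; exact forall_congr' fun v => h2 _ _ _ _

/-- Every formula of `CMSO₁(σ, q, X)` is equivalent to a normalized one. -/
theorem cmso_complete {p : ℕ} (σ : Signature) {n m : ℕ} (φ : Formula p n m) (q : ℕ)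
   (h : φ.IsCMSO σ) (hq : φ.qrank ≤ q) : ∃ ψ ∈ cmso σ q n m, φ.Equiv ψ := by
  rw [cmso_eq]; exact dnfs_complete (determined σ φ q h hq)

end Formula

/-! ### Tables -/

/-- `⌈α^j⌉/γ` and `⌊α^j⌋/γ` for all natural `j`, as far as they lie in `[0, N]`, together with `0`
and `N`. -/
def roundedN (α : ℝ) (N γ : ℕ) : Set ℝ :=
  (Set.Icc 0 (N : ℝ) ∩ Set.range fun j : ℕ => (⌈α ^ j⌉ : ℝ) / γ) ∪
  (Set.Icc 0 (N : ℝ) ∩ Set.range fun j : ℕ => (⌊α ^ j⌋ : ℝ) / γ) ∪ {0, (N : ℝ)}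

/-- A table formula over the signature `σ`, the quantifier rank `q`, the set variables
`X_1, …, X_x` and `Y_1, …, Y_y` and families of `m₁` and `m₂` weight terms. It is determined by
its thresholds, one for each term and each of the two directions (and, for terms of the second
family, each normalized formula). -/
structure TableFormula (p : ℕ) (σ : Signature) (q x y m₁ m₂ : ℕ) where
  le₁ : Fin m₁ → ℝ
  ge₁ : Fin m₁ → ℝ
  le₂ : Fin m₂ → {ψ : Formula p 0 (x + y) // ψ ∈ Formula.cmso σ q 0 (x + y)} → ℝ
  ge₂ : Fin m₂ → {ψ : Formula p 0 (x + y) // ψ ∈ Formula.cmso σ q 0 (x + y)} → ℝ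

namespace TableFormula

variable {p : ℕ} {σ : Signature} {q x y m₁ m₂ : ℕ}

/-- All thresholds of the table formula satisfy `P`. -/
def AllThresholds (P : ℝ → Prop) (ω : TableFormula p σ q x y m₁ m₂) : Prop :=
  (∀ i, P (ω.le₁ i) ∧ P (ω.ge₁ i)) ∧ ∀ i ψ, P (ω.le₂ i ψ) ∧ P (ω.ge₂ i ψ)

/-- `g ≤ t ≤ g'` as a formula. -/
def between {n m : ℕ} (t : WTerm ℝ p m) (g g' : ℝ) : Formula p n m :=
  .and (.cmp .le t (.ofConst g')) (.cmp .ge t (.ofConst g))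

/-- The table formula as a formula in the free variables `X_1, …, X_x`:
the conjunction of `t ≤ g_{t,≤} ∧ t ≥ g_{t,≥}` over all terms `t` of the first family, and of
`∀ Y_1 ⋯ Y_y, ψ ∨ (t ≤ g_{t,ψ,≤} ∧ t ≥ g_{t,ψ,≥})` over all terms `t` of the second family and all
normalized formulas `ψ`. -/
def toFormula (τ₁ : Fin m₁ → WTerm ℝ p x) (τ₂ : Fin m₂ → WTerm ℝ p (x + y))
    (ω : TableFormula p σ q x y m₁ m₂) : Formula p 0 x :=
  .and
    (.conj ((List.finRange m₁).map fun i => between (τ₁ i) (ω.ge₁ i) (ω.le₁ i)))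
    (.conj ((List.finRange m₂).flatMap fun i =>
      (Formula.cmso σ q 0 (x + y)).attach.map fun ψ =>
        .allSets y (.or ψ.1 (between (τ₂ i) (ω.ge₂ i ψ) (ω.le₂ i ψ)))))

end TableFormula

/-- The approximate table: all table formulas whose thresholds have granularity `γ` and lie in
`roundedN α N γ`. -/
def approxTable (p : ℕ) (α : ℝ) (N γ : ℕ) (σ : Signature) (q x y m₁ m₂ : ℕ) :
    Set (TableFormula p σ q x y m₁ m₂) :=
  {ω | ω.AllThresholds (Granular γ) ∧ ω.AllThresholds (· ∈ roundedN α N γ)}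

/-! ### `k`-expressions -/

/-- `k`-expressions over the vertices `Fin n`: single vertices with at most one label, disjoint
unions, relabelings of `i` to `j`, and insertions of all edges between labels `i ≠ j`. -/
inductive KExpr (k n : ℕ)
  | vertex (v : Fin n) (i : Option (Fin k))
  | union (a b : KExpr k n)
  | relabel (i j : Fin k) (a : KExpr k n)
  | join (i j : Fin k) (h : i ≠ j) (a : KExpr k n)

namespace KExpr

variable {k n : ℕ}

def leaves : KExpr k n → List (Fin n)
  | .vertex v _ => [v]
  | .union a b => a.leaves ++ b.leaves
  | .relabel _ _ a => a.leaves
  | .join _ _ _ a => a.leaves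

/-- The label of a vertex in the constructed `k`-graph. -/
def label : KExpr k n → Fin n → Option (Fin k)
  | .vertex v i, u => if u = v then i else none
  | .union a b, u => if u ∈ a.leaves then a.label u else b.label u
  | .relabel i j a, u => (a.label u).map fun l => if l = i then j else l
  | .join _ _ _ a, u => a.label u

/-- The edges of the constructed `k`-graph. -/
def Adj : KExpr k n → Fin n → Fin n → Prop
  | .vertex _ _, _, _ => False
  | .union a b, u, v => a.Adj u v ∨ b.Adj u v
  | .relabel _ _ a, u, v => a.Adj u v
  | .join i j _ a, u, v => a.Adj u v ∨ (a.label u = some i ∧ a.label v = some j) ∨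
      (a.label u = some j ∧ a.label v = some i)

/-- The expression constructs the graph `G` with vertex set `Fin n`: unions are disjoint, and
vertices and edges agree. -/
def Builds (χ : KExpr k n) (G : SimpleGraph (Fin n)) : Prop :=
  χ.leaves.Nodup ∧ (∀ v, v ∈ χ.leaves) ∧ ∀ u v, G.Adj u v ↔ χ.Adj u v

/-- The maximal number of nested operations. -/
def depth : KExpr k n → ℕ
  | .vertex _ _ => 0
  | .union a b => max a.depth b.depth + 1
  | .relabel _ _ a => a.depth + 1
  | .join _ _ _ a => a.depth + 1

/-- The number of nodes, where the introduction of a single vertex counts as one. -/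
def size : KExpr k n → ℕ
  | .vertex _ _ => 1
  | .union a b => a.size + b.size + 1
  | .relabel _ _ a => a.size + 1
  | .join _ _ _ a => a.size + 1

end KExpr

/-! ### A machine model with a step count

Programs work on binary trees with integers at the leaves. Trees are thought of as linked cells in
memory, so forming a pair and reading a component of a pair are single steps, and so is one
arithmetic operation or comparison on integers. There is no random access. -/

inductive Val
  | num (z : ℤ)
  | pair (a b : Val)

/-- Elementary operations. -/
inductive Prim
  | id
  | const (z : ℤ)
  | fst | snd
  | isPair
  | add | sub | mul | div
  | le | eq

/-- The effect of an elementary operation; outside of the intended domain the result is `0`. -/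
def Prim.eval : Prim → Val → Val
  | .id, v => v
  | .const z, _ => .num z
  | .fst, .pair a _ => a
  | .snd, .pair _ b => b
  | .isPair, .pair _ _ => .num 1
  | .add, .pair (.num a) (.num b) => .num (a + b)
  | .sub, .pair (.num a) (.num b) => .num (a - b)
  | .mul, .pair (.num a) (.num b) => .num (a * b)
  | .div, .pair (.num a) (.num b) => .num (a / b)
  | .le, .pair (.num a) (.num b) => .num (if a ≤ b then 1 else 0)
  | .eq, .pair (.num a) (.num b) => .num (if a = b then 1 else 0)
  | _, _ => .num 0

/-- Programs. `pair c d` runs both programs on the input, `comp d c` runs `c` and then `d`,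
`ite c d e` branches on whether the result of `c` differs from `0`, and `fix c` runs `c`, where
`recur` calls the body `c` of the innermost enclosing `fix` again. -/
inductive Code
  | prim (o : Prim)
  | pair (c d : Code)
  | comp (d c : Code)
  | ite (c d e : Code)
  | fix (c : Code)
  | recur

/-- `Run body c v r s`: on input `v`, the program `c` halts with result `r` after exactly `s`
steps, where `recur` stands for a call of `body`. -/
inductive Run : Code → Code → Val → Val → ℕ → Prop
  | prim {μ : Code} (o : Prim) (v : Val) : Run μ (.prim o) v (o.eval v) 1
  | pair {μ c d : Code} {v a b : Val} {s t : ℕ} :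
      Run μ c v a s → Run μ d v b t → Run μ (.pair c d) v (.pair a b) (s + t + 1)
  | comp {μ c d : Code} {v a b : Val} {s t : ℕ} :
      Run μ c v a s → Run μ d a b t → Run μ (.comp d c) v b (s + t + 1)
  | iteTrue {μ c d e : Code} {v a b : Val} {s t : ℕ} :
      Run μ c v a s → a ≠ .num 0 → Run μ d v b t → Run μ (.ite c d e) v b (s + t + 1)
  | iteFalse {μ c d e : Code} {v b : Val} {s t : ℕ} :
      Run μ c v (.num 0) s → Run μ e v b t → Run μ (.ite c d e) v b (s + t + 1)
  | fix {μ c : Code} {v a : Val} {s : ℕ} : Run c c v a s → Run μ (.fix c) v a (s + 1)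
  | recur {μ : Code} {v a : Val} {s : ℕ} : Run μ μ v a s → Run μ .recur v a (s + 1)

/-- The program `c` halts on input `v` with output `r` after exactly `s` steps. -/
def Code.HaltsWith (c : Code) (v r : Val) (s : ℕ) : Prop := Run c c v r s

/-! ### Encoding of inputs and outputs -/

namespace Val

def ofNat (a : ℕ) : Val := .num a

def ofList (L : List Val) : Val := L.foldr .pair (.num 0)

/-- A number of granularity `γ`, given by its numerator over `γ`. -/
def ofGranular (γ : ℕ) (x : ℝ) : Val := .num ⌊x * γ⌋

def ofTerm {R : Type} (enc : R → Val) {p l : ℕ} (t : WTerm R p l) : Val :=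
  .pair (enc t.const) (ofList ((List.finRange l).map fun j =>
    ofList ((List.finRange p).map fun i => enc (t.coeff i j))))

def ofRel : Rel → Val
  | .edge => .pair (.num 0) (.num 0)
  | .color c => .pair (.num 1) (ofNat c)
  | .card a r => .pair (.num 2) (.pair (ofNat a) (ofNat r))

/-- The record of a vertex: its name, the list of its colors in `σ`, the list of its weights. -/
def ofVertex {p n : ℕ} (σ : Signature) (G : WGraph p n) (v : Fin n) : Val :=
  .pair (ofNat v) (.pair
    (ofList (σ.rels.filterMap fun
      | .color c => if v ∈ G.color c then some (ofNat c) else none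
      | _ => none))
    (ofList ((List.finRange p).map fun i => ofNat (G.weight i v))))

def ofLabel {k : ℕ} : Option (Fin k) → Val
  | none => .num 0
  | some i => ofNat (i + 1)

/-- A graph together with a `k`-expression for it: the expression tree, whose leaves carry the
records of the vertices. The edges are given only through the expression. -/
def ofExpr {p k n : ℕ} (σ : Signature) (G : WGraph p n) : KExpr k n → Val
  | .vertex v i => .pair (.num 0) (.pair (ofLabel i) (ofVertex σ G v))
  | .union a b => .pair (.num 1) (.pair (ofExpr σ G a) (ofExpr σ G b))
  | .relabel i j a => .pair (.num 2) (.pair (.pair (ofLabel (some i)) (ofLabel (some j))) (ofExpr σ G a))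
  | .join i j _ a => .pair (.num 3) (.pair (.pair (ofLabel (some i)) (ofLabel (some j))) (ofExpr σ G a))

/-- The full input. -/
def ofInput {p x y m₁ m₂ k n : ℕ} (b N γ : ℕ) (σ : Signature) (q : ℕ)
    (τ₁ : Fin m₁ → WTerm ℝ p x) (τ₂ : Fin m₂ → WTerm ℝ p (x + y)) (target : WTerm ℤ p x)
    (G : WGraph p n) (χ : KExpr k n) : Val :=
  ofList [ofNat b, ofNat N, ofNat γ, ofNat p, ofNat q, ofNat x, ofNat y, ofNat k,
    ofList (σ.rels.map ofRel),
    ofList ((List.finRange m₁).map fun i => ofTerm (ofGranular γ) (τ₁ i)),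
    ofList ((List.finRange m₂).map fun i => ofTerm (ofGranular γ) (τ₂ i)),
    ofTerm .num target,
    ofExpr σ G χ]

/-- A table formula, given by its thresholds: for each term of the first family the pair of its
thresholds, and for each term of the second family the list of pairs of thresholds for all
normalized formulas. -/
def ofTableFormula {p : ℕ} {σ : Signature} {q x y m₁ m₂ : ℕ} (γ : ℕ)
    (ω : TableFormula p σ q x y m₁ m₂) : Val :=
  .pair
    (ofList ((List.finRange m₁).map fun i =>
      .pair (ofGranular γ (ω.le₁ i)) (ofGranular γ (ω.ge₁ i))))
    (ofList ((List.finRange m₂).map fun i =>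
      ofList ((Formula.cmso σ q 0 (x + y)).attach.map fun ψ =>
        .pair (ofGranular γ (ω.le₂ i ψ)) (ofGranular γ (ω.ge₂ i ψ)))))

/-- `v` lists the elements of `S`, in any order and without repetition. -/
def IsSet {n : ℕ} (v : Val) (S : Finset (Fin n)) : Prop :=
  ∃ L : List (Fin n), L.Nodup ∧ (∀ u, u ∈ L ↔ u ∈ S) ∧ v = ofList (L.map fun u : Fin n => ofNat u)

/-- `v` describes a tuple of sets, or the absence of one. -/
def IsWitness {x n : ℕ} (v : Val) : Option (Fin x → Finset (Fin n)) → Prop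
  | none => v = .num 0
  | some W => ∃ s : Fin x → Val, (∀ i, (s i).IsSet (W i)) ∧
      v = .pair (.num 1) (ofList ((List.finRange x).map s))

/-- `v` is the explicit value table of the function `witness` on `T`: a list that has, for each
`ω ∈ T`, exactly one entry, consisting of `ω` and a description of `witness ω`. -/
def IsTable {p : ℕ} {σ : Signature} {q x y m₁ m₂ n : ℕ} (γ : ℕ) (v : Val)
    (T : Set (TableFormula p σ q x y m₁ m₂))
    (witness : TableFormula p σ q x y m₁ m₂ → Option (Fin x → Finset (Fin n))) : Prop :=
  ∃ (L : List (TableFormula p σ q x y m₁ m₂)) (w : TableFormula p σ q x y m₁ m₂ → Val),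
    L.Nodup ∧ (∀ ω, ω ∈ L ↔ ω ∈ T) ∧ (∀ ω ∈ L, (w ω).IsWitness (witness ω)) ∧
      v = ofList (L.map fun ω => .pair (ofTableFormula γ ω) (w ω))

end Val

end ApproxMSO

end

noncomputable section

namespace ApproxMSO

/-! ### Programs with cost bounds -/

class Enc (α : Type) where
  enc : α → Val

open Enc List
open Encodable (encode)

notation "fp" => (by fun_prop)

instance : Enc ℕ := ⟨fun n => .num n⟩
instance : Enc ℤ := ⟨fun z => .num z⟩
instance : Enc Bool := ⟨fun b => .num (if b then 1 else 0)⟩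
instance : Enc Val := ⟨id⟩
instance {α β : Type} [Enc α] [Enc β] : Enc (α × β) := ⟨fun p => .pair (enc p.1) (enc p.2)⟩
instance {α : Type} [Enc α] : Enc (List α) := ⟨fun l => Val.ofList (l.map enc)⟩
instance {α : Type} [Enc α] (P : α → Prop) : Enc {a // P a} := ⟨fun a => enc a.1⟩

lemma enc_prod {α β : Type} [Enc α] [Enc β] (p : α × β) :
    enc p = Val.pair (enc p.1) (enc p.2) := rfl

/-- The function `f` is computed by a program in `O(u a + 1)` steps on input `a`. -/
@[fun_prop] def TM {α β : Type} [Enc α] [Enc β] (f : α → β) (u : α → ℕ) : Prop :=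
  ∃ (c : Code) (K : ℕ), ∀ a, ∃ s, s ≤ K * (u a + 1) ∧ ∀ μ, Run μ c (enc a) (enc (f a)) s

def Dom {α : Type} (u v : α → ℕ) : Prop := ∃ C, ∀ a, u a ≤ C * (v a + 1)

section Dom

variable {α : Type} {u v w : α → ℕ}

lemma Dom.of_le (h : ∀ a, u a ≤ v a) : Dom u v := ⟨1, fun a => by have := h a; omega⟩

lemma Dom.refl : Dom u u := .of_le fun _ => le_rfl

lemma Dom.zero : Dom (fun _ => 0) v := .of_le fun _ => Nat.zero_le _

lemma Dom.trans (h : Dom u v) (h' : Dom v w) : Dom u w := by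
  obtain ⟨C, h⟩ := h
  obtain ⟨D, h'⟩ := h'
  refine ⟨C * (D + 1), fun a => (h a).trans ?_⟩
  rw [mul_assoc]
  refine Nat.mul_le_mul_left _ ?_
  have := h' a
  nlinarith

lemma Dom.const_mul (c : ℕ) (h : Dom u w) : Dom (fun a => c * u a) w := by
  obtain ⟨C, h⟩ := h
  refine ⟨c * C, fun a => ?_⟩
  rw [mul_assoc]
  exact Nat.mul_le_mul_left _ (h a)

end Dom

namespace TM

section Basic

variable {α β γ δ : Type} [Enc α] [Enc β] [Enc γ] [Enc δ] {u v : α → ℕ}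

lemma mono {f : α → β} (h : TM f u) (huv : Dom u v) : TM f v := by
  obtain ⟨c, K, h⟩ := h
  obtain ⟨C, hC⟩ := huv
  refine ⟨c, K * (C + 1), fun a => ?_⟩
  obtain ⟨s, hs, hr⟩ := h a
  refine ⟨s, hs.trans ?_, hr⟩
  rw [mul_assoc]
  refine Nat.mul_le_mul_left _ ?_
  have := hC a
  nlinarith

lemma mono_le {f : α → β} (h : TM f u) (huv : ∀ a, u a ≤ v a) : TM f v := h.mono (.of_le huv)

lemma of_run {f : α → β} (c : Code) (K : ℕ)
    (h : ∀ a, ∃ s, s ≤ K ∧ ∀ μ, Run μ c (enc a) (enc (f a)) s) : TM f u := by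
  refine ⟨c, K, fun a => ?_⟩
  obtain ⟨s, hs, hr⟩ := h a
  exact ⟨s, hs.trans (Nat.le_mul_of_pos_right _ (by omega)), hr⟩

lemma of_prim {f : α → β} (o : Prim) (h : ∀ a, o.eval (enc a) = enc (f a)) : TM f u :=
  of_run (.prim o) 1 fun a => ⟨1, le_rfl, fun _ => h a ▸ Run.prim o _⟩

lemma of_eq {f g : α → β} (h : TM f u) (hg : ∀ a, f a = g a) : TM g u := funext hg ▸ h

lemma transfer {α' β' : Type} [Enc α'] [Enc β'] {f : α → β} (h : TM f u) {f' : α' → β'}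
    (i : α' → α) (hi : ∀ a, enc (i a) = enc a) (ho : ∀ a, enc (f (i a)) = enc (f' a)) :
    TM f' (fun a => u (i a)) := by
  obtain ⟨c, K, h⟩ := h
  refine ⟨c, K, fun a => ?_⟩
  obtain ⟨s, hs, hr⟩ := h (i a)
  exact ⟨s, hs, fun μ => by rw [← hi, ← ho]; exact hr μ⟩

lemma comp' {f : α → β} {g : β → γ} {w : β → ℕ} (hg : TM g w) (hf : TM f u)
    (h : Dom (fun a => w (f a)) u) : TM (fun a => g (f a)) u := by
  obtain ⟨c, K, hc⟩ := hf
  obtain ⟨d, L, hd⟩ := hg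
  obtain ⟨C, hC⟩ := h
  refine ⟨.comp d c, K + L * (C + 1) + 1, fun a => ?_⟩
  obtain ⟨s, hs, hr⟩ := hc a
  obtain ⟨t, ht, hr'⟩ := hd (f a)
  refine ⟨s + t + 1, ?_, fun μ => .comp (hr μ) (hr' μ)⟩
  have h1 : L * (w (f a) + 1) ≤ L * ((C + 1) * (u a + 1)) :=
    Nat.mul_le_mul_left _ (by have := hC a; nlinarith)
  nlinarith

lemma app {g : β → γ} {w : β → ℕ} (hg : TM g w) (F : α → β) (hF : TM F fun _ => 0 := by fun_prop) :
    TM (fun a => g (F a)) fun a => w (F a) :=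
  hg.comp' (hF.mono_le fun _ => Nat.zero_le _) .refl

@[fun_prop]
lemma comp {f : α → β} {g : β → γ} (hg : TM g (fun _ => 0)) (hf : TM f u) :
    TM (fun a => g (f a)) u := hg.comp' hf .zero

@[fun_prop]
lemma id' : TM (fun a : α => a) u := of_prim .id fun _ => rfl

lemma exists_const (v : Val) : ∃ (c : Code) (K : ℕ), ∀ w, ∃ s, s ≤ K ∧ ∀ μ, Run μ c w v s := by
  induction v with
  | num z => exact ⟨.prim (.const z), 1, fun w => ⟨1, le_rfl, fun μ => .prim (.const z) w⟩⟩
  | pair a b iha ihb =>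
    obtain ⟨c, K, hc⟩ := iha
    obtain ⟨d, L, hd⟩ := ihb
    refine ⟨.pair c d, K + L + 1, fun w => ?_⟩
    obtain ⟨s, hs, hr⟩ := hc w
    obtain ⟨t, ht, hr'⟩ := hd w
    exact ⟨s + t + 1, by omega, fun μ => .pair (hr μ) (hr' μ)⟩

@[fun_prop]
lemma const (b : β) : TM (fun _ : α => b) u := by
  obtain ⟨c, K, hc⟩ := exists_const (enc b)
  exact of_run c K fun a => hc _

@[fun_prop]
lemma prodMk {f : α → β} {g : α → γ} (hf : TM f u) (hg : TM g u) :
    TM (fun a => (f a, g a)) u := by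
  obtain ⟨c, K, hc⟩ := hf
  obtain ⟨d, L, hd⟩ := hg
  refine ⟨.pair c d, K + L + 1, fun a => ?_⟩
  obtain ⟨s, hs, hr⟩ := hc a
  obtain ⟨t, ht, hr'⟩ := hd a
  exact ⟨s + t + 1, by nlinarith, fun μ => .pair (hr μ) (hr' μ)⟩

lemma prim₂ {f : α → β} {g : α → γ} (o : Prim) {h : β → γ → δ}
    (ho : ∀ a b, o.eval (.pair (enc a) (enc b)) = enc (h a b)) (hf : TM f u) (hg : TM g u) :
    TM (fun a => h (f a) (g a)) u :=
  comp (g := fun p : β × γ => h p.1 p.2) (of_prim o fun p => ho p.1 p.2) (hf.prodMk hg)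

@[fun_prop]
lemma fst {f : α → β × γ} (hf : TM f u) : TM (fun a => (f a).1) u :=
  comp (g := Prod.fst) (of_prim .fst fun _ => rfl) hf

@[fun_prop]
lemma snd {f : α → β × γ} (hf : TM f u) : TM (fun a => (f a).2) u :=
  comp (g := Prod.snd) (of_prim .snd fun _ => rfl) hf

@[fun_prop]
lemma val {P : β → Prop} {f : α → Subtype P} (hf : TM f u) : TM (fun a => (f a).1) u :=
  comp (g := Subtype.val) (of_prim .id fun _ => rfl) hf

lemma subtypeMk {P : β → Prop} {f : α → β} (hf : TM f u) (h : ∀ a, P (f a)) :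
    TM (fun a => (⟨f a, h a⟩ : Subtype P)) u :=
  hf.transfer id (fun _ => rfl) fun _ => rfl

lemma restrict {P : α → Prop} {f : α → β} (hf : TM f u) :
    TM (fun a => f a.1) (fun a : Subtype P => u a.1) :=
  hf.transfer Subtype.val (fun _ => rfl) fun _ => rfl

/-- Branching, where each branch only has to work where it is taken. -/
lemma ite_of {p : α → Prop} [DecidablePred p] {f g : α → β} (hp : TM (fun a => decide (p a)) u)
    (hf : TM (fun a => f a.1) (fun a : {a // p a} => u a.1))
    (hg : TM (fun a => g a.1) (fun a : {a // ¬ p a} => u a.1)) :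
    TM (fun a => if p a then f a else g a) u := by
  obtain ⟨c, K, hc⟩ := hp
  obtain ⟨d, L, hd⟩ := hf
  obtain ⟨e, M, he⟩ := hg
  refine ⟨.ite c d e, K + L + M + 1, fun a => ?_⟩
  obtain ⟨s, hs, hr⟩ := hc a
  by_cases h : p a
  · obtain ⟨t, ht, hr'⟩ := hd ⟨a, h⟩
    refine ⟨s + t + 1, ?_, fun μ => ?_⟩
    · simp only at ht
      nlinarith [Nat.zero_le (M * (u a + 1))]
    · simp only [h, decide_true, if_true] at hr ⊢
      exact .iteTrue (hr μ) (by simp [enc]) (hr' μ)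
  · obtain ⟨t, ht, hr'⟩ := he ⟨a, h⟩
    refine ⟨s + t + 1, ?_, fun μ => ?_⟩
    · simp only at ht
      nlinarith [Nat.zero_le (L * (u a + 1))]
    · simp only [h, decide_false, if_false] at hr ⊢
      exact .iteFalse (by simpa [enc] using hr μ) (hr' μ)

@[fun_prop]
lemma ite {p : α → Prop} [DecidablePred p] {f g : α → β} (hp : TM (fun a => decide (p a)) u)
    (hf : TM f u) (hg : TM g u) : TM (fun a => if p a then f a else g a) u :=
  ite_of hp hf.restrict hg.restrict

@[fun_prop]
lemma decide_eq_true {p : α → Bool} (hp : TM p u) : TM (fun a => decide (p a = true)) u := by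
  simpa using hp

end Basic

section Arith

@[fun_prop] lemma natAdd : TM (fun p : ℕ × ℕ => p.1 + p.2) fun _ => 0 :=
  of_prim .add fun _ => by simp [enc, Prim.eval]

@[fun_prop] lemma natMul : TM (fun p : ℕ × ℕ => p.1 * p.2) fun _ => 0 :=
  of_prim .mul fun _ => by simp [enc, Prim.eval]

@[fun_prop] lemma natDiv : TM (fun p : ℕ × ℕ => p.1 / p.2) fun _ => 0 :=
  of_prim .div fun _ => by simp [enc, Prim.eval]

@[fun_prop] lemma intAdd : TM (fun p : ℤ × ℤ => p.1 + p.2) fun _ => 0 :=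
  of_prim .add fun _ => by simp [enc, Prim.eval]

@[fun_prop] lemma intMul : TM (fun p : ℤ × ℤ => p.1 * p.2) fun _ => 0 :=
  of_prim .mul fun _ => by simp [enc, Prim.eval]

@[fun_prop] lemma natCast : TM (fun n : ℕ => (n : ℤ)) fun _ => 0 := of_prim .id fun _ => rfl

variable {α : Type} [Enc α] {u : α → ℕ} {f g : α → ℕ}

@[fun_prop] lemma natLe (hf : TM f u) (hg : TM g u) : TM (fun a => decide (f a ≤ g a)) u :=
  prim₂ .le (h := fun a b => decide (a ≤ b)) (fun a b => by simp [enc, Prim.eval]) hf hg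

@[fun_prop] lemma natLt (hf : TM f u) (hg : TM g u) : TM (fun a => decide (f a < g a)) u :=
  natLe (f := fun a => f a + 1) fp hg

@[fun_prop] lemma intLe {f g : α → ℤ} (hf : TM f u) (hg : TM g u) :
    TM (fun a => decide (f a ≤ g a)) u :=
  prim₂ .le (h := fun a b => decide (a ≤ b)) (fun a b => by simp [enc, Prim.eval]) hf hg

@[fun_prop] lemma natEq (hf : TM f u) (hg : TM g u) : TM (fun a => decide (f a = g a)) u :=
  prim₂ .eq (h := fun a b => decide (a = b)) (fun a b => by simp [enc, Prim.eval]) hf hg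

@[fun_prop] lemma bnot : TM not fun _ => 0 :=
  (fp : TM (fun b : Bool => if b = true then false else true) _).of_eq fun b => by
    cases b <;> rfl

@[fun_prop] lemma band : TM (fun p : Bool × Bool => p.1 && p.2) fun _ => 0 :=
  (fp : TM (fun p : Bool × Bool => if p.1 = true then p.2 else false) _).of_eq fun p => by
    cases h : p.1 <;> simp

@[fun_prop] lemma bor : TM (fun p : Bool × Bool => p.1 || p.2) fun _ => 0 :=
  (fp : TM (fun p : Bool × Bool => if p.1 = true then true else p.2) _).of_eq fun p => by
    cases h : p.1 <;> simp

variable {p q : α → Prop} [DecidablePred p] [DecidablePred q]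

@[fun_prop] lemma decide_and (hp : TM (fun a => decide (p a)) u)
    (hq : TM (fun a => decide (q a)) u) : TM (fun a => decide (p a ∧ q a)) u := by
  simp only [Bool.decide_and]
  fun_prop

@[fun_prop] lemma decide_or (hp : TM (fun a => decide (p a)) u)
    (hq : TM (fun a => decide (q a)) u) : TM (fun a => decide (p a ∨ q a)) u := by
  simp only [Bool.decide_or]
  fun_prop

@[fun_prop] lemma natSub : TM (fun p : ℕ × ℕ => p.1 - p.2) fun _ => 0 := by
  have h : TM (fun p : {p : ℕ × ℕ // p.2 ≤ p.1} => p.1.1 - p.1.2) (fun _ => 0) :=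
    of_prim .sub fun p => by
      have := p.2
      simp [enc, Prim.eval]
      omega
  have : TM (fun p : ℕ × ℕ => if p.2 ≤ p.1 then p.1 - p.2 else 0) fun _ => 0 :=
    ite_of fp h (const _)
  refine this.of_eq fun a => ?_
  split_ifs <;> omega

@[fun_prop] lemma natMod : TM (fun p : ℕ × ℕ => p.1 % p.2) fun _ => 0 := by
  simp only [Nat.mod_eq_sub_mul_div]
  fun_prop

@[fun_prop] lemma natMax : TM (fun p : ℕ × ℕ => max p.1 p.2) fun _ => 0 := by
  simp only [max_def]
  fun_prop

@[fun_prop] lemma natMin : TM (fun p : ℕ × ℕ => min p.1 p.2) fun _ => 0 := by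
  simp only [min_def]
  fun_prop

@[fun_prop] lemma natPair : TM (fun p : ℕ × ℕ => Nat.pair p.1 p.2) fun _ => 0 := by
  unfold Nat.pair
  fun_prop

end Arith
end TM

namespace TM

/-! ### Loops -/

/-- The loop `while p do f` leads from one state to another, with the given cost. -/
inductive WhileRun {σ : Type} (p : σ → Bool) (f : {x // p x = true} → σ) (w : σ → ℕ) :
    σ → σ → ℕ → Prop
  | done {a : σ} : p a = false → WhileRun p f w a a 0
  | step {a b : σ} {t : ℕ} (h : p a = true) : WhileRun p f w (f ⟨a, h⟩) b t →
      WhileRun p f w a b (w a + 1 + t)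

lemma exists_while {σ : Type} [Enc σ] {p : σ → Bool} {f : {x // p x = true} → σ} {w : σ → ℕ}
    (hp : TM p (fun _ => 0)) (hf : TM f (fun x => w x.1)) :
    ∃ (c : Code) (K : ℕ), ∀ a b t, WhileRun p f w a b t →
      ∃ s, s ≤ K * (t + 1) ∧ ∀ μ, Run μ c (enc a) (enc b) s := by
  obtain ⟨c, K, hc⟩ := hp
  obtain ⟨d, L, hd⟩ := hf
  let body : Code := .ite c (.comp .recur d) (.prim .id)
  have key : ∀ a b t, WhileRun p f w a b t →
      ∃ s, s ≤ (K + L + 4) * (t + 1) ∧ Run body body (enc a) (enc b) s := by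
    intro a b t h
    induction h with
    | @done a h =>
      obtain ⟨s, hs, hr⟩ := hc a
      refine ⟨s + 1 + 1, by nlinarith, .iteFalse ?_ (.prim .id _)⟩
      simpa [h, enc] using hr body
    | @step a b t h _ ih =>
      obtain ⟨s, hs, hr⟩ := hc a
      obtain ⟨s', hs', hr'⟩ := hd ⟨a, h⟩
      obtain ⟨s'', hs'', hr''⟩ := ih
      simp only at hs' hs
      refine ⟨s + (s' + (s'' + 1) + 1) + 1, ?_,
        .iteTrue (hr body) (by simp [h, enc]) (.comp (hr' body) (.recur hr''))⟩
      have h1 : L * (w a + 1) ≤ (K + L + 4) * (w a + 1) := Nat.mul_le_mul_right _ (by omega)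
      nlinarith [Nat.zero_le (K * w a), Nat.zero_le (L * t), Nat.zero_le (L * w a)]
  refine ⟨.fix body, K + L + 5, fun a b t h => ?_⟩
  obtain ⟨s, hs, hr⟩ := key a b t h
  exact ⟨s + 1, by nlinarith, fun μ => .fix hr⟩

section FoldCost

variable {γ σ : Type}

/-- The cost of a left fold in terms of the costs of its steps. -/
def foldCost (w : σ → γ → ℕ) (g : σ → γ → σ) : σ → List γ → ℕ
  | _, [] => 0
  | s, x :: l => w s x + 1 + foldCost w g (g s x) l

lemma foldCost_le {w : σ → γ → ℕ} {g : σ → γ → σ} (Inv : σ → Prop) {T : ℕ} {l : List γ} {s : σ}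
    (hs : Inv s) (h : ∀ s, ∀ x ∈ l, Inv s → Inv (g s x) ∧ w s x ≤ T) :
    foldCost w g s l ≤ l.length * (T + 1) := by
  induction l generalizing s with
  | nil => simp [foldCost]
  | cons x l ih =>
    obtain ⟨h1, h2⟩ := h s x (by simp) hs
    have := ih h1 fun s y hy => h s y (by simp [hy])
    simp only [foldCost, length_cons]
    nlinarith

lemma foldCost_append {w : σ → γ → ℕ} {g : σ → γ → σ} {l m : List γ} {s : σ} :
    foldCost w g s (l ++ m) = foldCost w g s l + foldCost w g (l.foldl g s) m := by
  induction l generalizing s with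
  | nil => simp [foldCost]
  | cons x l ih => simp [foldCost, ih, add_assoc]

lemma foldCost_const {v : γ → ℕ} {g : σ → γ → σ} {l : List γ} {s : σ} :
    foldCost (fun _ x => v x) g s l = (l.map fun x => v x + 1).sum := by
  induction l generalizing s with
  | nil => simp [foldCost]
  | cons x l ih => simp [foldCost, ih]

end FoldCost

section Lists

variable {α β γ δ σ : Type} [Enc α] [Enc β] [Enc γ] [Enc δ] [Enc σ] {u : α → ℕ}

@[fun_prop] lemma cons : TM (fun p : β × List β => p.1 :: p.2) fun _ => 0 :=
  of_prim .id fun _ => rfl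

@[fun_prop] lemma isEmpty : TM (List.isEmpty (α := β)) fun _ => 0 := by
  have : TM (fun l : List β => !l.isEmpty) (fun _ => 0) := of_prim .isPair fun l => by
    cases l <;> simp [enc, Val.ofList, Prim.eval]
  simpa using bnot.comp this

@[fun_prop] lemma tail : TM (List.tail (α := β)) fun _ => 0 := of_prim .snd fun l => by
  cases l <;> simp [enc, Val.ofList, Prim.eval]

lemma head : TM (fun l : {l : List β // l ≠ []} => l.1.head l.2) (fun _ => 0) :=
  of_prim .fst fun l => by
    obtain ⟨l, h⟩ := l
    cases l <;> simp [enc, Val.ofList, Prim.eval] at h ⊢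

@[fun_prop] lemma headD : TM (fun p : List β × β => p.1.headD p.2) fun _ => 0 := by
  have h : TM (fun p : {p : List β × β // p.1 ≠ []} => p.1.1.head p.2) (fun _ => 0) :=
    head.comp (f := fun p : {p : List β × β // p.1 ≠ []} => (⟨p.1.1, p.2⟩ : {l : List β // l ≠ []}))
      (TM.subtypeMk fp fun p => p.2)
  have : TM (fun p : List β × β => if p.1.isEmpty = true then p.2 else p.1.headD p.2)
      (fun _ => 0) := by
    refine ite_of fp fp ?_
    refine h.transfer (fun p => ⟨p.1, by simpa using p.2⟩) (fun _ => rfl) ?_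
    rintro ⟨⟨_ | _, d⟩, hp⟩ <;> simp at hp ⊢
  exact this.of_eq fun p => by rcases p with ⟨_ | _, d⟩ <;> rfl

variable {l : α → List γ} {s₀ : α → σ} {g : α → σ → γ → σ} {h : α → γ → δ} {p : α → γ → Bool}

lemma foldl {w : α × σ × γ → ℕ}
    (hg : TM (fun p : α × σ × γ => g p.1 p.2.1 p.2.2) w) (hl : TM l u) (hs : TM s₀ u)
    (hc : Dom (fun a => foldCost (fun s x => w (a, s, x)) (g a) (s₀ a) (l a)) u) :
    TM (fun a => (l a).foldl (g a) (s₀ a)) u := by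
  let p : ((σ × List γ) × α) → Bool := fun x => !x.1.2.isEmpty
  have hne : ∀ x : {x : ((σ × List γ) × α) // p x = true}, x.1.1.2 ≠ [] := fun x => by simpa [p] using x.2
  let f : {x : ((σ × List γ) × α) // p x = true} → ((σ × List γ) × α) := fun x =>
    ((g x.1.2 x.1.1.1 (x.1.1.2.head (hne x)), x.1.1.2.tail), x.1.2)
  let W : ((σ × List γ) × α) → ℕ := fun x => match x.1.2 with
    | [] => 0
    | y :: _ => w (x.2, x.1.1, y)
  have hf : TM f (fun x => W x.1) := by
    have h1 : TM (fun x : {x : ((σ × List γ) × α) // p x = true} => x.1.1.2.head (hne x)) (fun x => W x.1) :=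
      head.comp (f := fun x : {x : ((σ × List γ) × α) // p x = true} =>
        (⟨x.1.1.2, hne x⟩ : {l : List γ // l ≠ []})) (subtypeMk fp _)
    have h2 := hg.comp' (f := fun x : {x : ((σ × List γ) × α) // p x = true} =>
      (x.1.2, x.1.1.1, x.1.1.2.head (hne x))) (u := fun x => W x.1) fp
      (.of_le fun x => by
        obtain ⟨⟨⟨s, l⟩, a⟩, h⟩ := x
        cases l
        · simp [p] at h
        · simp [W])
    exact prodMk (prodMk h2 fp) fp
  obtain ⟨c, K, hw⟩ := exists_while (p := p) (w := W) fp hf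
  obtain ⟨d, L, hd⟩ : TM (fun a => ((s₀ a, l a), a)) u := by fun_prop
  obtain ⟨C, hC⟩ := hc
  refine ⟨.comp (.prim .fst) (.comp (.prim .fst) (.comp c d)), L + K * (C + 1) + 5, fun a => ?_⟩
  have hrun : ∀ (l : List γ) (s : σ), WhileRun p f W ((s, l), a) ((l.foldl (g a) s, []), a)
      (foldCost (fun s x => w (a, s, x)) (g a) s l) := by
    intro l
    induction l with
    | nil => exact fun s => .done rfl
    | cons x l ih => exact fun s => .step (a := ((s, x :: l), a)) rfl (ih _)
  obtain ⟨s, hs, hr⟩ := hd a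
  obtain ⟨t, ht, hr'⟩ := hw _ _ _ (hrun (l a) (s₀ a))
  refine ⟨s + t + 1 + 1 + 1 + 1 + 1, ?_,
    fun μ => .comp (.comp (.comp (hr μ) (hr' μ)) (.prim .fst _)) (.prim .fst _)⟩
  have := hC a
  have : K * (foldCost (fun s x => w (a, s, x)) (g a) (s₀ a) (l a) + 1) ≤
      K * ((C + 1) * (u a + 1)) := Nat.mul_le_mul_left _ (by nlinarith)
  nlinarith

lemma foldl_le {w : α × σ × γ → ℕ}
    (hg : TM (fun p : α × σ × γ => g p.1 p.2.1 p.2.2) w) (hl : TM l u) (hs : TM s₀ u)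
    (Inv : α → σ → Prop) (T : α → ℕ) (h₀ : ∀ a, Inv a (s₀ a))
    (h : ∀ a, ∀ s, ∀ x ∈ l a, Inv a s → Inv a (g a s x) ∧ w (a, s, x) ≤ T a)
    (hc : Dom (fun a => (l a).length * (T a + 1)) u) :
    TM (fun a => (l a).foldl (g a) (s₀ a)) u :=
  foldl hg hl hs (.trans (.of_le fun a => foldCost_le (Inv a) (h₀ a) (h a)) hc)

lemma foldl_sum {v : α × γ → ℕ}
    (hg : TM (fun p : α × σ × γ => g p.1 p.2.1 p.2.2) (fun p => v (p.1, p.2.2)))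
    (hl : TM l u) (hs : TM s₀ u)
    (hc : Dom (fun a => ((l a).map fun x => v (a, x) + 1).sum) u) :
    TM (fun a => (l a).foldl (g a) (s₀ a)) u :=
  foldl hg hl hs (.trans (.of_le fun a => by rw [foldCost_const (v := fun x => v (a, x))]) hc)

lemma foldl₁ (hg : TM (fun p : α × σ × γ => g p.1 p.2.1 p.2.2) (fun _ => 0))
    (hl : TM l u) (hs : TM s₀ u) (hc : Dom (fun a => (l a).length) u) :
    TM (fun a => (l a).foldl (g a) (s₀ a)) u :=
  foldl_sum (v := fun _ => 0) hg hl hs (.trans (.of_le fun a => by simp) hc)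

lemma reverse (hl : TM l u) (hc : Dom (fun a => (l a).length) u) :
    TM (fun a => (l a).reverse) u := by
  have : TM (fun a => (l a).foldl (fun s x => x :: s) []) u :=
    foldl₁ (g := fun _ s x => x :: s) fp hl fp hc
  exact this.of_eq fun a => by simp

lemma length (hl : TM l u) (hc : Dom (fun a => (l a).length) u) :
    TM (fun a => (l a).length) u := by
  have : TM (fun a => (l a).foldl (fun s _ => s + 1) 0) u :=
    foldl₁ (g := fun _ s _ => s + 1) fp hl fp hc
  exact this.of_eq fun a => by simp

lemma reverseAux {l m : α → List γ} (hl : TM l u) (hm : TM m u)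
    (hc : Dom (fun a => (l a).length) u) : TM (fun a => (l a).reverse ++ m a) u := by
  have : TM (fun a => (l a).foldl (fun s x => x :: s) (m a)) u :=
    foldl₁ (g := fun _ s x => x :: s) fp hl hm hc
  exact this.of_eq fun a => by simp

lemma flatMap {h : α → γ → List δ} {v : α × γ → ℕ}
    (hh : TM (fun p : α × γ => h p.1 p.2) v) (hl : TM l u)
    (hc : Dom (fun a => ((l a).map fun x => v (a, x) + (h a x).length + 1).sum) u) :
    TM (fun a => (l a).flatMap (h a)) u := by
  have h1 : TM (fun a => (l a).foldl (fun s x => (h a x).reverse ++ s) []) u := by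
    refine foldl_sum (g := fun a s x => (h a x).reverse ++ s)
      (v := fun p => v p + (h p.1 p.2).length) ?_ hl fp hc
    refine reverseAux ?_ fp (.of_le fun p => by simp)
    exact hh.comp' (f := fun p : α × List δ × γ => (p.1, p.2.2)) fp
      (.of_le fun p => by simp)
  have h2 : ∀ a, (l a).foldl (fun s x => (h a x).reverse ++ s) [] =
      ((l a).flatMap (h a)).reverse := by
    intro a
    suffices ∀ (m : List γ) s, m.foldl (fun s x => (h a x).reverse ++ s) s =
        (m.flatMap (h a)).reverse ++ s by simpa using this (l a) []
    intro m
    induction m with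
    | nil => simp
    | cons x m ih => intro s; simp [ih]
  have h3 : TM (fun a => ((l a).flatMap (h a)).reverse) u := h1.of_eq h2
  have := h3.reverse (.trans (.of_le fun a => ?_) hc)
  · simpa using this
  · simp only [length_reverse, length_flatMap]
    refine sum_le_sum fun x _ => ?_
    omega

lemma map {v : α × γ → ℕ}
    (hh : TM (fun p : α × γ => h p.1 p.2) v) (hl : TM l u)
    (hc : Dom (fun a => ((l a).map fun x => v (a, x) + 1).sum) u) :
    TM (fun a => (l a).map (h a)) u := by
  have := flatMap (h := fun a x => [h a x]) (v := v) (u := u) (l := l)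
    fp hl (.trans (.of_le fun a => ?_) (hc.const_mul 2))
  · exact this.of_eq fun a => by induction l a <;> simp_all
  · rw [← sum_map_mul_left]
    refine sum_le_sum fun x _ => ?_
    simp

lemma map₁ {h : α → γ → δ}
    (hh : TM (fun p : α × γ => h p.1 p.2) (fun _ => 0)) (hl : TM l u)
    (hc : Dom (fun a => (l a).length) u) :
    TM (fun a => (l a).map (h a)) u :=
  map hh hl (.trans (.of_le fun a => by simp) hc)

lemma map_le {v : α × γ → ℕ}
    (hh : TM (fun p : α × γ => h p.1 p.2) v) (hl : TM l u)
    (T : α → ℕ) (hT : ∀ a, ∀ x ∈ l a, v (a, x) ≤ T a)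
    (hc : Dom (fun a => (l a).length * (T a + 1)) u) :
    TM (fun a => (l a).map (h a)) u :=
  map hh hl (.trans (.of_le fun a => by
    refine (sum_le_card_nsmul _ (T a + 1) fun y hy => ?_).trans (by simp)
    obtain ⟨x, hx, rfl⟩ := mem_map.1 hy
    exact Nat.succ_le_succ (hT a x hx)) hc)

lemma all {v : α × γ → ℕ}
    (hh : TM (fun q : α × γ => p q.1 q.2) v) (hl : TM l u)
    (hc : Dom (fun a => ((l a).map fun x => v (a, x) + 1).sum) u) :
    TM (fun a => (l a).all (p a)) u := by
  have := isEmpty.comp (flatMap (h := fun a x => if p a x = true then [] else [x]) (v := v) (u := u)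
    fp hl (.trans (.of_le fun a => ?_) (hc.const_mul 2)))
  · refine this.of_eq fun a => ?_
    induction l a with
    | nil => rfl
    | cons x l ih => cases h : p a x <;> simp_all
  · rw [← sum_map_mul_left]
    refine sum_le_sum fun x _ => ?_
    split_ifs <;> simp

lemma zip {m : α → List δ} (hl : TM l u) (hm : TM m u)
    (hc : Dom (fun a => (l a).length) u) : TM (fun a => (l a).zip (m a)) u := by
  by_cases hd : Nonempty δ
  · obtain ⟨d⟩ := hd
    have h1 : TM (fun a => ((l a).foldl (fun (s : List δ × List (γ × δ)) x =>
        if s.1.isEmpty = true then s else (s.1.tail, (x, s.1.headD d) :: s.2)) (m a, [])).2) u :=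
      (foldl₁ (g := fun _ (s : List δ × List (γ × δ)) x =>
        if s.1.isEmpty = true then s else (s.1.tail, (x, s.1.headD d) :: s.2)) fp hl
        fp hc).snd
    have h2 : TM (fun a => ((l a).zip (m a)).reverse) u := by
      refine h1.of_eq fun a => ?_
      suffices ∀ (l : List γ) (m : List δ) (acc : List (γ × δ)),
          (l.foldl (fun (s : List δ × List (γ × δ)) x =>
          if s.1.isEmpty = true then s else (s.1.tail, (x, s.1.headD d) :: s.2)) (m, acc)).2 =
          (l.zip m).reverse ++ acc by simpa using this (l a) (m a) []
      intro l
      induction l with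
      | nil => simp
      | cons x l ih =>
        intro m acc
        cases m with
        | nil =>
          have := ih [] acc
          simpa using this
        | cons y m =>
          have := ih m ((x, y) :: acc)
          simpa using this
    have := h2.reverse (.trans (.of_le fun a => by simp) hc)
    simpa using this
  · refine (TM.const (β := List (γ × δ)) []).of_eq fun a => ?_
    have : m a = [] := eq_nil_iff_forall_not_mem.2 fun x => (hd ⟨x⟩).elim
    simp [this]

lemma zipWith {κ : Type} [Enc κ] {h : γ → δ → κ} (hh : TM (fun q : γ × δ => h q.1 q.2) fun _ => 0) :
    TM (fun p : List γ × List δ => List.zipWith h p.1 p.2) fun p => p.1.length :=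
  (map₁ (l := fun p : List γ × List δ => p.1.zip p.2) (h := fun _ x => h x.1 x.2) fp
    (zip fp fp .refl) (.of_le fun p => by simp)).of_eq fun p => by rw [List.zip, map_zipWith]

end Lists

end TM

attribute [fun_prop] Primrec Primrec.unpair Primrec.list_reverse Primrec.list_length
  Primrec.list_range Primrec.not Primrec.fst Primrec.snd Primrec.encode

/-! ### Automation for primitive recursion -/

namespace PR

variable {α β γ : Type} [Primcodable α] [Primcodable β] [Primcodable γ]

@[fun_prop] lemma id' : Primrec (fun a : α => a) := .id

@[fun_prop] lemma const (b : β) : Primrec (fun _ : α => b) := .const b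

@[fun_prop] lemma comp {g : β → γ} {f : α → β} (hg : Primrec g) (hf : Primrec f) :
    Primrec (fun a => g (f a)) := hg.comp hf

@[fun_prop] lemma prodMk {g : α → γ} {f : α → β} (hg : Primrec g) (hf : Primrec f) :
    Primrec (fun a => (g a, f a)) := hg.pair hf

@[fun_prop] lemma add : Primrec fun p : ℕ × ℕ => p.1 + p.2 := .nat_add

@[fun_prop] lemma mul : Primrec fun p : ℕ × ℕ => p.1 * p.2 := .nat_mul

@[fun_prop] lemma sub : Primrec fun p : ℕ × ℕ => p.1 - p.2 := .nat_sub

@[fun_prop] lemma div : Primrec fun p : ℕ × ℕ => p.1 / p.2 := .nat_div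

@[fun_prop] lemma mod : Primrec fun p : ℕ × ℕ => p.1 % p.2 := .nat_mod

@[fun_prop] lemma pow : Primrec fun p : ℕ × ℕ => p.1 ^ p.2 := Primrec₂.unpaired'.1 Nat.Primrec.pow

@[fun_prop] lemma natPair : Primrec fun p : ℕ × ℕ => Nat.pair p.1 p.2 := Primrec₂.natPair

@[fun_prop] lemma natRec {n : α → ℕ} {s : α → β} {g : α → ℕ → β → β} (hn : Primrec n)
    (hs : Primrec s) (hg : Primrec (fun p : α × ℕ × β => g p.1 p.2.1 p.2.2)) :
    Primrec (fun a => Nat.rec (motive := fun _ => β) (s a) (g a) (n a)) :=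
  Primrec.nat_rec' hn hs (h := fun a p => g a p.1 p.2) hg

@[fun_prop] lemma factorial : Primrec Nat.factorial := by
  have : Primrec (fun n : ℕ => Nat.rec (motive := fun _ => ℕ) 1 (fun n s => (n + 1) * s) n) := by
    fun_prop
  refine this.of_eq fun n => ?_
  induction n with
  | zero => rfl
  | succ n ih => simp [Nat.factorial, ih]

@[fun_prop] lemma decide_lt {f g : α → ℕ} (hf : Primrec f) (hg : Primrec g) :
    Primrec (fun a => decide (f a < g a)) := (Primrec.nat_lt.comp hf hg).decide

@[fun_prop] lemma decide_eq {f g : α → ℕ} (hf : Primrec f) (hg : Primrec g) :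
    Primrec (fun a => decide (f a = g a)) := (Primrec.eq.comp hf hg).decide

@[fun_prop] lemma band : Primrec fun p : Bool × Bool => p.1 && p.2 := Primrec.and

@[fun_prop] lemma bor : Primrec fun p : Bool × Bool => p.1 || p.2 := Primrec.or

@[fun_prop] lemma ite {p : α → Prop} [DecidablePred p] {f g : α → β}
    (hp : Primrec fun a => decide (p a)) (hf : Primrec f) (hg : Primrec g) :
    Primrec (fun a => if p a then f a else g a) := Primrec.ite hp.primrecPred hf hg

@[fun_prop] lemma cons : Primrec fun p : β × List β => p.1 :: p.2 := .list_cons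

@[fun_prop] lemma append : Primrec fun p : List β × List β => p.1 ++ p.2 := .list_append

@[fun_prop] lemma getD (d : β) : Primrec fun p : List β × ℕ => p.1.getD p.2 d := .list_getD d

@[fun_prop] lemma headD : Primrec fun p : List β × β => p.1.headD p.2 :=
  (Primrec.option_getD.comp (Primrec.list_head?.comp .fst) .snd).of_eq fun p => by simp

variable {f : α → List β} {h : α → β → γ} {c : α → β → Bool} {s : α → γ}

@[fun_prop] lemma map (hh : Primrec (fun p : α × β => h p.1 p.2)) (hf : Primrec f) :
    Primrec (fun a => (f a).map (h a)) := .list_map hf hh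

@[fun_prop] lemma flatMap {h : α → β → List γ} (hh : Primrec (fun p : α × β => h p.1 p.2))
    (hf : Primrec f) : Primrec (fun a => (f a).flatMap (h a)) := .list_flatMap hf hh

@[fun_prop] lemma foldl {g : α → γ → β → γ} (hf : Primrec f) (hs : Primrec s)
    (hg : Primrec (fun p : α × γ × β => g p.1 p.2.1 p.2.2)) :
    Primrec (fun a => (f a).foldl (g a) (s a)) :=
  .list_foldl hf hs (h := fun a p => g a p.1 p.2) hg

@[fun_prop] lemma foldr {g : α → β → γ → γ} (hf : Primrec f) (hs : Primrec s)
    (hg : Primrec (fun p : α × β × γ => g p.1 p.2.1 p.2.2)) :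
    Primrec (fun a => (f a).foldr (g a) (s a)) :=
  .list_foldr hf hs (h := fun a p => g a p.1 p.2) hg

@[fun_prop] lemma filter (hh : Primrec (fun p : α × β => c p.1 p.2)) (hf : Primrec f) :
    Primrec (fun a => (f a).filter (c a)) := by
  have : Primrec (fun a => (f a).foldr (fun x s => if c a x = true then x :: s else s) []) := by
    have : Primrec (fun p : α × β × List β => decide (c p.1 p.2.1 = true)) := by
      simpa using hh.comp (g := fun p : α × β × List β => (p.1, p.2.1)) fp
    fun_prop
  refine this.of_eq fun a => ?_
  induction f a with
  | nil => rfl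
  | cons x l ih => by_cases hx : c a x <;> simp [hx, ih]

@[fun_prop] lemma any (hh : Primrec (fun p : α × β => c p.1 p.2)) (hf : Primrec f) :
    Primrec (fun a => (f a).any (c a)) := by
  have : Primrec (fun a => ((f a).map (c a)).foldr (fun x s => x || s) false) := by fun_prop
  exact this.of_eq fun a => by induction f a <;> simp_all

@[fun_prop] lemma all (hh : Primrec (fun p : α × β => c p.1 p.2)) (hf : Primrec f) :
    Primrec (fun a => (f a).all (c a)) := by
  have : Primrec (fun a => ((f a).map (c a)).foldr (fun x s => x && s) true) := by fun_prop
  exact this.of_eq fun a => by induction f a <;> simp_all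

/-- Recursion on a level, with values given by those at smaller arguments of the previous level. -/
lemma level {F : ℕ → α → ℕ → β} {H : (α × ℕ × ℕ) × List β → β}
    (h0 : Primrec fun p : α × ℕ => F 0 p.1 p.2) (hH : Primrec H)
    (hs : ∀ j a x N, x < N → F (j + 1) a x = H ((a, j, x), (List.range N).map (F j a))) :
    Primrec fun p : ℕ × α × ℕ => F p.1 p.2.1 p.2.2 := by
  have h1 : Primrec fun p : ℕ × α × ℕ => Nat.rec (motive := fun _ => List β)
      ((List.range (p.2.2 + 1)).map (F 0 p.2.1))
      (fun j t => (List.range (p.2.2 + 1)).map fun x => H ((p.2.1, j, x), t)) p.1 := by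
    fun_prop
  have h2 : ∀ p : ℕ × α × ℕ, Nat.rec (motive := fun _ => List β)
      ((List.range (p.2.2 + 1)).map (F 0 p.2.1))
      (fun j t => (List.range (p.2.2 + 1)).map fun x => H ((p.2.1, j, x), t)) p.1 =
      (List.range (p.2.2 + 1)).map (F p.1 p.2.1) := by
    rintro ⟨j, a, x⟩
    induction j with
    | zero => rfl
    | succ j ih =>
      simp only at ih ⊢
      rw [ih]
      refine List.map_congr_left fun y hy => ?_
      rw [hs _ _ _ (x + 1) (List.mem_range.1 hy)]
  have h3 := Primrec.list_getElem?.comp (h1.of_eq h2) (Primrec.snd.comp Primrec.snd)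
  rw [← Primrec.option_some_iff]
  exact h3.of_eq fun p => by simp

end PR

namespace TM

section NatRec

variable {α σ γ : Type} [Enc α] [Enc σ] [Enc γ] {u : α → ℕ}

lemma range {n : α → ℕ} (hn : TM n u) (hc : Dom n u) : TM (fun a => List.range (n a)) u := by
  let p : ℕ × List ℕ → Bool := fun x => decide (0 < x.1)
  let f : {x // p x = true} → ℕ × List ℕ := fun x => (x.1.1 - 1, (x.1.1 - 1) :: x.1.2)
  obtain ⟨c, K, hw⟩ := exists_while (p := p) (f := f) (w := fun _ => 0) fp fp
  have hrun : ∀ i l, WhileRun p f (fun _ => 0) (i, l) (0, List.range i ++ l) i := by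
    intro i
    induction i with
    | zero => exact fun l => .done rfl
    | succ i ih =>
      intro l
      rw [range_succ, append_assoc, (by omega : i + 1 = 0 + 1 + i)]
      exact .step (by simp [p]) (by simpa [f] using ih (i :: l))
  have h : TM (fun x : {x : ℕ × List ℕ // ∃ i, x = (i, [])} => (0, List.range x.1.1))
      fun x => x.1.1 := by
    refine ⟨c, K, ?_⟩
    rintro ⟨_, i, rfl⟩
    exact hw _ _ _ (by simpa using hrun i [])
  exact .snd (h.comp' (.subtypeMk (f := fun a => (n a, ([] : List ℕ))) fp fun a => ⟨_, rfl⟩) hc)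

lemma natRec {n : α → ℕ} {s₀ : α → σ} {g : α → ℕ → σ → σ} {w : α × ℕ × σ → ℕ}
    (hg : TM (fun p : α × ℕ × σ => g p.1 p.2.1 p.2.2) w) (hn : TM n u) (hs : TM s₀ u)
    (hc : Dom (fun a => ∑ i ∈ Finset.range (n a),
      (w (a, i, Nat.rec (motive := fun _ => σ) (s₀ a) (g a) i) + 1)) u) :
    TM (fun a => Nat.rec (motive := fun _ => σ) (s₀ a) (g a) (n a)) u := by
  have key : ∀ a m, (List.range m).foldl (fun s i => g a i s) (s₀ a) =
      Nat.rec (motive := fun _ => σ) (s₀ a) (g a) m ∧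
      foldCost (fun s i => w (a, i, s)) (fun s i => g a i s) (s₀ a) (List.range m) =
        ∑ i ∈ Finset.range m, (w (a, i, Nat.rec (motive := fun _ => σ) (s₀ a) (g a) i) + 1) := by
    intro a m
    induction m with
    | zero => simp [foldCost]
    | succ m ih => simp [range_succ, foldCost_append, foldCost, ih, Finset.sum_range_succ]
  refine (foldl (g := fun a s i => g a i s) (hg.app fun p : α × σ × ℕ => (p.1, p.2.2, p.2.1))
    (hn.range (.trans (.of_le fun a => ?_) hc)) hs ?_).of_eq fun a => (key a _).1
  · simp [Finset.sum_add_distrib]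
  · simpa only [key] using hc

lemma natRec₁ {n : α → ℕ} {s₀ : α → σ} {g : α → ℕ → σ → σ}
    (hg : TM (fun p : α × ℕ × σ => g p.1 p.2.1 p.2.2) (fun _ => 0)) (hn : TM n u) (hs : TM s₀ u)
    (hc : Dom n u) :
    TM (fun a => Nat.rec (motive := fun _ => σ) (s₀ a) (g a) (n a)) u :=
  natRec hg hn hs (.trans (.of_le fun a => by simp) hc)

lemma natPow {f g : α → ℕ} (hf : TM f u) (hg : TM g u) (hc : Dom g u) :
    TM (fun a => f a ^ g a) u := by
  refine ((natRec₁ (α := ℕ × ℕ) (n := Prod.snd) (s₀ := fun _ => 1) (g := fun a _ s => s * a.1)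
    fp fp fp .refl).comp' (f := fun a => (f a, g a)) fp hc).of_eq fun a => ?_
  induction g a with
  | zero => simp
  | succ n ih => simp [pow_succ, ih]

lemma sqrt : TM Nat.sqrt (fun n => n) := by
  have : TM (fun n : ℕ => Nat.rec (motive := fun _ => ℕ) 0
      (fun _ s => if (s + 1) * (s + 1) ≤ n then s + 1 else s) n) (fun n => n) :=
    natRec₁ (g := fun n _ s => if (s + 1) * (s + 1) ≤ n then s + 1 else s) fp
      fp fp .refl
  refine this.of_eq fun n => ?_
  suffices ∀ i, Nat.rec (motive := fun _ => ℕ) 0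
      (fun _ s => if (s + 1) * (s + 1) ≤ n then s + 1 else s) i = min i (Nat.sqrt n) by
    rw [this, min_eq_right (Nat.sqrt_le_self n)]
  intro i
  induction i with
  | zero => simp
  | succ i ih =>
    simp only [ih]
    simp only [← Nat.le_sqrt]
    split_ifs <;> omega

lemma unpair : TM Nat.unpair (fun n => n) := by
  have := sqrt
  unfold Nat.unpair
  simp only
  fun_prop

end NatRec

/-! ### Primitive recursive functions -/

lemma exists_of_natPrimrec {f : ℕ → ℕ} (hf : Nat.Primrec f) : ∃ t, Primrec t ∧ TM f t := by
  induction hf with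
  | zero => exact ⟨fun _ => 0, Primrec.const 0, const 0⟩
  | succ => exact ⟨fun _ => 0, Primrec.const 0, natAdd.comp (id'.prodMk (const 1))⟩
  | left => exact ⟨fun n => n, Primrec.id, unpair.fst⟩
  | right => exact ⟨fun n => n, Primrec.id, unpair.snd⟩
  | pair _ _ hf hg =>
    obtain ⟨t, ht, hf⟩ := hf
    obtain ⟨t', ht', hg⟩ := hg
    exact ⟨fun n => t n + t' n, fp, natPair.comp <| .prodMk
      (hf.mono_le fun n => by omega) (hg.mono_le fun n => by omega)⟩
  | @comp f g _ hg hf hg' =>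
    obtain ⟨t, ht, hf⟩ := hf
    obtain ⟨t', ht', hg'⟩ := hg'
    exact ⟨fun n => t' n + t (g n), have := Primrec.nat_iff.2 hg; fp,
      hf.comp' (hg'.mono_le fun n => by omega) (.of_le fun n => by omega)⟩
  | @prec f g hfp hgp hf hg =>
    obtain ⟨t, ht, hf⟩ := hf
    obtain ⟨t', ht', hg⟩ := hg
    have hfp := Primrec.nat_iff.2 hfp
    have hgp := Primrec.nat_iff.2 hgp
    let F : ℕ → ℕ → ℕ := fun z n => Nat.rec (f z) (fun y IH => g (Nat.pair z (Nat.pair y IH))) n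
    have hF : Primrec fun p : ℕ × ℕ => F p.1 p.2 := by fun_prop
    let S : ℕ → ℕ → ℕ := fun z n => Nat.rec (motive := fun _ => ℕ) 0
      (fun y acc => acc + (t' (Nat.pair z (Nat.pair y (F z y))) + 1)) n
    have hS : Primrec fun p : ℕ × ℕ => S p.1 p.2 := by fun_prop
    have hS' : ∀ z n, S z n = ∑ y ∈ Finset.range n, (t' (Nat.pair z (Nat.pair y (F z y))) + 1) := by
      intro z n
      induction n with
      | zero => rfl
      | succ n ih => rw [Finset.sum_range_succ, ← ih]
    refine ⟨fun n => n + t n.unpair.1 + S n.unpair.1 n.unpair.2, fp, ?_⟩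
    have hun : TM Nat.unpair fun n => n + t n.unpair.1 + S n.unpair.1 n.unpair.2 :=
      unpair.mono_le fun n => by omega
    have key := natRec (α := ℕ × ℕ × ℕ) (n := fun p => p.2.1) (s₀ := fun p => p.2.2)
      (u := fun p => p.2.1 + ∑ i ∈ Finset.range p.2.1, (t' (Nat.pair p.1 (Nat.pair i
        (Nat.rec (motive := fun _ => ℕ) p.2.2 (fun y IH => g (Nat.pair p.1 (Nat.pair y IH))) i)))
          + 1))
      (g := fun p y IH => g (Nat.pair p.1 (Nat.pair y IH)))
      (hg.app fun p : (ℕ × ℕ × ℕ) × ℕ × ℕ => Nat.pair p.1.1 (Nat.pair p.2.1 p.2.2)) fp fp (.of_le fun p => by simp)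
    have hfz : TM (fun n : ℕ => f n.unpair.1)
        (fun n => n + t n.unpair.1 + S n.unpair.1 n.unpair.2) :=
      hf.comp' hun.fst (.of_le fun n => by omega)
    refine (key.comp' (f := fun n : ℕ => (n.unpair.1, n.unpair.2, f n.unpair.1))
      (hun.fst.prodMk (hun.snd.prodMk hfz))
      (.of_le fun n => ?_)).of_eq fun n => rfl
    have := hS' n.unpair.1 n.unpair.2
    have := Nat.unpair_right_le n
    simp only [F] at *
    omega

def sumUpTo (t : ℕ → ℕ) (n : ℕ) : ℕ := Nat.rec (t 0) (fun i s => s + t (i + 1)) n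

lemma primrec_sumUpTo {t : ℕ → ℕ} (ht : Primrec t) : Primrec (sumUpTo t) := by
  unfold sumUpTo
  fun_prop

lemma monotone_sumUpTo (t : ℕ → ℕ) : Monotone (sumUpTo t) :=
  monotone_nat_of_le_succ fun n => Nat.le_add_right _ (t (n + 1))

lemma le_sumUpTo (t : ℕ → ℕ) (n : ℕ) : t n ≤ sumUpTo t n := by
  cases n with
  | zero => exact le_rfl
  | succ n => exact Nat.le_add_left _ _

section Encode

open Encodable

variable {α β : Type} [Enc α] [Enc β]

lemma exists_of_primrec [Primcodable α] {v : α → ℕ} (hv : TM (encode : α → ℕ) v) {f : α → ℕ}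
    (hf : Primrec f) :
    ∃ t, Primrec t ∧ Monotone t ∧ TM f (fun a => v a + t (encode a)) := by
  obtain ⟨t, ht, h⟩ := exists_of_natPrimrec hf
  refine ⟨sumUpTo t, primrec_sumUpTo ht, monotone_sumUpTo t, ?_⟩
  have := h.comp' (hv.mono_le (v := fun a => v a + sumUpTo t (encode a)) fun a => by omega)
    (.of_le fun a => (le_sumUpTo t _).trans (Nat.le_add_left _ _))
  refine (natSub.comp (this.prodMk (const 1))).of_eq fun a => ?_
  simp [encodek]

@[fun_prop]
lemma encodeNat : TM (encode : ℕ → ℕ) (fun _ => 0) := id'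

@[fun_prop]
lemma encodeProd [Encodable α] [Encodable β] {v : α → ℕ} {w : β → ℕ}
    (hv : TM (encode : α → ℕ) v) (hw : TM (encode : β → ℕ) w) :
    TM (encode : α × β → ℕ) (fun p => v p.1 + w p.2) :=
  (natPair.comp <| .prodMk (hv.comp' (f := Prod.fst) fp (.of_le fun p => by omega))
    (hw.comp' (f := Prod.snd) fp (.of_le fun p => by omega))).of_eq fun p => rfl

lemma encodeList [Encodable α] {v : α → ℕ} (hv : TM (encode : α → ℕ) v) :
    TM (encode : List α → ℕ) (fun l => (l.map fun x => v x + 1).sum) := by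
  have h1 : TM (fun l : List α => l.reverse.foldl (fun s x => Nat.pair (encode x) s + 1) 0)
      (fun l => (l.map fun x => v x + 1).sum) := by
    refine foldl_sum (g := fun _ s x => Nat.pair (encode x) s + 1) (v := fun p => v p.2) ?_
      (reverse id' (.of_le fun l => ?_)) fp (.of_le fun l => ?_)
    · have := hv.app fun p : List α × ℕ × α => p.2.2
      exact natAdd.comp (.prodMk (natPair.comp (this.prodMk fp)) fp)
    · induction l with
      | nil => simp
      | cons a l ih => simp at ih ⊢; omega
    · rw [map_reverse, sum_reverse]
  refine h1.of_eq fun l => ?_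
  rw [foldl_reverse]
  induction l with
  | nil => rfl
  | cons a l ih => simp [encode_list_cons, ih]

end Encode

end TM



/-! ### Types as natural numbers: the effective part -/

def bit (a i : ℕ) : ℕ := a / 2 ^ i % 2

@[fun_prop] lemma PR.bit {α : Type} [Primcodable α] {f g : α → ℕ} (hf : Primrec f)
    (hg : Primrec g) : Primrec (fun a => bit (f a) (g a)) := by
  unfold ApproxMSO.bit
  fun_prop

def setCode (L : List ℕ) : ℕ := L.foldl (fun s i => if bit s i = 1 then s else s + 2 ^ i) 0

@[fun_prop] lemma PR.setCode {α : Type} [Primcodable α] {f : α → List ℕ} (hf : Primrec f) :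
    Primrec (fun a => setCode (f a)) := by
  unfold ApproxMSO.setCode
  fun_prop

/-- The members of the set coded by a number. -/
def elems (A : ℕ) : List ℕ := (range A).filter fun i => decide (bit A i = 1)

@[fun_prop] lemma PR.elems {α : Type} [Primcodable α] {f : α → ℕ} (hf : Primrec f) :
    Primrec (fun a => elems (f a)) := by
  unfold ApproxMSO.elems
  fun_prop

def decodeList (a : ℕ) : List ℕ := ((Encodable.decode a : Option (List ℕ))).getD []

@[fun_prop] lemma PR.decodeList {α : Type} [Primcodable α] {f : α → ℕ} (hf : Primrec f) :
    Primrec (fun a => decodeList (f a)) :=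
  Primrec.option_getD.comp (Primrec.decode.comp hf) (Primrec.const [])

lemma decodeList_encode (L : List ℕ) : decodeList (encode L) = L := by
  simp [decodeList]

/-- The size of the signature, and the numbers of labels, of nested quantifiers and of free variables. -/
abbrev Params := ℕ × ℕ × ℕ × ℕ

/-- A code `(kind, i, j)` of an operation on graphs. -/
abbrev Op := ℕ × ℕ × ℕ

namespace Params

def npos (p : Params) : ℕ := p.2.2.2 + p.2.2.1

def labBase (p : Params) : ℕ := p.npos + p.1

def adjBase (p : Params) : ℕ := p.labBase + p.2.1 + 1

def width (p : Params) : ℕ := p.adjBase + p.npos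

variable {α : Type} [Primcodable α] {f : α → Params}

@[fun_prop] lemma primrec_npos (hf : Primrec f) : Primrec (fun a => (f a).npos) := by
  unfold npos; fun_prop

@[fun_prop] lemma primrec_labBase (hf : Primrec f) : Primrec (fun a => (f a).labBase) := by
  unfold labBase; fun_prop

@[fun_prop] lemma primrec_adjBase (hf : Primrec f) : Primrec (fun a => (f a).adjBase) := by
  unfold adjBase; fun_prop

@[fun_prop] lemma primrec_width (hf : Primrec f) : Primrec (fun a => (f a).width) := by
  unfold width; fun_prop

end Params

/-- Counting up to a threshold of two and modulo `s!`. -/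
def nrm (s c : ℕ) : ℕ := if c < 2 then c else 2 + (c - 2) % s.factorial

@[fun_prop] lemma PR.nrm {α : Type} [Primcodable α] {f g : α → ℕ} (hf : Primrec f)
    (hg : Primrec g) : Primrec (fun a => nrm (f a) (g a)) := by
  unfold ApproxMSO.nrm
  fun_prop

/-- The list of the values of a matrix with `npos` rows and `width` columns. -/
def matrixList (p : Params) (F : ℕ → ℕ → ℕ) : List ℕ :=
  (range (p.npos * p.width)).map fun z => F (z / p.width) (z % p.width)

@[fun_prop] lemma PR.matrixList {α : Type} [Primcodable α] {f : α → Params}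
    {F : α → ℕ → ℕ → ℕ} (hf : Primrec f)
    (hF : Primrec (fun x : α × ℕ × ℕ => F x.1 x.2.1 x.2.2)) :
    Primrec (fun a => matrixList (f a) (F a)) := by
  unfold ApproxMSO.matrixList
  have : Primrec fun x : α × ℕ => F x.1 (x.2 / (f x.1).width) (x.2 % (f x.1).width) :=
    hF.comp (g := fun x : α × ℕ => (x.1, x.2 / (f x.1).width, x.2 % (f x.1).width)) fp
  fun_prop

def entry (p : Params) (D : List ℕ) (u w : ℕ) : ℕ := D.getD (u * p.width + w) 0

@[fun_prop] lemma PR.entry {α : Type} [Primcodable α] {f : α → Params} {D : α → List ℕ}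
    {u w : α → ℕ} (hf : Primrec f) (hD : Primrec D) (hu : Primrec u) (hw : Primrec w) :
    Primrec (fun a => entry (f a) (D a) (u a) (w a)) := by
  unfold ApproxMSO.entry
  fun_prop

/-- The effect of the disjoint union (`c.1 = 1`), a relabeling (`2`) or a join (`3`) on data. -/
def combEntry (p : Params) (c : Op) (A B : ℕ → ℕ → ℕ) (u w : ℕ) : ℕ :=
  if c.1 = 1 then A u w + B u w
  else if c.1 = 2 then
    if c.2.1 = c.2.2 then A u w
    else if w = p.labBase + c.2.1 then 0
    else if w = p.labBase + c.2.2 then A u w + A u (p.labBase + c.2.1)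
    else A u w
  else if w < p.adjBase then A u w
  else A u w + A u (p.labBase + c.2.1) * A (w - p.adjBase) (p.labBase + c.2.2) +
    A u (p.labBase + c.2.2) * A (w - p.adjBase) (p.labBase + c.2.1)

def combData (p : Params) (c : Op) (A B : List ℕ) (u w : ℕ) : ℕ :=
  nrm p.1 (combEntry p c (entry p A) (entry p B) u w)

@[fun_prop] lemma PR.combData {α : Type} [Primcodable α] {f : α → Params}
    {c : α → Op} {A B : α → List ℕ} {u w : α → ℕ} (hf : Primrec f) (hc : Primrec c)
    (hA : Primrec A) (hB : Primrec B) (hu : Primrec u) (hw : Primrec w) :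
    Primrec (fun a => combData (f a) (c a) (A a) (B a) (u a) (w a)) := by
  unfold ApproxMSO.combData combEntry
  fun_prop

/-- The effect of an operation on types of level `j`. -/
def comb (p : Params) (c : Op) : ℕ → ℕ → ℕ → ℕ
  | 0, A, B => encode (matrixList p (combData p c (decodeList A) (decodeList B)))
  | j + 1, A, B => setCode ((elems A).flatMap fun i =>
      (if c.1 = 1 then elems B else [0]).map fun i' => comb p c j i i')

lemma lt_of_mem_elems {A i : ℕ} (h : i ∈ elems A) : i < A :=
  mem_range.1 (mem_filter.1 h).1

lemma PR.comb : Primrec fun x : ℕ × (Params × Op) × ℕ × ℕ =>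
    comb x.2.1.1 x.2.1.2 x.1 x.2.2.1 x.2.2.2 := by
  have := PR.level (α := Params × Op) (β := ℕ)
    (F := fun j a x => ApproxMSO.comb a.1 a.2 j x.unpair.1 x.unpair.2)
    (H := fun x => ApproxMSO.setCode ((ApproxMSO.elems x.1.2.2.unpair.1).flatMap fun i =>
      (if x.1.1.2.1 = 1 then ApproxMSO.elems x.1.2.2.unpair.2 else [0]).map fun i' =>
        x.2.getD (Nat.pair i i') 0))
    ?_ fp ?_
  · have h2 := this.comp (g := fun x : ℕ × (Params × Op) × ℕ × ℕ =>
      (x.1, x.2.1, Nat.pair x.2.2.1 x.2.2.2)) fp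
    exact h2.of_eq fun x => by simp
  · simp only [ApproxMSO.comb]
    fun_prop
  · intro j a x N hx
    simp only [ApproxMSO.comb]
    congr 1
    refine flatMap_congr fun i hi => map_congr_left fun i' hi' => ?_
    have h1 := lt_of_mem_elems hi
    have h2 : i' ≤ x.unpair.2 := by
      split_ifs at hi'
      · exact (lt_of_mem_elems hi').le
      · simp at hi'; omega
    have h3 : Nat.pair i i' < N := by
      calc Nat.pair i i' < Nat.pair x.unpair.1 i' := Nat.pair_lt_pair_left _ h1
        _ ≤ Nat.pair x.unpair.1 x.unpair.2 := by
          rcases h2.eq_or_lt with h | h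
          · rw [h]
          · exact (Nat.pair_lt_pair_right _ h).le
        _ = x := Nat.pair_unpair x
        _ < N := hx
    simp [getD_eq_getElem?_getD, h3]

/-- The data of a single vertex that lies in the sets given by `mask`. -/
def leafEntry (p : Params) (lab colors mask u w : ℕ) : ℕ :=
  if bit mask u = 0 then 0
  else if w < p.npos then bit mask w
  else if w < p.labBase then bit colors (w - p.npos)
  else if w = p.labBase + lab then 1
  else 0

/-- The types of a single vertex, where the index gives the quantified sets that contain it. -/
def leafTypes (p : Params) (lab colors m j : ℕ) : List ℕ :=
  Nat.rec (motive := fun _ => List ℕ)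
    ((range (2 ^ p.2.2.1)).map fun e =>
      encode (matrixList p (leafEntry p lab colors (2 ^ p.2.2.1 * m + e))))
    (fun _ T => (range (T.length / 2)).map fun e =>
      setCode [T.getD (2 * e) 0, T.getD (2 * e + 1) 0]) j

def leafType (p : Params) (lab colors m : ℕ) : ℕ :=
  (leafTypes p lab colors m p.2.2.1).getD 0 0

@[fun_prop] lemma PR.leafEntry {α : Type} [Primcodable α] {f : α → Params}
    {lab colors mask u w : α → ℕ} (hf : Primrec f) (hl : Primrec lab) (hc : Primrec colors)
    (hm : Primrec mask) (hu : Primrec u) (hw : Primrec w) :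
    Primrec (fun a => leafEntry (f a) (lab a) (colors a) (mask a) (u a) (w a)) := by
  unfold ApproxMSO.leafEntry
  fun_prop

lemma PR.leafType : Primrec fun x : Params × ℕ × ℕ × ℕ =>
    leafType x.1 x.2.1 x.2.2.1 x.2.2.2 := by
  unfold ApproxMSO.leafType leafTypes
  fun_prop

def drill (j A : ℕ) : ℕ := Nat.rec (motive := fun _ => ℕ) A (fun _ A => (elems A).headD 0) j

@[fun_prop] lemma PR.drill {α : Type} [Primcodable α] {f g : α → ℕ} (hf : Primrec f)
    (hg : Primrec g) : Primrec (fun a => drill (f a) (g a)) := by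
  unfold ApproxMSO.drill
  fun_prop

/-- The truth values of the disjunctive normal forms over formulas with given truth values. -/
def dnfBits (L : List Bool) : List Bool :=
  (((L.flatMap fun b => [b, !b]).sublists.map fun l => l.foldr and true).sublists).map
    fun l => l.foldr or false

@[fun_prop] lemma PR.sublists {α β : Type} [Primcodable α] [Primcodable β] {f : α → List β}
    (hf : Primrec f) : Primrec (fun a => (f a).sublists) := by
  unfold List.sublists
  fun_prop

@[fun_prop] lemma PR.dnfBits {α : Type} [Primcodable α] {f : α → List Bool}
    (hf : Primrec f) : Primrec (fun a => dnfBits (f a)) := by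
  have h1 : Primrec fun l : List Bool => l.foldr and true := by
    have : Primrec fun l : List Bool => l.foldr (fun a b => a && b) true := by fun_prop
    exact this
  have h2 : Primrec fun l : List Bool => l.foldr or false := by
    have : Primrec fun l : List Bool => l.foldr (fun a b => a || b) false := by fun_prop
    exact this
  unfold ApproxMSO.dnfBits
  fun_prop

/-- The truth values of the atoms over variables at the positions `vs` and `ss`. -/
def atomBits (p : Params) (rl vs ss D : List ℕ) : List Bool :=
  (vs.flatMap fun x => ss.map fun X => decide (0 < entry p D x X)) ++
  (vs.flatMap fun x => vs.map fun y => decide (0 < entry p D x y)) ++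
  (range rl.length).flatMap fun t =>
    if rl.getD t 0 = 0 then
      vs.flatMap fun x => vs.map fun y => decide (0 < entry p D x (p.adjBase + y))
    else if rl.getD t 0 = 1 then vs.map fun x => decide (0 < entry p D x (p.npos + t))
    else ss.map fun X => decide (entry p D X X % (rl.getD t 0 - 2).unpair.2 =
      (rl.getD t 0 - 2).unpair.1 % (rl.getD t 0 - 2).unpair.2)

@[fun_prop] lemma PR.atomBits {α : Type} [Primcodable α] {f : α → Params}
    {rl vs ss D : α → List ℕ} (hf : Primrec f) (hr : Primrec rl) (hv : Primrec vs)
    (hs : Primrec ss) (hD : Primrec D) :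
    Primrec (fun a => atomBits (f a) (rl a) (vs a) (ss a) (D a)) := by
  unfold ApproxMSO.atomBits
  fun_prop

/-- The positions of the quantified variables of kind `b`, where `e` gives the kinds. -/
def quantPos (p : Params) (b j e : ℕ) : List ℕ :=
  ((range (p.2.2.1 - j)).reverse.filter fun t => decide (bit e t = b)).map fun t => j + t

@[fun_prop] lemma PR.quantPos {α : Type} [Primcodable α] {f : α → Params} {b j e : α → ℕ}
    (hf : Primrec f) (hb : Primrec b) (hj : Primrec j) (he : Primrec e) :
    Primrec (fun a => quantPos (f a) (b a) (j a) (e a)) := by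
  unfold ApproxMSO.quantPos
  fun_prop

def setPos (p : Params) (j e : ℕ) : List ℕ :=
  ((range p.2.2.2).map fun t => p.2.2.1 + t) ++ quantPos p 1 j e

@[fun_prop] lemma PR.setPos {α : Type} [Primcodable α] {f : α → Params} {j e : α → ℕ}
    (hf : Primrec f) (hj : Primrec j) (he : Primrec e) :
    Primrec (fun a => setPos (f a) (j a) (e a)) := by
  unfold ApproxMSO.setPos
  fun_prop

def orBits (I : List ℕ) (F : ℕ → List Bool) : List Bool :=
  (range (F (I.headD 0)).length).map fun t => I.any fun i => (F i).getD t false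

def andBits (I : List ℕ) (F : ℕ → List Bool) : List Bool :=
  (range (F (I.headD 0)).length).map fun t => I.all fun i => (F i).getD t false

/-- The members of a type of level `j + 1` for which the last set is a singleton. -/
def singles (p : Params) (j A : ℕ) : List ℕ :=
  (elems A).filter fun i => decide (entry p (decodeList (drill j i)) j j = 1)

@[fun_prop] lemma PR.singles {α : Type} [Primcodable α] {f : α → Params} {j A : α → ℕ}
    (hf : Primrec f) (hj : Primrec j) (hA : Primrec A) :
    Primrec (fun a => singles (f a) (j a) (A a)) := by
  unfold ApproxMSO.singles
  fun_prop

/-- The truth values of the building blocks of normalized formulas, given those of lower rank. -/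
def blockBits (p : Params) (rl : List ℕ) (j e A : ℕ) (F : ℕ → List (List Bool)) : List Bool :=
  atomBits p rl (quantPos p 0 (j + 1) e) (setPos p (j + 1) e) (decodeList (drill (j + 1) A)) ++
  orBits (singles p j A) (fun i => (F i).getD (2 * e) []) ++
  andBits (singles p j A) (fun i => (F i).getD (2 * e) []) ++
  orBits (elems A) (fun i => (F i).getD (2 * e + 1) []) ++
  andBits (elems A) (fun i => (F i).getD (2 * e + 1) [])

/-- The truth values of the normalized formulas, for all sequences of kinds of the variables. -/
def bitsTable (p : Params) (rl : List ℕ) : ℕ → ℕ → List (List Bool)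
  | 0, A => (range (2 ^ p.2.2.1)).map fun e =>
      dnfBits (atomBits p rl (quantPos p 0 0 e) (setPos p 0 e) (decodeList A))
  | j + 1, A => (range (2 ^ (p.2.2.1 - (j + 1)))).map fun e =>
      dnfBits (blockBits p rl j e A fun i => bitsTable p rl j i)

lemma headD_lt {I : List ℕ} {N : ℕ} (hN : 0 < N) (h : ∀ i ∈ I, i < N) : I.headD 0 < N := by
  cases I with
  | nil => simpa
  | cons a l => simpa using h a (by simp)

lemma orBits_congr {I : List ℕ} {N : ℕ} {F G : ℕ → List Bool} (hN : 0 < N)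
    (h : ∀ i ∈ I, i < N) (hFG : ∀ i < N, F i = G i) : orBits I F = orBits I G := by
  unfold orBits
  rw [hFG _ (headD_lt hN h)]
  refine map_congr_left fun t _ => ?_
  rw [Bool.eq_iff_iff, any_eq_true, any_eq_true]
  exact exists_congr fun i => and_congr_right fun hi => by rw [hFG i (h i hi)]

lemma andBits_congr {I : List ℕ} {N : ℕ} {F G : ℕ → List Bool} (hN : 0 < N)
    (h : ∀ i ∈ I, i < N) (hFG : ∀ i < N, F i = G i) : andBits I F = andBits I G := by
  unfold andBits
  rw [hFG _ (headD_lt hN h)]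
  refine map_congr_left fun t _ => ?_
  rw [Bool.eq_iff_iff, all_eq_true, all_eq_true]
  exact forall₂_congr fun i hi => by rw [hFG i (h i hi)]

lemma PR.bitsTable : Primrec fun x : ℕ × (Params × List ℕ) × ℕ =>
    bitsTable x.2.1.1 x.2.1.2 x.1 x.2.2 := by
  refine PR.level (α := Params × List ℕ) (β := List (List Bool))
    (F := fun j a x => ApproxMSO.bitsTable a.1 a.2 j x)
    (H := fun x => (List.range (2 ^ (x.1.1.1.2.2.1 - (x.1.2.1 + 1)))).map fun e =>
      ApproxMSO.dnfBits (blockBits x.1.1.1 x.1.1.2 x.1.2.1 e x.1.2.2 fun i => x.2.getD i []))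
    (by simp only [ApproxMSO.bitsTable]; fun_prop)
    (by simp only [blockBits, orBits, andBits]; fun_prop) ?_
  intro j a x N hx
  have hN : 0 < N := by omega
  have hF : ∀ e, ∀ i < N, (((List.range N).map
      (fun y => ApproxMSO.bitsTable a.1 a.2 j y)).getD i []).getD e [] =
      (ApproxMSO.bitsTable a.1 a.2 j i).getD e [] := by
    intro e i hi
    simp [List.getD_eq_getElem?_getD, hi]
  have hel : ∀ i ∈ ApproxMSO.elems x, i < N := fun i hi => (lt_of_mem_elems hi).trans hx
  have hel' : ∀ i ∈ ApproxMSO.singles a.1 j x, i < N :=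
    fun i hi => hel i (List.mem_filter.1 hi).1
  simp only [ApproxMSO.bitsTable, blockBits, orBits_congr hN hel (hF _),
    orBits_congr hN hel' (hF _), andBits_congr hN hel (hF _), andBits_congr hN hel' (hF _)]

/-! ### Sets of numbers coded by numbers -/

lemma bit_eq_one {a i : ℕ} : bit a i = 1 ↔ a.testBit i = true := by
  rw [Nat.testBit_eq_decide_div_mod_eq, decide_eq_true_iff, bit]

lemma bit_lt_two (a i : ℕ) : bit a i < 2 := Nat.mod_lt _ (by norm_num)

lemma bit_eq_toNat (a i : ℕ) : bit a i = (a.testBit i).toNat := by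
  have h := bit_eq_one (a := a) (i := i)
  have := bit_lt_two a i
  grind

lemma add_two_pow_eq_or {s i : ℕ} (h : s.testBit i = false) : s + 2 ^ i = s ||| 2 ^ i := by
  obtain ⟨q, r, hs, hr⟩ : ∃ q r, s = 2 ^ (i + 1) * q + r ∧ r < 2 ^ i := by
    refine ⟨s / 2 ^ (i + 1), s % 2 ^ (i + 1), (Nat.div_add_mod _ _).symm, ?_⟩
    refine Nat.lt_pow_two_of_testBit _ fun k hk => ?_
    grind
  have h2 : 2 ^ i + r = 2 ^ i ||| r := by simpa using Nat.two_pow_add_eq_or_of_lt hr 1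
  have h3 : 2 ^ (i + 1) = 2 ^ i + 2 ^ i := by ring
  have h4 : s = 2 ^ (i + 1) * q ||| r := by
    rw [hs, Nat.two_pow_add_eq_or_of_lt (by omega)]
  calc s + 2 ^ i = 2 ^ (i + 1) * q + (2 ^ i + r) := by rw [hs]; ring
    _ = 2 ^ (i + 1) * q ||| (2 ^ i + r) := Nat.two_pow_add_eq_or_of_lt (by omega) _
    _ = s ||| 2 ^ i := by rw [h2, h4, Nat.or_assoc, Nat.or_comm r]

lemma testBit_setCode {L : List ℕ} {k : ℕ} : (setCode L).testBit k = true ↔ k ∈ L := by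
  suffices ∀ (L : List ℕ) s,
      (L.foldl (fun s i => if bit s i = 1 then s else s + 2 ^ i) s).testBit k = true ↔
        s.testBit k = true ∨ k ∈ L by
    have h := this L 0
    rwa [Nat.zero_testBit, or_iff_right Bool.false_ne_true] at h
  intro L
  induction L with
  | nil =>
    simp
  | cons i L ih =>
    intro s
    rw [foldl_cons, ih, mem_cons, ← or_assoc]
    refine or_congr_left ?_
    by_cases h : bit s i = 1
    · rw [if_pos h]
      rw [bit_eq_one] at h
      grind
    · rw [if_neg h]
      rw [bit_eq_one] at h
      rw [add_two_pow_eq_or (by simpa using h), Nat.testBit_or, Nat.testBit_two_pow,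
        Bool.or_eq_true, decide_eq_true_iff, eq_comm (a := i)]

lemma mem_elems {A i : ℕ} : i ∈ elems A ↔ A.testBit i = true := by
  rw [elems, mem_filter, decide_eq_true_iff, bit_eq_one, mem_range, and_iff_right_iff_imp]
  intro h
  exact Nat.lt_two_pow_self.trans_le (Nat.ge_two_pow_of_testBit h)

lemma mem_elems_setCode {L : List ℕ} {i : ℕ} : i ∈ elems (setCode L) ↔ i ∈ L :=
  mem_elems.trans testBit_setCode

lemma setCode_congr {L M : List ℕ} (h : ∀ i, i ∈ L ↔ i ∈ M) : setCode L = setCode M :=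
  Nat.eq_of_testBit_eq fun i => by
    rw [Bool.eq_iff_iff, testBit_setCode, testBit_setCode, h]

lemma setCode_lt {L : List ℕ} {M : ℕ} (h : ∀ i ∈ L, i < M) : setCode L < 2 ^ M :=
  Nat.lt_pow_two_of_testBit _ fun i hi => by
    rw [← Bool.not_eq_true, testBit_setCode]
    grind

/-! ### Threshold and modulo counting is a congruence -/

section Nrm

variable {s a b a' b' : ℕ}

lemma nrm_eq_iff : nrm s a = nrm s b ↔
    a = b ∨ 2 ≤ a ∧ 2 ≤ b ∧ a ≡ b [MOD s.factorial] := by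
  unfold nrm Nat.ModEq
  by_cases ha : a < 2 <;> by_cases hb : b < 2
  · grind
  · grind
  · grind
  · simp only [ha, hb, if_false]
    obtain ⟨a, rfl⟩ := Nat.exists_eq_add_of_le (not_lt.1 ha)
    obtain ⟨b, rfl⟩ := Nat.exists_eq_add_of_le (not_lt.1 hb)
    have : a % s.factorial = b % s.factorial ↔ (2 + a) % s.factorial = (2 + b) % s.factorial :=
      ⟨fun h => Nat.ModEq.add_left 2 h, fun h => Nat.ModEq.add_left_cancel' 2 h⟩
    grind

lemma nrm_nrm : nrm s (nrm s a) = nrm s a := by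
  unfold nrm
  by_cases ha : a < 2
  · grind
  · simp [ha]

lemma nrm_add (ha : nrm s a = nrm s a') (hb : nrm s b = nrm s b') :
    nrm s (a + b) = nrm s (a' + b') := by
  rw [nrm_eq_iff] at *
  rcases ha with rfl | ⟨h1, h2, h3⟩ <;> rcases hb with rfl | ⟨h4, h5, h6⟩
  · simp
  · exact Or.inr ⟨by omega, by omega, h6.add_left _⟩
  · exact Or.inr ⟨by omega, by omega, h3.add_right _⟩
  · exact Or.inr ⟨by omega, by omega, h3.add h6⟩

lemma nrm_mul (ha : nrm s a = nrm s a') (hb : nrm s b = nrm s b') :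
    nrm s (a * b) = nrm s (a' * b') := by
  have key : ∀ {a a' b b' : ℕ}, nrm s a = nrm s a' → nrm s b = nrm s b' →
      nrm s (a * b) = nrm s (a' * b) := by
    intro a a' b b' ha hb
    rw [nrm_eq_iff] at *
    rcases ha with rfl | ⟨h1, h2, h3⟩
    · simp
    · rcases Nat.eq_zero_or_pos b with rfl | hb
      · simp
      · exact Or.inr ⟨by nlinarith, by nlinarith, h3.mul_right _⟩
  rw [key ha hb, mul_comm a' b, key hb (rfl : nrm s a' = nrm s a'), mul_comm b' a']

lemma nrm_pos : 0 < nrm s a ↔ 0 < a := by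
  unfold nrm
  grind

lemma nrm_eq_one : nrm s a = 1 ↔ a = 1 := by
  unfold nrm
  grind

lemma nrm_zero : nrm s 0 = 0 := rfl

lemma nrm_of_lt (h : a < 2) : nrm s a = a := by simp [nrm, h]

lemma nrm_mod {r : ℕ} (hr : r ∣ s.factorial) : nrm s a % r = a % r := by
  have h : nrm s (nrm s a) = nrm s a := nrm_nrm
  rw [nrm_eq_iff] at h
  rcases h with h | h
  · rw [h]
  · unfold nrm
    split_ifs with ha
    · rfl
    · have h1 : (a - 2) % s.factorial ≡ a - 2 [MOD r] := (Nat.mod_modEq _ _).of_dvd hr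
      have h2 := h1.add_left 2
      aesop

lemma nrm_lt : nrm s a < s.factorial + 2 := by
  unfold nrm
  have := Nat.mod_lt (a - 2) s.factorial_pos
  grind

end Nrm

/-! ### Matrices -/

section Matrix

variable {p : Params} {F G : ℕ → ℕ → ℕ} {u w : ℕ}

lemma entry_matrixList (hu : u < p.npos) (hw : w < p.width) :
    entry p (matrixList p F) u w = F u w := by
  have h : u * p.width + w < p.npos * p.width := by nlinarith
  have h1 : (u * p.width + w) / p.width = u := by
    rw [mul_comm, Nat.mul_add_div (by omega), Nat.div_eq_of_lt hw, add_zero]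
  have h2 : (u * p.width + w) % p.width = w := by
    rw [mul_comm, Nat.mul_add_mod, Nat.mod_eq_of_lt hw]
  simp [entry, matrixList, getD_eq_getElem?_getD, h, h1, h2]

lemma matrixList_congr (h : ∀ u < p.npos, ∀ w < p.width, F u w = G u w) :
    matrixList p F = matrixList p G := by
  refine map_congr_left fun z hz => ?_
  rw [mem_range] at hz
  have hw : 0 < p.width := Nat.pos_of_ne_zero fun h => by simp [h] at hz
  exact h _ (Nat.div_lt_of_lt_mul (by rwa [mul_comm])) _ (Nat.mod_lt _ hw)

end Matrix

/-! ### Labelled graphs and their types -/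

/-- Sequences of sets of vertices. -/
abbrev Sets (n : ℕ) := ℕ → Finset (Fin n)

/-- A graph with labelled vertices and multiple edges; the label `0` stands for no label. -/
structure LGraph (n : ℕ) where
  verts : Finset (Fin n)
  lab : Fin n → ℕ
  mult : Fin n → Fin n → ℕ

namespace LGraph

variable {n : ℕ} (p : Params) (col : Sets n)

/-- The quantities counted by the data of a tuple of sets. -/
def ent (S : LGraph n) (Z : Sets n) (u w : ℕ) : ℕ :=
  if w < p.npos then (Z u ∩ Z w).card
  else if w < p.labBase then (Z u ∩ col (w - p.npos)).card
  else if w < p.adjBase then ((Z u).filter fun v => S.lab v = w - p.labBase).card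
  else ∑ a ∈ Z u, ∑ b ∈ Z (w - p.adjBase), S.mult a b

def data (S : LGraph n) (Z : Sets n) : List ℕ :=
  matrixList p fun u w => nrm p.1 (S.ent p col Z u w)

/-- The type of level `j` of a tuple; the sets at the positions below `j` are irrelevant. -/
def ty (S : LGraph n) : ℕ → Sets n → ℕ
  | 0, Z => encode (S.data p col Z)
  | j + 1, Z => setCode (S.verts.powerset.toList.map fun U => ty S j (Function.update Z j U))

variable {p col}

lemma mem_elems_ty {S : LGraph n} {j : ℕ} {Z : Sets n} {i : ℕ} :
    i ∈ elems (S.ty p col (j + 1) Z) ↔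
      ∃ U ⊆ S.verts, S.ty p col j (Function.update Z j U) = i := by
  rw [ty, mem_elems_setCode]
  simp

def union (S T : LGraph n) : LGraph n where
  verts := S.verts ∪ T.verts
  lab v := if v ∈ S.verts then S.lab v else T.lab v
  mult a b := S.mult a b + T.mult a b

def relabel (S : LGraph n) (i j : ℕ) : LGraph n where
  verts := S.verts
  lab v := if S.lab v = i then j else S.lab v
  mult := S.mult

def join (S : LGraph n) (i j : ℕ) : LGraph n where
  verts := S.verts
  lab := S.lab
  mult a b := S.mult a b + (if S.lab a = i ∧ S.lab b = j then 1 else 0) +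
    (if S.lab a = j ∧ S.lab b = i then 1 else 0)

def single (v : Fin n) (l : ℕ) : LGraph n where
  verts := {v}
  lab u := if u = v then l else 0
  mult _ _ := 0

def Proper (S : LGraph n) : Prop := ∀ a b, S.mult a b ≠ 0 → a ∈ S.verts ∧ b ∈ S.verts

lemma inter_union_inter {V W U : Finset (Fin n)} (h : U ⊆ V ∪ W) :
    U = (U ∩ V) ∪ (U ∩ W) := by
  grind

lemma card_split {V W U : Finset (Fin n)} (hd : Disjoint V W) (h : U ⊆ V ∪ W) :
    U.card = (U ∩ V).card + (U ∩ W).card := by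
  rw [← Finset.card_union_of_disjoint (hd.mono Finset.inter_subset_right Finset.inter_subset_right),
    ← inter_union_inter h]

lemma sum_inter_of_eq_zero {U V : Finset (Fin n)} {f : Fin n → ℕ} (h : ∀ a ∉ V, f a = 0) :
    ∑ a ∈ U ∩ V, f a = ∑ a ∈ U, f a := by
  refine Finset.sum_subset Finset.inter_subset_left fun a ha ha' => h a fun hV => ha' ?_
  grind

lemma sum_mult_inter {S : LGraph n} (hS : S.Proper) (U U' : Finset (Fin n)) :
    ∑ a ∈ U ∩ S.verts, ∑ b ∈ U' ∩ S.verts, S.mult a b = ∑ a ∈ U, ∑ b ∈ U', S.mult a b := by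
  rw [sum_inter_of_eq_zero fun a ha => Finset.sum_eq_zero fun b _ =>
    by_contra fun h => ha (hS a b h).1]
  exact Finset.sum_congr rfl fun a _ => sum_inter_of_eq_zero fun b hb =>
    by_contra fun h => hb (hS a b h).2

lemma ent_union {S T : LGraph n} (hS : S.Proper) (hT : T.Proper)
    (hd : Disjoint S.verts T.verts) {Z : Sets n}
    (hZ : ∀ i, Z i ⊆ S.verts ∪ T.verts) (u w : ℕ) :
    (S.union T).ent p col Z u w =
      S.ent p col (fun i => Z i ∩ S.verts) u w + T.ent p col (fun i => Z i ∩ T.verts) u w := by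
  unfold ent
  have hdis : ∀ v, v ∈ T.verts → v ∉ S.verts := fun v h => Finset.disjoint_right.1 hd h
  split_ifs with h1 h2 h3
  · rw [card_split hd (Finset.inter_subset_left.trans (hZ u))]
    refine congrArg₂ (· + ·) (congrArg Finset.card ?_) (congrArg Finset.card ?_) <;>
    · grind
  · rw [card_split hd (Finset.inter_subset_left.trans (hZ u))]
    refine congrArg₂ (· + ·) (congrArg Finset.card ?_) (congrArg Finset.card ?_) <;>
    · grind
  · rw [card_split hd ((Finset.filter_subset _ _).trans (hZ u))]
    refine congrArg₂ (· + ·) (congrArg Finset.card ?_) (congrArg Finset.card ?_)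
    · ext v
      rw [Finset.mem_inter, Finset.mem_filter, Finset.mem_filter, Finset.mem_inter]
      simp only [union]
      grind
    · ext v
      rw [Finset.mem_inter, Finset.mem_filter, Finset.mem_filter, Finset.mem_inter]
      simp only [union]
      grind
  · rw [sum_mult_inter hS, sum_mult_inter hT, ← Finset.sum_add_distrib]
    exact Finset.sum_congr rfl fun a _ => Finset.sum_add_distrib

lemma ent_relabel {S : LGraph n} {Z : Sets n} {i j : ℕ} (hi : i ≤ p.2.1)
    (hj : j ≤ p.2.1) (B : ℕ → ℕ → ℕ) (u w : ℕ) :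
    (S.relabel i j).ent p col Z u w = combEntry p (2, i, j) (S.ent p col Z) B u w := by
  simp only [combEntry, OfNat.ofNat_ne_one, if_false, if_true]
  have hab : p.adjBase = p.labBase + p.2.1 + 1 := rfl
  have hnl : p.npos ≤ p.labBase := Nat.le_add_right _ _
  by_cases hij : i = j
  · subst hij
    simp only [if_true]
    have : (S.relabel i i).lab = S.lab := by
      funext v
      simp only [relabel]
      grind
    have hm : (S.relabel i i).mult = S.mult := rfl
    simp only [ent, this, hm]
  · simp only [hij, if_false]
    by_cases h1 : w < p.npos
    · have h2 : w ≠ p.labBase + i := by omega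
      have h3 : w ≠ p.labBase + j := by omega
      simp [ent, h1, h2, h3]
    by_cases h4 : w < p.labBase
    · have h2 : w ≠ p.labBase + i := by omega
      have h3 : w ≠ p.labBase + j := by omega
      simp [ent, h1, h2, h3, h4]
    by_cases h5 : w < p.adjBase
    · obtain ⟨l, rfl⟩ := Nat.exists_eq_add_of_le (not_lt.1 h4)
      have e1 : ∀ m ≤ p.2.1, S.ent p col Z u (p.labBase + m) =
          ((Z u).filter fun v => S.lab v = m).card := by
        intro m hm
        have h6 : ¬ p.labBase + m < p.npos := by omega
        have h7 : p.labBase + m < p.adjBase := by omega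
        simp [ent, h6, h7]
      have e2 : (S.relabel i j).ent p col Z u (p.labBase + l) =
          ((Z u).filter fun v => (if S.lab v = i then j else S.lab v) = l).card := by
        simp [ent, h1, h5, relabel]
      rw [e2, e1 l (by omega), e1 i hi]
      simp only [Nat.add_left_cancel_iff]
      by_cases hli : l = i
      · subst hli
        simp only [if_true, Finset.card_eq_zero, Finset.filter_eq_empty_iff]
        grind
      · simp only [hli, if_false]
        by_cases hlj : l = j
        · subst hlj
          simp only [if_true]
          rw [← Finset.card_union_of_disjoint, ← Finset.filter_or]
          · congr 1
            grind
          · refine Finset.disjoint_filter.2 fun v _ h => ?_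
            omega
        · simp only [hlj, if_false]
          congr 1
          grind
    · have h2 : w ≠ p.labBase + i := by omega
      have h3 : w ≠ p.labBase + j := by omega
      simp [ent, h1, h2, h3, h4, h5, relabel]

lemma sum_ite_card (U U' : Finset (Fin n)) (f : Fin n → ℕ) (i j : ℕ) :
    ∑ a ∈ U, ∑ b ∈ U', (if f a = i ∧ f b = j then 1 else 0) =
      (U.filter fun v => f v = i).card * (U'.filter fun v => f v = j).card := by
  rw [Finset.card_filter, Finset.card_filter, Finset.sum_mul_sum]
  grind

lemma ent_join {S : LGraph n} {Z : Sets n} {i j : ℕ} (hi : i ≤ p.2.1)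
    (hj : j ≤ p.2.1) (B : ℕ → ℕ → ℕ) (u w : ℕ) :
    (S.join i j).ent p col Z u w = combEntry p (3, i, j) (S.ent p col Z) B u w := by
  have hab : p.adjBase = p.labBase + p.2.1 + 1 := rfl
  have hnl : p.npos ≤ p.labBase := Nat.le_add_right _ _
  have e1 : ∀ u, ∀ m ≤ p.2.1, S.ent p col Z u (p.labBase + m) =
      ((Z u).filter fun v => S.lab v = m).card := by
    intro u m hm
    have h6 : ¬ p.labBase + m < p.npos := by omega
    have h7 : p.labBase + m < p.adjBase := by omega
    simp [ent, h6, h7]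
  simp only [combEntry, OfNat.ofNat_ne_one, if_false, Nat.reduceEqDiff, e1 _ _ hi, e1 _ _ hj]
  split_ifs with h
  · simp only [ent, h, if_true]
    rfl
  · have h1 : ¬ w < p.npos := by omega
    have h2 : ¬ w < p.labBase := by omega
    simp only [ent, h, h1, h2, if_false, join, Finset.sum_add_distrib, sum_ite_card]

lemma combData_nrm {c : Op} {A B : ℕ → ℕ → ℕ} {u w : ℕ}
    (hc : c.2.1 ≤ p.2.1 ∧ c.2.2 ≤ p.2.1) (hu : u < p.npos) (hw : w < p.width) {LA LB : List ℕ}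
    (hA : ∀ u < p.npos, ∀ w < p.width, entry p LA u w = nrm p.1 (A u w))
    (hB : c.1 = 1 → ∀ u < p.npos, ∀ w < p.width, entry p LB u w = nrm p.1 (B u w)) :
    combData p c LA LB u w = nrm p.1 (combEntry p c A B u w) := by
  have hab : p.adjBase = p.labBase + p.2.1 + 1 := rfl
  have hwd : p.width = p.adjBase + p.npos := rfl
  unfold combData combEntry
  have h0 := hA u hu w hw
  split_ifs with h1 h2 h3 h4 h5 h6
  · rw [h0, hB h1 u hu w hw]
    exact nrm_add nrm_nrm nrm_nrm
  · rw [h0]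
    exact nrm_nrm
  · rfl
  · rw [h0, hA u hu _ (by omega)]
    exact nrm_add nrm_nrm nrm_nrm
  · rw [h0]
    exact nrm_nrm
  · rw [h0]
    exact nrm_nrm
  · rw [h0, hA u hu _ (by omega), hA u hu _ (by omega), hA _ (by omega) _ (by omega),
      hA _ (by omega) _ (by omega)]
    exact nrm_add (nrm_add nrm_nrm (nrm_mul nrm_nrm nrm_nrm)) (nrm_mul nrm_nrm nrm_nrm)

lemma ty_zero_eq_comb {R S T : LGraph n} {c : Op} {Z Z₁ Z₂ : Sets n}
    (hc : c.2.1 ≤ p.2.1 ∧ c.2.2 ≤ p.2.1)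
    (h : ∀ u w, R.ent p col Z u w = combEntry p c (S.ent p col Z₁) (T.ent p col Z₂) u w) (B : ℕ)
    (hB : c.1 = 1 → B = T.ty p col 0 Z₂) :
    R.ty p col 0 Z = comb p c 0 (S.ty p col 0 Z₁) B := by
  simp only [ty, comb, data]
  refine congrArg encode (matrixList_congr fun u hu w hw => ?_)
  rw [h, combData_nrm hc hu hw (A := S.ent p col Z₁) (B := T.ent p col Z₂)]
  · intro u hu w hw
    rw [decodeList_encode, entry_matrixList hu hw]
  · intro h1 u hu w hw
    rw [hB h1, ty, data, decodeList_encode, entry_matrixList hu hw]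

lemma update_inter (Z : Sets n) (j : ℕ) (U V : Finset (Fin n)) :
    (fun i => Function.update Z j U i ∩ V) = Function.update (fun i => Z i ∩ V) j (U ∩ V) := by
  grind

lemma ty_union {S T : LGraph n} (hS : S.Proper) (hT : T.Proper)
    (hd : Disjoint S.verts T.verts) {Z : Sets n}
    (hZ : ∀ i, Z i ⊆ S.verts ∪ T.verts) (j : ℕ) :
    (S.union T).ty p col j Z = comb p (1, 0, 0) j
      (S.ty p col j fun i => Z i ∩ S.verts) (T.ty p col j fun i => Z i ∩ T.verts) := by
  induction j generalizing Z with
  | zero =>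
    exact ty_zero_eq_comb (by simp) (fun u w => by
      rw [ent_union hS hT hd hZ]; simp [combEntry]) _ fun _ => rfl
  | succ j ih =>
    rw [comb]
    refine setCode_congr fun i => ?_
    simp only [mem_map, Finset.mem_toList, Finset.mem_powerset, mem_flatMap, if_true,
      mem_elems_ty]
    constructor
    · rintro ⟨U, hU, rfl⟩
      have hU : U ⊆ S.verts ∪ T.verts := hU
      refine ⟨_, ⟨U ∩ S.verts, Finset.inter_subset_right, rfl⟩, _,
        ⟨U ∩ T.verts, Finset.inter_subset_right, rfl⟩, ?_⟩
      rw [ih, update_inter, update_inter]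
      grind
    · rintro ⟨_, ⟨U, hU, rfl⟩, _, ⟨U', hU', rfl⟩, rfl⟩
      refine ⟨U ∪ U', Finset.union_subset_union hU hU', ?_⟩
      rw [ih, update_inter, update_inter]
      · congr 3
        · rw [Finset.union_inter_distrib_right, Finset.inter_eq_left.2 hU,
            Finset.disjoint_iff_inter_eq_empty.1 (hd.symm.mono_left hU'), Finset.union_empty]
        · rw [Finset.union_inter_distrib_right, Finset.inter_eq_left.2 hU',
            Finset.disjoint_iff_inter_eq_empty.1 (hd.mono_left hU), Finset.empty_union]
      grind

lemma ty_unary {R S : LGraph n} {c : Op} (hc : c.2.1 ≤ p.2.1 ∧ c.2.2 ≤ p.2.1)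
    (h1 : c.1 ≠ 1) (hv : R.verts = S.verts)
    (h : ∀ Z u w, R.ent p col Z u w = combEntry p c (S.ent p col Z) (S.ent p col Z) u w)
    (Z : Sets n) (B j : ℕ) :
    R.ty p col j Z = comb p c j (S.ty p col j Z) B := by
  induction j generalizing Z B with
  | zero => exact ty_zero_eq_comb hc (h Z) B fun h => absurd h h1
  | succ j ih =>
    rw [comb]
    refine setCode_congr fun i => ?_
    simp only [mem_map, Finset.mem_toList, Finset.mem_powerset, mem_flatMap, h1, if_false,
      mem_elems_ty, hv]
    constructor
    · rintro ⟨U, hU, rfl⟩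
      exact ⟨_, ⟨U, hU, rfl⟩, 0, by simp, (ih _ 0).symm⟩
    · rintro ⟨_, ⟨U, hU, rfl⟩, i', _, rfl⟩
      exact ⟨U, hU, ih _ _⟩

lemma ty_relabel {S : LGraph n} {i j : ℕ} (hi : i ≤ p.2.1) (hj : j ≤ p.2.1)
    (Z : Sets n) (B m : ℕ) :
    (S.relabel i j).ty p col m Z = comb p (2, i, j) m (S.ty p col m Z) B :=
  ty_unary (R := S.relabel i j) (S := S) (c := (2, i, j)) ⟨hi, hj⟩ (by norm_num) rfl
    (fun _ u w => ent_relabel hi hj _ u w) Z B m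

lemma ty_join {S : LGraph n} {i j : ℕ} (hi : i ≤ p.2.1) (hj : j ≤ p.2.1)
    (Z : Sets n) (B m : ℕ) :
    (S.join i j).ty p col m Z = comb p (3, i, j) m (S.ty p col m Z) B :=
  ty_unary (R := S.join i j) (S := S) (c := (3, i, j)) ⟨hi, hj⟩ (by norm_num) rfl
    (fun _ u w => ent_join hi hj _ u w) Z B m

lemma bit_two_pow_mul (X c j : ℕ) (hc : c < 2) : bit (2 ^ j * (2 * X + c)) j = c := by
  rw [bit, Nat.mul_div_cancel_left _ (by positivity)]
  omega

lemma bit_two_pow_mul_of_lt (X c j u : ℕ) (hc : c < 2) (hu : j < u) :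
    bit (2 ^ j * (2 * X + c)) u = bit (2 ^ (j + 1) * X) u := by
  obtain ⟨v, rfl⟩ := Nat.exists_eq_add_of_le hu
  rw [bit, bit, Nat.succ_eq_add_one, pow_add, ← Nat.div_div_eq_div_mul, ← Nat.div_div_eq_div_mul,
    Nat.mul_div_cancel_left _ (by positivity), pow_succ, ← Nat.div_div_eq_div_mul,
    Nat.mul_div_cancel_left _ (by positivity)]
  grind

variable {v : Fin n} {lab colors : ℕ}

lemma ty_single_zero (hl : lab ≤ p.2.1)
    (hc : ∀ t < p.1, bit colors t = if v ∈ col t then 1 else 0) {M : ℕ} {Z : Sets n}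
    (hZ : ∀ u < p.npos, Z u = if bit M u = 1 then {v} else ∅) :
    (single v lab).ty p col 0 Z = encode (matrixList p (leafEntry p lab colors M)) := by
  have hab : p.adjBase = p.labBase + p.2.1 + 1 := rfl
  have hlb : p.labBase = p.npos + p.1 := rfl
  refine congrArg encode (matrixList_congr fun u hu w hw => ?_)
  have hb : ∀ x, bit M x = 0 ∨ bit M x = 1 := fun x => by have := bit_lt_two M x; omega
  unfold leafEntry
  rcases hb u with h0 | h0
  · have : Z u = ∅ := by rw [hZ u hu, h0]; simp
    rw [if_pos h0, ent, this]
    simp [nrm_zero]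
  have hZu : Z u = {v} := by rw [hZ u hu, h0]; simp
  rw [if_neg (by omega), ent, hZu]
  split_ifs with h1 h2 h3 h4 h5
  · rw [hZ w h1]
    rcases hb w with h | h <;> simp [h, nrm_of_lt]
  · rw [hc _ (by omega), Finset.singleton_inter]
    split_ifs <;> simp [nrm_of_lt]
  · rw [Finset.filter_singleton, if_pos (by simp [single, h4]), Finset.card_singleton,
      nrm_of_lt (by norm_num)]
  · rw [Finset.filter_singleton, if_neg (by simp [single]; omega), Finset.card_empty, nrm_zero]
  · omega
  · simp [single, nrm_of_lt]

lemma ty_single (hl : lab ≤ p.2.1) (hc : ∀ t < p.1, bit colors t = if v ∈ col t then 1 else 0)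
    {m : ℕ} {Z : Sets n}
    (hZ : ∀ i < p.2.2.2, Z (p.2.2.1 + i) = if bit m i = 1 then {v} else ∅) :
    (single v lab).ty p col p.2.2.1 Z = leafType p lab colors m := by
  obtain ⟨R, hR0, hRs, hR⟩ : ∃ R : ℕ → List ℕ, R 0 = ((range (2 ^ p.2.2.1)).map fun e =>
        encode (matrixList p (leafEntry p lab colors (2 ^ p.2.2.1 * m + e)))) ∧
      (∀ j, R (j + 1) = (range ((R j).length / 2)).map fun e =>
        setCode [(R j).getD (2 * e) 0, (R j).getD (2 * e + 1) 0]) ∧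
      leafType p lab colors m = (R p.2.2.1).getD 0 0 :=
    ⟨leafTypes p lab colors m, rfl, fun _ => rfl, rfl⟩
  rw [hR]
  suffices ∀ j ≤ p.2.2.1, (R j).length = 2 ^ (p.2.2.1 - j) ∧
      ∀ e < 2 ^ (p.2.2.1 - j), ∀ Z : Sets n,
        (∀ u, j ≤ u → u < p.npos →
          Z u = if bit (2 ^ p.2.2.1 * m + 2 ^ j * e) u = 1 then {v} else ∅) →
        (single v lab).ty p col j Z = (R j).getD e 0 by
    refine (this p.2.2.1 le_rfl).2 0 (by simp) Z fun u hu hu' => ?_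
    obtain ⟨i, rfl⟩ := Nat.exists_eq_add_of_le hu
    have hn : p.npos = p.2.2.2 + p.2.2.1 := rfl
    rw [hZ i (by omega), bit, bit, mul_zero, add_zero, pow_add, ← Nat.div_div_eq_div_mul,
      Nat.mul_div_cancel_left _ (by positivity)]
  intro j
  induction j with
  | zero =>
    intro _
    rw [hR0]
    refine ⟨by simp, fun e he Z hZ => ?_⟩
    rw [ty_single_zero hl hc fun u hu => hZ u (Nat.zero_le u) hu]
    simp_all
  | succ j ih =>
    intro hj
    obtain ⟨h1, h2⟩ := ih (by omega)
    obtain ⟨r, hr⟩ : ∃ r, p.2.2.1 = j + 1 + r := Nat.exists_eq_add_of_le hj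
    have e1 : p.2.2.1 - j = r + 1 := by omega
    have e2 : p.2.2.1 - (j + 1) = r := by omega
    rw [e1] at h1 h2
    rw [e2, hRs, h1, pow_succ, Nat.mul_div_cancel _ two_pos]
    refine ⟨by simp, fun e he Z hZ => ?_⟩
    have key : ∀ c < 2, ∀ U : Finset (Fin n), (U = if c = 1 then {v} else ∅) →
        (single v lab).ty p col j (Function.update Z j U) = (R j).getD (2 * e + c) 0 := by
      intro c hc2 U hU
      refine h2 (2 * e + c) (by rw [pow_succ]; omega) _ fun u hu hu' => ?_
      have hM : 2 ^ p.2.2.1 * m + 2 ^ j * (2 * e + c) = 2 ^ j * (2 * (2 ^ r * m + e) + c) := by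
        rw [hr]; ring
      have hM' : 2 ^ p.2.2.1 * m + 2 ^ (j + 1) * e = 2 ^ (j + 1) * (2 ^ r * m + e) := by
        grind
      rw [hM]
      rcases hu.eq_or_lt with rfl | hu
      · rw [bit_two_pow_mul _ _ _ hc2, Function.update_self, hU]
      · rw [bit_two_pow_mul_of_lt _ _ _ _ hc2 hu, Function.update_of_ne (by omega),
          hZ u hu hu', hM']
    have hg : ∀ (F : ℕ → ℕ), ((range (2 ^ r)).map F).getD e 0 = F e := fun F => by
      grind
    rw [hg]
    refine setCode_congr fun i => ?_
    rw [mem_cons, mem_singleton, ← key 1 (by omega) {v} (by simp)]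
    have k0 := key 0 (by omega) ∅ (by simp)
    rw [add_zero] at k0
    rw [← k0]
    simp only [mem_map, Finset.mem_toList, Finset.mem_powerset, single,
      Finset.subset_singleton_iff]
    grind

end LGraph

/-! ### A bound on types -/

/-- A bound on the codes of the lists of length `n` whose members are less than `B`. -/
def listBound (B n : ℕ) : ℕ := Nat.rec (motive := fun _ => ℕ) 1 (fun _ r => Nat.pair B r + 1) n

lemma encode_lt_listBound {B : ℕ} (L : List ℕ) (h : ∀ a ∈ L, a < B) :
    encode L < listBound B L.length := by
  induction L with
  | nil => simp [listBound]
  | cons a L ih =>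
    rw [Encodable.encode_list_cons, Encodable.encode_nat]
    have h1 := ih fun a ha => h a (by simp [ha])
    have h2 : Nat.pair a (encode L) < Nat.pair B (listBound B L.length) :=
      (Nat.pair_lt_pair_left _ (h a (by simp))).trans (Nat.pair_lt_pair_right _ h1)
    exact Nat.succ_lt_succ h2

def tyBound (p : Params) (j : ℕ) : ℕ :=
  Nat.rec (motive := fun _ => ℕ) (listBound (p.1.factorial + 2) (p.npos * p.width))
    (fun _ r => 2 ^ r) j

@[fun_prop] lemma PR.tyBound {α : Type} [Primcodable α] {f : α → Params} {j : α → ℕ}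
    (hf : Primrec f) (hj : Primrec j) : Primrec (fun a => tyBound (f a) (j a)) := by
  unfold ApproxMSO.tyBound listBound
  fun_prop

lemma LGraph.ty_lt {n : ℕ} (p : Params) (col : Sets n) (S : LGraph n) (j : ℕ)
    (Z : Sets n) : S.ty p col j Z < tyBound p j := by
  induction j generalizing Z with
  | zero =>
    have h := encode_lt_listBound (B := p.1.factorial + 2) (S.data p col Z) (by
      simp only [LGraph.data, matrixList, mem_map]
      rintro _ ⟨_, _, rfl⟩
      exact nrm_lt)
    have hlen : (S.data p col Z).length = p.npos * p.width := by simp [LGraph.data, matrixList]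
    aesop
  | succ j ih =>
    refine setCode_lt fun i hi => ?_
    aesop

/-! ### Truth values of normalized formulas -/

namespace Formula

variable {wt N n m : ℕ}

open Classical in
def tv (G : WGraph wt N) (xs : Fin n → Fin N) (Xs : Fin m → Finset (Fin N))
    (φ : Formula wt n m) : Bool := decide (φ.Sat G xs Xs)

open Classical in
lemma tv_eq {G : WGraph wt N} {xs : Fin n → Fin N} {Xs : Fin m → Finset (Fin N)}
    {φ : Formula wt n m} {P : Prop} [Decidable P] (h : P ↔ φ.Sat G xs Xs) :
    decide P = tv G xs Xs φ := by
  rw [tv, Bool.eq_iff_iff, decide_eq_true_iff, decide_eq_true_iff, h]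

open Classical in
lemma tv_iff {G : WGraph wt N} {xs : Fin n → Fin N} {Xs : Fin m → Finset (Fin N)}
    {φ : Formula wt n m} : tv G xs Xs φ = true ↔ φ.Sat G xs Xs := by
  rw [tv, decide_eq_true_iff]

lemma dnfBits_map (G : WGraph wt N) (xs : Fin n → Fin N) (Xs : Fin m → Finset (Fin N))
    (L : List (Formula wt n m)) : dnfBits (L.map (tv G xs Xs)) = (dnfs L).map (tv G xs Xs) := by
  have hc : ∀ l : List (Formula wt n m), (l.map (tv G xs Xs)).foldr Bool.and true =
      tv G xs Xs (conj l) := by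
    intro l
    rw [Bool.eq_iff_iff, tv_iff, sat_conj]
    induction l with
    | nil => simp
    | cons a l ih => simp [ih, tv_iff]
  have hd : ∀ l : List (Formula wt n m), (l.map (tv G xs Xs)).foldr Bool.or false =
      tv G xs Xs (disj l) := by
    intro l
    rw [Bool.eq_iff_iff, tv_iff, sat_disj]
    induction l with
    | nil => simp
    | cons a l ih => simp [ih, tv_iff]
  have hn : (L.map (tv G xs Xs)).flatMap (fun b => [b, !b]) =
      (L.flatMap fun a => [a, .not a]).map (tv G xs Xs) := by
    rw [flatMap_map, map_flatMap]
    refine flatMap_congr fun a _ => ?_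
    have : (!tv G xs Xs a) = tv G xs Xs (.not a) := by
      rw [Bool.eq_iff_iff, tv_iff, Sat, ← tv_iff]
      simp
    simp [this]
  have h1 : ∀ M : List (Formula wt n m), ((M.map (tv G xs Xs)).sublists.map fun l =>
      l.foldr Bool.and true) = (M.sublists.map conj).map (tv G xs Xs) := fun M => by
    rw [sublists_map, map_map, map_map]
    exact map_congr_left fun l _ => hc l
  have h2 : ∀ M : List (Formula wt n m), ((M.map (tv G xs Xs)).sublists.map fun l =>
      l.foldr Bool.or false) = (M.sublists.map disj).map (tv G xs Xs) := fun M => by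
    rw [sublists_map, map_map, map_map]
    exact map_congr_left fun l _ => hd l
  rw [dnfBits, dnfs, hn, h1, h2]

/-! ### The normalized formulas are listed without repetition -/

lemma conj_injective : Function.Injective (conj : List (Formula wt n m) → _) := by
  intro l l' h
  induction l generalizing l' with
  | nil =>
    cases l' with
    | nil => rfl
    | cons => cases h
  | cons a l ih =>
    cases l' with
    | nil => cases h
    | cons b l' =>
      simp only [conj, foldr_cons, and.injEq] at h
      rw [h.1, ih h.2]

lemma disj_injective : Function.Injective (disj : List (Formula wt n m) → _) := by
  intro l l' h
  induction l generalizing l' with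
  | nil =>
    cases l' with
    | nil => rfl
    | cons => cases h
  | cons a l ih =>
    cases l' with
    | nil => cases h
    | cons b l' =>
      simp only [disj, foldr_cons, or.injEq] at h
      rw [h.1, ih h.2]

lemma nodup_dnfs {L : List (Formula wt n m)} (h : L.Nodup) (hn : ∀ φ, .not φ ∉ L) :
    (dnfs L).Nodup := by
  have : (L.flatMap fun a => [a, .not a]).Nodup := by
    rw [nodup_flatMap]
    refine ⟨fun a ha => ?_, ?_⟩
    · simp only [nodup_cons, mem_singleton, not_mem_nil, not_false_eq_true,
        nodup_nil, and_true]
      intro h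
      exact hn a (h ▸ ha)
    · refine h.imp_of_mem fun {a b} ha hb hab => ?_
      intro x hx hx'
      simp only [mem_cons, not_mem_nil, or_false] at hx hx'
      rcases hx with rfl | rfl <;> rcases hx' with h' | h'
      · exact hab h'
      · exact hn b (h' ▸ ha)
      · exact hn a (h' ▸ hb)
      · exact hab (by simpa using h')
  exact ((((nodup_sublists.2 this).map conj_injective).sublists).map disj_injective)

def relOf : Formula wt n m → Option Rel
  | .edge _ _ => some .edge
  | .color c _ => some (.color c)
  | .card a r _ => some (.card a r)
  | _ => none

lemma relOf_of_mem {r : Rel} {φ : Formula wt n m} (h : φ ∈ relAtoms n m r) :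
    φ.relOf = some r := by
  cases r <;> simp only [relAtoms, mem_flatMap, mem_map] at h
  · obtain ⟨_, _, _, _, rfl⟩ := h; rfl
  · obtain ⟨_, _, rfl⟩ := h; rfl
  · obtain ⟨_, _, rfl⟩ := h; rfl

lemma nodup_atoms (σ : Signature) : (atoms σ n m : List (Formula wt n m)).Nodup := by
  have hp : ∀ {k l : ℕ} {f : Fin k → Fin l → Formula wt n m},
      (∀ a b a' b', f a b = f a' b' → a = a' ∧ b = b') →
      ((finRange k).flatMap fun x => (finRange l).map fun y => f x y).Nodup := by
    intro k l f hf
    rw [nodup_flatMap]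
    refine ⟨fun a _ => (nodup_finRange l).map fun b b' h => (hf _ _ _ _ h).2,
      (nodup_finRange k).imp fun {a b} hab => ?_⟩
    intro x hx hx'
    simp only [mem_map, mem_finRange, true_and] at hx hx'
    obtain ⟨c, rfl⟩ := hx
    obtain ⟨d, hd⟩ := hx'
    exact hab (hf _ _ _ _ hd).1.symm
  have hr : (σ.rels.flatMap (relAtoms n m : Rel → List (Formula wt n m))).Nodup := by
    rw [nodup_flatMap]
    constructor
    · intro r _
      cases r with
      | edge => exact hp fun _ _ _ _ h => by simpa using h
      | color c => exact (nodup_finRange n).map fun a b h => by simpa using h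
      | card a r => exact (nodup_finRange m).map fun a b h => by simpa using h
    · refine σ.nodup.imp fun {a b} hab => ?_
      intro x hx hx'
      exact hab (Option.some_injective _ ((relOf_of_mem hx).symm.trans (relOf_of_mem hx')))
  unfold atoms
  rw [nodup_append, nodup_append]
  refine ⟨⟨hp fun _ _ _ _ h => by simpa using h, hp fun _ _ _ _ h => by simpa using h, ?_⟩, hr, ?_⟩
  · intro a ha b hb
    simp only [mem_flatMap, mem_map, mem_finRange, true_and] at ha hb
    obtain ⟨_, _, rfl⟩ := ha
    obtain ⟨_, _, rfl⟩ := hb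
    exact fun h => by cases h
  · intro a ha b hb hab
    obtain ⟨r, _, hb⟩ := mem_flatMap.1 hb
    have h := relOf_of_mem hb
    simp only [mem_append, mem_flatMap, mem_map, mem_finRange, true_and] at ha
    subst hab
    rcases ha with ⟨_, _, rfl⟩ | ⟨_, _, rfl⟩ <;> cases h

lemma not_notMem_atoms (σ : Signature) (φ : Formula wt n m) : .not φ ∉ atoms σ n m := by
  intro h
  simp only [atoms, mem_append, mem_flatMap, mem_map, mem_finRange,
    true_and] at h
  rcases h with (⟨_, _, h⟩ | ⟨_, _, h⟩) | ⟨r, _, h⟩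
  · cases h
  · cases h
  · cases r <;> simp [relAtoms] at h

lemma nodup_cmso (σ : Signature) (q : ℕ) (n m : ℕ) :
    (cmso σ q n m : List (Formula wt n m)).Nodup := by
  induction q generalizing n m with
  | zero => exact nodup_dnfs (nodup_atoms σ) (not_notMem_atoms σ)
  | succ q ih =>
    refine nodup_dnfs ?_ ?_
    · have ha : ∀ φ ∈ (atoms σ n m : List (Formula wt n m)), φ.qrank = 0 :=
        fun φ h => (good_atoms σ n m φ h).2
      simp only [nodup_append, mem_append, mem_map]
      refine ⟨⟨⟨⟨nodup_atoms σ, (ih _ _).map fun a b h => by simpa using h, ?_⟩,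
        (ih _ _).map fun a b h => by simpa using h, ?_⟩,
        (ih _ _).map fun a b h => by simpa using h, ?_⟩,
        (ih _ _).map fun a b h => by simpa using h, ?_⟩
      · rintro a h1 _ ⟨b, _, rfl⟩ rfl
        simpa [qrank] using ha _ h1
      · rintro a (h1 | ⟨c, _, rfl⟩) _ ⟨b, _, rfl⟩ h2
        · subst h2; simpa [qrank] using ha _ h1
        · cases h2
      · rintro a ((h1 | ⟨c, _, rfl⟩) | ⟨c, _, rfl⟩) _ ⟨b, _, rfl⟩ h2
        · subst h2; simpa [qrank] using ha _ h1
        · cases h2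
        · cases h2
      · rintro a (((h1 | ⟨c, _, rfl⟩) | ⟨c, _, rfl⟩) | ⟨c, _, rfl⟩) _ ⟨b, _, rfl⟩ h2
        · subst h2; simpa [qrank] using ha _ h1
        · cases h2
        · cases h2
        · cases h2
    · intro φ h
      simp only [mem_append, mem_map, reduceCtorEq, and_false, exists_false,
        or_false] at h
      exact not_notMem_atoms σ φ h

end Formula

/-! ### Evaluation of formulas on types -/

lemma orBits_eq {X β : Type} [Nonempty X] {I : List ℕ} {F : ℕ → List Bool} {code : X → ℕ}
    (hI : ∀ i, i ∈ I ↔ ∃ x, code x = i) (L : List β) (B : X → β → Bool)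
    (hF : ∀ x, F (code x) = L.map (B x)) (R : β → Bool)
    (hR : ∀ b, R b = true ↔ ∃ x, B x b = true) : orBits I F = L.map R := by
  obtain ⟨x₀⟩ := ‹Nonempty X›
  have h0 : I.headD 0 ∈ I := by
    have := (hI _).2 ⟨x₀, rfl⟩
    cases I with
    | nil => simp at this
    | cons a l => simp
  obtain ⟨x, hx⟩ := (hI _).1 h0
  refine ext_getElem (by rw [orBits, ← hx, hF]; simp) fun t h1 h2 => ?_
  have ht : t < L.length := by simpa using h2
  simp only [orBits, getElem_map, getElem_range]
  rw [Bool.eq_iff_iff, any_eq_true, hR]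
  constructor
  · rintro ⟨i, hi, h⟩
    obtain ⟨x, rfl⟩ := (hI i).1 hi
    refine ⟨x, ?_⟩
    simpa [hF, getD_eq_getElem?_getD, ht] using h
  · rintro ⟨x, h⟩
    exact ⟨_, (hI _).2 ⟨x, rfl⟩, by simpa [hF, getD_eq_getElem?_getD, ht] using h⟩

lemma andBits_eq {X β : Type} [Nonempty X] {I : List ℕ} {F : ℕ → List Bool} {code : X → ℕ}
    (hI : ∀ i, i ∈ I ↔ ∃ x, code x = i) (L : List β) (B : X → β → Bool)
    (hF : ∀ x, F (code x) = L.map (B x)) (R : β → Bool)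
    (hR : ∀ b, R b = true ↔ ∀ x, B x b = true) : andBits I F = L.map R := by
  obtain ⟨x₀⟩ := ‹Nonempty X›
  have h0 : I.headD 0 ∈ I := by
    have := (hI _).2 ⟨x₀, rfl⟩
    cases I with
    | nil => simp at this
    | cons a l => simp
  obtain ⟨x, hx⟩ := (hI _).1 h0
  refine ext_getElem (by rw [andBits, ← hx, hF]; simp) fun t h1 h2 => ?_
  have ht : t < L.length := by simpa using h2
  simp only [andBits, getElem_map, getElem_range]
  rw [Bool.eq_iff_iff, all_eq_true, hR]
  constructor
  · intro h x
    have := h _ ((hI _).2 ⟨x, rfl⟩)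
    simpa [hF, getD_eq_getElem?_getD, ht] using this
  · intro h i hi
    obtain ⟨x, rfl⟩ := (hI i).1 hi
    simpa [hF, getD_eq_getElem?_getD, ht] using h x

lemma flatMap_range_length {α β : Type} {L : List α} {F : ℕ → List β} {h : α → List β}
    (hF : ∀ t (ht : t < L.length), F t = h L[t]) : (range L.length).flatMap F = L.flatMap h := by
  rw [flatMap_def, flatMap_def]
  congr 1
  exact ext_getElem (by simp) fun t h1 h2 => by simpa using hF t (by simpa using h1)

def Rel.code : Rel → ℕ
  | .edge => 0
  | .color _ => 1
  | .card a r => 2 + Nat.pair a r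

lemma quantPos_double {p : Params} {b c j e : ℕ} (hj : j + 1 ≤ p.2.2.1) (hc : c < 2) :
    quantPos p b j (2 * e + c) = quantPos p b (j + 1) e ++ if c = b then [j] else [] := by
  obtain ⟨r, hr⟩ := Nat.exists_eq_add_of_le hj
  have e1 : p.2.2.1 - j = r + 1 := by omega
  have e2 : p.2.2.1 - (j + 1) = r := by omega
  have h0 : bit (2 * e + c) 0 = c := by simp [bit]; omega
  have hs : ∀ t, bit (2 * e + c) (t + 1) = bit e t := fun t => by
    rw [bit, bit, pow_succ', ← Nat.div_div_eq_div_mul]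
    congr 2
    omega
  rw [quantPos, quantPos, e1, e2, range_succ_eq_map, reverse_cons, filter_append,
    map_append, ← map_reverse, filter_map, map_map]
  congr 1
  · have : (fun t => decide (bit (2 * e + c) t = b)) ∘ Nat.succ = fun t => decide (bit e t = b) := by
      funext t
      simp [hs]
    rw [this]
    refine map_congr_left fun t _ => ?_
    simp
    omega
  · by_cases h : c = b
    · subst h
      simp [h0]
    · simp [h0, h]

lemma mem_quantPos {p : Params} {b j e u : ℕ} (h : u ∈ quantPos p b j e) :
    j ≤ u ∧ u < p.2.2.1 := by
  simp only [quantPos, mem_map, mem_filter, mem_reverse, mem_range] at h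
  obtain ⟨t, ⟨ht, _⟩, rfl⟩ := h
  omega

lemma mem_setPos {p : Params} {j e u : ℕ} (hj : j ≤ p.2.2.1) (h : u ∈ setPos p j e) :
    j ≤ u ∧ u < p.npos := by
  have hn : p.npos = p.2.2.2 + p.2.2.1 := rfl
  simp only [setPos, mem_append, mem_map, mem_range] at h
  rcases h with ⟨t, ht, rfl⟩ | h
  · omega
  · have := mem_quantPos h
    omega

lemma map_snoc {α : Type} {k : ℕ} (v : Fin k → α) (a : α) :
    (finRange (k + 1)).map (Fin.snoc v a : Fin (k + 1) → α) = (finRange k).map v ++ [a] := by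
  rw [finRange_succ_last, map_append, map_map]
  congr 1
  · exact map_congr_left fun i _ => by simp
  · simp

lemma Signature.length_le_size (σ : Signature) : σ.rels.length ≤ σ.size := by
  have : ∀ L : List Rel, (∀ r ∈ L, 1 ≤ r.size) → L.length ≤ (L.map Rel.size).sum := by
    intro L h
    induction L with
    | nil => simp
    | cons a L ih =>
      have h1 := h a (by simp)
      have h2 := ih fun r hr => h r (by simp [hr])
      simp; omega
  refine this _ fun r hr => ?_
  cases r with
  | edge => exact le_rfl
  | color => exact le_rfl
  | card a r => have := σ.valid a r hr; simp [Rel.size]; omega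

lemma Signature.le_size (σ : Signature) {a r : ℕ} (h : Rel.card a r ∈ σ.rels) : r ≤ σ.size :=
  single_le_sum (fun _ _ => Nat.zero_le _) _ (mem_map.2 ⟨_, h, rfl⟩)

namespace LGraph

variable {wt n : ℕ}

/-- The labelled graph, with sets giving the colors, is a presentation of `G`. -/
structure Presents (S : LGraph n) (σ : Signature) (col : Sets n) (G : WGraph wt n) :
    Prop where
  pos : 0 < n
  verts : S.verts = Finset.univ
  adj : ∀ a b, G.graph.Adj a b ↔ 0 < S.mult a b
  color : ∀ t (ht : t < σ.rels.length) c, σ.rels[t] = .color c → col t = G.color c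

variable {p : Params} {col : Sets n} {S : LGraph n} {G : WGraph wt n} {σ : Signature}

lemma drill_ty (j : ℕ) (Z : Sets n) :
    ∃ Z', (∀ i, j ≤ i → Z' i = Z i) ∧ drill j (S.ty p col j Z) = S.ty p col 0 Z' := by
  have hd : ∀ j A, drill (j + 1) A = drill j ((elems A).headD 0) := by
    intro j
    induction j with
    | zero => exact fun _ => rfl
    | succ j ih => intro A; rw [drill]; exact congrArg (fun B => (elems B).headD 0) (ih A)
  induction j generalizing Z with
  | zero => exact ⟨Z, fun _ _ => rfl, rfl⟩
  | succ j ih =>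
    have h0 : (elems (S.ty p col (j + 1) Z)).headD 0 ∈ elems (S.ty p col (j + 1) Z) := by
      have := mem_elems_ty (p := p) (col := col) (S := S) (j := j) (Z := Z).2
        ⟨∅, Finset.empty_subset _, rfl⟩
      revert this
      cases elems (S.ty p col (j + 1) Z) <;> simp
    obtain ⟨U, _, hU⟩ := mem_elems_ty.1 h0
    obtain ⟨Z', h1, h2⟩ := ih (Function.update Z j U)
    refine ⟨Z', fun i hi => ?_, ?_⟩
    · rw [h1 i (by omega), Function.update_of_ne (by omega)]
    · rw [hd, ← hU, h2]

lemma entry_data {Z : Sets n} {u w : ℕ} (hu : u < p.npos) (hw : w < p.width) :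
    entry p (S.data p col Z) u w = nrm p.1 (S.ent p col Z u w) :=
  entry_matrixList hu hw

lemma atomBits_eq (hS : S.Presents σ col G) (hp : p.1 = σ.size) {j e nn mm : ℕ}
    (hj : j ≤ p.2.2.1) {v : Fin nn → ℕ} {w : Fin mm → ℕ} {xs : Fin nn → Fin n}
    {Xs : Fin mm → Finset (Fin n)} {Z : Sets n}
    (hv : quantPos p 0 j e = (finRange nn).map v)
    (hw : setPos p j e = (finRange mm).map w) (hx : ∀ i, Z (v i) = {xs i})
    (hX : ∀ i, Z (w i) = Xs i) :
    atomBits p (σ.rels.map Rel.code) (quantPos p 0 j e) (setPos p j e)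
      (decodeList (drill j (S.ty p col j Z))) =
      (Formula.atoms σ nn mm).map (Formula.tv G xs Xs) := by
  obtain ⟨Z', hZ', hd⟩ := drill_ty (p := p) (col := col) (S := S) j Z
  have hn : p.npos = p.2.2.2 + p.2.2.1 := rfl
  have hlb : p.labBase = p.npos + p.1 := rfl
  have hab : p.adjBase = p.labBase + p.2.1 + 1 := rfl
  have hwd : p.width = p.adjBase + p.npos := rfl
  have hvl : ∀ i, j ≤ v i ∧ v i < p.npos := fun i => by
    have := mem_quantPos (hv ▸ mem_map_of_mem (mem_finRange i) : v i ∈ quantPos p 0 j e)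
    omega
  have hwl : ∀ i, j ≤ w i ∧ w i < p.npos := fun i =>
    mem_setPos hj (hw ▸ mem_map_of_mem (mem_finRange i) : w i ∈ setPos p j e)
  replace hx : ∀ i, Z' (v i) = {xs i} := fun i => by rw [hZ' _ (hvl i).1, hx]
  replace hX : ∀ i, Z' (w i) = Xs i := fun i => by rw [hZ' _ (hwl i).1, hX]
  rw [hd, ty, decodeList_encode, hv, hw]
  have key : ∀ {a b : ℕ} {f : Fin a → ℕ} {g : Fin b → ℕ} {F : ℕ → ℕ → Bool}
      {H : Fin a → Fin b → Formula wt nn mm},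
      (∀ i k, F (f i) (g k) = Formula.tv G xs Xs (H i k)) →
      (((finRange a).map f).flatMap fun x => ((finRange b).map g).map fun y => F x y) =
      ((finRange a).flatMap fun x => (finRange b).map fun y => H x y).map
        (Formula.tv G xs Xs) := by
    intro a b f g F H h
    rw [flatMap_map, map_flatMap]
    refine flatMap_congr fun i _ => ?_
    rw [map_map, map_map]
    exact map_congr_left fun k _ => h i k
  unfold atomBits Formula.atoms
  rw [map_append, map_append]
  congr 1
  · congr 1
    · refine key fun i k => Formula.tv_eq ?_
      rw [entry_data (hvl i).2 (by have := (hwl k).2; omega), nrm_pos, ent, if_pos (hwl k).2, hx, hX]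
      by_cases h : xs i ∈ Xs k <;> simp [Formula.Sat, h]
    · refine key fun i k => Formula.tv_eq ?_
      rw [entry_data (hvl i).2 (by have := (hvl k).2; omega), nrm_pos, ent, if_pos (hvl k).2, hx, hx]
      by_cases h : xs i = xs k <;> simp [Formula.Sat, h]
  · rw [length_map, map_flatMap]
    refine flatMap_range_length fun t ht => ?_
    have hts := ht.trans_le (σ.length_le_size.trans hp.ge)
    have hg : (σ.rels.map Rel.code).getD t 0 = σ.rels[t].code := by
      simp [getD_eq_getElem?_getD, ht]
    rw [hg]
    cases hr : σ.rels[t] with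
    | edge =>
      rw [if_pos (show Rel.edge.code = 0 from rfl)]
      refine key fun i k => Formula.tv_eq ?_
      have := (hvl k).2
      rw [entry_data (hvl i).2 (by omega), nrm_pos, ent, if_neg (by omega), if_neg (by omega),
        if_neg (by omega), Nat.add_sub_cancel_left, hx, hx, Finset.sum_singleton,
        Finset.sum_singleton, Formula.Sat, hS.adj]
    | color c =>
      rw [if_neg (by simp [Rel.code]), if_pos (show (Rel.color c).code = 1 from rfl), Formula.relAtoms,
        map_map, map_map]
      refine map_congr_left fun i _ => Formula.tv_eq ?_
      rw [entry_data (hvl i).2 (by omega), nrm_pos, ent, if_neg (by omega), if_pos (by omega),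
        Nat.add_sub_cancel_left, hx, hS.color t ht c hr]
      by_cases h : xs i ∈ G.color c <;> simp [Formula.Sat, h]
    | card a r =>
      have hm : Rel.card a r ∈ σ.rels := hr ▸ getElem_mem ht
      rw [if_neg (by simp [Rel.code]), if_neg (by simp [Rel.code]; omega), Formula.relAtoms,
        map_map, map_map]
      refine map_congr_left fun i _ => Formula.tv_eq ?_
      have := (hwl i).2
      have hrs : r ∣ p.1.factorial := Nat.dvd_factorial (by have := σ.valid a r hm; omega)
        (hp ▸ σ.le_size hm)
      rw [entry_data (hwl i).2 (by omega), ent, if_pos this, Finset.inter_self, hX, Rel.code,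
        Nat.add_sub_cancel_left, Nat.unpair_pair, nrm_mod hrs]
      rfl

lemma mem_singles {j : ℕ} (hj : j < p.2.2.1) {Z : Sets n}
    (hS : S.verts = Finset.univ) {i : ℕ} :
    i ∈ singles p j (S.ty p col (j + 1) Z) ↔
      ∃ v : Fin n, S.ty p col j (Function.update Z j {v}) = i := by
  have hn : p.npos = p.2.2.2 + p.2.2.1 := rfl
  have hwd : p.width = p.npos + p.1 + p.2.1 + 1 + p.npos := rfl
  rw [singles, mem_filter, mem_elems_ty, hS, decide_eq_true_iff]
  have key : ∀ U, entry p (decodeList (drill j (S.ty p col j (Function.update Z j U)))) j j = 1 ↔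
      U.card = 1 := by
    intro U
    obtain ⟨Z', hZ', hd⟩ := drill_ty (p := p) (col := col) (S := S) j (Function.update Z j U)
    rw [hd, ty, decodeList_encode, entry_data (by omega) (by omega), nrm_eq_one, ent,
      if_pos (by omega), hZ' j le_rfl, Function.update_self, Finset.inter_self]
  constructor
  · rintro ⟨⟨U, _, rfl⟩, h⟩
    obtain ⟨v, rfl⟩ := Finset.card_eq_one.1 ((key U).1 h)
    exact ⟨v, rfl⟩
  · rintro ⟨v, rfl⟩
    exact ⟨⟨_, Finset.subset_univ _, rfl⟩, (key _).2 (Finset.card_singleton v)⟩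

lemma bitsTable_ty (hS : S.Presents σ col G) (hp : p.1 = σ.size) (j : ℕ) :
    ∀ {e nn mm : ℕ}, j ≤ p.2.2.1 → e < 2 ^ (p.2.2.1 - j) →
    ∀ {v : Fin nn → ℕ} {w : Fin mm → ℕ} {xs : Fin nn → Fin n}
    {Xs : Fin mm → Finset (Fin n)} {Z : Sets n},
    quantPos p 0 j e = (finRange nn).map v → setPos p j e = (finRange mm).map w →
    (∀ i, Z (v i) = {xs i}) → (∀ i, Z (w i) = Xs i) →
    (bitsTable p (σ.rels.map Rel.code) j (S.ty p col j Z)).getD e [] =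
      (Formula.cmso σ j nn mm).map (Formula.tv G xs Xs) := by
  induction j with
  | zero =>
    intro e nn mm hj he v w xs Xs Z hv hw hx hX
    have := atomBits_eq hS hp hj hv hw hx hX
    rw [bitsTable, Formula.cmso, ← Formula.dnfBits_map, ← this]
    rw [Nat.sub_zero] at he
    simp [getD_eq_getElem?_getD, he, drill]
  | succ j ih =>
    intro e nn mm hj he v w xs Xs Z hv hw hx hX
    have hvl : ∀ i, j < v i := fun i => (mem_quantPos
      (hv ▸ mem_map_of_mem (mem_finRange i) : v i ∈ quantPos p 0 (j + 1) e)).1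
    have hwl : ∀ i, j < w i := fun i => (mem_setPos hj
      (hw ▸ mem_map_of_mem (mem_finRange i) : w i ∈ setPos p (j + 1) e)).1
    have he' : ∀ c < 2, 2 * e + c < 2 ^ (p.2.2.1 - j) := fun c hc => by
      have : p.2.2.1 - j = p.2.2.1 - (j + 1) + 1 := by omega
      rw [this, pow_succ]
      omega
    have : Nonempty (Fin n) := ⟨⟨0, hS.pos⟩⟩
    have hV : ∀ a : Fin n, (bitsTable p (σ.rels.map Rel.code) j
        (S.ty p col j (Function.update Z j {a}))).getD (2 * e) [] =
        (Formula.cmso σ j (nn + 1) mm).map (Formula.tv G (Fin.snoc xs a) Xs) := by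
      intro a
      refine ih (v := Fin.snoc v j) (w := w) (by omega) (he' 0 (by omega)) ?_ ?_ ?_ ?_
      · have := quantPos_double (b := 0) (c := 0) (e := e) hj (by omega)
        rw [map_snoc, ← hv]
        simpa using this
      · have := quantPos_double (b := 1) (c := 0) (e := e) hj (by omega)
        rw [← hw, setPos, setPos]
        simpa using this
      · intro i
        refine Fin.lastCases ?_ (fun i => ?_) i
        · simp
        · simp [(hvl i).ne', hx]
      · intro i
        rw [Function.update_of_ne (hwl i).ne', hX]
    have hU : ∀ U : Finset (Fin n), (bitsTable p (σ.rels.map Rel.code) j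
        (S.ty p col j (Function.update Z j U))).getD (2 * e + 1) [] =
        (Formula.cmso σ j nn (mm + 1)).map (Formula.tv G xs (Fin.snoc Xs U)) := by
      intro U
      refine ih (v := v) (w := Fin.snoc w j) (by omega) (he' 1 (by omega)) ?_ ?_ ?_ ?_
      · have := quantPos_double (b := 0) (c := 1) (e := e) hj (by omega)
        rw [← hv]
        simpa using this
      · have := quantPos_double (b := 1) (c := 1) (e := e) hj (by omega)
        rw [map_snoc, ← hw, setPos, setPos, this]
        simp
      · intro i
        rw [Function.update_of_ne (hvl i).ne', hx]
      · intro i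
        refine Fin.lastCases ?_ (fun i => ?_) i
        · simp
        · simp [(hwl i).ne', hX]
    have hI : ∀ i, i ∈ elems (S.ty p col (j + 1) Z) ↔
        ∃ U, S.ty p col j (Function.update Z j U) = i := fun i => by
      rw [mem_elems_ty, hS.verts]
      simp
    have h := fun i => mem_singles (p := p) (col := col) (Z := Z) (S := S) (i := i) hj hS.verts
    have : (bitsTable p (σ.rels.map Rel.code) (j + 1) (S.ty p col (j + 1) Z)).getD e [] =
        dnfBits (blockBits p (σ.rels.map Rel.code) j e (S.ty p col (j + 1) Z)
          fun i => bitsTable p (σ.rels.map Rel.code) j i) := by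
      rw [bitsTable]
      simp [getD_eq_getElem?_getD, he]
    rw [this, blockBits, atomBits_eq hS hp hj hv hw hx hX, Formula.cmso, ← Formula.dnfBits_map]
    simp only [map_append, map_map]
    congr 1
    congr 1
    · congr 1
      · congr 1
        · congr 1
          refine orBits_eq h _ _ hV _ fun φ => ?_
          simp only [Function.comp_apply, Formula.tv_iff, Formula.Sat]
        · refine andBits_eq h _ _ hV _ fun φ => ?_
          simp only [Function.comp_apply, Formula.tv_iff, Formula.Sat]
      · refine orBits_eq hI _ _ hU _ fun φ => ?_
        simp only [Function.comp_apply, Formula.tv_iff, Formula.Sat]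
    · refine andBits_eq hI _ _ hU _ fun φ => ?_
      simp only [Function.comp_apply, Formula.tv_iff, Formula.Sat]

end LGraph

/-- The truth values of the normalized formulas of maximal rank on a type. -/
def bits (p : Params) (rl : List ℕ) (A : ℕ) : List Bool := (bitsTable p rl p.2.2.1 A).getD 0 []

lemma PR.bits : Primrec fun x : (Params × List ℕ) × ℕ => bits x.1.1 x.1.2 x.2 := by
  have h := PR.bitsTable.comp (g := fun x : (Params × List ℕ) × ℕ => (x.1.1.2.2.1, x.1, x.2))
    fp
  exact (Primrec.list_getD []).comp h (Primrec.const 0)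

variable {wt n : ℕ} {p : Params} {col : Sets n} {S : LGraph n} {G : WGraph wt n}
  {σ : Signature}

lemma bits_ty (hS : S.Presents σ col G) (hp : p.1 = σ.size) {l : ℕ} (hl : p.2.2.2 = l)
    {Z : Sets n} {Xs : Fin l → Finset (Fin n)}
    (hX : ∀ i : Fin l, Z (p.2.2.1 + i) = Xs i) :
    bits p (σ.rels.map Rel.code) (S.ty p col p.2.2.1 Z) =
      (Formula.cmso σ p.2.2.1 0 l).map (Formula.tv G Fin.elim0 Xs) := by
  refine S.bitsTable_ty hS hp p.2.2.1 le_rfl (by simp) (v := Fin.elim0)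
    (w := fun i : Fin l => p.2.2.1 + i) (by simp [quantPos]) ?_ (fun i => i.elim0) hX
  simp only [setPos, quantPos, Nat.sub_self, range_zero, reverse_nil, filter_nil,
    map_nil, append_nil, hl]
  refine ext_getElem (by simp) fun t h1 h2 => by simp

def numFormulas (p : Params) (rl : List ℕ) : ℕ := (bits p rl (leafType p 0 0 0)).length

lemma PR.numFormulas : Primrec fun x : Params × List ℕ => numFormulas x.1 x.2 := by
  have h1 := PR.leafType.comp (g := fun x : Params × List ℕ => (x.1, 0, 0, 0)) fp
  have h2 := PR.bits.comp
    (g := fun x : Params × List ℕ => (x, ApproxMSO.leafType x.1 0 0 0)) fp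
  exact Primrec.list_length.comp h2

lemma numFormulas_eq (σ : Signature) (wt : ℕ) (hp : p.1 = σ.size) {l : ℕ} (hl : p.2.2.2 = l) :
    numFormulas p (σ.rels.map Rel.code) =
      (Formula.cmso σ p.2.2.1 0 l : List (Formula wt 0 l)).length := by
  let G : WGraph wt 1 := ⟨⊥, fun _ => ∅, fun _ _ => 0⟩
  have h0 : ∀ i, bit 0 i = 0 := fun i => by simp [bit]
  have h1 := LGraph.ty_single (n := 1) (p := p) (col := fun _ => ∅) (v := 0) (lab := 0)
    (colors := 0) (Nat.zero_le _) (by simp [h0]) (m := 0) (Z := fun _ => ∅) (by simp [h0])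
  have h2 := bits_ty (S := LGraph.single (0 : Fin 1) 0) (σ := σ) (col := fun _ => ∅) (G := G)
    ⟨by norm_num, by simp [LGraph.single], by simp [G, LGraph.single],
      by intros; rfl⟩ hp hl (Z := fun _ => ∅) (Xs := fun _ => ∅) (by simp)
  rw [numFormulas, ← h1, h2, length_map]

def pairsWith {γ δ κ : Type} (h : γ → δ → κ) (l : List γ) (m : List δ) : List κ :=
  l.flatMap fun x => m.map (h x)

lemma length_pairsWith {γ δ κ : Type} (h : γ → δ → κ) (l : List γ) (m : List δ) :
    (pairsWith h l m).length = l.length * m.length := by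
  simp [pairsWith]

/-! ### Cost bounds on a domain -/

def DomOn {α : Type} (D : α → Prop) (u v : α → ℕ) : Prop := ∃ C, ∀ a, D a → u a ≤ C * (v a + 1)

namespace DomOn

variable {α : Type} {D : α → Prop} {u v w : α → ℕ}

lemma of_le (h : ∀ a, D a → u a ≤ v a) : DomOn D u v :=
  ⟨1, fun a ha => by have := h a ha; omega⟩

lemma of_le_mul (C : ℕ) (h : ∀ a, D a → u a ≤ C * (v a + 1)) : DomOn D u v := ⟨C, h⟩

lemma refl : DomOn D u u := of_le fun _ _ => le_rfl

lemma zero : DomOn D (fun _ => 0) v := of_le fun _ _ => Nat.zero_le _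

lemma trans (h : DomOn D u v) (h' : DomOn D v w) : DomOn D u w := by
  obtain ⟨C, h⟩ := h
  obtain ⟨C', h'⟩ := h'
  refine ⟨C * (C' + 1), fun a ha => (h a ha).trans ?_⟩
  rw [mul_assoc]
  refine Nat.mul_le_mul_left _ ?_
  have := h' a ha
  nlinarith

lemma add (h : DomOn D u w) (h' : DomOn D v w) : DomOn D (fun a => u a + v a) w := by
  obtain ⟨C, h⟩ := h
  obtain ⟨C', h'⟩ := h'
  refine ⟨C + C', fun a ha => ?_⟩
  have := h a ha
  have := h' a ha
  nlinarith

lemma const_mul (c : ℕ) (h : DomOn D u w) : DomOn D (fun a => c * u a) w := by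
  obtain ⟨C, h⟩ := h
  refine ⟨c * C, fun a ha => ?_⟩
  rw [mul_assoc]
  exact Nat.mul_le_mul_left _ (h a ha)

end DomOn

/-- The function `f` is computed by a program, in `O(u a + 1)` steps if `a` lies in `D`. -/
def TMD {α β : Type} [Enc α] [Enc β] (D : α → Prop) (f : α → β) (u : α → ℕ) : Prop :=
  ∃ v, TM f v ∧ DomOn D v u

lemma TM.on {α β : Type} [Enc α] [Enc β] {D : α → Prop} {f : α → β} {u v : α → ℕ} (h : TM f v)
    (h' : DomOn D v u) : TMD D f u := ⟨v, h, h'⟩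

lemma TM.on' {α β : Type} [Enc α] [Enc β] {D : α → Prop} {f : α → β} {u : α → ℕ}
    (h : TM f u) : TMD D f u := ⟨u, h, .refl⟩

lemma TM.on₀ {α β : Type} [Enc α] [Enc β] {D : α → Prop} {f : α → β} {u : α → ℕ}
    (h : TM f (fun _ => 0) := by fun_prop) : TMD D f u := ⟨_, h, .zero⟩

namespace TMD

variable {α β γ δ σ : Type} [Enc α] [Enc β] [Enc γ] [Enc δ] [Enc σ] {D : α → Prop} {u v : α → ℕ}

lemma mono {f : α → β} (h : TMD D f u) (h' : DomOn D u v) : TMD D f v := by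
  obtain ⟨w, h1, h2⟩ := h
  exact ⟨w, h1, h2.trans h'⟩

lemma restrict {E : α → Prop} {f : α → β} (h : TMD D f u) (h' : ∀ a, E a → D a) : TMD E f u := by
  obtain ⟨w, h1, C, h2⟩ := h
  exact ⟨w, h1, C, fun a ha => h2 a (h' a ha)⟩

lemma of_eq {f g : α → β} (h : TMD D f u) (hg : ∀ a, f a = g a) : TMD D g u := funext hg ▸ h

lemma comp {E : β → Prop} {f : α → β} {g : β → γ} {w : β → ℕ} (hg : TMD E g w) (hf : TMD D f u)
    (hE : ∀ a, D a → E (f a)) (h : DomOn D (fun a => w (f a)) u) :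
    TMD D (fun a => g (f a)) u := by
  obtain ⟨w', h1, C, h2⟩ := hg
  obtain ⟨u', h3, h4⟩ := hf
  refine ⟨fun a => u' a + w' (f a), h1.comp' (h3.mono_le fun a => Nat.le_add_right _ _)
    (.of_le fun a => Nat.le_add_left _ _), h4.add (.trans ⟨C, fun a ha => h2 _ (hE a ha)⟩ h)⟩

lemma app {E : β → Prop} {g : β → γ} {w : β → ℕ} (hg : TMD E g w) (F : α → β)
    (hE : ∀ a, D a → E (F a)) (h : DomOn D (fun a => w (F a)) u)
    (hF : TM F fun _ => 0 := by fun_prop) : TMD D (fun a => g (F a)) u := hg.comp hF.on₀ hE h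

lemma prodMk {f : α → β} {g : α → γ} (hf : TMD D f u) (hg : TMD D g u) :
    TMD D (fun a => (f a, g a)) u := by
  obtain ⟨w, h1, h2⟩ := hf
  obtain ⟨w', h3, h4⟩ := hg
  exact ⟨fun a => w a + w' a, (h1.mono_le fun a => Nat.le_add_right _ _).prodMk
    (h3.mono_le fun a => Nat.le_add_left _ _), h2.add h4⟩

lemma comp₀ {f : α → β} {g : β → γ} (hg : TM g fun _ => 0) (hf : TMD D f u) :
    TMD D (fun a => g (f a)) u :=
  TMD.comp (E := fun _ => True) hg.on' hf (fun _ _ => trivial) .zero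

lemma ite {p : α → Prop} [DecidablePred p] {f g : α → β} (hp : TMD D (fun a => decide (p a)) u)
    (hf : TMD D f u) (hg : TMD D g u) : TMD D (fun a => if p a then f a else g a) u := by
  obtain ⟨w, h1, h2⟩ := hp
  obtain ⟨w', h3, h4⟩ := hf
  obtain ⟨w'', h5, h6⟩ := hg
  exact ⟨fun a => w a + w' a + w'' a, TM.ite (h1.mono_le fun a => by omega)
    (h3.mono_le fun a => by omega) (h5.mono_le fun a => by omega), (h2.add h4).add h6⟩

lemma ite_of {p : α → Prop} [DecidablePred p] {f g : α → β}
    (hp : TMD D (fun a => decide (p a)) u) (hf : TMD (fun a => D a ∧ p a) f u)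
    (hg : TMD (fun a => D a ∧ ¬ p a) g u) : TMD D (fun a => if p a then f a else g a) u := by
  obtain ⟨w, h1, h2⟩ := hp
  obtain ⟨w', h3, C, h4⟩ := hf
  obtain ⟨w'', h5, C', h6⟩ := hg
  refine ⟨fun a => w a + (if p a then w' a else w'' a), TM.ite_of (h1.mono_le fun a => by omega)
    (h3.restrict.mono_le fun a => ?_) (h5.restrict.mono_le fun a => ?_), h2.add ⟨C + C', fun a ha => ?_⟩⟩
  · simp [a.2]
  · simp [a.2]
  · beta_reduce
    split_ifs with h
    · exact (h4 a ⟨ha, h⟩).trans (Nat.mul_le_mul_right _ (by omega))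
    · exact (h6 a ⟨ha, h⟩).trans (Nat.mul_le_mul_right _ (by omega))

lemma foldl {E : α × σ × γ → Prop} {l : α → List γ} {s₀ : α → σ} {g : α → σ → γ → σ}
    {w : α × σ × γ → ℕ} (hg : TMD E (fun p : α × σ × γ => g p.1 p.2.1 p.2.2) w)
    (hl : TMD D l u) (hs : TMD D s₀ u) (Inv : α → σ → Prop) (T : α → ℕ)
    (h₀ : ∀ a, D a → Inv a (s₀ a))
    (h : ∀ a, D a → ∀ s, ∀ x ∈ l a, Inv a s →
      Inv a (g a s x) ∧ E (a, s, x) ∧ w (a, s, x) ≤ T a)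
    (hc : DomOn D (fun a => (l a).length * (T a + 1)) u) :
    TMD D (fun a => (l a).foldl (g a) (s₀ a)) u := by
  obtain ⟨w', h1, C, h2⟩ := hg
  obtain ⟨u₁, h3, h4⟩ := hl
  obtain ⟨u₂, h5, h6⟩ := hs
  refine ⟨fun a => u₁ a + u₂ a + TM.foldCost (fun s x => w' (a, s, x)) (g a) (s₀ a) (l a),
    TM.foldl h1 (h3.mono_le fun a => by omega) (h5.mono_le fun a => by omega)
      (.of_le fun a => by omega), (h4.add h6).add (.trans ?_ (hc.const_mul (C + 1)))⟩
  refine .of_le fun a ha => (TM.foldCost_le (Inv a) (T := C * (T a + 1)) (h₀ a ha)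
    fun s x hx hs => ?_).trans ?_
  · obtain ⟨i1, i2, i3⟩ := h a ha s x hx hs
    exact ⟨i1, (h2 _ i2).trans (Nat.mul_le_mul_left _ (by omega))⟩
  · rw [mul_comm (C + 1), mul_assoc]
    refine Nat.mul_le_mul_left _ ?_
    nlinarith

lemma flatMap {E : α × γ → Prop} {l : α → List γ} {h : α → γ → List δ} {w : α × γ → ℕ}
    (hh : TMD E (fun p : α × γ => h p.1 p.2) w) (hl : TMD D l u) (T : α → ℕ)
    (hT : ∀ a, D a → ∀ x ∈ l a, E (a, x) ∧ w (a, x) ≤ T a ∧ (h a x).length ≤ T a)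
    (hc : DomOn D (fun a => (l a).length * (T a + 1)) u) :
    TMD D (fun a => (l a).flatMap (h a)) u := by
  obtain ⟨w', h1, C, h2⟩ := hh
  obtain ⟨u₁, h3, h4⟩ := hl
  refine ⟨fun a => u₁ a + ((l a).map fun x => w' (a, x) + (h a x).length + 1).sum,
    TM.flatMap h1 (h3.mono_le fun a => by omega) (.of_le fun a => by omega),
    h4.add (.trans (.of_le fun a ha => ?_) (hc.const_mul (C + 1)))⟩
  refine (sum_le_card_nsmul _ ((C + 1) * (T a + 1)) fun y hy => ?_).trans ?_
  · obtain ⟨x, hx, rfl⟩ := mem_map.1 hy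
    obtain ⟨i1, i2, i3⟩ := hT a ha x hx
    have := h2 _ i1
    have := Nat.mul_le_mul_left C (Nat.add_le_add_right i2 1)
    nlinarith
  · rw [length_map, smul_eq_mul]
    exact (Nat.mul_left_comm _ _ _).le

lemma map {E : α × γ → Prop} {l : α → List γ} {h : α → γ → δ} {w : α × γ → ℕ}
    (hh : TMD E (fun p : α × γ => h p.1 p.2) w) (hl : TMD D l u) (T : α → ℕ)
    (hT : ∀ a, D a → ∀ x ∈ l a, E (a, x) ∧ w (a, x) ≤ T a)
    (hc : DomOn D (fun a => (l a).length * (T a + 1)) u) :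
    TMD D (fun a => (l a).map (h a)) u := by
  have := flatMap (h := fun a x => [h a x]) (hh.comp₀ (g := fun x => [x]) fp) hl (fun a => T a + 1)
    (fun a ha x hx => ⟨(hT a ha x hx).1, (hT a ha x hx).2.trans (Nat.le_succ _), by simp⟩)
    (.trans (.of_le_mul 2 fun a _ => by nlinarith) hc)
  exact this.of_eq fun a => by induction l a <;> simp_all

lemma filter {E : α × γ → Prop} {l : α → List γ} {p : α → γ → Bool} {w : α × γ → ℕ}
    (hh : TMD E (fun q : α × γ => p q.1 q.2) w) (hl : TMD D l u) (T : α → ℕ)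
    (hT : ∀ a, D a → ∀ x ∈ l a, E (a, x) ∧ w (a, x) ≤ T a)
    (hc : DomOn D (fun a => (l a).length * (T a + 1)) u) :
    TMD D (fun a => (l a).filter (p a)) u := by
  have h1 : TMD E (fun q : α × γ => if p q.1 q.2 = true then [q.2] else []) w :=
    .ite (comp₀ (g := fun b : Bool => decide (b = true)) fp hh) TM.on₀ TM.on₀
  have h2 := flatMap (h := fun a x => if p a x = true then [x] else []) h1 hl (fun a => T a + 1)
    (fun a ha x hx => ?_) (.trans (.of_le_mul 2 fun a ha => ?_) hc)
  · refine h2.of_eq fun a => ?_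
    induction l a with
    | nil => rfl
    | cons x l ih => rw [flatMap_cons, ih, filter_cons]; split_ifs <;> rfl
  · obtain ⟨i1, i2⟩ := hT a ha x hx
    refine ⟨i1, by omega, ?_⟩
    split_ifs <;> simp
  · nlinarith

lemma foldl_geom {E : α × σ × γ → Prop} {l : α → List γ} {s₀ : α → σ} {g : α → σ → γ → σ}
    {w : α × σ × γ → ℕ} (hg : TMD E (fun p : α × σ × γ => g p.1 p.2.1 p.2.2) w)
    (hl : TMD D l u) (hs : TMD D s₀ u) (Inv : α → ℕ → σ → Prop) (Y X : α → ℕ)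
    (h₀ : ∀ a, D a → 2 ≤ Y a ∧ Inv a 1 (s₀ a))
    (h : ∀ a, D a → ∀ m, 0 < m → ∀ s, ∀ x ∈ l a, Inv a m s →
      Inv a (Y a * m) (g a s x) ∧ E (a, s, x) ∧ w (a, s, x) ≤ X a * (m * Y a))
    (hc : DomOn D (fun a => (X a + 1) * Y a ^ (l a).length) u) :
    TMD D (fun a => (l a).foldl (g a) (s₀ a)) u := by
  obtain ⟨w', h1, C, h2⟩ := hg
  obtain ⟨u₁, h3, h4⟩ := hl
  obtain ⟨u₂, h5, h6⟩ := hs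
  refine ⟨fun a => u₁ a + u₂ a + TM.foldCost (fun s x => w' (a, s, x)) (g a) (s₀ a) (l a),
    TM.foldl h1 (h3.mono_le fun a => by omega) (h5.mono_le fun a => by omega)
      (.of_le fun a => by omega), (h4.add h6).add (.trans (.of_le fun a ha => ?_)
        (hc.const_mul (2 * (C + 1))))⟩
  obtain ⟨hY, hi⟩ := h₀ a ha
  suffices ∀ L : List γ, (∀ x ∈ L, x ∈ l a) → ∀ m, 0 < m → ∀ s, Inv a m s →
      TM.foldCost (fun s x => w' (a, s, x)) (g a) s L + 2 * (C + 1) * ((X a + 1) * m) ≤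
        2 * (C + 1) * ((X a + 1) * (m * Y a ^ L.length)) by
    have := this (l a) (fun _ => id) 1 one_pos _ hi
    rw [one_mul] at this
    omega
  intro L
  induction L with
  | nil => intro _ m _ s _; simp [TM.foldCost]
  | cons x L ih =>
    intro hL m hm s hs
    obtain ⟨i1, i2, i3⟩ := h a ha m hm s x (hL x (by simp)) hs
    have h7 := ih (fun y hy => hL y (by simp [hy])) (Y a * m) (by positivity) _ i1
    have h8 := h2 _ i2
    rw [TM.foldCost, length_cons, pow_succ']
    have h9 : w' (a, s, x) + 1 ≤ (C + 1) * ((X a + 1) * (m * Y a)) := by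
      have h10 : w (a, s, x) + 1 ≤ (X a + 1) * (m * Y a) := by nlinarith [Nat.mul_pos hm (by omega : 0 < Y a)]
      have h11 : 1 ≤ (X a + 1) * (m * Y a) := by omega
      have := Nat.mul_le_mul_left C h10
      nlinarith
    have e1 : Y a * m * Y a ^ L.length = m * (Y a * Y a ^ L.length) := by ring
    rw [e1] at h7
    have h12 : 2 * ((X a + 1) * m) ≤ (X a + 1) * (m * Y a) := by nlinarith [Nat.zero_le ((X a + 1) * m)]
    have h13 : (X a + 1) * (Y a * m) = (X a + 1) * (m * Y a) := by ring
    rw [h13] at h7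
    nlinarith

lemma all {E : α × γ → Prop} {l : α → List γ} {p : α → γ → Bool} {w : α × γ → ℕ}
    (hh : TMD E (fun q : α × γ => p q.1 q.2) w) (hl : TMD D l u) (T : α → ℕ)
    (hT : ∀ a, D a → ∀ x ∈ l a, E (a, x) ∧ w (a, x) ≤ T a)
    (hc : DomOn D (fun a => (l a).length * (T a + 1)) u) :
    TMD D (fun a => (l a).all (p a)) u := by
  have := (filter (p := fun a x => !p a x) (hh.comp₀ (g := not) fp) hl T hT hc).comp₀
    (g := List.isEmpty) fp
  exact this.of_eq fun a => by rw [Bool.eq_iff_iff]; simp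

lemma pairsWith {κ : Type} [Enc κ] {E : α × γ × δ → Prop} {l : α → List γ} {m : α → List δ}
    {h : α → γ → δ → κ} {w : α × γ × δ → ℕ}
    (hh : TMD E (fun p : α × γ × δ => h p.1 p.2.1 p.2.2) w) (hl : TMD D l u) (hm : TMD D m u)
    (T : α → ℕ) (hT : ∀ a, D a → ∀ x ∈ l a, ∀ y ∈ m a, E (a, x, y) ∧ w (a, x, y) ≤ T a)
    (hc : DomOn D (fun a => (l a).length * ((m a).length * (T a + 1) + 1)) u) :
    TMD D (fun a => ApproxMSO.pairsWith (h a) (l a) (m a)) u := by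
  have h1 : TMD (fun q : (α × List δ) × γ => ∀ y ∈ q.1.2, E (q.1.1, q.2, y) ∧
      w (q.1.1, q.2, y) ≤ T q.1.1) (fun q : (α × List δ) × γ => q.1.2.map (h q.1.1 q.2))
      (fun q => q.1.2.length * (T q.1.1 + 1)) :=
    map (h := fun q : (α × List δ) × γ => h q.1.1 q.2) (comp hh
      (f := fun q : ((α × List δ) × γ) × δ => (q.1.1.1, q.1.2, q.2))
      TM.on₀ (fun q (hq : E _) => hq) .refl) TM.on₀
      (fun q => T q.1.1) (fun q hq y hy => hq y hy) .refl
  have h2 : TMD (fun q : α × List δ => D q.1 ∧ q.2 = m q.1)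
      (fun q : α × List δ => (l q.1).flatMap fun x => q.2.map (h q.1 x)) (fun q => u q.1) := by
    refine flatMap (h := fun q : α × List δ => fun x => q.2.map (h q.1 x)) h1
      (comp hl (f := fun q : α × List δ => q.1) TM.on₀ (fun q hq => hq.1) .refl)
      (fun q => q.2.length * (T q.1 + 1)) ?_ ?_
    · rintro ⟨a, M⟩ ⟨ha, hM⟩ x hx
      obtain rfl : M = m a := hM
      refine ⟨fun y hy => hT a ha x hx y hy, le_rfl, ?_⟩
      rw [length_map]
      exact Nat.le_mul_of_pos_right _ (by omega)
    · obtain ⟨C, hc⟩ := hc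
      refine ⟨C, ?_⟩
      rintro ⟨a, M⟩ ⟨ha, hM⟩
      obtain rfl : M = m a := hM
      exact hc a ha
  exact comp (f := fun a => (a, m a)) h2 (.prodMk TM.on₀ hm)
    (fun a ha => ⟨ha, rfl⟩) .refl

lemma zipWith {κ : Type} [Enc κ] {E : α × γ × δ → Prop} {l : α → List γ} {m : α → List δ}
    {h : α → γ → δ → κ} {w : α × γ × δ → ℕ}
    (hh : TMD E (fun p : α × γ × δ => h p.1 p.2.1 p.2.2) w) (hl : TMD D l u) (hm : TMD D m u)
    (T : α → ℕ) (hT : ∀ a, D a → ∀ x ∈ l a, ∀ y ∈ m a, E (a, x, y) ∧ w (a, x, y) ≤ T a)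
    (hc : DomOn D (fun a => (l a).length * (T a + 1)) u) :
    TMD D (fun a => zipWith (h a) (l a) (m a)) u := by
  have hz : TM (fun p : List γ × List δ => p.1.zip p.2) fun p => p.1.length := .zip fp fp .refl
  have := map (h := fun a x => h a x.1 x.2) (l := fun a => (l a).zip (m a)) hh
    (.comp (E := fun _ => True) hz.on' (.prodMk hl hm) (fun _ _ => trivial)
      (.trans (.of_le fun a _ => Nat.le_mul_of_pos_right _ (Nat.succ_pos _)) hc)) T
    (fun a ha x hx => hT a ha x.1 (of_mem_zip hx).1 x.2 (of_mem_zip hx).2)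
    (.trans (.of_le fun a _ => Nat.mul_le_mul_right _ (by simp)) hc)
  exact this.of_eq fun a => by rw [List.zip, map_zipWith]

end TMD

/-! ### Optional values -/

instance {α : Type} [Enc α] : Enc (Option α) :=
  ⟨fun o => o.elim (.num 0) fun a => .pair (.num 1) (enc a)⟩

lemma TM.optionSome {α β : Type} [Enc α] [Enc β] {f : α → β} {u : α → ℕ} (h : TM f u) :
    TM (fun a => some (f a)) u :=
  TM.transfer (f := fun a => ((1 : ℕ), f a)) fp id (fun _ => rfl) fun _ => rfl

/-! ### Expressions as data -/

/-- The record of a vertex: its label, its name, its colors and its weights. -/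
abbrev VertexData := ℕ × ℕ × List ℕ × List ℕ

/-- Expressions whose leaves carry the data of the vertices. -/
inductive DExpr
  | vertex (r : VertexData)
  | union (a b : DExpr)
  | op (c : Op) (a : DExpr)

namespace DExpr

def toVal : DExpr → Val
  | vertex r => .pair (.num 0) (enc r)
  | union a b => .pair (.num 1) (.pair a.toVal b.toVal)
  | op c a => .pair (enc c.1) (.pair (enc c.2) a.toVal)

instance : Enc DExpr := ⟨toVal⟩

def size : DExpr → ℕ
  | vertex _ => 1
  | union a b => a.size + b.size + 1
  | op _ a => a.size + 1

def Ok : DExpr → Prop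
  | vertex _ => True
  | union a b => a.Ok ∧ b.Ok
  | op c a => 2 ≤ c.1 ∧ a.Ok

def eval {β : Type} (L : VertexData → β) (B : β → β → β) (U : Op → β → β) : DExpr → β
  | vertex r => L r
  | union a b => B (a.eval L B U) (b.eval L B U)
  | op c a => U c (a.eval L B U)

end DExpr

namespace TMD

lemma iff_run {α β : Type} [Enc α] [Enc β] {D : α → Prop} {f : α → β} {u : α → ℕ} :
    TMD D f u ↔ ∃ (c : Code) (K : ℕ), ∀ a, ∃ s, (D a → s ≤ K * (u a + 1)) ∧
      ∀ μ, Run μ c (enc a) (enc (f a)) s := by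
  constructor
  · rintro ⟨v, ⟨c, K, h⟩, C, h'⟩
    refine ⟨c, K * (C + 1), fun a => ?_⟩
    obtain ⟨s, hs, hr⟩ := h a
    refine ⟨s, fun ha => hs.trans ?_, hr⟩
    rw [mul_assoc]
    have := h' a ha
    exact Nat.mul_le_mul_left _ (by nlinarith)
  · rintro ⟨c, K, h⟩
    choose s h1 h2 using h
    exact ⟨s, ⟨c, 1, fun a => ⟨s a, by omega, h2 a⟩⟩, K, h1⟩

lemma exprEval {α β : Type} [Enc α] [Enc β] {L : α → VertexData → β} {B : α → β → β → β}
    {U : α → Op → β → β} {EL : α × VertexData → Prop} {EB : α × β × β → Prop}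
    {EU : α × Op × β → Prop} {wL : α × VertexData → ℕ} {wB : α × β × β → ℕ}
    {wU : α × Op × β → ℕ} (hL : TMD EL (fun p : α × VertexData => L p.1 p.2) wL)
    (hB : TMD EB (fun p : α × β × β => B p.1 p.2.1 p.2.2) wB)
    (hU : TMD EU (fun p : α × Op × β => U p.1 p.2.1 p.2.2) wU)
    (D : α → DExpr → Prop) (T : α → ℕ)
    (h0 : ∀ a r, D a (.vertex r) → EL (a, r) ∧ wL (a, r) ≤ T a)
    (h1 : ∀ a e e', D a (.union e e') → D a e ∧ D a e' ∧
      EB (a, e.eval (L a) (B a) (U a), e'.eval (L a) (B a) (U a)) ∧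
      wB (a, e.eval (L a) (B a) (U a), e'.eval (L a) (B a) (U a)) ≤ T a)
    (h2 : ∀ a c e, D a (.op c e) → D a e ∧ EU (a, c, e.eval (L a) (B a) (U a)) ∧
      wU (a, c, e.eval (L a) (B a) (U a)) ≤ T a) :
    TMD (fun p : {p : α × DExpr // p.2.Ok} => D p.1.1 p.1.2)
      (fun p : {p : α × DExpr // p.2.Ok} => p.1.2.eval (L p.1.1) (B p.1.1) (U p.1.1))
      (fun p => p.1.2.size * (T p.1.1 + 1)) := by
  obtain ⟨cL, KL, hL⟩ := iff_run.1 hL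
  obtain ⟨cB, KB, hB⟩ := iff_run.1 hB
  obtain ⟨cU, KU, hU⟩ := iff_run.1 hU
  let p1 : Code := .prim .fst
  let p2 : Code := .prim .snd
  let tag : Code := .comp p1 p2
  let at2 : Code := .comp p1 (.comp p2 p2)
  let rec1 (c : Code) : Code := .comp .recur (.pair p1 (.comp c (.comp p2 p2)))
  let body : Code := .ite tag (.ite (.comp (.prim .le) (.pair tag (.prim (.const 1))))
      (.comp cB (.pair p1 (.pair (rec1 p1) (rec1 p2))))
      (.comp cU (.pair p1 (.pair (.pair tag at2) (rec1 p2)))))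
    (.comp cL (.pair p1 (.comp p2 p2)))
  have h₁ : ∀ {μ a b}, Run μ p1 (.pair a b) a 1 := .prim .fst _
  have h₂ : ∀ {μ a b}, Run μ p2 (.pair a b) b 1 := .prim .snd _
  have hrec : ∀ {c : Code} {a b d e r : Val} {t : ℕ}, Run body c d e 1 →
      Run body body (.pair a e) r t → Run body (rec1 c) (.pair a (.pair b d)) r (t + 9) :=
    fun {c a b d e r t} h h' => (by omega : 1 + (1 + 1 + 1 + 1 + 1) + 1 + (t + 1) + 1 = t + 9) ▸
      .comp (.pair h₁ (.comp (.comp h₂ h₂) h)) (.recur h')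
  have main : ∀ a (e : DExpr), e.Ok → ∃ s,
      (D a e → s ≤ (KL + KB + KU + 50) * (e.size * (T a + 1))) ∧
      Run body body (.pair (enc a) e.toVal) (enc (e.eval (L a) (B a) (U a))) s := by
    intro a e
    induction e with
    | vertex r =>
      obtain ⟨s, hs, hr⟩ := hL (a, r)
      refine fun _ => ⟨_, fun hD => ?_,
        .iteFalse (.comp h₂ h₁) (.comp (.pair h₁ (.comp h₂ h₂)) (hr _))⟩
      obtain ⟨i1, i2⟩ := h0 a r hD
      have := (hs i1).trans (Nat.mul_le_mul_left _ (Nat.add_le_add_right i2 1))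
      simp only [DExpr.size]
      nlinarith [Nat.zero_le (KB * T a), Nat.zero_le (KU * T a)]
    | union e e' ih ih' =>
      intro hok
      obtain ⟨s, hs, hr⟩ := ih hok.1
      obtain ⟨s', hs', hr'⟩ := ih' hok.2
      obtain ⟨t, ht, hr''⟩ := hB (a, e.eval (L a) (B a) (U a), e'.eval (L a) (B a) (U a))
      refine ⟨_, fun hD => ?_, .iteTrue (.comp h₂ h₁) (by simp) (.iteTrue
        (.comp (.pair (.comp h₂ h₁) (.prim (.const 1) _)) (.prim .le _)) (by simp [Prim.eval])
        (.comp (.pair h₁ (.pair (hrec h₁ hr) (hrec h₂ hr'))) (hr'' _)))⟩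
      obtain ⟨i1, i2, i3, i4⟩ := h1 a e e' hD
      have := (ht i3).trans (Nat.mul_le_mul_left _ (Nat.add_le_add_right i4 1))
      have := hs i1
      have := hs' i2
      simp only [DExpr.size]
      nlinarith [Nat.zero_le (KL * T a), Nat.zero_le (KU * T a)]
    | op c e ih =>
      intro hok
      obtain ⟨s, hs, hr⟩ := ih hok.2
      obtain ⟨t, ht, hr'⟩ := hU (a, c, e.eval (L a) (B a) (U a))
      have h := hok.1
      refine ⟨_, fun hD => ?_, .iteTrue (.comp h₂ h₁) (a := enc c.1) (by simp [enc]; omega)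
        (.iteFalse (s := 7) ?_ (.comp (.pair h₁ (.pair (.pair (.comp h₂ h₁)
          (.comp (.comp h₂ h₂) h₁)) (hrec h₂ hr))) (hr' _)))⟩
      · obtain ⟨i1, i3, i4⟩ := h2 a c e hD
        have := (ht i3).trans (Nat.mul_le_mul_left _ (Nat.add_le_add_right i4 1))
        have := hs i1
        simp only [DExpr.size]
        nlinarith [Nat.zero_le (KL * T a), Nat.zero_le (KB * T a)]
      · have : Run body _ (.pair (enc c.1) (.num 1)) (.num (if (c.1 : ℤ) ≤ 1 then 1 else 0)) 1 :=
          .prim .le _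
        rw [if_neg (show ¬ (c.1 : ℤ) ≤ 1 by omega)] at this
        exact .comp (.pair (.comp h₂ h₁) (.prim (.const 1) _)) this
  refine iff_run.2 ⟨.fix body, KL + KB + KU + 50, fun p => ?_⟩
  obtain ⟨s, hs, hr⟩ := main p.1.1 p.1.2 p.2
  exact ⟨s + 1, fun h => by nlinarith [hs h], fun μ => .fix hr⟩

end TMD

/-! ### Sets of vertices given by trees -/

/-- Trees whose leaves are vertices, with the indices of those sets that contain the vertex. -/
inductive Rope
  | leaf (v m : ℕ)
  | node (a b : Rope)

namespace Rope

def toVal : Rope → Val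
  | leaf v m => .pair (.num 0) (.pair (enc v) (enc m))
  | node a b => .pair (.num 1) (.pair a.toVal b.toVal)

instance : Enc Rope := ⟨toVal⟩

def size : Rope → ℕ
  | leaf _ _ => 1
  | node a b => a.size + b.size + 1

def leaves : Rope → List (ℕ × ℕ)
  | leaf v m => [(v, m)]
  | node a b => a.leaves ++ b.leaves

lemma length_leaves_le (r : Rope) : r.leaves.length ≤ r.size := by
  induction r with
  | leaf => exact le_rfl
  | node a b h h' => simp only [leaves, size, length_append]; omega

end Rope

namespace TM

variable {α : Type} [Enc α] {u : α → ℕ}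

@[fun_prop] lemma ropeLeaf {f g : α → ℕ} (hf : TM f u) (hg : TM g u) :
    TM (fun a => Rope.leaf (f a) (g a)) u :=
  TM.transfer (f := fun a => ((0 : ℕ), f a, g a)) fp id (fun _ => rfl) fun _ => rfl

@[fun_prop] lemma ropeNode {f g : α → Rope} (hf : TM f u) (hg : TM g u) :
    TM (fun a => Rope.node (f a) (g a)) u :=
  TM.transfer (f := fun a => ((1 : ℕ), f a, g a)) fp id (fun _ => rfl) fun _ => rfl

lemma ropeLeaves : TM Rope.leaves Rope.size := by
  let p1 : Code := .prim .fst
  let p2 : Code := .prim .snd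
  let body : Code := .ite (.comp p1 p1) (.comp .recur (.pair (.comp p1 (.comp p2 p1))
    (.comp .recur (.pair (.comp p2 (.comp p2 p1)) p2)))) (.pair (.comp p2 p1) p2)
  have h₁ : ∀ {μ a b}, Run μ p1 (.pair a b) a 1 := .prim .fst _
  have h₂ : ∀ {μ a b}, Run μ p2 (.pair a b) b 1 := .prim .snd _
  have main : ∀ (r : Rope) (l : List (ℕ × ℕ)), ∃ s, s ≤ 30 * r.size ∧
      Run body body (.pair r.toVal (enc l)) (enc (r.leaves ++ l)) s := by
    intro r
    induction r with
    | leaf v m => exact fun l => ⟨_, by simp [Rope.size],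
        .iteFalse (.comp h₁ h₁) (.pair (.comp h₁ h₂) h₂)⟩
    | node a b iha ihb =>
      intro l
      obtain ⟨s, hs, hr⟩ := ihb l
      obtain ⟨t, ht, hr'⟩ := iha (b.leaves ++ l)
      rw [← append_assoc] at hr'
      refine ⟨_, ?_, .iteTrue (.comp h₁ h₁) (by simp) (.comp (.pair (.comp (.comp h₁ h₂) h₁)
        (.comp (.pair (.comp (.comp h₁ h₂) h₂) h₂) (.recur hr))) (.recur hr'))⟩
      simp only [Rope.size]
      omega
  refine ⟨.comp (.fix body) (.pair (.prim .id) (.prim (.const 0))), 40, fun r => ?_⟩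
  obtain ⟨s, hs, hr⟩ := main r []
  rw [append_nil] at hr
  exact ⟨_, by omega, fun μ => .comp (.pair (.prim .id _) (.prim (.const 0) _)) (.fix hr)⟩

end TM

/-! ### Rounding and linear terms -/

/-- The largest member of a list that is at most `m` (or `0`). -/
def roundDown (R : List ℕ) (m : ℕ) : ℕ := R.foldl (fun r e => if e ≤ m ∧ r ≤ e then e else r) 0

/-- Rounding of small numbers; all large numbers are identified. -/
def roundCap (R : List ℕ) (M m : ℕ) : ℕ := if M ≤ m then M else roundDown R m

def dot {K : Type} [Semiring K] (c : List K) (w : List ℕ) : K :=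
  (zipWith (fun (a : K) (b : ℕ) => a * (b : K)) c w).foldl (· + ·) 0

/-- The linear part of a term, for a single vertex of weights `w` in the sets given by `m`. -/
def linMask {K : Type} [Semiring K] (cs : List (List K)) (w : List ℕ) (m : ℕ) : K :=
  (cs.foldl (fun (s : K × ℕ) c => (s.1 + (if s.2 % 2 = 1 then dot c w else 0), s.2 / 2)) (0, m)).1

namespace TM

attribute [fun_prop] TM.optionSome

lemma roundDown : TM (fun a : List ℕ × ℕ => roundDown a.1 a.2) (fun a => a.1.length) :=
  foldl₁ (l := fun a : List ℕ × ℕ => a.1) (s₀ := fun _ => 0)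
    (g := fun a r e => if e ≤ a.2 ∧ r ≤ e then e else r)
    fp fp fp .refl

lemma roundCap : TM (fun a : List ℕ × ℕ × ℕ => roundCap a.1 a.2.1 a.2.2) (fun a => a.1.length) :=
  .ite fp fp (roundDown.app fun a : List ℕ × ℕ × ℕ => (a.1, a.2.2))

variable {K : Type} [Semiring K] [Enc K]

lemma dot (hadd : TM (fun a : K × K => a.1 + a.2) fun _ => 0)
    (hmul : TM (fun a : K × ℕ => a.1 * (a.2 : K)) fun _ => 0) :
    TM (fun a : List K × List ℕ => ApproxMSO.dot a.1 a.2) (fun a => a.1.length) := by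
  unfold ApproxMSO.dot
  refine foldl₁ (u := fun a : List K × List ℕ => a.1.length) (l := fun a : List K × List ℕ => List.zipWith (fun (x : K) (y : ℕ) => x * (y : K)) a.1 a.2)
    (g := fun _ s x => s + x) (s₀ := fun _ => 0) (hadd.comp fp) ?_ fp
      (.of_le fun a => by simp)
  exact zipWith (h := fun (x : K) (y : ℕ) => x * (y : K)) hmul

end TM

/-- All members of a list of lists have length at most `b`. -/
def ListsLe {K : Type} (cs : List (List K)) (b : ℕ) : Prop := ∀ c ∈ cs, c.length ≤ b

lemma TMD.linMask {K : Type} [Semiring K] [Enc K] (hadd : TM (fun a : K × K => a.1 + a.2) fun _ => 0)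
    (hmul : TM (fun a : K × ℕ => a.1 * (a.2 : K)) fun _ => 0) {α : Type} [Enc α] {D : α → Prop}
    {cs : α → List (List K)} {w : α → List ℕ} {m : α → ℕ} {u : α → ℕ} (hcs : TM cs fun _ => 0)
    (hw : TM w fun _ => 0) (hm : TM m fun _ => 0) (b : α → ℕ)
    (hD : ∀ a, D a → ListsLe (cs a) (b a)) (hu : DomOn D (fun a => (cs a).length * (b a + 1)) u) :
    TMD D (fun a => linMask (cs a) (w a) (m a)) u := by
  refine .comp₀ (g := fun s : K × ℕ => s.1) fp ?_
  have hdot : TM (fun p : α × (K × ℕ) × List K =>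
      if p.2.1.2 % 2 = 1 then dot p.2.2 (w p.1) else 0) (fun p => p.2.2.length) :=
    .ite fp ((TM.dot hadd hmul).comp'
      (f := fun p : α × (K × ℕ) × List K => (p.2.2, w p.1))
      (.prodMk fp (.mono (hw.comp fp) .zero)) .refl) fp
  refine TMD.foldl (E := fun _ => True) (w := fun p => p.2.2.length)
    (g := fun a (s : K × ℕ) c => (s.1 + (if s.2 % 2 = 1 then dot c (w a) else 0), s.2 / 2))
    (TM.on' (.prodMk ?_ fp)) (TM.on₀ hcs)
    (TM.on₀ (.prodMk fp hm)) (fun _ _ => True) b (fun _ _ => trivial)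
    (fun a ha s c hc _ => ⟨trivial, trivial, hD a ha c hc⟩) hu
  exact hadd.comp (.prodMk fp hdot)

lemma TMD.linMaskNat {α : Type} [Enc α] {D : α → Prop} {cs : α → List (List ℕ)} {w : α → List ℕ}
    {m : α → ℕ} {u : α → ℕ} (hcs : TM cs fun _ => 0) (hw : TM w fun _ => 0) (hm : TM m fun _ => 0)
    (b : α → ℕ) (hD : ∀ a, D a → ListsLe (cs a) (b a))
    (hu : DomOn D (fun a => (cs a).length * (b a + 1)) u) :
    TMD D (fun a => ApproxMSO.linMask (cs a) (w a) (m a)) u :=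
  TMD.linMask fp (by simpa only [Nat.cast_id] using
    (fp : TM (fun a : ℕ × ℕ => a.1 * a.2) fun _ => 0)) hcs hw hm b hD hu

lemma TMD.linMaskInt {α : Type} [Enc α] {D : α → Prop} {cs : α → List (List ℤ)} {w : α → List ℕ}
    {m : α → ℕ} {u : α → ℕ} (hcs : TM cs fun _ => 0) (hw : TM w fun _ => 0) (hm : TM m fun _ => 0)
    (b : α → ℕ) (hD : ∀ a, D a → ListsLe (cs a) (b a))
    (hu : DomOn D (fun a => (cs a).length * (b a + 1)) u) :
    TMD D (fun a => ApproxMSO.linMask (cs a) (w a) (m a)) u :=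
  TMD.linMask fp fp hcs hw hm b hD hu

/-! ### Bounds for the effective functions on types -/

lemma pair_le_pair {a b c d : ℕ} (h : a ≤ c) (h' : b ≤ d) : Nat.pair a b ≤ Nat.pair c d := by
  rcases h.eq_or_lt with rfl | h <;> rcases h'.eq_or_lt with rfl | h'
  exacts [le_rfl, (Nat.pair_lt_pair_right _ h').le, (Nat.pair_lt_pair_left _ h).le,
    ((Nat.pair_lt_pair_left _ h).trans (Nat.pair_lt_pair_right _ h')).le]

lemma encode_prod_le {α β : Type} [Encodable α] [Encodable β] {a a' : α} {b b' : β}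
    (h : encode a ≤ encode a') (h' : encode b ≤ encode b') :
    encode (a, b) ≤ encode (a', b') := by
  rw [Encodable.encode_prod_val, Encodable.encode_prod_val]
  exact pair_le_pair h h'

lemma listBound_mono {B n m : ℕ} (h : n ≤ m) : listBound B n ≤ listBound B m := by
  refine monotone_nat_of_le_succ (f := listBound B) (fun n => ?_) h
  exact (Nat.right_le_pair B (listBound B n)).trans (Nat.le_succ _)

lemma comb_lt (p : Params) (c : Op) (j A B : ℕ) : comb p c j A B < tyBound p j := by
  induction j generalizing A B with
  | zero =>
    have h := encode_lt_listBound (B := p.1.factorial + 2)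
      (matrixList p (combData p c (decodeList A) (decodeList B))) (by
        simp only [matrixList, mem_map]
        rintro _ ⟨_, _, rfl⟩
        exact nrm_lt)
    have hlen : (matrixList p (combData p c (decodeList A) (decodeList B))).length =
        p.npos * p.width := by simp [matrixList]
    rwa [hlen] at h
  | succ j ih =>
    refine setCode_lt fun i hi => ?_
    obtain ⟨_, _, hi⟩ := mem_flatMap.1 hi
    obtain ⟨_, _, rfl⟩ := mem_map.1 hi
    exact ih _ _

lemma leafType_lt {p : Params} {lab : ℕ} (hl : lab ≤ p.2.1) (colors m : ℕ) :
    leafType p lab colors m < tyBound p p.2.2.1 := by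
  have h := LGraph.ty_single (n := 1) (p := p) (v := 0) (lab := lab) (colors := colors)
    (col := fun t => if bit colors t = 1 then {0} else ∅) hl (fun t _ => by
      have := bit_lt_two colors t
      by_cases h : bit colors t = 1
      · simp [h]
      · simp [h]; omega) (m := m)
    (Z := fun i => if bit m (i - p.2.2.1) = 1 then {0} else ∅) (by simp)
  rw [← h]
  exact LGraph.ty_lt _ _ _ _ _

def CombDom (a : (Params × Op) × ℕ × ℕ) : Prop :=
  (a.1.2.1 ≤ 3 ∧ a.1.2.2.1 ≤ a.1.1.2.1 ∧ a.1.2.2.2 ≤ a.1.1.2.1) ∧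
    a.2.1 < tyBound a.1.1 a.1.1.2.2.1 ∧ a.2.2 < tyBound a.1.1 a.1.1.2.2.1

lemma TM.encodeProd₀ {α β : Type} [Enc α] [Enc β] [Encodable α] [Encodable β]
    (hv : TM (encode : α → ℕ) fun _ => 0) (hw : TM (encode : β → ℕ) fun _ => 0) :
    TM (encode : α × β → ℕ) fun _ => 0 :=
  (TM.encodeProd hv hw).mono_le fun _ => le_rfl

lemma TM.encodeParams : TM (encode : Params → ℕ) fun _ => 0 :=
  .encodeProd₀ .encodeNat (.encodeProd₀ .encodeNat (.encodeProd₀ .encodeNat .encodeNat))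

lemma exists_of_encode_le {α : Type} [Primcodable α] [Enc α] {v : α → ℕ}
    (hv : TM (encode : α → ℕ) v) {f : α → ℕ} (hf : Primrec f) (p : α → Params)
    (D : α → Prop) (e : Params → ℕ) (he : Primrec e)
    (hD : ∀ a, D a → encode a ≤ e (p a) ∧ v a ≤ e (p a)) :
    ∃ g : Params → ℕ, Primrec g ∧ TMD D f (fun a => g (p a)) ∧ ∀ a, D a → f a ≤ g (p a) := by
  obtain ⟨t, h1, h2, h3⟩ := TM.exists_of_primrec hv hf
  obtain ⟨t', h4, h5⟩ : ∃ t' : ℕ → ℕ, Primrec t' ∧ ∀ a, f a ≤ t' (encode a) := by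
    refine ⟨fun n => ((Encodable.decode (α := α) n).map f).getD 0, ?_, fun a => by simp⟩
    exact Primrec.option_getD.comp (Primrec.option_map Primrec.decode
      (hf.comp Primrec.snd).to₂) (Primrec.const 0)
  refine ⟨fun q => t (e q) + e q + TM.sumUpTo t' (e q), ?_, h3.on (.of_le fun a ha => ?_),
    fun a ha => ?_⟩
  · exact Primrec.nat_add.comp (Primrec.nat_add.comp (h1.comp he) he)
      ((TM.primrec_sumUpTo h4).comp he)
  · obtain ⟨i1, i2⟩ := hD a ha
    have := h2 i1
    dsimp only
    omega
  · have := (h5 a).trans ((TM.le_sumUpTo t' _).trans (TM.monotone_sumUpTo t' (hD a ha).1))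
    dsimp only
    omega

lemma exists_comb : ∃ g : Params → ℕ, Primrec g ∧
    TMD CombDom (fun a : (Params × Op) × ℕ × ℕ =>
      comb a.1.1 a.1.2 a.1.1.2.2.1 a.2.1 a.2.2) (fun a => g a.1.1) := by
  have hp : Primrec fun a : (Params × Op) × ℕ × ℕ =>
      comb a.1.1 a.1.2 a.1.1.2.2.1 a.2.1 a.2.2 :=
    PR.comb.comp (g := fun a : (Params × Op) × ℕ × ℕ => (a.1.1.2.2.1, a)) fp
  obtain ⟨g, h1, h2, -⟩ := exists_of_encode_le (.encodeProd₀ (.encodeProd₀ .encodeParams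
    (.encodeProd₀ .encodeNat (.encodeProd₀ .encodeNat .encodeNat)))
    (.encodeProd₀ .encodeNat .encodeNat)) hp (fun a => a.1.1) CombDom
    (fun p => encode ((p, ((3, p.2.1, p.2.1) : Op)),
      (tyBound p p.2.2.1, tyBound p p.2.2.1))) fp (fun a ha => by
    obtain ⟨⟨p, c1, c2, c3⟩, A, B⟩ := a
    obtain ⟨⟨i1, i2, i3⟩, i4, i5⟩ := ha
    exact ⟨encode_prod_le (encode_prod_le le_rfl (encode_prod_le i1 (encode_prod_le i2 i3)))
      (encode_prod_le i4.le i5.le), Nat.zero_le _⟩)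
  exact ⟨g, h1, h2⟩

lemma exists_leafType : ∃ g : Params → ℕ, Primrec g ∧
    TMD (fun a : Params × ℕ × ℕ × ℕ => a.2.1 ≤ a.1.2.1 ∧ a.2.2.1 < 2 ^ a.1.1 ∧
        a.2.2.2 < 2 ^ a.1.2.2.2)
      (fun a => leafType a.1 a.2.1 a.2.2.1 a.2.2.2) (fun a => g a.1) := by
  obtain ⟨g, h1, h2, -⟩ := exists_of_encode_le (.encodeProd₀ .encodeParams
    (.encodeProd₀ .encodeNat (.encodeProd₀ .encodeNat .encodeNat))) PR.leafType (fun a => a.1)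
    (fun a => a.2.1 ≤ a.1.2.1 ∧ a.2.2.1 < 2 ^ a.1.1 ∧ a.2.2.2 < 2 ^ a.1.2.2.2)
    (fun p => encode (p, (p.2.1, 2 ^ p.1, 2 ^ p.2.2.2))) fp (fun a ha => by
    obtain ⟨p, lab, c, m⟩ := a
    obtain ⟨i1, i2, i3⟩ := ha
    exact ⟨encode_prod_le le_rfl (encode_prod_le i1 (encode_prod_le i2.le i3.le)), Nat.zero_le _⟩)
  exact ⟨g, h1, h2⟩

/-- Codes of signatures of size at most `s`. -/
def RelsOk (s : ℕ) (rl : List ℕ) : Prop := rl.length ≤ s ∧ ∀ r ∈ rl, r < Nat.pair s s + 3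

lemma RelsOk.encode_le {s : ℕ} {rl : List ℕ} (h : RelsOk s rl) :
    encode rl ≤ listBound (Nat.pair s s + 3) s :=
  (encode_lt_listBound _ h.2).le.trans (listBound_mono h.1)

/-- A bound on the codes of signatures, types and parameters. -/
def relsBound (p : Params) : ℕ :=
  Nat.pair (Nat.pair (encode p) (listBound (Nat.pair p.1 p.1 + 3) p.1))
    (tyBound p p.2.2.1) + p.1

lemma primrec_relsBound : Primrec relsBound := by
  unfold relsBound listBound
  fun_prop

lemma RelsOk.bound {p : Params} {rl : List ℕ} (h : RelsOk p.1 rl) {A : ℕ}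
    (hA : A ≤ tyBound p p.2.2.1) : encode ((p, rl), A) ≤ relsBound p ∧
      rl.length ≤ relsBound p := by
  rw [Encodable.encode_prod_val, Encodable.encode_prod_val]
  exact ⟨(pair_le_pair (pair_le_pair le_rfl h.encode_le) hA).trans (Nat.le_add_right _ _),
    h.1.trans (Nat.le_add_left _ _)⟩

lemma TM.encodeRels : TM (encode : (Params × List ℕ) × ℕ → ℕ)
    (fun a => a.1.2.length) :=
  (TM.encodeProd (TM.encodeProd .encodeParams (.encodeList .encodeNat)) .encodeNat).mono_le
    fun a => by simp

lemma exists_numFormulas : ∃ g : Params → ℕ, Primrec g ∧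
    TMD (fun a : Params × List ℕ => RelsOk a.1.1 a.2)
      (fun a => numFormulas a.1 a.2) (fun a => g a.1) ∧
    ∀ p rl, RelsOk p.1 rl → numFormulas p rl ≤ g p := by
  obtain ⟨g, h1, h2, h3⟩ := exists_of_encode_le .encodeRels
    (PR.numFormulas.comp (Primrec.fst (α := Params × List ℕ) (β := ℕ))) (fun a => a.1.1)
    (fun a => RelsOk a.1.1.1 a.1.2 ∧ a.2 = 0) relsBound primrec_relsBound (fun a ha => by
      obtain ⟨⟨p, rl⟩, A⟩ := a
      obtain ⟨i1, rfl⟩ := ha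
      exact i1.bound (Nat.zero_le _))
  refine ⟨g, h1, TMD.comp (f := fun a : Params × List ℕ => (a, 0)) h2 TM.on₀
    (fun a ha => ⟨ha, rfl⟩) .refl, fun p rl h => h3 ((p, rl), 0) ⟨h, rfl⟩⟩

def boolsCode (L : List Bool) : ℕ := setCode ((range L.length).filter fun i => L.getD i false)

lemma primrec_boolsCode : Primrec boolsCode := by
  unfold boolsCode
  fun_prop

lemma boolsCode_spec (L : List Bool) :
    (range L.length).map (fun i => decide (bit (boolsCode L) i = 1)) = L := by
  refine ext_getElem (by simp) fun t h1 h2 => ?_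
  rw [getElem_map, getElem_range, Bool.eq_iff_iff, decide_eq_true_iff, bit_eq_one,
    boolsCode, testBit_setCode]
  simp [h2, getD_eq_getElem?_getD]

lemma TM.bit : TM (fun a : ℕ × ℕ => bit a.1 a.2) (fun a => a.2) := by
  have : TM (fun a : ℕ × ℕ => 2 ^ a.2) (fun a => a.2) :=
    TM.natPow fp fp .refl
  unfold ApproxMSO.bit
  fun_prop

lemma exists_bits : ∃ g : Params → ℕ, Primrec g ∧
    TMD (fun a : (Params × List ℕ) × ℕ => RelsOk a.1.1.1 a.1.2 ∧
        a.2 < tyBound a.1.1 a.1.1.2.2.1)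
      (fun a => bits a.1.1 a.1.2 a.2) (fun a => g a.1.1) ∧
    ∀ p rl A, RelsOk p.1 rl → A < tyBound p p.2.2.1 → (bits p rl A).length ≤ g p := by
  have hD : ∀ a : (Params × List ℕ) × ℕ, (RelsOk a.1.1.1 a.1.2 ∧ a.2 < tyBound a.1.1 a.1.1.2.2.1) →
      encode a ≤ relsBound a.1.1 ∧ a.1.2.length ≤ relsBound a.1.1 :=
    fun a ha => ha.1.bound ha.2.le
  obtain ⟨g, h1, h2, h3⟩ := exists_of_encode_le .encodeRels (Primrec.list_length.comp PR.bits)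
    (fun a => a.1.1) _ relsBound primrec_relsBound hD
  obtain ⟨g', h4, h5, -⟩ := exists_of_encode_le .encodeRels (primrec_boolsCode.comp PR.bits)
    (fun a => a.1.1) _ relsBound primrec_relsBound hD
  refine ⟨fun p => g p * (g p + 1) + g p + g' p, fp, ?_, fun p rl A h h' =>
    (h3 ((p, rl), A) ⟨h, h'⟩).trans (by nlinarith)⟩
  have h6 := TMD.map (γ := ℕ) (D := fun q : (Params × ℕ) × ℕ => q.1.2 ≤ g q.1.1)
    (l := fun q => range q.1.2) (E := fun _ => True) (w := fun q => q.2)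
    (u := fun q => g q.1.1 * (g q.1.1 + 1))
    (h := fun (q : (Params × ℕ) × ℕ) (i : ℕ) => decide (ApproxMSO.bit q.2 i = 1))
    (TM.on' (TM.natEq (TM.bit.app fun q : ((Params × ℕ) × ℕ) × ℕ => (q.1.2, q.2)) fp))
    (TM.on (TM.range (u := fun q => q.1.2) fp .refl) (.of_le fun q hq => by nlinarith))
    (fun q => g q.1.1) (fun q hq i hi => ⟨trivial, (mem_range.1 hi).le.trans hq⟩)
    (.of_le fun q hq => by
      rw [length_range]
      exact Nat.mul_le_mul_right _ hq)
  have h7 := h6.comp (D := fun a : (Params × List ℕ) × ℕ => RelsOk a.1.1.1 a.1.2 ∧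
      a.2 < tyBound a.1.1 a.1.1.2.2.1)
    (f := fun a => ((a.1.1, (bits a.1.1 a.1.2 a.2).length), boolsCode (bits a.1.1 a.1.2 a.2)))
    (u := fun a => g a.1.1 * (g a.1.1 + 1) + g a.1.1 + g' a.1.1)
    (.prodMk (.prodMk TM.on₀ (h2.mono (.of_le fun a _ => by omega)))
      (h5.mono (.of_le fun a _ => by omega))) (fun a ha => h3 a ha) (.of_le fun a _ => by dsimp only; omega)
  exact h7.of_eq fun a => boolsCode_spec _

/-! ### The dynamic program -/

/-- For each term of the second family a lower and an upper value. -/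
abbrev Vec := List (ℕ × ℕ)

/-- Types together with the values realized by tuples of that type. -/
abbrev Assoc := List (ℕ × Vec)

/-- The values of the terms of the first family, and the types and values of the extensions. -/
abbrev State := List ℕ × Assoc

/-- The code of a state, the state, the value of the target, and a tuple of sets. -/
abbrev Entry := ℕ × State × ℤ × Rope

abbrev Table := List Entry

/-- The global data of the dynamic program. -/
structure Env where
  par : Params
  grid : List ℕ
  cap : ℕ
  terms₁ : List (List (List ℕ))
  terms₂ : List (List (List ℕ))
  target : List (List ℤ)
  numX : ℕ
  colors : List ℕ

namespace Env

def toProd (E : Env) : Params × List ℕ × ℕ × List (List (List ℕ)) × List (List (List ℕ)) ×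
    List (List ℤ) × ℕ × List ℕ :=
  (E.par, E.grid, E.cap, E.terms₁, E.terms₂, E.target, E.numX, E.colors)

instance : Enc Env := ⟨fun E => enc E.toProd⟩

def tb (E : Env) : ℕ := tyBound E.par E.par.2.2.1

end Env

namespace TM

variable {α : Type} [Enc α] {f : α → Env} {u : α → ℕ}

lemma envProd (h : TM f u) : TM (fun a => (f a).toProd) u := h.transfer id (fun _ => rfl) fun _ => rfl

@[fun_prop] lemma envPar (h : TM f u) : TM (fun a => (f a).par) u := h.envProd.fst
@[fun_prop] lemma envGrid (h : TM f u) : TM (fun a => (f a).grid) u := h.envProd.snd.fst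
@[fun_prop] lemma envCap (h : TM f u) : TM (fun a => (f a).cap) u := h.envProd.snd.snd.fst
@[fun_prop] lemma envTerms₁ (h : TM f u) : TM (fun a => (f a).terms₁) u :=
  h.envProd.snd.snd.snd.fst
@[fun_prop] lemma envTerms₂ (h : TM f u) : TM (fun a => (f a).terms₂) u :=
  h.envProd.snd.snd.snd.snd.fst
@[fun_prop] lemma envTarget (h : TM f u) : TM (fun a => (f a).target) u :=
  h.envProd.snd.snd.snd.snd.snd.fst
@[fun_prop] lemma envNumX (h : TM f u) : TM (fun a => (f a).numX) u :=
  h.envProd.snd.snd.snd.snd.snd.snd.fst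
@[fun_prop] lemma envColors (h : TM f u) : TM (fun a => (f a).colors) u :=
  h.envProd.snd.snd.snd.snd.snd.snd.snd

end TM

def mergeVec (v v' : Vec) : Vec :=
  zipWith (fun a b : ℕ × ℕ => (min a.1 b.1, max a.2 b.2)) v v'

def addVec (E : Env) (v v' : Vec) : Vec :=
  zipWith (fun a b : ℕ × ℕ =>
    (roundCap E.grid E.cap (a.1 + b.1), roundCap E.grid E.cap (a.2 + b.2))) v v'

def insTy (A : Assoc) (i : ℕ × Vec) : Assoc :=
  if (A.all fun e => !decide (e.1 = i.1)) = true then i :: A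
  else A.map fun e => if e.1 = i.1 then (i.1, mergeVec i.2 e.2) else e

def assocOf (L : List (ℕ × Vec)) : Assoc := L.foldl insTy []

abbrev combPair (E : Env) (c : Op) (e e' : ℕ × Vec) : ℕ × Vec :=
  (comb E.par c E.par.2.2.1 e.1 e'.1, addVec E e.2 e'.2)

def combAssoc (E : Env) (c : Op) (A B : Assoc) : Assoc := assocOf (pairsWith (combPair E c) A B)

def combState (E : Env) (c : Op) (s s' : State) : State :=
  (zipWith (fun a b => roundCap E.grid E.cap (a + b)) s.1 s'.1, combAssoc E c s.2 s'.2)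

def mkEntry (s : State) (z : ℤ) (r : Rope) : Entry := (encode s, s, z, r)

/-- Insertion of an entry; of two entries with the same state the better one is kept. -/
def insEntry (T : Table) (e : Entry) : Table :=
  if (T.all fun e' => !decide (e'.1 = e.1)) = true then e :: T
  else T.map fun e' => if e'.1 = e.1 ∧ e'.2.2.1 < e.2.2.1 then e else e'

def combTable (E : Env) (c : Op) (S S' : Table) : Table :=
  ((pairsWith (fun e e' : Entry => mkEntry (combState E c e.2.1 e'.2.1) (e.2.2.1 + e'.2.2.1)
    (Rope.node e.2.2.2 e'.2.2.2)) S S').filter fun e =>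
      e.2.1.1.all fun a => decide (a < E.cap)).foldl insEntry []

/-- The table of the empty graph, without information on types. -/
def trivialTable (E : Env) : Table :=
  [mkEntry (E.terms₁.map fun _ => 0, [(0, E.terms₂.map fun _ => (0, 0))]) 0 (Rope.leaf 0 0)]

def colorMask (cl colors : List ℕ) : ℕ :=
  cl.foldr (fun c s => 2 * s + if (colors.all fun d => !decide (d + 1 = c)) = true then 0 else 1) 0

abbrev leafMasks (E : Env) (m : ℕ) : List ℕ :=
  (range (2 ^ E.par.2.2.2)).filter fun m' => decide (m' % 2 ^ E.numX = m)

abbrev leafPair (E : Env) (r : VertexData) (m : ℕ) : ℕ × Vec :=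
  (leafType E.par r.1 (colorMask E.colors r.2.2.1) m, E.terms₂.map fun cs =>
    (linMask cs r.2.2.2 m, linMask cs r.2.2.2 m))

def leafAssoc (E : Env) (r : VertexData) (m : ℕ) : Assoc :=
  assocOf ((leafMasks E m).map (leafPair E r))

def leafTable (E : Env) (r : VertexData) : Table :=
  (range (2 ^ E.numX)).map fun m => mkEntry
    (E.terms₁.map fun cs => linMask cs r.2.2.2 m, leafAssoc E r m) (linMask E.target r.2.2.2 m)
    (Rope.leaf r.2.1 m)

def treeTable (E : Env) (e : DExpr) : Table :=
  e.eval (leafTable E) (combTable E (1, 0, 0)) (fun c S => combTable E c S (trivialTable E))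

/-! ### Validity and size of tables -/

section Valid

structure AssocOk (E : Env) (A : Assoc) : Prop where
  nodup : (A.map Prod.fst).Nodup
  lt : ∀ e ∈ A, e.1 < E.tb
  len : ∀ e ∈ A, e.2.length = E.terms₂.length

lemma AssocOk.length_le {E : Env} {A : Assoc} (h : AssocOk E A) : A.length ≤ E.tb := by
  have := (subperm_of_subset h.nodup (l₂ := range E.tb) (by
    intro i hi
    obtain ⟨e, he, rfl⟩ := mem_map.1 hi
    exact mem_range.2 (h.lt e he))).length_le
  simpa using this

structure StateOk (E : Env) (s : State) : Prop where
  len : s.1.length = E.terms₁.length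
  assoc : AssocOk E s.2

lemma mem_insTy {A : Assoc} {i e : ℕ × Vec} (h : e ∈ insTy A i) :
    e = i ∨ e ∈ A ∨ ∃ e' ∈ A, e'.1 = i.1 ∧ e = (i.1, mergeVec i.2 e'.2) := by
  unfold insTy at h
  split_ifs at h
  · exact (mem_cons.1 h).imp_right Or.inl
  · obtain ⟨e', he', rfl⟩ := mem_map.1 h
    split_ifs with h2
    · exact Or.inr (Or.inr ⟨e', he', h2, rfl⟩)
    · exact Or.inr (Or.inl he')

lemma all_ne_iff {γ : Type} (f : γ → ℕ) (A : List γ) (i : ℕ) :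
    (A.all fun e => !decide (f e = i)) = true ↔ i ∉ A.map f := by
  rw [all_eq_true, mem_map]
  constructor
  · rintro h ⟨e, he, rfl⟩
    simpa using h e he
  · intro h e he
    simpa using fun h1 => h ⟨e, he, h1⟩

lemma map_fst_insTy (A : Assoc) (i : ℕ × Vec) : (insTy A i).map Prod.fst =
    if i.1 ∈ A.map Prod.fst then A.map Prod.fst else i.1 :: A.map Prod.fst := by
  have h : (A.all fun e => !decide (e.1 = i.1)) = true ↔ i.1 ∉ A.map Prod.fst :=
    all_ne_iff Prod.fst A i.1
  unfold insTy
  by_cases hm : i.1 ∈ A.map Prod.fst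
  · rw [if_neg (by rw [h]; simpa using hm), if_pos hm, map_map]
    refine map_congr_left fun e _ => ?_
    simp only [Function.comp_apply]
    split_ifs with h2
    · exact h2.symm
    · rfl
  · rw [if_pos (h.2 hm), if_neg hm, map_cons]

lemma AssocOk.insTy {E : Env} {A : Assoc} (hA : AssocOk E A) {i : ℕ × Vec} (hi : i.1 < E.tb)
    (hl : i.2.length = E.terms₂.length) : AssocOk E (insTy A i) where
  nodup := by
    rw [map_fst_insTy]
    split_ifs with h
    · exact hA.nodup
    · exact nodup_cons.2 ⟨h, hA.nodup⟩
  lt e he := by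
    rcases mem_insTy he with rfl | h | ⟨e', he', h1, rfl⟩
    · exact hi
    · exact hA.lt e h
    · exact hi
  len e he := by
    rcases mem_insTy he with rfl | h | ⟨e', he', h1, rfl⟩
    · exact hl
    · exact hA.len e h
    · simp [mergeVec, hl, hA.len e' he']

lemma assocOk_nil (E : Env) : AssocOk E [] := ⟨by simp, by simp, by simp⟩

lemma assocOk_assocOf {E : Env} {L : List (ℕ × Vec)}
    (h : ∀ i ∈ L, i.1 < E.tb ∧ i.2.length = E.terms₂.length) : AssocOk E (assocOf L) := by
  suffices ∀ A, AssocOk E A → AssocOk E (L.foldl insTy A) from this [] (assocOk_nil E)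
  induction L with
  | nil => exact fun A hA => hA
  | cons i L ih =>
    exact fun A hA => ih (fun j hj => h j (by simp [hj])) _
      (hA.insTy (h i (by simp)).1 (h i (by simp)).2)

lemma mem_pairsWith {γ δ κ : Type} {h : γ → δ → κ} {l : List γ} {m : List δ} {z : κ} :
    z ∈ pairsWith h l m ↔ ∃ x ∈ l, ∃ y ∈ m, h x y = z := by
  simp [pairsWith]

lemma assocOk_combAssoc {E : Env} {c : Op} {A B : Assoc} (hA : AssocOk E A)
    (hB : AssocOk E B) : AssocOk E (combAssoc E c A B) := by
  refine assocOk_assocOf fun i hi => ?_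
  obtain ⟨e, he, e', he', rfl⟩ := mem_pairsWith.1 hi
  exact ⟨comb_lt _ _ _ _ _, by simp [addVec, hA.len e he, hB.len e' he']⟩

lemma StateOk.combState {E : Env} {c : Op} {s s' : State} (h : StateOk E s)
    (h' : StateOk E s') : StateOk E (combState E c s s') :=
  ⟨by simp [ApproxMSO.combState, h.len, h'.len], assocOk_combAssoc h.assoc h'.assoc⟩

lemma stateOk_leaf {E : Env} {r : VertexData} (hr : r.1 ≤ E.par.2.1) (m : ℕ) :
    StateOk E (E.terms₁.map fun cs => linMask cs r.2.2.2 m, leafAssoc E r m) := by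
  refine ⟨by simp, assocOk_assocOf fun i hi => ?_⟩
  obtain ⟨m', _, rfl⟩ := mem_map.1 hi
  exact ⟨leafType_lt hr _ _, by simp⟩

def tuples {γ : Type} (P : List γ) (k : ℕ) : List (List γ) :=
  (range k).foldl (fun T _ => pairsWith (fun a l => a :: l) P T) [[]]

lemma tuples_succ {γ : Type} (P : List γ) (k : ℕ) :
    tuples P (k + 1) = pairsWith (fun a l => a :: l) P (tuples P k) := by
  rw [tuples, range_succ, foldl_append]
  rfl

lemma length_tuples {γ : Type} (P : List γ) (k : ℕ) : (tuples P k).length = P.length ^ k := by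
  induction k with
  | zero => rfl
  | succ k ih => rw [tuples_succ, length_pairsWith, ih, pow_succ']

lemma mem_tuples {γ : Type} {P : List γ} {k : ℕ} {l : List γ} :
    l ∈ tuples P k ↔ l.length = k ∧ ∀ a ∈ l, a ∈ P := by
  induction k generalizing l with
  | zero =>
    simp only [tuples, range_zero, foldl_nil, mem_singleton, length_eq_zero_iff]
    constructor
    · rintro rfl; simp
    · exact fun h => h.1
  | succ k ih =>
    rw [tuples_succ, mem_pairsWith]
    constructor
    · rintro ⟨a, ha, l, hl, rfl⟩
      obtain ⟨h1, h2⟩ := ih.1 hl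
      exact ⟨by simp [h1], by simpa [ha] using h2⟩
    · rintro ⟨h1, h2⟩
      cases l with
      | nil => simp at h1
      | cons a l => exact ⟨a, h2 a (by simp), l, ih.2 ⟨by simpa using h1,
          fun b hb => h2 b (by simp [hb])⟩, rfl⟩

lemma nodup_pairsWith {γ δ κ : Type} {h : γ → δ → κ} {l : List γ} {m : List δ}
    (hh : ∀ a b a' b', h a b = h a' b' → a = a' ∧ b = b') (hl : l.Nodup) (hm : m.Nodup) :
    (pairsWith h l m).Nodup := by
  rw [pairsWith, nodup_flatMap]
  refine ⟨fun a _ => hm.map fun b b' hb => (hh _ _ _ _ hb).2, hl.imp fun {a b} hab => ?_⟩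
  intro x hx hx'
  obtain ⟨c, _, rfl⟩ := mem_map.1 hx
  obtain ⟨d, _, hd⟩ := mem_map.1 hx'
  exact hab (hh _ _ _ _ hd).1.symm

lemma nodup_tuples {γ : Type} {P : List γ} (hP : P.Nodup) (k : ℕ) : (tuples P k).Nodup := by
  induction k with
  | zero => simp [tuples]
  | succ k ih =>
    rw [tuples_succ]
    exact nodup_pairsWith (fun a b a' b' h => by simpa using h) hP ih

structure StateRounded (E : Env) (s : State) : Prop where
  ok : StateOk E s
  fst : ∀ a ∈ s.1, a ∈ E.grid
  snd : ∀ e ∈ s.2, ∀ a ∈ e.2, a.1 ∈ E.cap :: E.grid ∧ a.2 ∈ E.cap :: E.grid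

lemma foldl_roundDown_mem {R L : List ℕ} {m r : ℕ} (hL : ∀ e ∈ L, e ∈ R) (hr : r ∈ R) :
    L.foldl (fun r e => if e ≤ m ∧ r ≤ e then e else r) r ∈ R := by
  induction L generalizing r with
  | nil => exact hr
  | cons e L ih =>
    rw [foldl_cons]
    refine ih (fun e he => hL e (by simp [he])) ?_
    split_ifs
    · exact hL e (by simp)
    · exact hr

lemma roundDown_mem {R : List ℕ} {m : ℕ} (h : 0 ∈ R) : roundDown R m ∈ R :=
  foldl_roundDown_mem (fun _ => id) h

lemma roundCap_mem {R : List ℕ} {M m : ℕ} (h : 0 ∈ R) : roundCap R M m ∈ M :: R := by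
  unfold roundCap
  split_ifs
  · simp
  · exact mem_cons_of_mem _ (roundDown_mem h)

lemma mem_zipWith {α β γ : Type} {f : α → β → γ} {l : List α} {l' : List β} {z : γ}
    (h : z ∈ zipWith f l l') : ∃ x ∈ l, ∃ y ∈ l', z = f x y := by
  rw [← map_uncurry_zip_eq_zipWith] at h
  obtain ⟨p, hp, rfl⟩ := mem_map.1 h
  exact ⟨p.1, (of_mem_zip hp).1, p.2, (of_mem_zip hp).2, rfl⟩

lemma rounded_assocOf {E : Env} {L : List (ℕ × Vec)}
    (h : ∀ i ∈ L, ∀ a ∈ i.2, a.1 ∈ E.cap :: E.grid ∧ a.2 ∈ E.cap :: E.grid) :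
    ∀ e ∈ assocOf L, ∀ a ∈ e.2, a.1 ∈ E.cap :: E.grid ∧ a.2 ∈ E.cap :: E.grid := by
  suffices ∀ A : Assoc, (∀ i ∈ A, ∀ a ∈ i.2, a.1 ∈ E.cap :: E.grid ∧ a.2 ∈ E.cap :: E.grid) →
      ∀ e ∈ L.foldl insTy A, ∀ a ∈ e.2, a.1 ∈ E.cap :: E.grid ∧ a.2 ∈ E.cap :: E.grid from
    this [] (by simp)
  induction L with
  | nil => exact fun A hA => hA
  | cons i L ih =>
    intro A hA
    refine ih (fun j hj => h j (by simp [hj])) _ fun e he => ?_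
    rcases mem_insTy he with rfl | he | ⟨e', he', h1, rfl⟩
    · exact h _ (by simp)
    · exact hA e he
    · intro a ha
      obtain ⟨x, hx, y, hy, rfl⟩ := mem_zipWith ha
      have h1 := h i (by simp) x hx
      have h2 := hA e' he' y hy
      constructor
      · rcases min_choice x.1 y.1 with h | h
        · rw [h]; exact h1.1
        · rw [h]; exact h2.1
      · rcases max_choice x.2 y.2 with h | h
        · rw [h]; exact h1.2
        · rw [h]; exact h2.2

lemma stateRounded_combState {E : Env} {c : Op} {s s' : State} (h : StateOk E s)
    (h' : StateOk E s') (h0 : 0 < E.terms₁.length + E.terms₂.length → 0 ∈ E.grid)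
    (hc : ∀ a ∈ (combState E c s s').1, a < E.cap) : StateRounded E (combState E c s s') where
  ok := h.combState h'
  fst a ha := by
    obtain ⟨x, hx, y, hy, h1⟩ := mem_zipWith ha
    have hm : 0 < E.terms₁.length := h.len ▸ length_pos_of_mem hx
    have := roundCap_mem (h0 (by omega)) (M := E.cap) (m := x + y)
    rw [← h1, mem_cons] at this
    rcases this with h2 | h2
    · exact absurd (hc a ha) (by omega)
    · exact h2
  snd := by
    refine rounded_assocOf fun i hi a ha => ?_
    obtain ⟨e, he, e', he', rfl⟩ := mem_pairsWith.1 hi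
    obtain ⟨x, hx, y, hy, rfl⟩ := mem_zipWith ha
    have hm : 0 < E.terms₂.length := h.assoc.len e he ▸ length_pos_of_mem hx
    exact ⟨roundCap_mem (h0 (by omega)), roundCap_mem (h0 (by omega))⟩

def Env.maxStates (E : Env) : ℕ :=
  2 ^ E.numX + E.grid.length ^ E.terms₁.length *
    ((E.tb + 1) * (E.tb * ((E.grid.length + 1) ^ 2) ^ E.terms₂.length) ^ E.tb)

lemma Env.tb_pos (E : Env) : 0 < E.tb := (Nat.zero_le _).trans_lt
  (comb_lt E.par (0, 0, 0) E.par.2.2.1 0 0)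

lemma length_le_maxStates {E : Env} {L : List State} (hL : L.Nodup)
    (h : ∀ s ∈ L, StateRounded E s) : L.length ≤ E.maxStates := by
  let P := E.cap :: E.grid
  let W := tuples (pairsWith Prod.mk P P) E.terms₂.length
  let X := pairsWith Prod.mk (range E.tb) W
  let U : List State := pairsWith Prod.mk (tuples E.grid E.terms₁.length)
    ((range (E.tb + 1)).flatMap (tuples X))
  have hU : L ⊆ U := by
    intro s hs
    have := h s hs
    refine mem_pairsWith.2 ⟨s.1, mem_tuples.2 ⟨this.ok.len, this.fst⟩, s.2,
      mem_flatMap.2 ⟨s.2.length, mem_range.2 (Nat.lt_succ_of_le this.ok.assoc.length_le),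
      mem_tuples.2 ⟨rfl, fun e he => ?_⟩⟩, rfl⟩
    exact mem_pairsWith.2 ⟨e.1, mem_range.2 (this.ok.assoc.lt e he), e.2,
      mem_tuples.2 ⟨this.ok.assoc.len e he, fun a ha => mem_pairsWith.2 ⟨a.1, (this.snd e he a ha).1,
        a.2, (this.snd e he a ha).2, rfl⟩⟩, rfl⟩
  have hX : X.length = E.tb * ((E.grid.length + 1) ^ 2) ^ E.terms₂.length := by
    simp [X, W, P, length_pairsWith, length_tuples, sq]
  have h1 := (subperm_of_subset hL hU).length_le
  have h2 : ((range (E.tb + 1)).flatMap (tuples X)).length ≤ (E.tb + 1) * X.length ^ E.tb := by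
    rw [length_flatMap]
    refine (sum_le_card_nsmul _ (X.length ^ E.tb) fun y hy => ?_).trans (by simp)
    obtain ⟨i, hi, rfl⟩ := mem_map.1 hy
    rw [length_tuples]
    refine Nat.pow_le_pow_right ?_ (Nat.le_of_lt_succ (mem_range.1 hi))
    rw [hX]
    have := E.tb_pos
    positivity
  simp only [U, length_pairsWith, length_tuples] at h1
  rw [hX] at h2
  exact h1.trans ((Nat.mul_le_mul_left _ h2).trans (Nat.le_add_left _ _))

structure TableOk (E : Env) (T : Table) : Prop where
  key : ∀ e ∈ T, e.1 = encode e.2.1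
  state : ∀ e ∈ T, StateOk E e.2.1
  len : T.length ≤ E.maxStates

lemma map_fst_insEntry (T : Table) (e : Entry) : (insEntry T e).map Prod.fst =
    if e.1 ∈ T.map Prod.fst then T.map Prod.fst else e.1 :: T.map Prod.fst := by
  have h : (T.all fun e' => !decide (e'.1 = e.1)) = true ↔ e.1 ∉ T.map Prod.fst :=
    all_ne_iff Prod.fst T e.1
  unfold insEntry
  by_cases hm : e.1 ∈ T.map Prod.fst
  · rw [if_neg (by rw [h]; simpa using hm), if_pos hm, map_map]
    refine map_congr_left fun e' _ => ?_
    simp only [Function.comp_apply]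
    split_ifs with h2
    · exact h2.1.symm
    · rfl
  · rw [if_pos (h.2 hm), if_neg hm, map_cons]

lemma mem_insEntry {T : Table} {e e' : Entry} (h : e' ∈ insEntry T e) : e' = e ∨ e' ∈ T := by
  unfold insEntry at h
  split_ifs at h
  · exact mem_cons.1 h
  · obtain ⟨e'', he'', rfl⟩ := mem_map.1 h
    split_ifs with h2
    · exact Or.inl rfl
    · exact Or.inr he''

structure CombOk (E : Env) (T : Table) : Prop where
  nodup : (T.map Prod.fst).Nodup
  key : ∀ e ∈ T, e.1 = encode e.2.1
  state : ∀ e ∈ T, StateRounded E e.2.1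

lemma CombOk.length_le {E : Env} {T : Table} (h : CombOk E T) : T.length ≤ E.maxStates := by
  have h1 : (T.map fun e => e.2.1).Nodup := by
    have : T.map Prod.fst = (T.map fun e => e.2.1).map encode := by
      rw [map_map]
      exact map_congr_left h.key
    have hn := h.nodup
    rw [this] at hn
    exact hn.of_map
  rw [← length_map (f := fun e : Entry => e.2.1)]
  refine length_le_maxStates h1 fun s hs => ?_
  obtain ⟨e, he, rfl⟩ := mem_map.1 hs
  exact h.state e he

lemma CombOk.tableOk {E : Env} {T : Table} (h : CombOk E T) : TableOk E T :=
  ⟨h.key, fun e he => (h.state e he).ok, h.length_le⟩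

lemma CombOk.insEntry {E : Env} {T : Table} (h : CombOk E T) {e : Entry}
    (he : e.1 = encode e.2.1) (hs : StateRounded E e.2.1) :
    CombOk E (insEntry T e) where
  nodup := by
    rw [map_fst_insEntry]
    split_ifs with h1
    · exact h.nodup
    · exact nodup_cons.2 ⟨h1, h.nodup⟩
  key e' he' := by
    rcases mem_insEntry he' with rfl | h1
    · exact he
    · exact h.key e' h1
  state e' he' := by
    rcases mem_insEntry he' with rfl | h1
    · exact hs
    · exact h.state e' h1

lemma combOk_nil (E : Env) : CombOk E [] := ⟨by simp, by simp, by simp⟩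

lemma combOk_foldl {E : Env} {L : List Entry}
    (h : ∀ e ∈ L, e.1 = encode e.2.1 ∧ StateRounded E e.2.1) {T : Table}
    (hT : CombOk E T) : CombOk E (L.foldl insEntry T) := by
  induction L generalizing T with
  | nil => exact hT
  | cons e L ih =>
    exact ih (fun e he => h e (by simp [he])) (hT.insEntry (h e (by simp)).1 (h e (by simp)).2)

lemma mem_combTable_list {E : Env} {c : Op} {S S' : Table} (hS : ∀ e ∈ S, StateOk E e.2.1)
    (hS' : ∀ e ∈ S', StateOk E e.2.1)
    (h0 : 0 < E.terms₁.length + E.terms₂.length → 0 ∈ E.grid) {e : Entry}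
    (he : e ∈ (pairsWith (fun e e' : Entry => mkEntry (combState E c e.2.1 e'.2.1)
      (e.2.2.1 + e'.2.2.1) (Rope.node e.2.2.2 e'.2.2.2)) S S').filter fun e =>
        e.2.1.1.all fun a => decide (a < E.cap)) :
    e.1 = encode e.2.1 ∧ StateRounded E e.2.1 := by
  obtain ⟨h1, h2⟩ := mem_filter.1 he
  obtain ⟨x, hx, y, hy, rfl⟩ := mem_pairsWith.1 h1
  exact ⟨rfl, stateRounded_combState (hS x hx) (hS' y hy) h0 (by simpa [mkEntry] using h2)⟩

lemma tableOk_combTable {E : Env} {c : Op} {S S' : Table} (hS : ∀ e ∈ S, StateOk E e.2.1)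
    (hS' : ∀ e ∈ S', StateOk E e.2.1)
    (h0 : 0 < E.terms₁.length + E.terms₂.length → 0 ∈ E.grid) : TableOk E (combTable E c S S') :=
  (combOk_foldl (fun _ he => mem_combTable_list hS hS' h0 he) (combOk_nil E)).tableOk

lemma stateOk_trivialTable (E : Env) : ∀ e ∈ trivialTable E, StateOk E e.2.1 := by
  intro e he
  rw [trivialTable, mem_singleton] at he
  subst he
  exact ⟨by simp [mkEntry], ⟨by simp [mkEntry], by simpa [mkEntry] using E.tb_pos,
    by simp [mkEntry]⟩⟩

lemma tableOk_leafTable {E : Env} {r : VertexData} (hr : r.1 ≤ E.par.2.1) :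
    TableOk E (leafTable E r) where
  key e he := by
    obtain ⟨m, _, rfl⟩ := mem_map.1 he
    rfl
  state e he := by
    obtain ⟨m, _, rfl⟩ := mem_map.1 he
    exact stateOk_leaf hr m
  len := by
    rw [leafTable, length_map, length_range]
    exact Nat.le_add_right _ _

end Valid

/-- The labels, and the number of colors of a vertex, are bounded in terms of the parameters. -/
def DExpr.Bounded (p : Params) : DExpr → Prop
  | .vertex r => r.1 ≤ p.2.1 ∧ r.2.2.1.length ≤ p.1
  | .union a b => a.Bounded p ∧ b.Bounded p
  | .op c a => (c.1 ≤ 3 ∧ c.2.1 ≤ p.2.1 ∧ c.2.2 ≤ p.2.1) ∧ a.Bounded p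

lemma tableOk_treeTable {E : Env} {e : DExpr} (he : e.Bounded E.par)
    (h0 : 0 < E.terms₁.length + E.terms₂.length → 0 ∈ E.grid) : TableOk E (treeTable E e) := by
  induction e with
  | vertex r => exact tableOk_leafTable he.1
  | union a b iha ihb => exact tableOk_combTable (iha he.1).state (ihb he.2).state h0
  | op c a ih => exact tableOk_combTable (ih he.2).state (stateOk_trivialTable E) h0

/-! ### The running time of the dynamic program -/

/-- The number of steps that are needed to add and round the values of all terms. -/
def Env.quota (E : Env) : ℕ := (E.terms₁.length + E.terms₂.length) * (E.grid.length + 1) + 1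

section Quota

variable (E : Env)

lemma Env.one_le_quota : 1 ≤ E.quota := Nat.le_add_left _ _

lemma Env.terms₁_le_quota : E.terms₁.length * (E.grid.length + 1) + 1 ≤ E.quota :=
  Nat.add_le_add_right (Nat.mul_le_mul_right _ (Nat.le_add_right _ _)) _

lemma Env.terms₂_le_quota : E.terms₂.length * (E.grid.length + 1) + 1 ≤ E.quota :=
  Nat.add_le_add_right (Nat.mul_le_mul_right _ (Nat.le_add_left _ _)) _

lemma Env.length₁_le_quota : E.terms₁.length + 1 ≤ E.quota :=
  (Nat.add_le_add_right (Nat.le_mul_of_pos_right _ (Nat.succ_pos _)) 1).trans E.terms₁_le_quota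

lemma Env.length₂_le_quota : E.terms₂.length + 1 ≤ E.quota :=
  (Nat.add_le_add_right (Nat.le_mul_of_pos_right _ (Nat.succ_pos _)) 1).trans E.terms₂_le_quota

end Quota

lemma TMD.addVec : TMD (fun p : Env × Vec × Vec => p.2.1.length ≤ p.1.terms₂.length)
    (fun p => addVec p.1 p.2.1 p.2.2) (fun p => p.1.terms₂.length * (p.1.grid.length + 1)) :=
  TMD.zipWith (E := fun _ => True) (w := fun p => p.1.1.grid.length)
    (h := fun (p : Env × Vec × Vec) (a b : ℕ × ℕ) =>
      (roundCap p.1.grid p.1.cap (a.1 + b.1), roundCap p.1.grid p.1.cap (a.2 + b.2)))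
    (TM.on' (.prodMk
      (TM.roundCap.app fun p : (Env × Vec × Vec) × (ℕ × ℕ) × (ℕ × ℕ) =>
        (p.1.1.grid, p.1.1.cap, p.2.1.1 + p.2.2.1))
      (TM.roundCap.app fun p : (Env × Vec × Vec) × (ℕ × ℕ) × (ℕ × ℕ) =>
        (p.1.1.grid, p.1.1.cap, p.2.1.2 + p.2.2.2))))
    TM.on₀ TM.on₀ (fun p => p.1.grid.length)
    (fun p _ x _ y _ => ⟨trivial, le_rfl⟩) (.of_le fun p hp => Nat.mul_le_mul_right _ hp)

lemma TM.mergeVec : TM (fun p : Vec × Vec => mergeVec p.1 p.2) (fun p => p.1.length) :=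
  TM.zipWith (h := fun a b : ℕ × ℕ => (min a.1 b.1, max a.2 b.2)) fp

lemma TM.insTy : TM (fun p : Assoc × (ℕ × Vec) => insTy p.1 p.2)
    (fun p => p.1.length * (p.2.2.length + 1)) := by
  unfold ApproxMSO.insTy
  refine .ite (TM.decide_eq_true (TM.all (v := fun _ => 0)
    (p := fun (p : Assoc × (ℕ × Vec)) (e : ℕ × Vec) => !decide (e.1 = p.2.1)) fp
    fp (.of_le fun p => ?_))) (TM.cons.comp (.prodMk fp fp)) ?_
  · simpa using Nat.le_mul_of_pos_right _ (Nat.succ_pos _)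
  · refine TM.map_le (v := fun q => q.1.2.2.length) (h := fun (p : Assoc × (ℕ × Vec))
      (e : ℕ × Vec) => if e.1 = p.2.1 then (p.2.1, ApproxMSO.mergeVec p.2.2 e.2) else e) ?_
      fp (fun p => p.2.2.length) (fun p x _ => le_rfl) .refl
    exact .ite fp (.prodMk fp (TM.mergeVec.comp'
      (f := fun q : (Assoc × (ℕ × Vec)) × (ℕ × Vec) => (q.1.2.2, q.2.2)) fp .refl))
      fp

lemma TM.insEntry : TM (fun p : Table × Entry => insEntry p.1 p.2) (fun p => p.1.length) := by
  unfold ApproxMSO.insEntry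
  refine .ite (TM.decide_eq_true (TM.all (v := fun _ => 0)
    (p := fun (p : Table × Entry) (e : Entry) => !decide (e.1 = p.2.1)) fp
    fp (.of_le fun p => by simp))) (TM.cons.comp (.prodMk fp fp)) ?_
  exact TM.map₁ (h := fun (p : Table × Entry) (e' : Entry) =>
    if e'.1 = p.2.1 ∧ e'.2.2.1 < p.2.2.2.1 then p.2 else e') fp fp .refl

lemma TMD.assocOf : TMD (fun p : Env × List (ℕ × Vec) => ∀ i ∈ p.2, i.1 < p.1.tb ∧
      i.2.length = p.1.terms₂.length) (fun p => assocOf p.2)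
    (fun p => p.2.length * (p.1.tb * (p.1.terms₂.length + 1) + 1)) := by
  refine TMD.foldl (E := fun _ => True) (w := fun q => q.2.1.length * (q.2.2.2.length + 1))
    (g := fun (_ : Env × List (ℕ × Vec)) A i => insTy A i)
    (TM.on' (TM.insTy.app fun q : (Env × List (ℕ × Vec)) × Assoc × (ℕ × Vec) => q.2)) TM.on₀ TM.on₀
    (fun p A => AssocOk p.1 A) (fun p => p.1.tb * (p.1.terms₂.length + 1))
    (fun p _ => assocOk_nil _) (fun p hp A i hi hA => ⟨hA.insTy (hp i hi).1 (hp i hi).2, trivial, ?_⟩)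
    .refl
  dsimp only
  rw [(hp i hi).2]
  exact Nat.mul_le_mul_right _ hA.length_le

def OpOk (p : Params) (c : Op) : Prop := c.1 ≤ 3 ∧ c.2.1 ≤ p.2.1 ∧ c.2.2 ≤ p.2.1

lemma exists_combAssoc : ∃ g : Params → ℕ, Primrec g ∧
    TMD (fun p : Env × Op × Assoc × Assoc => OpOk p.1.par p.2.1 ∧ AssocOk p.1 p.2.2.1 ∧
        AssocOk p.1 p.2.2.2)
      (fun p => combAssoc p.1 p.2.1 p.2.2.1 p.2.2.2) (fun p => g p.1.par * p.1.quota) := by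
  obtain ⟨g, h1, h2⟩ := exists_comb
  let b : Params → ℕ := fun p => tyBound p p.2.2.1
  refine ⟨fun p => b p * (b p * (g p + 2) + 1) + b p * b p * (b p + 1), fp, ?_⟩
  have h3 : TMD (fun p : Env × Op × Assoc × Assoc => OpOk p.1.par p.2.1 ∧
      AssocOk p.1 p.2.2.1 ∧ AssocOk p.1 p.2.2.2)
      (fun p => pairsWith (combPair p.1 p.2.1) p.2.2.1 p.2.2.2)
      (fun p => p.1.tb * (p.1.tb * (g p.1.par + 2) + 1) * p.1.quota) := by
    refine TMD.pairsWith (E := fun q : (Env × Op × Assoc × Assoc) × (ℕ × Vec) × (ℕ × Vec) =>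
        CombDom ((q.1.1.par, q.1.2.1), (q.2.1.1, q.2.2.1)) ∧ q.2.1.2.length ≤ q.1.1.terms₂.length)
      (w := fun q => g q.1.1.par + q.1.1.terms₂.length * (q.1.1.grid.length + 1))
      (h := fun p : Env × Op × Assoc × Assoc => combPair p.1 p.2.1)
      (.prodMk ?_ ?_) TM.on₀ TM.on₀
      (fun p => g p.1.par + p.1.terms₂.length * (p.1.grid.length + 1)) ?_ (.of_le ?_)
    · exact h2.app (fun q : (Env × Op × Assoc × Assoc) × (ℕ × Vec) × (ℕ × Vec) =>
        ((q.1.1.par, q.1.2.1), (q.2.1.1, q.2.2.1))) (fun q hq => hq.1)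
        (.of_le fun q _ => Nat.le_add_right _ _)
    · exact TMD.addVec.app (fun q : (Env × Op × Assoc × Assoc) × (ℕ × Vec) × (ℕ × Vec) =>
        (q.1.1, q.2.1.2, q.2.2.2)) (fun q hq => hq.2)
        (.of_le fun q _ => Nat.le_add_left _ _)
    · exact fun p hp x hx y hy => ⟨⟨⟨hp.1, hp.2.1.lt x hx, hp.2.2.lt y hy⟩, (hp.2.1.len x hx).le⟩,
        le_rfl⟩
    · intro p hp
      have i1 := hp.2.1.length_le
      have i2 := hp.2.2.length_le
      have i3 := p.1.terms₂_le_quota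
      have i4 := p.1.one_le_quota
      have i5 : g p.1.par + p.1.terms₂.length * (p.1.grid.length + 1) + 1 ≤
          (g p.1.par + 2) * p.1.quota := by nlinarith
      calc _ ≤ p.1.tb * (p.1.tb * ((g p.1.par + 2) * p.1.quota) + p.1.quota) := by gcongr
        _ = _ := by ring
  refine TMD.comp (f := fun p : Env × Op × Assoc × Assoc => (p.1, pairsWith
    (combPair p.1 p.2.1)
    p.2.2.1 p.2.2.2)) TMD.assocOf
    (.prodMk TM.on₀ (h3.mono (.of_le fun p _ => Nat.mul_le_mul_right _
      (Nat.le_add_right _ _)))) (fun p hp i hi => ?_) (.of_le fun p hp => ?_)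
  · obtain ⟨e, he, e', he', rfl⟩ := mem_pairsWith.1 hi
    exact ⟨comb_lt _ _ _ _ _, by simp [addVec, hp.2.1.len e he, hp.2.2.len e' he']⟩
  · have i1 := hp.2.1.length_le
    have i2 := hp.2.2.length_le
    have i3 := p.1.length₂_le_quota
    have i4 := p.1.one_le_quota
    dsimp only
    rw [length_pairsWith]
    calc _ ≤ p.1.tb * p.1.tb * (p.1.tb * p.1.quota + p.1.quota) := by gcongr
      _ = p.1.tb * p.1.tb * (p.1.tb + 1) * p.1.quota := by ring
      _ ≤ _ := Nat.mul_le_mul_right _ (Nat.le_add_left _ _)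

lemma exists_combState : ∃ g : Params → ℕ, Primrec g ∧
    TMD (fun p : Env × Op × State × State => OpOk p.1.par p.2.1 ∧ StateOk p.1 p.2.2.1 ∧
        StateOk p.1 p.2.2.2)
      (fun p => combState p.1 p.2.1 p.2.2.1 p.2.2.2) (fun p => g p.1.par * p.1.quota) := by
  obtain ⟨g, h1, h2⟩ := exists_combAssoc
  refine ⟨fun p => g p + 1, fp, .prodMk ?_ ?_⟩
  · refine TMD.zipWith (E := fun _ => True) (w := fun q => q.1.1.grid.length)
      (TM.on' (TM.roundCap.app fun p : (Env × Op × State × State) × ℕ × ℕ =>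
        (p.1.1.grid, p.1.1.cap, p.2.1 + p.2.2)))
      TM.on₀ TM.on₀ (fun p => p.1.grid.length)
      (fun p _ x _ y _ => ⟨trivial, le_rfl⟩) (.of_le fun p hp => ?_)
    rw [hp.2.1.len]
    have := p.1.terms₁_le_quota
    nlinarith
  · exact h2.app (fun p : Env × Op × State × State => (p.1, p.2.1, p.2.2.1.2, p.2.2.2.2)) (fun p hp => ⟨hp.1, hp.2.1.assoc, hp.2.2.assoc⟩)
      (.of_le fun p _ => Nat.mul_le_mul_right _ (Nat.le_succ _))

lemma TM.encodeVec : TM (encode : Vec → ℕ) List.length :=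
  (encodeList (encodeProd₀ .encodeNat .encodeNat)).mono_le fun l => by simp

lemma TMD.encodeState : TMD (fun p : Env × State => StateOk p.1 p.2)
    (fun p => encode p.2) (fun p => (p.1.tb + 1) * (p.1.quota + 1)) := by
  have h : TM (encode : State → ℕ) _ := TM.encodeProd
    (TM.encodeList TM.encodeNat) (TM.encodeList (TM.encodeProd TM.encodeNat TM.encodeVec))
  refine TM.on (h.comp' (f := fun p : Env × State => p.2) (u := fun p : Env × State =>
    p.2.1.length + (p.2.2.map fun e => e.2.length + 1).sum) fp
    (.of_le fun p => by simp)) (.of_le fun p hp => ?_)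
  have h1 : (p.2.2.map fun e => e.2.length + 1).sum ≤ p.2.2.length * p.1.quota := by
    refine (List.sum_le_card_nsmul _ p.1.quota fun y hy => ?_).trans (by simp)
    obtain ⟨e, he, rfl⟩ := List.mem_map.1 hy
    rw [hp.assoc.len e he]
    exact p.1.length₂_le_quota
  have h2 := hp.assoc.length_le
  have h3 := p.1.length₁_le_quota
  have h4 := Nat.mul_le_mul_right p.1.quota h2
  rw [hp.len]
  nlinarith

lemma exists_mkEntry : ∃ g : Params → ℕ, Primrec g ∧
    TMD (fun p : Env × Op × Entry × Entry => OpOk p.1.par p.2.1 ∧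
        StateOk p.1 p.2.2.1.2.1 ∧ StateOk p.1 p.2.2.2.2.1)
      (fun p => mkEntry (combState p.1 p.2.1 p.2.2.1.2.1 p.2.2.2.2.1)
        (p.2.2.1.2.2.1 + p.2.2.2.2.2.1) (Rope.node p.2.2.1.2.2.2 p.2.2.2.2.2.2))
      (fun p => g p.1.par * p.1.quota) := by
  obtain ⟨g, h1, h2⟩ := exists_combState
  refine ⟨fun p => g p + 2 * (tyBound p p.2.2.1 + 1), fp, ?_⟩
  have h3 := h2.comp (D := fun p : Env × Op × Entry × Entry => OpOk p.1.par p.2.1 ∧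
      StateOk p.1 p.2.2.1.2.1 ∧ StateOk p.1 p.2.2.2.2.1) (u := fun p => (g p.1.par +
      2 * (tyBound p.1.par p.1.par.2.2.1 + 1)) * p.1.quota)
    (f := fun p : Env × Op × Entry × Entry => (p.1, p.2.1, p.2.2.1.2.1, p.2.2.2.2.1))
    TM.on₀ (fun p hp => hp)
    (.of_le fun p _ => Nat.mul_le_mul_right _ (Nat.le_add_right _ _))
  have h4 : TMD (fun p : (Env × Op × Entry × Entry) × State => StateOk p.1.1 p.2)
      (fun p => mkEntry p.2 (p.1.2.2.1.2.2.1 + p.1.2.2.2.2.2.1)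
        (Rope.node p.1.2.2.1.2.2.2 p.1.2.2.2.2.2.2))
      (fun p => (p.1.1.tb + 1) * (p.1.1.quota + 1)) :=
    .prodMk (TMD.encodeState.app (fun p : (Env × Op × Entry × Entry) × State =>
      (p.1.1, p.2)) (fun p hp => hp) .refl) TM.on₀
  refine h4.comp (f := fun p : Env × Op × Entry × Entry =>
    (p, combState p.1 p.2.1 p.2.2.1.2.1 p.2.2.2.2.1)) (.prodMk TM.on₀ h3)
    (fun p hp => hp.2.1.combState hp.2.2) (.of_le fun p hp => ?_)
  have := p.1.one_le_quota
  change (p.1.tb + 1) * (p.1.quota + 1) ≤ (g p.1.par + 2 * (p.1.tb + 1)) * p.1.quota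
  nlinarith [Nat.zero_le (g p.1.par * p.1.quota)]

/-- The time for the combination of two tables, up to a factor for computations with types. -/
def Env.opTime (E : Env) (g : ℕ) : ℕ := E.maxStates * E.maxStates * (g * E.quota + E.maxStates)

lemma Env.one_le_maxStates (E : Env) : 1 ≤ E.maxStates :=
  Nat.one_le_two_pow.trans (Nat.le_add_right (2 ^ E.numX) _)

lemma Env.opTime_mono (E : Env) {g g' : ℕ} (h : g ≤ g') : E.opTime g ≤ E.opTime g' := by
  unfold Env.opTime
  gcongr

lemma Env.le_opTime (E : Env) (g : ℕ) : g * E.quota ≤ E.opTime g := by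
  have := E.one_le_maxStates
  exact (Nat.le_add_right _ _).trans (Nat.le_mul_of_pos_left _ (Nat.mul_pos this this))

structure EnvOk (E : Env) : Prop where
  zero_mem : 0 < E.terms₁.length + E.terms₂.length → 0 ∈ E.grid
  numX : E.numX ≤ E.par.2.2.2
  colors : E.colors.length ≤ E.par.1
  terms₁ : ∀ cs ∈ E.terms₁, cs.length ≤ E.par.2.2.2 ∧ ListsLe cs E.par.2.2.2
  terms₂ : ∀ cs ∈ E.terms₂, cs.length ≤ E.par.2.2.2 ∧ ListsLe cs E.par.2.2.2
  target : E.target.length ≤ E.par.2.2.2 ∧ ListsLe E.target E.par.2.2.2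

lemma exists_combTable : ∃ g : Params → ℕ, Primrec g ∧
    TMD (fun p : Env × Op × Table × Table => EnvOk p.1 ∧ OpOk p.1.par p.2.1 ∧
        TableOk p.1 p.2.2.1 ∧ TableOk p.1 p.2.2.2)
      (fun p => combTable p.1 p.2.1 p.2.2.1 p.2.2.2) (fun p => p.1.opTime (g p.1.par)) := by
  obtain ⟨g, h1, h2⟩ := exists_mkEntry
  refine ⟨fun p => g p + 2, fp, ?_⟩
  have len_le : ∀ p : Env × Op × Table × Table, TableOk p.1 p.2.2.1 → TableOk p.1 p.2.2.2 →
      p.2.2.1.length * p.2.2.2.length ≤ p.1.maxStates * p.1.maxStates := fun p h h' =>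
    Nat.mul_le_mul h.len h'.len
  have h3 : TMD (fun p : Env × Op × Table × Table => EnvOk p.1 ∧ OpOk p.1.par p.2.1 ∧
        TableOk p.1 p.2.2.1 ∧ TableOk p.1 p.2.2.2)
      (fun p => pairsWith (fun e e' : Entry => mkEntry (combState p.1 p.2.1 e.2.1 e'.2.1)
        (e.2.2.1 + e'.2.2.1) (Rope.node e.2.2.2 e'.2.2.2)) p.2.2.1 p.2.2.2)
      (fun p => p.1.opTime (g p.1.par + 2)) := by
    refine TMD.pairsWith (w := fun q => g q.1.1.par * q.1.1.quota)
      (h2.app (fun q : (Env × Op × Table × Table) × Entry × Entry =>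
        (q.1.1, q.1.2.1, q.2.1, q.2.2)) (fun q hq => hq) .refl)
      TM.on₀ TM.on₀
      (fun p => g p.1.par * p.1.quota) (fun p hp x hx y hy => ⟨⟨hp.2.1, hp.2.2.1.state x hx,
        hp.2.2.2.state y hy⟩, le_rfl⟩) (.of_le fun p hp => ?_)
    have i1 := hp.2.2.1.len
    have i2 := hp.2.2.2.len
    have i3 := p.1.one_le_quota
    have i4 := p.1.one_le_maxStates
    unfold Env.opTime
    calc _ ≤ p.1.maxStates * (p.1.maxStates * (g p.1.par * p.1.quota + p.1.quota) +
          p.1.maxStates * p.1.quota) := by gcongr; nlinarith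
      _ = p.1.maxStates * p.1.maxStates * ((g p.1.par + 2) * p.1.quota) := by ring
      _ ≤ _ := by gcongr; omega
  have h4 : TMD (fun q : Env × List Entry => q.2.length ≤ q.1.maxStates * q.1.maxStates ∧
        ∀ e ∈ q.2, StateOk q.1 e.2.1) (fun q => q.2.filter fun e =>
          e.2.1.1.all fun a => decide (a < q.1.cap))
      (fun q => q.1.opTime 1) := by
    refine TMD.filter (E := fun _ => True) (w := fun q => q.2.2.1.1.length)
      (p := fun (q : Env × List Entry) (e : Entry) => e.2.1.1.all fun a => decide (a < q.1.cap))
      (TM.on' (TM.all (v := fun _ => 0)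
        (p := fun (q : (Env × List Entry) × Entry) (a : ℕ) => decide (a < q.1.1.cap)) fp
        fp (.of_le fun q => by simp))) TM.on₀
      (fun q => q.1.terms₁.length) (fun q hq e he => ⟨trivial, (hq.2 e he).len.le⟩)
      (.of_le fun q hq => ?_)
    have := q.1.length₁_le_quota
    unfold Env.opTime
    exact Nat.mul_le_mul hq.1 (by omega)
  have h5 : TMD (fun q : Env × List Entry => q.2.length ≤ q.1.maxStates * q.1.maxStates ∧
        ∀ e ∈ q.2, e.1 = encode e.2.1 ∧ StateRounded q.1 e.2.1)
      (fun q => q.2.foldl insEntry []) (fun q => q.1.opTime 1) := by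
    refine TMD.foldl (E := fun _ => True) (w := fun q => q.2.1.length)
      (g := fun (_ : Env × List Entry) T e => insEntry T e)
      (TM.on' (TM.insEntry.app fun q : (Env × List Entry) × Table × Entry => q.2)) TM.on₀ TM.on₀
      (fun q T => CombOk q.1 T) (fun q => q.1.maxStates) (fun q _ => combOk_nil _)
      (fun q hq T e he hT => ⟨hT.insEntry (hq.2 e he).1 (hq.2 e he).2, trivial, hT.length_le⟩)
      (.of_le fun q hq => ?_)
    have := q.1.one_le_quota
    unfold Env.opTime
    exact Nat.mul_le_mul hq.1 (by omega)
  have h6 := h4.comp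
    (.prodMk TM.on₀ h3) (fun p hp => ⟨?_, fun e he => ?_⟩)
    (.of_le fun p _ => p.1.opTime_mono (by omega))
  · refine h5.comp (.prodMk TM.on₀ h6)
      (fun p hp => ⟨?_, fun e he => ?_⟩) (.of_le fun p _ => p.1.opTime_mono (by omega))
    · refine (length_filter_le _ _).trans ?_
      rw [length_pairsWith]
      exact len_le p hp.2.2.1 hp.2.2.2
    · exact mem_combTable_list hp.2.2.1.state hp.2.2.2.state hp.1.zero_mem he
  · dsimp only
    rw [length_pairsWith]
    exact len_le p hp.2.2.1 hp.2.2.2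
  · obtain ⟨x, hx, y, hy, rfl⟩ := mem_pairsWith.1 he
    exact (hp.2.2.1.state x hx).combState (hp.2.2.2.state y hy)

lemma TM.colorMask : TM (fun p : List ℕ × List ℕ => colorMask p.1 p.2)
    (fun p => p.1.length * (p.2.length + 1)) := by
  have h : TM (fun p : List ℕ × List ℕ => p.1.reverse.foldl (fun s c => 2 * s +
      if (p.2.all fun d => !decide (d + 1 = c)) = true then 0 else 1) 0)
      (fun p => p.1.length * (p.2.length + 1)) := by
    refine TM.foldl_le (w := fun q => q.1.2.length) (g := fun (p : List ℕ × List ℕ) s c => 2 * s +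
      if (p.2.all fun d => !decide (d + 1 = c)) = true then 0 else 1) ?_
      (.reverse fp (.of_le fun p => Nat.le_mul_of_pos_right _ (Nat.succ_pos _)))
      fp (fun _ _ => True) (fun p => p.2.length) (fun _ => trivial)
      (fun p s x _ _ => ⟨trivial, le_rfl⟩) (.of_le fun p => by simp)
    refine TM.natAdd.comp <| .prodMk fp (.ite (TM.decide_eq_true (TM.all (v := fun _ => 0)
      (p := fun (q : (List ℕ × List ℕ) × ℕ × ℕ) (d : ℕ) => !decide (d + 1 = q.2.2)) fp
      fp (.of_le fun q => by simp))) fp fp)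
  refine h.of_eq fun p => ?_
  rw [foldl_reverse]
  rfl

lemma colorMask_lt (cl colors : List ℕ) : colorMask cl colors < 2 ^ cl.length := by
  induction cl with
  | nil => simp [colorMask]
  | cons c cl ih =>
    rw [length_cons, pow_succ, colorMask, foldr_cons]
    change 2 * colorMask cl colors + _ < _
    split_ifs <;> omega

lemma TMD.linMasks {α : Type} [Enc α] {D : α → Prop} {cl : α → List (List (List ℕ))}
    {w : α → List ℕ} {m : α → ℕ} (b : α → ℕ) (hcl : TM cl fun _ => 0)
    (hw : TM w fun _ => 0) (hm : TM m fun _ => 0)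
    (hD : ∀ a, D a → ∀ cs ∈ cl a, cs.length ≤ b a ∧ ListsLe cs (b a)) :
    TMD D (fun a => (cl a).map fun cs => ApproxMSO.linMask cs (w a) (m a))
      (fun a => (cl a).length * (b a * (b a + 1) + 1)) := by
  refine TMD.map (E := fun q : α × List (List ℕ) => q.2.length ≤ b q.1 ∧ ListsLe q.2 (b q.1))
    (w := fun q => b q.1 * (b q.1 + 1)) (h := fun a cs => ApproxMSO.linMask cs (w a) (m a))
    (TMD.linMaskNat (cs := fun q : α × List (List ℕ) => q.2) (w := fun q => w q.1)
      (m := fun q => m q.1) fp (hw.comp fp) (hm.comp fp)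
      (fun q => b q.1) (fun q hq => hq.2) (.of_le fun q hq => Nat.mul_le_mul_right _ hq.1))
    (TM.on₀ hcl) (fun a => b a * (b a + 1)) (fun a ha cs hcs => ⟨hD a ha cs hcs, le_rfl⟩) .refl

def LeafOk (p : Params) (r : VertexData) : Prop := r.1 ≤ p.2.1 ∧ r.2.2.1.length ≤ p.1

lemma exists_leafAssoc : ∃ g : Params → ℕ, Primrec g ∧
    TMD (fun p : Env × VertexData × ℕ => EnvOk p.1 ∧ LeafOk p.1.par p.2.1)
      (fun p => leafAssoc p.1 p.2.1 p.2.2) (fun p => g p.1.par * p.1.quota) := by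
  obtain ⟨g, h1, h2⟩ := exists_leafType
  let b : Params → ℕ := fun p => p.2.2.2 * (p.2.2.2 + 1) + 1
  let T : Params → ℕ := fun p => g p + p.1 * (p.1 + 1) + b p
  let H : Params → ℕ := fun p => 2 ^ p.2.2.2 * (T p + 1 + tyBound p p.2.2.1 + 1 + p.2.2.2 + 1)
  let D : Env × VertexData × ℕ → Prop := fun p => EnvOk p.1 ∧ LeafOk p.1.par p.2.1
  refine ⟨H, by dsimp only [H, T, b]; fun_prop, ?_⟩
  have hlen : ∀ p : Env × VertexData × ℕ, (leafMasks p.1 p.2.2).length ≤ 2 ^ p.1.par.2.2.2 := fun p =>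
    (length_filter_le _ _).trans length_range.le
  have h3 : TMD D (fun p => leafMasks p.1 p.2.2) (fun p => H p.1.par * p.1.quota) := by
    refine TMD.filter (E := fun _ => True) (w := fun q => q.1.1.numX)
      (p := fun (p : Env × VertexData × ℕ) m' => decide (m' % 2 ^ p.1.numX = p.2.2))
      (TM.on' (TM.natEq (TM.natMod.comp (.prodMk fp (TM.natPow fp fp .refl)))
        fp)) ?_ (fun p => p.1.par.2.2.2) (fun p hp m _ => ⟨trivial, hp.1.numX⟩)
      (.of_le fun p hp => ?_)
    · refine TM.on (v := fun p => 2 ^ p.1.par.2.2.2) (TM.range (TM.natPow fp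
        fp (.of_le fun p => Nat.lt_two_pow_self.le)) .refl) (.of_le fun p hp => ?_)
      exact (Nat.le_mul_of_pos_right _ (by omega)).trans (Nat.le_mul_of_pos_right _ p.1.one_le_quota)
    · rw [length_range]
      exact (Nat.mul_le_mul_left _ (by omega)).trans (Nat.le_mul_of_pos_right _ p.1.one_le_quota)
  have hE : TMD (fun q : (Env × VertexData × ℕ) × ℕ => D q.1 ∧ q.2 < 2 ^ q.1.1.par.2.2.2)
      (fun q => leafPair q.1.1 q.1.2.1 q.2)
      (fun q => T q.1.1.par * q.1.1.quota) := by
    have hT : ∀ (E : Env) n, n ≤ T E.par → n ≤ T E.par * E.quota := fun E n h =>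
      h.trans (Nat.le_mul_of_pos_right _ E.one_le_quota)
    refine .prodMk ?_ ?_
    · refine h2.comp (f := fun q : (Env × VertexData × ℕ) × ℕ => (q.1.1.par, q.1.2.1.1,
        colorMask q.1.1.colors q.1.2.1.2.2.1, q.2)) (.prodMk TM.on₀ (.prodMk
        TM.on₀ (.prodMk ?_ TM.on₀)))
        (fun q hq => ⟨hq.1.2.1, (colorMask_lt _ _).trans_le (Nat.pow_le_pow_right two_pos
          hq.1.1.colors), hq.2⟩) (.of_le fun q _ => hT _ _ (by dsimp only [T]; omega))
      exact TM.on (TM.colorMask.app fun q : (Env × VertexData × ℕ) × ℕ =>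
        (q.1.1.colors, q.1.2.1.2.2.1)) (.of_le fun q hq => hT _ _ <|
        (Nat.mul_le_mul hq.1.1.colors (Nat.add_le_add_right hq.1.2.2 1)).trans
          (by dsimp only [T]; omega))
    · have h4 := TMD.linMasks (D := fun q : (Env × VertexData × ℕ) × ℕ => D q.1 ∧
        q.2 < 2 ^ q.1.1.par.2.2.2) (cl := fun q => q.1.1.terms₂)
        (w := fun q => q.1.2.1.2.2.2) (m := fun q => q.2) (fun q => q.1.1.par.2.2.2) fp
        fp fp (fun q hq => hq.1.1.terms₂)
      have h5 : TM (fun l : List ℕ => l.map fun a => (a, a)) length :=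
        TM.map₁ (h := fun _ a => (a, a)) fp fp .refl
      have hb : ∀ q : (Env × VertexData × ℕ) × ℕ, q.1.1.terms₂.length * b q.1.1.par ≤
          T q.1.1.par * q.1.1.quota := fun q => by
        have := q.1.1.length₂_le_quota
        rw [mul_comm]
        exact Nat.mul_le_mul (by dsimp only [T]; omega) (by omega)
      exact (TMD.comp (E := fun _ => True) (f := fun q : (Env × VertexData × ℕ) × ℕ =>
        q.1.1.terms₂.map fun cs => linMask cs q.1.2.1.2.2.2 q.2) h5.on' (h4.mono (.of_le fun q _ =>
          hb q)) (fun _ _ => trivial) (.of_le fun q _ => by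
            rw [length_map]
            exact (Nat.le_mul_of_pos_right _ (by dsimp only [b]; omega)).trans (hb q))).of_eq
          fun q => by simp
  have h4 : TMD D (fun p => (leafMasks p.1 p.2.2).map fun m' =>
        leafPair p.1 p.2.1 m')
      (fun p => H p.1.par * p.1.quota) := by
    refine TMD.map (h := fun (p : Env × VertexData × ℕ) m' =>
        leafPair p.1 p.2.1 m')
      hE h3 (fun p => T p.1.par * p.1.quota) (fun p hp m hm => ⟨⟨hp, mem_range.1
        (mem_filter.1 hm).1⟩, le_rfl⟩) (.of_le fun p hp => ?_)
    have := p.1.one_le_quota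
    calc _ ≤ 2 ^ p.1.par.2.2.2 * (T p.1.par * p.1.quota + p.1.quota) :=
          Nat.mul_le_mul (hlen p) (by omega)
      _ = 2 ^ p.1.par.2.2.2 * (T p.1.par + 1) * p.1.quota := by ring
      _ ≤ _ := Nat.mul_le_mul_right _ (Nat.mul_le_mul_left _ (by omega))
  refine TMD.assocOf.comp (f := fun p : Env × VertexData × ℕ =>
    (p.1, (leafMasks p.1 p.2.2).map fun m' =>
        leafPair p.1 p.2.1 m'))
    (.prodMk TM.on₀ h4) (fun p hp i hi => ?_) (.of_le fun p hp => ?_)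
  · obtain ⟨m', _, rfl⟩ := mem_map.1 hi
    exact ⟨leafType_lt hp.2.1 _ _, by simp⟩
  · dsimp only
    rw [length_map]
    have i1 := p.1.one_le_quota
    have i2 := p.1.length₂_le_quota
    calc _ ≤ 2 ^ p.1.par.2.2.2 * (p.1.tb * p.1.quota + p.1.quota) :=
          Nat.mul_le_mul (hlen p) (Nat.add_le_add (Nat.mul_le_mul_left _ i2) i1)
      _ = 2 ^ p.1.par.2.2.2 * (p.1.tb + 1) * p.1.quota := by ring
      _ ≤ _ := Nat.mul_le_mul_right _ (Nat.mul_le_mul_left _ (by unfold Env.tb; omega))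

lemma exists_leafTable : ∃ g : Params → ℕ, Primrec g ∧
    TMD (fun p : Env × VertexData => EnvOk p.1 ∧ LeafOk p.1.par p.2)
      (fun p => leafTable p.1 p.2) (fun p => g p.1.par * p.1.quota) := by
  obtain ⟨g, h1, h2⟩ := exists_leafAssoc
  let T : Params → ℕ := fun p => g p + 2 * (p.2.2.2 * (p.2.2.2 + 1) + 1) +
    2 * (tyBound p p.2.2.1 + 1)
  refine ⟨fun p => 2 ^ p.2.2.2 * (T p + 1), by dsimp only [T]; fun_prop, ?_⟩
  have h3 : TMD (fun q : Env × VertexData × ℕ => EnvOk q.1 ∧ LeafOk q.1.par q.2.1)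
      (fun q => (q.1.terms₁.map fun cs => linMask cs q.2.1.2.2.2 q.2.2, leafAssoc q.1 q.2.1 q.2.2))
      (fun q => T q.1.par * q.1.quota) := by
    refine .prodMk ((TMD.linMasks (cl := fun q : Env × VertexData × ℕ => q.1.terms₁)
        (w := fun q => q.2.1.2.2.2) (m := fun q => q.2.2) (fun q => q.1.par.2.2.2) fp
        fp fp (fun q hq => hq.1.terms₁)).mono (.of_le fun q _ => ?_))
      (h2.mono (.of_le fun q _ => Nat.mul_le_mul_right _ (by dsimp only [T]; omega)))
    have := q.1.length₁_le_quota
    rw [mul_comm]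
    exact Nat.mul_le_mul (by dsimp only [T]; omega) (by omega)
  have h4 : TMD (fun q : (Env × VertexData × ℕ) × State => EnvOk q.1.1 ∧ StateOk q.1.1 q.2)
      (fun q => mkEntry q.2 (linMask q.1.1.target q.1.2.1.2.2.2 q.1.2.2)
        (Rope.leaf q.1.2.1.2.1 q.1.2.2)) (fun q => T q.1.1.par * q.1.1.quota) := by
    refine .prodMk (TMD.encodeState.app (fun q : (Env × VertexData × ℕ) × State =>
      (q.1.1, q.2)) (fun q hq => hq.2) (.of_le fun q _ => ?_))
      (.prodMk TM.on₀ (.prodMk (TMD.linMaskInt fp fp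
        fp (fun q => q.1.1.par.2.2.2) (fun q hq => hq.1.target.2) (.of_le fun q hq => ?_))
        TM.on₀))
    · have := q.1.1.one_le_quota
      change (q.1.1.tb + 1) * (q.1.1.quota + 1) ≤ _
      calc _ ≤ (q.1.1.tb + 1) * (2 * q.1.1.quota) := Nat.mul_le_mul_left _ (by omega)
        _ = 2 * (q.1.1.tb + 1) * q.1.1.quota := by ring
        _ ≤ _ := Nat.mul_le_mul_right _ (Nat.le_add_left _ _)
    · refine (Nat.mul_le_mul_right _ hq.1.target.1).trans (le_trans ?_
        (Nat.le_mul_of_pos_right _ q.1.1.one_le_quota))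
      dsimp only [T]
      omega
  have h5 := h4.comp (D := fun q : Env × VertexData × ℕ => EnvOk q.1 ∧ LeafOk q.1.par q.2.1)
    (.prodMk TM.on₀ h3) (fun q hq => ⟨hq.1, stateOk_leaf hq.2.1 _⟩) .refl
  have hpow : ∀ E : Env, EnvOk E → 2 ^ E.numX ≤ 2 ^ E.par.2.2.2 := fun E hE =>
    Nat.pow_le_pow_right two_pos hE.numX
  refine TMD.map (h5.app (fun q : (Env × VertexData) × ℕ => (q.1.1, q.1.2, q.2)) (fun q hq => hq) .refl)
    (TM.on (v := fun p => 2 ^ p.1.numX) (TM.range (TM.natPow fp fp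
      (.of_le fun p => Nat.lt_two_pow_self.le)) .refl) (.of_le fun p hp => ?_))
    (fun p => T p.1.par * p.1.quota) (fun p hp m _ => ⟨hp, le_rfl⟩) (.of_le fun p hp => ?_)
  · exact (hpow _ hp.1).trans ((Nat.le_mul_of_pos_right _ (by omega)).trans
      (Nat.le_mul_of_pos_right _ p.1.one_le_quota))
  · rw [length_range]
    have := p.1.one_le_quota
    calc _ ≤ 2 ^ p.1.par.2.2.2 * (T p.1.par * p.1.quota + p.1.quota) :=
          Nat.mul_le_mul (hpow _ hp.1) (by omega)
      _ = _ := by ring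

lemma TMD.trivialTable : TMD (fun _ : Env => True) (fun E => trivialTable E)
    (fun E => 8 * (E.tb + 1) * E.quota) := by
  have h1 : TMD (fun _ : Env => True) (fun E : Env => ((E.terms₁.map fun _ => 0,
      [(0, E.terms₂.map fun _ => (0, 0))]) : State)) (fun E => 8 * (E.tb + 1) * E.quota) := by
    have hq : ∀ E : Env, E.quota ≤ 8 * (E.tb + 1) * E.quota := fun E =>
      Nat.le_mul_of_pos_left _ (by omega)
    refine .prodMk (TM.on (v := fun E => E.terms₁.length) (TM.map₁ (h := fun _ _ => 0) fp
      fp .refl) (.of_le fun E _ => ?_)) (TM.on (v := fun E => E.terms₂.length)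
      (TM.cons.comp (.prodMk (.prodMk fp (TM.map₁ (h := fun _ _ => (0, 0)) fp
        fp .refl)) fp)) (.of_le fun E _ => ?_))
    · exact le_trans (by have := E.length₁_le_quota; omega) (hq E)
    · exact le_trans (by have := E.length₂_le_quota; omega) (hq E)
  have h2 : TMD (fun q : Env × State => StateOk q.1 q.2)
      (fun q => [mkEntry q.2 0 (Rope.leaf 0 0)]) (fun q => (q.1.tb + 1) * (q.1.quota + 1)) :=
    .comp₀ (g := fun e : Entry => [e]) (TM.cons.comp (.prodMk .id' (.const [])))
      (.prodMk TMD.encodeState TM.on₀)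
  refine h2.comp (f := fun E : Env => (E, ((E.terms₁.map fun _ => 0,
    [(0, E.terms₂.map fun _ => (0, 0))]) : State))) (.prodMk TM.on₀ h1)
    (fun E _ => stateOk_trivialTable E (mkEntry _ 0 (Rope.leaf 0 0)) (mem_singleton.2 rfl))
    (.of_le fun E _ => ?_)
  have := E.one_le_quota
  dsimp only
  nlinarith

lemma tableOk_trivialTable (E : Env) : TableOk E (trivialTable E) where
  key e he := by
    rw [trivialTable, mem_singleton] at he
    subst he
    rfl
  state := stateOk_trivialTable E
  len := E.one_le_maxStates

lemma exists_treeTable : ∃ g : Params → ℕ, Primrec g ∧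
    TMD (fun p : {p : Env × DExpr // p.2.Ok} => EnvOk p.1.1 ∧ p.1.2.Bounded p.1.1.par)
      (fun p => treeTable p.1.1 p.1.2) (fun p => p.1.2.size * (p.1.1.opTime (g p.1.1.par) + 1)) := by
  obtain ⟨g, h1, h2⟩ := exists_combTable
  obtain ⟨g', h3, h4⟩ := exists_leafTable
  refine ⟨fun p => g p + g' p + 8 * (tyBound p p.2.2.1 + 1), fp, ?_⟩
  have hop : ∀ E : Env, E.opTime (g E.par) ≤ E.opTime (g E.par + g' E.par +
      8 * (tyBound E.par E.par.2.2.1 + 1)) := fun E => E.opTime_mono (by omega)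
  refine TMD.exprEval (L := leafTable) (B := fun E => combTable E (1, 0, 0))
    (U := fun E c S => combTable E c S (trivialTable E)) (EU := fun q => EnvOk q.1 ∧
      OpOk q.1.par q.2.1 ∧ TableOk q.1 q.2.2) (wU := fun q => q.1.opTime (g q.1.par + g' q.1.par +
      8 * (tyBound q.1.par q.1.par.2.2.1 + 1))) h4
    (h2.comp (f := fun q : Env × Table × Table => (q.1, (1, 0, 0), q.2.1, q.2.2))
      (D := fun q => EnvOk q.1 ∧ TableOk q.1 q.2.1 ∧ TableOk q.1 q.2.2) TM.on₀
      (fun q hq => ⟨hq.1, ⟨show 1 ≤ 3 by omega, Nat.zero_le _, Nat.zero_le _⟩, hq.2⟩) .refl) ?_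
    (fun E e => EnvOk E ∧ e.Bounded E.par)
    (fun E => E.opTime (g E.par + g' E.par + 8 * (tyBound E.par E.par.2.2.1 + 1))) ?_ ?_ ?_
  · refine h2.comp (f := fun q : Env × Op × Table => (q.1, q.2.1, q.2.2, trivialTable q.1))
      (.prodMk TM.on₀ (.prodMk TM.on₀ (.prodMk TM.on₀
        ?_))) (fun q hq => ⟨hq.1, hq.2.1, hq.2.2, tableOk_trivialTable _⟩) (.of_le fun q _ => hop q.1)
    refine TMD.trivialTable.app (fun q : Env × Op × Table => q.1) (fun _ _ => trivial) (.of_le fun q _ => ?_)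
    exact (Nat.mul_le_mul_right _ (Nat.le_add_left _ (g q.1.par + g' q.1.par))).trans (q.1.le_opTime _)
  · exact fun E r h => ⟨h, (Nat.mul_le_mul_right _ (show g' E.par ≤ _ by
      omega)).trans (E.le_opTime _)⟩
  · exact fun E e e' h => ⟨⟨h.1, h.2.1⟩, ⟨h.1, h.2.2⟩, ⟨h.1, tableOk_treeTable h.2.1 h.1.zero_mem,
      tableOk_treeTable h.2.2 h.1.zero_mem⟩, hop E⟩
  · exact fun E c e h => ⟨⟨h.1, h.2.2⟩, ⟨h.1, h.2.1, tableOk_treeTable h.2.2 h.1.zero_mem⟩, le_rfl⟩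

/-! ### Correctness of the dynamic program -/

section Lin

variable {K : Type} [Semiring K] {n : ℕ} (ws : Fin n → List ℕ)

/-- The linear part of a term. -/
def linSet (cs : List (List K)) (Z : Sets n) : K :=
  ∑ j ∈ Finset.range cs.length, ∑ v ∈ Z j, dot (cs.getD j []) (ws v)

variable {ws}

lemma linSet_congr {cs : List (List K)} {Z Z' : Sets n}
    (h : ∀ i < cs.length, Z i = Z' i) : linSet ws cs Z = linSet ws cs Z' :=
  Finset.sum_congr rfl fun j hj => by rw [h j (mem_range.1 hj)]

lemma linSet_union {cs : List (List K)} {V V' : Finset (Fin n)} (hd : Disjoint V V')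
    {Z Z' : Sets n} (hZ : ∀ i, Z i ⊆ V) (hZ' : ∀ i, Z' i ⊆ V') :
    linSet ws cs (fun i => Z i ∪ Z' i) = linSet ws cs Z + linSet ws cs Z' := by
  unfold linSet
  rw [← Finset.sum_add_distrib]
  exact Finset.sum_congr rfl fun j _ => Finset.sum_union (hd.mono (hZ j) (hZ' j))

lemma linSet_mono {cs : List (List ℕ)} {Z Z' : Sets n} (h : ∀ i, Z i ⊆ Z' i) :
    linSet ws cs Z ≤ linSet ws cs Z' :=
  sum_le_sum fun j _ => Finset.sum_le_sum_of_subset (h j)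

lemma linSet_empty {cs : List (List K)} : linSet ws cs (fun _ => ∅) = 0 := by
  simp [linSet]

lemma linMask_eq (cs : List (List K)) (w : List ℕ) (m : ℕ) : linMask cs w m =
    ∑ j ∈ Finset.range cs.length, if bit m j = 1 then dot (cs.getD j []) w else 0 := by
  suffices ∀ (s : K) m, (cs.foldl (fun s c =>
      (s.1 + (if s.2 % 2 = 1 then dot c w else 0), s.2 / 2)) (s, m)).1 =
      s + ∑ j ∈ Finset.range cs.length, if bit m j = 1 then dot (cs.getD j []) w else 0 by
    rw [linMask, this, zero_add]
  induction cs with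
  | nil => simp
  | cons c cs ih =>
    intro s m
    rw [foldl_cons, ih, length_cons, Finset.sum_range_succ', add_assoc]
    congr 1
    rw [add_comm]
    congr 1
    · refine Finset.sum_congr rfl fun j _ => ?_
      have : bit (m / 2) j = bit m (j + 1) := by
        rw [bit, bit, Nat.div_div_eq_div_mul, pow_succ']
      grind
    · simp [bit]

lemma linMask_eq_linSet (cs : List (List K)) {v : Fin n} {m : ℕ} {Z : Sets n}
    (hZ : ∀ i < cs.length, Z i = if bit m i = 1 then {v} else ∅) :
    linMask cs (ws v) m = linSet ws cs Z := by
  rw [linMask_eq]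
  refine Finset.sum_congr rfl fun j hj => ?_
  grind

end Lin

lemma roundDown_le (R : List ℕ) (m : ℕ) : roundDown R m ≤ m := by
  suffices ∀ (L : List ℕ) r, r ≤ m → L.foldl (fun r e => if e ≤ m ∧ r ≤ e then e else r) r ≤ m from
    this R 0 (Nat.zero_le m)
  intro L
  induction L with
  | nil => exact fun r h => h
  | cons e L ih =>
    grind

lemma roundCap_le (R : List ℕ) (M m : ℕ) : roundCap R M m ≤ m := by
  unfold roundCap
  split_ifs with h
  · exact h
  · exact roundDown_le R m

lemma getD_zipWith {α β γ : Type} (f : α → β → γ) {l : List α} {l' : List β} {t : ℕ}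
    (h : t < l.length) (h' : t < l'.length) (a : α) (b : β) (c : γ) :
    (zipWith f l l').getD t c = f (l.getD t a) (l'.getD t b) := by
  grind

lemma getD_map {α β : Type} (f : α → β) {l : List α} {t : ℕ} (h : t < l.length) (a : α) (b : β) :
    (l.map f).getD t b = f (l.getD t a) := by
  grind

section Correct

variable {n : ℕ} (E : Env) (ws : Fin n → List ℕ) (α c : ℝ)

/-- Rounding changes values at most by a factor `α`. -/
def Env.RoundOk : Prop := 0 < E.terms₁.length + E.terms₂.length →
  ∀ m < E.cap, (m : ℝ) ≤ α * roundDown E.grid m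

/-- Up to the factor `c`, the value `A` is at most `s`, where large values are identified. -/
def UpTo (A s : ℕ) : Prop := E.cap ≤ s ∨ (A : ℝ) ≤ c * s

variable {E ws α c}

lemma UpTo.mono {c' : ℝ} (h : c ≤ c') {A s : ℕ} (hA : UpTo E c A s) : UpTo E c' A s :=
  hA.imp_right fun h1 => h1.trans (mul_le_mul_of_nonneg_right h (Nat.cast_nonneg s))

lemma UpTo.mono_right {A s s' : ℕ} (h : s ≤ s') (hc : 0 ≤ c) (hA : UpTo E c A s) :
    UpTo E c A s' :=
  hA.imp (fun h1 => h1.trans h) fun h1 => h1.trans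
    (mul_le_mul_of_nonneg_left (Nat.cast_le.2 h) hc)

lemma upTo_self (hc : 1 ≤ c) (A : ℕ) : UpTo E c A A :=
  .inr (le_mul_of_one_le_left (Nat.cast_nonneg A) hc)

lemma UpTo.add (hr : E.RoundOk α) (hm : 0 < E.terms₁.length + E.terms₂.length) (hc : 0 ≤ c)
    {A A' s s' : ℕ} (h : UpTo E c A s)
    (h' : UpTo E c A' s') : UpTo E (α * c) (A + A') (roundCap E.grid E.cap (s + s')) := by
  unfold roundCap
  split_ifs with h1
  · exact .inl le_rfl
  · right
    have h2 := h.resolve_left (by omega)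
    have h3 := h'.resolve_left (by omega)
    have h4 := hr hm (s + s') (by omega)
    push_cast at h4 ⊢
    calc (A : ℝ) + A' ≤ c * (s + s') := by rw [mul_add]; exact add_le_add h2 h3
      _ ≤ c * (α * roundDown E.grid (s + s')) := mul_le_mul_of_nonneg_left h4 hc
      _ = _ := by ring

variable (E ws c)

/-- The associations describe the types and the values of the extensions of `W`. -/
structure AssocGood (V : Finset (Fin n)) (θ : Sets n → ℕ) (A : Assoc)
    (W : Sets n) : Prop where
  len : ∀ e ∈ A, e.2.length = E.terms₂.length
  cover : ∀ Z, (∀ i, Z i ⊆ V) → (∀ i < E.numX, Z i = W i) → ∃ e ∈ A, e.1 = θ Z ∧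
    ∀ t < E.terms₂.length, (e.2.getD t 0).1 ≤ linSet ws (E.terms₂.getD t []) Z ∧
      UpTo E c (linSet ws (E.terms₂.getD t []) Z) (e.2.getD t 0).2
  lower : ∀ e ∈ A, ∀ t < E.terms₂.length, ∃ Z, (∀ i, Z i ⊆ V) ∧ (∀ i < E.numX, Z i = W i) ∧
    θ Z = e.1 ∧ UpTo E c (linSet ws (E.terms₂.getD t []) Z) (e.2.getD t 0).1
  upper : ∀ e ∈ A, ∀ t < E.terms₂.length, ∃ Z, (∀ i, Z i ⊆ V) ∧ (∀ i < E.numX, Z i = W i) ∧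
    θ Z = e.1 ∧ (e.2.getD t 0).2 ≤ linSet ws (E.terms₂.getD t []) Z

variable {E ws c}

lemma insTy_of (P : ℕ × Vec → Prop) (h : ∀ i e, P i → P e → e.1 = i.1 →
    P (i.1, mergeVec i.2 e.2)) {A : Assoc} (hA : ∀ e ∈ A, P e) {i : ℕ × Vec} (hi : P i) :
    ∀ e ∈ insTy A i, P e := by
  intro e he
  rcases mem_insTy he with rfl | h1 | ⟨e', he', h1, rfl⟩
  · exact hi
  · grind
  · grind

lemma assocOf_of (P : ℕ × Vec → Prop) (h : ∀ i e, P i → P e → e.1 = i.1 →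
    P (i.1, mergeVec i.2 e.2)) {L : List (ℕ × Vec)} (hL : ∀ i ∈ L, P i) : ∀ e ∈ assocOf L, P e := by
  suffices ∀ A : Assoc, (∀ e ∈ A, P e) → ∀ e ∈ L.foldl insTy A, P e from this [] (by simp)
  induction L with
  | nil => exact fun A hA => hA
  | cons i L ih =>
    exact fun A hA => ih (fun j hj => hL j (by simp [hj])) _ (insTy_of P h hA (hL i (by simp)))

/-- The values `e` comprise the values `i`. -/
def Wider (k : ℕ) (i e : ℕ × Vec) : Prop := e.1 = i.1 ∧ ∀ t < k,
  (e.2.getD t 0).1 ≤ (i.2.getD t 0).1 ∧ (i.2.getD t 0).2 ≤ (e.2.getD t 0).2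

lemma Wider.refl (k : ℕ) (i : ℕ × Vec) : Wider k i i := ⟨rfl, fun _ _ => ⟨le_rfl, le_rfl⟩⟩

lemma Wider.trans {k : ℕ} {i j e : ℕ × Vec} (h : Wider k i j) (h' : Wider k j e) : Wider k i e :=
  ⟨h'.1.trans h.1, fun t ht => ⟨(h'.2 t ht).1.trans (h.2 t ht).1, (h.2 t ht).2.trans (h'.2 t ht).2⟩⟩

lemma getD_mergeVec {k : ℕ} {v v' : Vec} (hv : v.length = k) (hv' : v'.length = k) {t : ℕ}
    (ht : t < k) : (mergeVec v v').getD t 0 =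
      (min (v.getD t 0).1 (v'.getD t 0).1, max (v.getD t 0).2 (v'.getD t 0).2) :=
  getD_zipWith _ (by omega) (by omega) _ _ _

lemma exists_wider_insTy {k : ℕ} {A : Assoc} (hA : ∀ e ∈ A, e.2.length = k) {i : ℕ × Vec}
    (hi : i.2.length = k) : (∃ e ∈ insTy A i, Wider k i e) ∧
      ∀ e ∈ A, ∃ e' ∈ insTy A i, Wider k e e' := by
  have hw : ∀ e ∈ A, e.1 = i.1 → Wider k i (i.1, mergeVec i.2 e.2) ∧
      Wider k e (i.1, mergeVec i.2 e.2) := fun e he h => by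
    refine ⟨⟨rfl, fun t ht => ?_⟩, h.symm, fun t ht => ?_⟩ <;>
      simp only [getD_mergeVec hi (hA e he) ht]
    · exact ⟨min_le_left _ _, le_max_left _ _⟩
    · exact ⟨min_le_right _ _, le_max_right _ _⟩
  unfold insTy
  split_ifs with h
  · exact ⟨⟨i, by simp, .refl _ _⟩, fun e he => ⟨e, by simp [he], .refl _ _⟩⟩
  · rw [all_ne_iff, not_not, mem_map] at h
    have ⟨e, he, h1⟩ := h
    refine ⟨⟨_, mem_map.2 ⟨e, he, if_pos h1⟩, (hw e he h1).1⟩, fun e' he' => ?_⟩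
    refine ⟨_, mem_map.2 ⟨e', he', rfl⟩, ?_⟩
    split_ifs with h2
    · exact (hw e' he' h2).2
    · exact .refl _ _

lemma exists_wider_assocOf {k : ℕ} {L : List (ℕ × Vec)} (hL : ∀ i ∈ L, i.2.length = k) :
    ∀ i ∈ L, ∃ e ∈ assocOf L, Wider k i e := by
  suffices ∀ A : Assoc, (∀ e ∈ A, e.2.length = k) → (∀ i ∈ L, ∃ e ∈ L.foldl insTy A, Wider k i e) ∧
      ∀ e ∈ A, ∃ e' ∈ L.foldl insTy A, Wider k e e' from (this [] (by simp)).1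
  induction L with
  | nil => exact fun A _ => ⟨by simp, fun e he => ⟨e, he, .refl _ _⟩⟩
  | cons i L ih =>
    intro A hA
    have hi := hL i (by simp)
    have ⟨h1, h2⟩ := ih (fun j hj => hL j (by simp [hj])) (insTy A i)
      (insTy_of (fun e => e.2.length = k) (fun i e h h' _ => by simp [mergeVec, h, h']) hA hi)
    have ⟨h3, h4⟩ := exists_wider_insTy hA hi
    refine ⟨fun j hj => ?_, fun e he => ?_⟩
    · rcases mem_cons.1 hj with rfl | hj
      · have ⟨e, he, h5⟩ := h3
        have ⟨e', he', h6⟩ := h2 e he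
        exact ⟨e', he', h5.trans h6⟩
      · exact h1 j hj
    · have ⟨e', he', h5⟩ := h4 e he
      have ⟨e'', he'', h6⟩ := h2 e' he'
      exact ⟨e'', he'', h5.trans h6⟩

lemma AssocGood.assocOf (hc : 0 ≤ c) {V : Finset (Fin n)} {θ : Sets n → ℕ}
    {L : Assoc} {W : Sets n} (h : AssocGood E ws c V θ L W) :
    AssocGood E ws c V θ (assocOf L) W where
  len := assocOf_of (fun e => e.2.length = E.terms₂.length)
    (fun i e h h' _ => by simp [mergeVec, h, h']) h.len
  cover Z hZ hW := by
    obtain ⟨i, hi, h1, h2⟩ := h.cover Z hZ hW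
    obtain ⟨e, he, h3, h4⟩ := exists_wider_assocOf h.len i hi
    exact ⟨e, he, h3.trans h1, fun t ht => ⟨(h4 t ht).1.trans (h2 t ht).1,
      (h2 t ht).2.mono_right (h4 t ht).2 hc⟩⟩
  lower := fun e he => (assocOf_of (fun e => e.2.length = E.terms₂.length ∧
      ∀ t < E.terms₂.length, ∃ Z, (∀ i, Z i ⊆ V) ∧ (∀ i < E.numX, Z i = W i) ∧
        θ Z = e.1 ∧ UpTo E c (linSet ws (E.terms₂.getD t []) Z) (e.2.getD t 0).1)
      (fun i e h h' h1 => ⟨by simp [mergeVec, h.1, h'.1], fun t ht => by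
        rw [getD_mergeVec h.1 h'.1 ht]
        rcases min_choice (i.2.getD t 0).1 (e.2.getD t 0).1 with h2 | h2 <;> rw [h2]
        · exact h.2 t ht
        · rw [← h1]; exact h'.2 t ht⟩) (fun i hi => ⟨h.len i hi, h.lower i hi⟩) e he).2
  upper := fun e he => (assocOf_of (fun e => e.2.length = E.terms₂.length ∧
      ∀ t < E.terms₂.length, ∃ Z, (∀ i, Z i ⊆ V) ∧ (∀ i < E.numX, Z i = W i) ∧
        θ Z = e.1 ∧ (e.2.getD t 0).2 ≤ linSet ws (E.terms₂.getD t []) Z)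
      (fun i e h h' h1 => ⟨by simp [mergeVec, h.1, h'.1], fun t ht => by
        rw [getD_mergeVec h.1 h'.1 ht]
        rcases max_choice (i.2.getD t 0).2 (e.2.getD t 0).2 with h2 | h2 <;> rw [h2]
        · exact h.2 t ht
        · rw [← h1]; exact h'.2 t ht⟩) (fun i hi => ⟨h.len i hi, h.upper i hi⟩) e he).2

lemma AssocGood.mono {c' : ℝ} (hc : c ≤ c') {V : Finset (Fin n)}
    {θ : Sets n → ℕ} {A : Assoc} {W : Sets n}
    (h : AssocGood E ws c V θ A W) : AssocGood E ws c' V θ A W where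
  len := h.len
  cover Z hZ hW := by
    have ⟨e, he, h1, h2⟩ := h.cover Z hZ hW
    exact ⟨e, he, h1, fun t ht => ⟨(h2 t ht).1, (h2 t ht).2.mono hc⟩⟩
  lower e he t ht := by
    have ⟨Z, h1, h2, h3, h4⟩ := h.lower e he t ht
    exact ⟨Z, h1, h2, h3, h4.mono hc⟩
  upper := h.upper

/-- The types of tuples are determined by the types of their restrictions to `V₁` and `V₂`. -/
structure IsComb (p : Params) (op : Op) (V V₁ V₂ : Finset (Fin n))
    (θ θ₁ θ₂ : Sets n → ℕ) : Prop where
  verts : V = V₁ ∪ V₂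
  disj : Disjoint V₁ V₂
  ty : ∀ Z, (∀ i, Z i ⊆ V) → θ Z =
    comb p op p.2.2.1 (θ₁ fun i => Z i ∩ V₁) (θ₂ fun i => Z i ∩ V₂)

section Comb

variable {op : Op} {V V₁ V₂ : Finset (Fin n)} {θ θ₁ θ₂ : Sets n → ℕ}

lemma IsComb.inter_union (h : IsComb E.par op V V₁ V₂ θ θ₁ θ₂) {U : Finset (Fin n)} (hU : U ⊆ V) :
    (U ∩ V₁) ∪ (U ∩ V₂) = U := by
  rw [← Finset.inter_union_distrib_left, ← h.verts, Finset.inter_eq_left.2 hU]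

lemma IsComb.union_inter_left (h : IsComb E.par op V V₁ V₂ θ θ₁ θ₂) {U₁ U₂ : Finset (Fin n)}
    (h₁ : U₁ ⊆ V₁) (h₂ : U₂ ⊆ V₂) : (U₁ ∪ U₂) ∩ V₁ = U₁ := by
  rw [Finset.union_inter_distrib_right, Finset.inter_eq_left.2 h₁,
    Finset.disjoint_iff_inter_eq_empty.1 (h.disj.symm.mono_left h₂), Finset.union_empty]

lemma IsComb.union_inter_right (h : IsComb E.par op V V₁ V₂ θ θ₁ θ₂) {U₁ U₂ : Finset (Fin n)}
    (h₁ : U₁ ⊆ V₁) (h₂ : U₂ ⊆ V₂) : (U₁ ∪ U₂) ∩ V₂ = U₂ := by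
  rw [Finset.union_inter_distrib_right, Finset.inter_eq_left.2 h₂,
    Finset.disjoint_iff_inter_eq_empty.1 (h.disj.mono_left h₁), Finset.empty_union]

lemma IsComb.union_subset (h : IsComb E.par op V V₁ V₂ θ θ₁ θ₂) {U₁ U₂ : Finset (Fin n)}
    (h₁ : U₁ ⊆ V₁) (h₂ : U₂ ⊆ V₂) : U₁ ∪ U₂ ⊆ V := by
  rw [h.verts]
  grind

lemma IsComb.ty_union (h : IsComb E.par op V V₁ V₂ θ θ₁ θ₂) {Z₁ Z₂ : Sets n}
    (h₁ : ∀ i, Z₁ i ⊆ V₁) (h₂ : ∀ i, Z₂ i ⊆ V₂) :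
    θ (fun i => Z₁ i ∪ Z₂ i) = comb E.par op E.par.2.2.1 (θ₁ Z₁) (θ₂ Z₂) := by
  rw [h.ty _ fun i => h.union_subset (h₁ i) (h₂ i)]
  congr 2
  · exact funext fun i => h.union_inter_left (h₁ i) (h₂ i)
  · exact funext fun i => h.union_inter_right (h₁ i) (h₂ i)

lemma AssocGood.comb (hr : E.RoundOk α) (hα : 1 ≤ α) (hc : 1 ≤ c)
    (h : IsComb E.par op V V₁ V₂ θ θ₁ θ₂) {A B : Assoc} {W₁ W₂ : Sets n}
    (hW₁ : ∀ i, W₁ i ⊆ V₁) (hW₂ : ∀ i, W₂ i ⊆ V₂)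
    (hA : AssocGood E ws c V₁ θ₁ A W₁) (hB : AssocGood E ws c V₂ θ₂ B W₂) :
    AssocGood E ws (α * c) V θ (combAssoc E op A B) (fun i => W₁ i ∪ W₂ i) := by
  have hc0 : 0 ≤ c := by linarith
  have hget : ∀ e ∈ A, ∀ e' ∈ B, ∀ t < E.terms₂.length, (addVec E e.2 e'.2).getD t 0 =
      (roundCap E.grid E.cap ((e.2.getD t 0).1 + (e'.2.getD t 0).1),
        roundCap E.grid E.cap ((e.2.getD t 0).2 + (e'.2.getD t 0).2)) := fun e he e' he' t ht =>
    getD_zipWith _ (by rw [hA.len e he]; exact ht) (by rw [hB.len e' he']; exact ht) _ _ _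
  refine AssocGood.assocOf (by nlinarith) ⟨fun e he => ?_, fun Z hZ hW => ?_, fun e he t ht => ?_,
    fun e he t ht => ?_⟩
  · obtain ⟨a, ha, b, hb, rfl⟩ := mem_pairsWith.1 he
    simp [addVec, hA.len a ha, hB.len b hb]
  · have ⟨a, ha, h1, h2⟩ := hA.cover (fun i => Z i ∩ V₁) (fun i => Finset.inter_subset_right)
      fun i hi => by rw [hW i hi, h.union_inter_left (hW₁ i) (hW₂ i)]
    have ⟨b, hb, h3, h4⟩ := hB.cover (fun i => Z i ∩ V₂) (fun i => Finset.inter_subset_right)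
      fun i hi => by rw [hW i hi, h.union_inter_right (hW₁ i) (hW₂ i)]
    refine ⟨_, mem_pairsWith.2 ⟨a, ha, b, hb, rfl⟩, ?_, fun t ht => ?_⟩
    · dsimp
      rw [h.ty Z hZ, h1, h3]
    · have e1 : linSet ws (E.terms₂.getD t []) Z = linSet ws (E.terms₂.getD t [])
          (fun i => Z i ∩ V₁) + linSet ws (E.terms₂.getD t []) fun i => Z i ∩ V₂ := by
        rw [← linSet_union h.disj (fun i => Finset.inter_subset_right)
          fun i => Finset.inter_subset_right]
        exact linSet_congr fun i _ => (h.inter_union (hZ i)).symm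
      dsimp
      rw [hget a ha b hb t ht, e1]
      exact ⟨(roundCap_le _ _ _).trans (add_le_add (h2 t ht).1 (h4 t ht).1),
        (h2 t ht).2.add hr (by omega) hc0 (h4 t ht).2⟩
  · obtain ⟨a, ha, b, hb, rfl⟩ := mem_pairsWith.1 he
    have ⟨Z₁, h1, h2, h3, h4⟩ := hA.lower a ha t ht
    have ⟨Z₂, h5, h6, h7, h8⟩ := hB.lower b hb t ht
    refine ⟨fun i => Z₁ i ∪ Z₂ i, fun i => h.union_subset (h1 i) (h5 i), fun i hi =>
      congrArg₂ (· ∪ ·) (h2 i hi) (h6 i hi), by rw [h.ty_union h1 h5, h3, h7], ?_⟩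
    dsimp
    rw [hget a ha b hb t ht, linSet_union h.disj h1 h5]
    exact h4.add hr (by omega) hc0 h8
  · obtain ⟨a, ha, b, hb, rfl⟩ := mem_pairsWith.1 he
    have ⟨Z₁, h1, h2, h3, h4⟩ := hA.upper a ha t ht
    have ⟨Z₂, h5, h6, h7, h8⟩ := hB.upper b hb t ht
    refine ⟨fun i => Z₁ i ∪ Z₂ i, fun i => h.union_subset (h1 i) (h5 i), fun i hi =>
      congrArg₂ (· ∪ ·) (h2 i hi) (h6 i hi), by rw [h.ty_union h1 h5, h3, h7], ?_⟩
    dsimp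
    rw [hget a ha b hb t ht, linSet_union h.disj h1 h5]
    exact (roundCap_le _ _ _).trans (add_le_add h4 h8)

variable (E ws c)

/-- The state describes the tuple `W` of subsets of `V`. -/
structure StateGood (V : Finset (Fin n)) (θ : Sets n → ℕ) (s : State)
    (W : Sets n) : Prop where
  len : s.1.length = E.terms₁.length
  fst : ∀ t < E.terms₁.length, s.1.getD t 0 ≤ linSet ws (E.terms₁.getD t []) W ∧
    UpTo E c (linSet ws (E.terms₁.getD t []) W) (s.1.getD t 0)
  snd : AssocGood E ws c V θ s.2 W

variable {E ws c}

lemma StateGood.mono {c' : ℝ} (hc : c ≤ c') {s : State} {W : Sets n}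
    (h : StateGood E ws c V θ s W) : StateGood E ws c' V θ s W :=
  ⟨h.len, fun t ht => ⟨(h.fst t ht).1, (h.fst t ht).2.mono hc⟩, h.snd.mono hc⟩

lemma StateGood.comb (hr : E.RoundOk α) (hα : 1 ≤ α) (hc : 1 ≤ c)
    (h : IsComb E.par op V V₁ V₂ θ θ₁ θ₂) {s s' : State} {W₁ W₂ : Sets n}
    (hW₁ : ∀ i, W₁ i ⊆ V₁) (hW₂ : ∀ i, W₂ i ⊆ V₂)
    (hs : StateGood E ws c V₁ θ₁ s W₁) (hs' : StateGood E ws c V₂ θ₂ s' W₂) :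
    StateGood E ws (α * c) V θ (combState E op s s') (fun i => W₁ i ∪ W₂ i) where
  len := by simp [combState, hs.len, hs'.len]
  fst t ht := by
    rw [combState, getD_zipWith _ (by rw [hs.len]; exact ht) (by rw [hs'.len]; exact ht) 0 0 0,
      linSet_union h.disj hW₁ hW₂]
    exact ⟨(roundCap_le _ _ _).trans (add_le_add (hs.fst t ht).1 (hs'.fst t ht).1),
      (hs.fst t ht).2.add hr (by omega) (by linarith) (hs'.fst t ht).2⟩
  snd := hs.snd.comb hr hα hc h hW₁ hW₂ hs'.snd

/-- The tree lists the elements of the first `x` sets of a tuple. -/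
def RopeGood (x : ℕ) (r : Rope) (W : Sets n) : Prop :=
  ∀ i < x, ∃ L : List (Fin n), L.Nodup ∧ (∀ u, u ∈ L ↔ u ∈ W i) ∧
    (r.leaves.filter fun e => decide (bit e.2 i = 1)).map Prod.fst = L.map fun u : Fin n => (u : ℕ)

lemma RopeGood.node {x : ℕ} {r r' : Rope} {W₁ W₂ : Sets n} (hd : Disjoint V₁ V₂)
    (hW₁ : ∀ i, W₁ i ⊆ V₁) (hW₂ : ∀ i, W₂ i ⊆ V₂) (h : RopeGood x r W₁) (h' : RopeGood x r' W₂) :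
    RopeGood x (.node r r') fun i => W₁ i ∪ W₂ i := by
  intro i hi
  have ⟨L, h1, h2, h3⟩ := h i hi
  have ⟨L', h4, h5, h6⟩ := h' i hi
  refine ⟨L ++ L', h1.append h4 fun u hu hu' => ?_, fun u => ?_, ?_⟩
  · exact Finset.disjoint_left.1 hd (hW₁ i ((h2 u).1 hu)) (hW₂ i ((h5 u).1 hu'))
  · grind
  · rw [Rope.leaves, filter_append, map_append, map_append, h3, h6]

variable (E ws c)

/-- The entries describe tuples, and for each tuple with small values some entry is as good. -/
structure TableGood (V : Finset (Fin n)) (θ : Sets n → ℕ) (T : Table) : Prop where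
  key : ∀ e ∈ T, e.1 = encode e.2.1
  sound : ∀ e ∈ T, ∃ W, (∀ i, W i ⊆ V) ∧ StateGood E ws c V θ e.2.1 W ∧
    e.2.2.1 = linSet ws E.target W ∧ RopeGood E.numX e.2.2.2 W
  complete : ∀ W, (∀ i, W i ⊆ V) → (∀ t < E.terms₁.length, linSet ws (E.terms₁.getD t []) W < E.cap) →
    ∃ e ∈ T, StateGood E ws c V θ e.2.1 W ∧ linSet ws E.target W ≤ e.2.2.1

variable {E ws c}

lemma TableGood.mono {c' : ℝ} (hc : c ≤ c') {T : Table} (h : TableGood E ws c V θ T) :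
    TableGood E ws c' V θ T where
  key := h.key
  sound e he := by
    have ⟨W, h1, h2, h3⟩ := h.sound e he
    exact ⟨W, h1, h2.mono hc, h3⟩
  complete W hW hl := by
    have ⟨e, he, h1, h2⟩ := h.complete W hW hl
    exact ⟨e, he, h1.mono hc, h2⟩

lemma exists_insEntry {T : Table} {e : Entry} :
    (∃ e' ∈ insEntry T e, e'.1 = e.1 ∧ e.2.2.1 ≤ e'.2.2.1) ∧
      ∀ f ∈ T, ∃ e' ∈ insEntry T e, e'.1 = f.1 ∧ f.2.2.1 ≤ e'.2.2.1 := by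
  unfold insEntry
  split_ifs with h
  · grind
  · rw [all_ne_iff, not_not, mem_map] at h
    have ⟨f, hf, h1⟩ := h
    refine ⟨⟨_, mem_map.2 ⟨f, hf, rfl⟩, ?_⟩, fun f' hf' => ⟨_, mem_map.2 ⟨f', hf', rfl⟩, ?_⟩⟩
    · grind
    · grind

lemma exists_foldl_insEntry (L : List Entry) (T : Table) : (∀ e ∈ L, ∃ e' ∈ L.foldl insEntry T,
    e'.1 = e.1 ∧ e.2.2.1 ≤ e'.2.2.1) ∧ (∀ e ∈ T, ∃ e' ∈ L.foldl insEntry T,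
    e'.1 = e.1 ∧ e.2.2.1 ≤ e'.2.2.1) ∧ ∀ e ∈ L.foldl insEntry T, e ∈ L ∨ e ∈ T := by
  induction L generalizing T with
  | nil => exact ⟨by simp, fun e he => ⟨e, he, rfl, le_rfl⟩, fun e he => .inr he⟩
  | cons i L ih =>
    have ⟨h1, h2, h3⟩ := ih (insEntry T i)
    obtain ⟨h4, h5⟩ := exists_insEntry
    refine ⟨fun e he => ?_, fun e he => ?_, fun e he => ?_⟩
    · rcases mem_cons.1 he with rfl | he
      · obtain ⟨e', he', h6, h7⟩ := h4
        obtain ⟨e'', he'', h8, h9⟩ := h2 e' he'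
        exact ⟨e'', he'', h8.trans h6, h7.trans h9⟩
      · exact h1 e he
    · obtain ⟨e', he', h6, h7⟩ := h5 e he
      obtain ⟨e'', he'', h8, h9⟩ := h2 e' he'
      exact ⟨e'', he'', h8.trans h6, h7.trans h9⟩
    · rcases h3 e he with h | h
      · grind
      · rcases mem_insEntry h with rfl | h
        · simp
        · grind

lemma TableGood.comb (hr : E.RoundOk α) (hα : 1 ≤ α) (hc : 1 ≤ c)
    (h : IsComb E.par op V V₁ V₂ θ θ₁ θ₂) {S S' : Table}
    (hS : TableGood E ws c V₁ θ₁ S) (hS' : TableGood E ws c V₂ θ₂ S') :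
    TableGood E ws (α * c) V θ (combTable E op S S') := by
  obtain ⟨h1, -, h3⟩ := exists_foldl_insEntry ((pairsWith (fun e e' : Entry =>
    mkEntry (combState E op e.2.1 e'.2.1) (e.2.2.1 + e'.2.2.1) (Rope.node e.2.2.2 e'.2.2.2))
    S S').filter fun e => e.2.1.1.all fun a => decide (a < E.cap)) []
  have key : ∀ e ∈ combTable E op S S', e.1 = encode e.2.1 := fun e he => by
    obtain ⟨a, ha, b, hb, rfl⟩ := mem_pairsWith.1 (mem_filter.1
      ((h3 e he).resolve_right (by simp))).1
    rfl
  refine ⟨key, fun e he => ?_, fun W hW hl => ?_⟩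
  · obtain ⟨a, ha, b, hb, rfl⟩ := mem_pairsWith.1 (mem_filter.1
      ((h3 e he).resolve_right (by simp))).1
    have ⟨W₁, h4, h5, h6, h7⟩ := hS.sound a ha
    have ⟨W₂, h8, h9, h10, h11⟩ := hS'.sound b hb
    refine ⟨fun i => W₁ i ∪ W₂ i, fun i => h.union_subset (h4 i) (h8 i),
      h5.comb hr hα hc h h4 h8 h9, ?_, h7.node h.disj h4 h8 h11⟩
    rw [linSet_union h.disj h4 h8, ← h6, ← h10]
    rfl
  · have hsub : ∀ U : Finset (Fin n), ∀ i, W i ∩ U ⊆ U := fun U i => Finset.inter_subset_right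
    have hlt : ∀ U : Finset (Fin n), ∀ t < E.terms₁.length,
        linSet ws (E.terms₁.getD t []) (fun i => W i ∩ U) < E.cap := fun U t ht =>
      (linSet_mono fun i => Finset.inter_subset_left).trans_lt (hl t ht)
    have ⟨a, ha, h4, h5⟩ := hS.complete (fun i => W i ∩ V₁) (hsub V₁) (hlt V₁)
    have ⟨b, hb, h6, h7⟩ := hS'.complete (fun i => W i ∩ V₂) (hsub V₂) (hlt V₂)
    have hWe := funext fun i => (h.inter_union (hW i)).symm
    have h8 := h4.comb hr hα hc h (hsub V₁) (hsub V₂) h6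
    rw [← hWe] at h8
    have ⟨e, he, h9, h10⟩ := h1 (mkEntry (combState E op a.2.1 b.2.1) (a.2.2.1 + b.2.2.1)
      (Rope.node a.2.2.2 b.2.2.2)) (mem_filter.2 ⟨mem_pairsWith.2 ⟨a, ha, b, hb, rfl⟩, by
        rw [all_eq_true]
        intro s hs
        obtain ⟨t, ht, rfl⟩ := mem_iff_getElem.1 hs
        have ht' : t < E.terms₁.length := by
          have := h8.len
          rw [← this]
          exact ht
        have := (h8.fst t ht').1.trans_lt (hl t ht')
        rw [getD_eq_getElem _ _ (show t < (combState E op a.2.1 b.2.1).1.length from ht)] at this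
        exact decide_eq_true this⟩)
    refine ⟨e, he, ?_, ?_⟩
    · have h11 := (key e he).symm.trans h9
      have h12 := Encodable.encode_injective h11
      grind
    · have h11 : linSet ws E.target W = linSet ws E.target (fun i => W i ∩ V₁) +
          linSet ws E.target (fun i => W i ∩ V₂) := by
        rw [← linSet_union h.disj (hsub V₁) (hsub V₂), ← hWe]
      rw [h11]
      exact (add_le_add h5 h7).trans h10

lemma tableGood_trivialTable (hc : 1 ≤ c) :
    TableGood E ws c ∅ (fun _ => 0) (trivialTable E) := by
  have hst : ∀ W : Sets n, (∀ i, W i ⊆ ∅) → StateGood E ws c ∅ (fun _ => 0)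
      (E.terms₁.map fun _ => 0, [(0, E.terms₂.map fun _ => (0, 0))]) W := by
    intro W hW
    obtain rfl : W = fun _ => ∅ := funext fun i => Finset.subset_empty.1 (hW i)
    have h0 : ∀ t, ((E.terms₂.map fun _ => (0, 0)) : Vec).getD t 0 = 0 := fun t => by
      by_cases ht : t < E.terms₂.length
      · simp_all
      · grind
    refine ⟨by simp, fun t ht => ?_, by simp, fun Z hZ _ => ⟨_, mem_singleton.2 rfl, rfl,
      fun t ht => ?_⟩, fun e he t ht => ⟨fun _ => ∅, fun _ => by simp, fun _ _ => rfl, ?_⟩,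
      fun e he t ht => ⟨fun _ => ∅, fun _ => by simp, fun _ _ => rfl, ?_⟩⟩
    · rw [getD_map _ ht [], linSet_empty]
      exact ⟨le_rfl, upTo_self hc 0⟩
    · obtain rfl : Z = fun _ => ∅ := funext fun i => Finset.subset_empty.1 (hZ i)
      dsimp
      rw [h0, linSet_empty]
      exact ⟨le_rfl, upTo_self hc 0⟩
    · rw [mem_singleton.1 he]
      dsimp
      rw [h0, linSet_empty]
      exact ⟨rfl, upTo_self hc 0⟩
    · grind
  refine ⟨(tableOk_trivialTable E).key, fun e he => ?_, fun W hW _ => ?_⟩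
  · rw [trivialTable, mem_singleton] at he
    subst he
    refine ⟨fun _ => ∅, fun _ => le_rfl, hst _ fun _ => le_rfl, linSet_empty.symm, fun i _ =>
      ⟨[], by simp, by simp, ?_⟩⟩
    simp [mkEntry, Rope.leaves, bit]
  · refine ⟨_, mem_singleton.2 rfl, hst W hW, ?_⟩
    obtain rfl : W = fun _ => ∅ := funext fun i => Finset.subset_empty.1 (hW i)
    rw [linSet_empty]
    aesop

lemma mod_two_pow_eq {m m' x : ℕ} (hm : m < 2 ^ x)
    (h : ∀ i < x, m'.testBit i = true ↔ m.testBit i = true) : m' % 2 ^ x = m := by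
  refine Nat.eq_of_testBit_eq fun i => ?_
  rw [Nat.testBit_mod_two_pow]
  by_cases hi : i < x
  · grind
  · rw [Nat.testBit_lt_two_pow (hm.trans_le (Nat.pow_le_pow_right two_pos (not_lt.1 hi)))]
    grind

/-- The code of the indices of those sets that contain a vertex. -/
def maskOf (l : ℕ) (v : Fin n) (Z : Sets n) : ℕ :=
  setCode ((range l).filter fun i => decide (v ∈ Z i))

lemma testBit_maskOf {l : ℕ} {v : Fin n} {Z : Sets n} {i : ℕ} :
    (maskOf l v Z).testBit i = true ↔ i < l ∧ v ∈ Z i := by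
  rw [maskOf, testBit_setCode]
  simp

lemma maskOf_lt {l : ℕ} {v : Fin n} {Z : Sets n} : maskOf l v Z < 2 ^ l :=
  setCode_lt fun i hi => mem_range.1 (mem_filter.1 hi).1

def ofMask (v : Fin n) (m : ℕ) (i : ℕ) : Finset (Fin n) := if bit m i = 1 then {v} else ∅

lemma eq_ofMask {l : ℕ} {v : Fin n} {Z : Sets n} (hZ : ∀ i, Z i ⊆ {v}) {i : ℕ}
    (hi : i < l) : Z i = ofMask v (maskOf l v Z) i := by
  unfold ofMask
  split_ifs with h
  · rw [bit_eq_one, testBit_maskOf] at h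
    grind
  · rw [bit_eq_one, testBit_maskOf] at h
    grind

lemma ofMask_subset (v : Fin n) (m i : ℕ) : ofMask v m i ⊆ {v} := by
  unfold ofMask
  grind

lemma mem_ofMask {v : Fin n} {m i : ℕ} : v ∈ ofMask v m i ↔ m.testBit i = true := by
  rw [ofMask, ← bit_eq_one]
  grind

section Leaf

variable {v : Fin n} {lab : ℕ} {colors : List ℕ}

lemma assocGood_leafAssoc (hc : 1 ≤ c) (hx : E.numX ≤ E.par.2.2.2)
    (h₂ : ∀ cs ∈ E.terms₂, cs.length ≤ E.par.2.2.2)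
    (hθ : ∀ m Z, (∀ i < E.par.2.2.2, Z i = ofMask v m i) →
      θ Z = leafType E.par lab (colorMask E.colors colors) m) {m : ℕ} (hm : m < 2 ^ E.numX)
    {W : Sets n} (hW : ∀ i < E.numX, W i = ofMask v m i) :
    AssocGood E ws c {v} θ (leafAssoc E (lab, v, colors, ws v) m) W := by
  have hget : ∀ m' t, t < E.terms₂.length → (E.terms₂.map fun cs =>
      (linMask cs (ws v) m', linMask cs (ws v) m')).getD t 0 =
      (linMask (E.terms₂.getD t []) (ws v) m', linMask (E.terms₂.getD t []) (ws v) m') :=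
    fun m' t ht => getD_map _ ht _ _
  have hlin : ∀ m' Z, (∀ i < E.par.2.2.2, Z i = ofMask v m' i) → ∀ t < E.terms₂.length,
      linMask (E.terms₂.getD t []) (ws v) m' = linSet ws (E.terms₂.getD t []) Z :=
    fun m' Z hZ t ht => linMask_eq_linSet _ fun i hi => hZ i (hi.trans_le (h₂ _ (by
      rw [getD_eq_getElem _ _ ht]
      exact getElem_mem ht)))
  have hext : ∀ m', m' % 2 ^ E.numX = m → ∀ i < E.numX, ofMask v m' i = W i := by
    rintro m' rfl i hi
    rw [hW i hi, ofMask, ofMask]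
    refine if_congr ?_ rfl rfl
    rw [bit_eq_one, bit_eq_one, Nat.testBit_mod_two_pow, decide_eq_true hi, Bool.true_and]
  refine AssocGood.assocOf (by linarith) ⟨fun e he => ?_, fun Z hZ hZW => ?_, fun e he t ht => ?_,
    fun e he t ht => ?_⟩
  · grind
  · have hZm : ∀ i < E.par.2.2.2, Z i = ofMask v (maskOf E.par.2.2.2 v Z) i :=
      fun i hi => eq_ofMask hZ hi
    refine ⟨_, mem_map.2 ⟨maskOf E.par.2.2.2 v Z, mem_filter.2 ⟨mem_range.2 maskOf_lt,
      decide_eq_true (mod_two_pow_eq hm fun i hi => ?_)⟩, rfl⟩, (hθ _ Z hZm).symm, fun t ht => ?_⟩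
    · rw [testBit_maskOf, hZW i hi, hW i hi, mem_ofMask]
      grind
    · dsimp
      rw [hget _ t ht, hlin _ Z hZm t ht]
      exact ⟨le_rfl, upTo_self hc _⟩
  · obtain ⟨m', hm', rfl⟩ := mem_map.1 he
    refine ⟨ofMask v m', ofMask_subset v m', hext m' (of_decide_eq_true (mem_filter.1 hm').2),
      hθ _ _ fun _ _ => rfl, ?_⟩
    dsimp
    rw [hget _ t ht, hlin _ _ (fun _ _ => rfl) t ht]
    exact upTo_self hc _
  · obtain ⟨m', hm', rfl⟩ := mem_map.1 he
    refine ⟨ofMask v m', ofMask_subset v m', hext m' (of_decide_eq_true (mem_filter.1 hm').2),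
      hθ _ _ fun _ _ => rfl, ?_⟩
    grind

lemma tableGood_leafTable (hc : 1 ≤ c) (hx : E.numX ≤ E.par.2.2.2)
    (h₁ : ∀ cs ∈ E.terms₁, cs.length ≤ E.numX) (h₂ : ∀ cs ∈ E.terms₂, cs.length ≤ E.par.2.2.2)
    (ht : E.target.length ≤ E.numX)
    (hθ : ∀ m Z, (∀ i < E.par.2.2.2, Z i = ofMask v m i) →
      θ Z = leafType E.par lab (colorMask E.colors colors) m) :
    TableGood E ws c {v} θ (leafTable E (lab, v, colors, ws v)) := by
  have hst : ∀ m < 2 ^ E.numX, ∀ W : Sets n, (∀ i < E.numX, W i = ofMask v m i) →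
      StateGood E ws c {v} θ (E.terms₁.map fun cs => linMask cs (ws v) m,
        leafAssoc E (lab, v, colors, ws v) m) W ∧ linMask E.target (ws v) m = linSet ws E.target W := by
    intro m hm W hW
    refine ⟨⟨by simp, fun t ht => ?_, assocGood_leafAssoc hc hx h₂ hθ hm hW⟩,
      linMask_eq_linSet _ fun i hi => hW i (hi.trans_le ht)⟩
    rw [getD_map _ ht [], linMask_eq_linSet _ fun i hi => hW i (hi.trans_le (h₁ _ (by
      rw [getD_eq_getElem _ _ ht]
      exact getElem_mem ht)))]
    exact ⟨le_rfl, upTo_self hc _⟩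
  refine ⟨fun e he => ?_, fun e he => ?_, fun W hW _ => ?_⟩
  · obtain ⟨m, _, rfl⟩ := mem_map.1 he
    rfl
  · obtain ⟨m, hm, rfl⟩ := mem_map.1 he
    have ⟨h1, h2⟩ := hst m (mem_range.1 hm) (ofMask v m) fun _ _ => rfl
    refine ⟨ofMask v m, ofMask_subset v m, h1, h2, fun i _ => ?_⟩
    by_cases h : bit m i = 1
    · exact ⟨[v], by simp, fun u => by simp [ofMask, h], by simp [mkEntry, Rope.leaves, h]⟩
    · exact ⟨[], by simp, fun u => by simp [ofMask, h], by simp [mkEntry, Rope.leaves, h]⟩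
  · have ⟨h1, h2⟩ := hst _ maskOf_lt W fun i hi => eq_ofMask hW hi
    exact ⟨_, mem_map.2 ⟨_, mem_range.2 maskOf_lt, rfl⟩, h1, h2.symm.le⟩

end Leaf

end Comb

end Correct

/-! ### Expressions and labelled graphs -/

namespace KExpr

variable {k n wt : ℕ}

def labelNum : Option (Fin k) → ℕ
  | none => 0
  | some i => i + 1

lemma labelNum_le (i : Option (Fin k)) : labelNum i ≤ k := by
  cases i with
  | none => exact Nat.zero_le _
  | some i => exact i.2

lemma labelNum_eq {o : Option (Fin k)} {i : Fin k} : labelNum o = i + 1 ↔ o = some i := by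
  cases o with
  | none => simp [labelNum]
  | some j => simp [labelNum, Fin.ext_iff]

def colorList (σ : Signature) (G : WGraph wt n) (v : Fin n) : List ℕ :=
  σ.rels.filterMap fun
    | .color c => if v ∈ G.color c then some c else none
    | _ => none

def weightList (G : WGraph wt n) (v : Fin n) : List ℕ := (finRange wt).map fun i => G.weight i v

variable (σ : Signature) (G : WGraph wt n)

def toD : KExpr k n → DExpr
  | .vertex v i => .vertex (labelNum i, v, colorList σ G v, weightList G v)
  | .union a b => .union a.toD b.toD
  | .relabel i j a => .op (2, i + 1, j + 1) a.toD
  | .join i j _ a => .op (3, i + 1, j + 1) a.toD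

lemma toD_ok (χ : KExpr k n) : (χ.toD σ G).Ok := by
  induction χ with
  | vertex => trivial
  | union a b iha ihb => exact ⟨iha, ihb⟩
  | relabel i j a ih => exact ⟨le_rfl, ih⟩
  | join i j h a ih => exact ⟨show 2 ≤ 3 by omega, ih⟩

lemma size_toD (χ : KExpr k n) : (χ.toD σ G).size = χ.size := by
  induction χ with
  | vertex => rfl
  | union a b iha ihb => simp [toD, DExpr.size, KExpr.size, iha, ihb]
  | relabel i j a ih => simp [toD, DExpr.size, KExpr.size, ih]
  | join i j h a ih => simp [toD, DExpr.size, KExpr.size, ih]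

lemma enc_toD (χ : KExpr k n) : enc (χ.toD σ G) = Val.ofExpr σ G χ := by
  induction χ with
  | vertex v i =>
    have h1 : enc (labelNum i) = Val.ofLabel i := by cases i <;> rfl
    have h2 : enc (colorList σ G v, weightList G v) = Val.pair
        (Val.ofList (σ.rels.filterMap fun
          | .color c => if v ∈ G.color c then some (Val.ofNat c) else none
          | _ => none)) (Val.ofList ((finRange wt).map fun i => Val.ofNat (G.weight i v))) := by
      rw [enc_prod]
      refine congrArg₂ Val.pair ?_ ?_
      · change Val.ofList ((colorList σ G v).map enc) = _
        rw [colorList, map_filterMap]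
        congr 2
        funext r
        cases r with
        | edge => rfl
        | color c => dsimp only; split_ifs <;> rfl
        | card a r => rfl
      · change Val.ofList ((weightList G v).map enc) = _
        rw [weightList, map_map]
        rfl
    change Val.pair _ (Val.pair (enc (labelNum i)) (Val.pair (enc (v : ℕ))
      (enc (colorList σ G v, weightList G v)))) = _
    rw [h1, h2]
    rfl
  | union a b iha ihb =>
    change Val.pair _ (Val.pair (enc (a.toD σ G)) (enc (b.toD σ G))) = _
    rw [iha, ihb]
    rfl
  | relabel i j a ih =>
    change Val.pair _ (Val.pair _ (enc (a.toD σ G))) = _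
    rw [ih]
    rfl
  | join i j h a ih =>
    change Val.pair _ (Val.pair _ (enc (a.toD σ G))) = _
    rw [ih]
    rfl

lemma bounded_toD (q l : ℕ) (χ : KExpr k n) : (χ.toD σ G).Bounded (σ.size, k, q, l) := by
  induction χ with
  | vertex v i =>
    exact ⟨labelNum_le i, (length_filterMap_le _ _).trans σ.length_le_size⟩
  | union a b iha ihb => exact ⟨iha, ihb⟩
  | relabel i j a ih => exact ⟨⟨show 2 ≤ 3 by omega, i.2, j.2⟩, ih⟩
  | join i j h a ih => exact ⟨⟨le_rfl, i.2, j.2⟩, ih⟩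

def toLGraph : KExpr k n → LGraph n
  | .vertex v i => LGraph.single v (labelNum i)
  | .union a b => a.toLGraph.union b.toLGraph
  | .relabel i j a => a.toLGraph.relabel (i + 1) (j + 1)
  | .join i j _ a => a.toLGraph.join (i + 1) (j + 1)

lemma mem_verts {χ : KExpr k n} {v : Fin n} : v ∈ χ.toLGraph.verts ↔ v ∈ χ.leaves := by
  induction χ with
  | vertex u i => simp [toLGraph, LGraph.single, leaves]
  | union a b iha ihb => simp [toLGraph, LGraph.union, leaves, iha, ihb]
  | relabel i j a ih => exact ih
  | join i j h a ih => exact ih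

lemma lab_eq (χ : KExpr k n) (v : Fin n) : χ.toLGraph.lab v = labelNum (χ.label v) := by
  induction χ with
  | vertex u i =>
    simp only [toLGraph, LGraph.single, label]
    split_ifs <;> rfl
  | union a b iha ihb =>
    simp only [toLGraph, LGraph.union, label, mem_verts, iha, ihb]
    split_ifs <;> rfl
  | relabel i j a ih =>
    simp only [toLGraph, LGraph.relabel, label, ih]
    cases h : a.label v with
    | none => simp [labelNum]
    | some l =>
      simp only [labelNum, Option.map_some, add_left_inj, ← Fin.ext_iff]
      split_ifs <;> rfl
  | join i j h a ih => exact ih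

lemma label_eq_none {χ : KExpr k n} {v : Fin n} (h : v ∉ χ.leaves) : χ.label v = none := by
  induction χ with
  | vertex u i => simp only [leaves, mem_singleton] at h; simp [label, h]
  | union a b iha ihb =>
    simp only [leaves, mem_append, not_or] at h
    simp [label, h.1, ihb h.2]
  | relabel i j a ih => simp [label, ih h]
  | join i j hij a ih => exact ih h

lemma adj_iff (χ : KExpr k n) (u v : Fin n) : χ.Adj u v ↔ 0 < χ.toLGraph.mult u v := by
  induction χ with
  | vertex w i => simp [Adj, toLGraph, LGraph.single]
  | union a b iha ihb => simp only [Adj, toLGraph, LGraph.union, iha, ihb]; omega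
  | relabel i j a ih => exact ih
  | join i j h a ih =>
    simp only [Adj, toLGraph, LGraph.join, ih, lab_eq, labelNum_eq]
    split_ifs <;> simp_all

lemma proper (χ : KExpr k n) : χ.toLGraph.Proper := by
  induction χ with
  | vertex w i => intro a b h; exact absurd rfl h
  | union a b iha ihb =>
    intro u v h
    simp only [toLGraph, LGraph.union, ne_eq, Nat.add_eq_zero_iff, not_and_or,
      Finset.mem_union] at h ⊢
    rcases h with h | h
    · exact ⟨Or.inl (iha u v h).1, Or.inl (iha u v h).2⟩
    · exact ⟨Or.inr (ihb u v h).1, Or.inr (ihb u v h).2⟩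
  | relabel i j a ih => exact ih
  | join i j hij a ih =>
    intro u v h
    have hmem : ∀ w l, a.label w = some l → w ∈ a.toLGraph.verts := fun w l hw => by
      by_contra hn
      rw [mem_verts] at hn
      rw [label_eq_none hn] at hw
      exact absurd hw (by simp)
    simp only [toLGraph, LGraph.join, lab_eq, labelNum_eq] at h ⊢
    by_cases h1 : a.label u = some i ∧ a.label v = some j
    · exact ⟨hmem _ _ h1.1, hmem _ _ h1.2⟩
    · by_cases h2 : a.label u = some j ∧ a.label v = some i
      · exact ⟨hmem _ _ h2.1, hmem _ _ h2.2⟩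
      · simp only [h1, h2, if_false, add_zero] at h
        exact ih u v h

end KExpr

/-- The codes of the colors at the positions of a signature. -/
def Rel.colorCode : Rel → ℕ
  | .color c => c + 1
  | _ => 0

/-- The sets of the vertices that have the colors at the positions of a signature. -/
def WGraph.colorSet {wt n : ℕ} (G : WGraph wt n) (σ : Signature) (t : ℕ) : Finset (Fin n) :=
  match σ.rels[t]? with
  | some (.color c) => G.color c
  | _ => ∅

section Tree

variable {k n wt : ℕ} {σ : Signature} {G : WGraph wt n}

lemma KExpr.presents {χ : KExpr k n} (h : χ.Builds G.graph) :
    χ.toLGraph.Presents σ (G.colorSet σ) G where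
  pos := by
    have : χ.leaves ≠ [] := by
      clear h
      induction χ with
      | vertex => simp [KExpr.leaves]
      | union a b iha _ => simp [KExpr.leaves, iha]
      | relabel i j a ih => exact ih
      | join i j _ a ih => exact ih
    obtain ⟨v, _⟩ := exists_mem_of_ne_nil _ this
    exact v.pos
  verts := by
    ext v
    simp [KExpr.mem_verts, h.2.1 v]
  adj u v := (h.2.2 u v).trans (χ.adj_iff u v)
  color t ht c hc := by
    simp [WGraph.colorSet, getElem?_eq_getElem ht, hc]

lemma mem_colorList {c : ℕ} {v : Fin n} :
    c ∈ KExpr.colorList σ G v ↔ Rel.color c ∈ σ.rels ∧ v ∈ G.color c := by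
  simp only [KExpr.colorList, mem_filterMap]
  constructor
  · rintro ⟨r, hr, h⟩
    cases r with
    | edge => exact absurd h (by simp)
    | color d =>
      dsimp only at h
      split_ifs at h with h1
      obtain rfl : d = c := by simpa using h
      exact ⟨hr, h1⟩
    | card a r => exact absurd h (by simp)
  · rintro ⟨h, h1⟩
    exact ⟨_, h, by simp [h1]⟩

lemma bit_colorMask (cl colors : List ℕ) (t : ℕ) : bit (colorMask cl colors) t =
    if h : t < cl.length then (if ∃ d ∈ colors, d + 1 = cl[t] then 1 else 0) else 0 := by
  induction cl generalizing t with
  | nil => simp [colorMask, bit]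
  | cons c cl ih =>
    have h1 : colorMask (c :: cl) colors = 2 * colorMask cl colors +
        if ∃ d ∈ colors, d + 1 = c then 1 else 0 := by
      change 2 * colorMask cl colors + _ = _
      congr 1
      by_cases h : ∃ d ∈ colors, d + 1 = c
      · rw [if_pos h, if_neg]
        simpa [all_eq_true] using h
      · rw [if_neg h, if_pos]
        simpa [all_eq_true] using h
    have h2 : ∀ e, e ≤ 1 → (2 * colorMask cl colors + e) / 2 = colorMask cl colors := by omega
    cases t with
    | zero =>
      rw [bit, pow_zero, Nat.div_one, h1]
      simp only [length_cons, Nat.succ_pos, dite_true, getElem_cons_zero]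
      split_ifs <;> omega
    | succ t =>
      have h3 : bit (colorMask (c :: cl) colors) (t + 1) = bit (colorMask cl colors) t := by
        rw [bit, bit, pow_succ', ← Nat.div_div_eq_div_mul, h1, h2 _ (by split_ifs <;> omega)]
      rw [h3, ih]
      simp

lemma bit_colorMask_colorList (v : Fin n) (t : ℕ) :
    bit (colorMask (σ.rels.map Rel.colorCode) (KExpr.colorList σ G v)) t =
      if v ∈ G.colorSet σ t then 1 else 0 := by
  rw [bit_colorMask]
  unfold WGraph.colorSet
  by_cases ht : t < σ.rels.length
  · rw [dif_pos (by simpa using ht), getElem?_eq_getElem ht, getElem_map]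
    have hmem := getElem_mem ht
    cases hr : σ.rels[t] with
    | edge => simp [Rel.colorCode]
    | color c =>
      rw [hr] at hmem
      simp [Rel.colorCode, mem_colorList, hmem]
    | card a r => simp [Rel.colorCode]
  · rw [dif_neg (by simpa using ht), getElem?_eq_none (not_lt.1 ht)]
    simp

/-- The type of a tuple of sets in the graph given by an expression. -/
def LGraph.tyOf (S : LGraph n) (p : Params) (col : Sets n)
    (Z : Sets n) : ℕ := S.ty p col p.2.2.1 fun i => Z (i - p.2.2.1)

lemma tableGood_treeTable {E : Env} {α : ℝ} {q l : ℕ} (hp : E.par = (σ.size, k, q, l))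
    (hcol : E.colors = σ.rels.map Rel.colorCode) (hx : E.numX ≤ l)
    (h₁ : ∀ cs ∈ E.terms₁, cs.length ≤ E.numX) (h₂ : ∀ cs ∈ E.terms₂, cs.length ≤ l)
    (ht : E.target.length ≤ E.numX) (hr : E.RoundOk α) (hα : 1 ≤ α) {χ : KExpr k n}
    (hχ : χ.leaves.Nodup) :
    TableGood E (KExpr.weightList G) (α ^ χ.depth) χ.toLGraph.verts
      (χ.toLGraph.tyOf E.par (G.colorSet σ)) (treeTable E (χ.toD σ G)) := by
  have hunary : ∀ (a : KExpr k n) (R : LGraph n) (op : Op), R.verts = a.toLGraph.verts →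
      (∀ Z, R.tyOf E.par (G.colorSet σ) Z =
        comb E.par op E.par.2.2.1 (a.toLGraph.tyOf E.par (G.colorSet σ) Z) 0) →
      IsComb E.par op R.verts a.toLGraph.verts ∅ (R.tyOf E.par (G.colorSet σ))
        (a.toLGraph.tyOf E.par (G.colorSet σ)) fun _ => 0 := by
    intro a R op h1 h2
    refine ⟨by simp [h1], by simp, fun Z hZ => ?_⟩
    rw [h2]
    congr 2
    exact funext fun i => (Finset.inter_eq_left.2 (h1 ▸ hZ i)).symm
  have hk : E.par.2.1 = k := by rw [hp]
  induction χ with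
  | vertex v i =>
    refine tableGood_leafTable (one_le_pow₀ hα) (by rw [hp]; exact hx) h₁ (by rw [hp]; exact h₂) ht
      fun m Z hZ => ?_
    refine LGraph.ty_single (by rw [hk]; exact KExpr.labelNum_le i) (fun t _ => ?_) fun i hi => ?_
    · rw [hcol]
      exact bit_colorMask_colorList v t
    · rw [Nat.add_sub_cancel_left]
      exact hZ i hi
  | union a b iha ihb =>
    obtain ⟨h1, h2, h3⟩ := nodup_append'.1 hχ
    have hc : IsComb E.par (1, 0, 0) (a.union b).toLGraph.verts a.toLGraph.verts b.toLGraph.verts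
        ((a.union b).toLGraph.tyOf E.par (G.colorSet σ)) (a.toLGraph.tyOf E.par (G.colorSet σ))
        (b.toLGraph.tyOf E.par (G.colorSet σ)) := by
      have hd : Disjoint a.toLGraph.verts b.toLGraph.verts := by
        rw [Finset.disjoint_left]
        exact fun v hv hv' => h3 (KExpr.mem_verts.1 hv) (KExpr.mem_verts.1 hv')
      exact ⟨rfl, hd, fun Z hZ => LGraph.ty_union a.proper b.proper hd (fun i => hZ _) _⟩
    have := ((iha h1).mono (pow_le_pow_right₀ hα (le_max_left a.depth b.depth))).comb hr hα
      (one_le_pow₀ hα) hc ((ihb h2).mono (pow_le_pow_right₀ hα (le_max_right a.depth b.depth)))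
    rwa [← pow_succ'] at this
  | relabel i j a ih =>
    have := (ih hχ).comb hr hα (one_le_pow₀ hα) (hunary a ((a.relabel i j).toLGraph)
      (2, i + 1, j + 1) rfl fun Z => LGraph.ty_relabel (by rw [hk]; exact i.2) (by rw [hk]; exact j.2)
        _ _ _) (tableGood_trivialTable (one_le_pow₀ hα))
    rwa [← pow_succ'] at this
  | join i j hij a ih =>
    have := (ih hχ).comb hr hα (one_le_pow₀ hα) (hunary a ((a.join i j hij).toLGraph)
      (3, i + 1, j + 1) rfl fun Z => LGraph.ty_join (by rw [hk]; exact i.2) (by rw [hk]; exact j.2)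
        _ _ _) (tableGood_trivialTable (one_le_pow₀ hα))
    rwa [← pow_succ'] at this

end Tree

/-! ### The numbers to which values are rounded -/

def powFloor (b j : ℕ) : ℕ := (b + 1) ^ j / b ^ j

def powCeil (b j : ℕ) : ℕ := ((b + 1) ^ j + b ^ j - 1) / b ^ j

def powList (b : ℕ) : ℕ → List ℕ
  | 0 => []
  | j + 1 => powFloor b j :: powCeil b j :: powList b j

lemma exists_pow_lt (b M : ℕ) : ∃ j, M * b ^ j < (b + 1) ^ j := by
  rcases Nat.eq_zero_or_pos b with rfl | hb
  · exact ⟨1, by simp⟩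
  · have hb' : (0 : ℝ) < b := Nat.cast_pos.2 hb
    obtain ⟨j, hj⟩ := pow_unbounded_of_one_lt (M : ℝ) (show (1 : ℝ) < ((b : ℝ) + 1) / b by
      rw [lt_div_iff₀ hb']; linarith)
    refine ⟨j, ?_⟩
    rw [div_pow, lt_div_iff₀ (by positivity)] at hj
    exact_mod_cast hj

def powCount (b M : ℕ) : ℕ := Nat.find (exists_pow_lt b M)

abbrev PowState := (ℕ × ℕ) × ℕ × ℕ × List ℕ

def powState (a : ℕ × ℕ) (j : ℕ) : PowState := (a, (a.1 + 1) ^ j, a.1 ^ j, powList a.1 j)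

lemma TM.powList : TM (fun p : ℕ × ℕ => powList p.1 (powCount p.1 p.2))
    (fun p => powCount p.1 p.2) := by
  let p : PowState → Bool := fun s => decide (s.2.1 ≤ s.1.2 * s.2.2.1)
  let f : {s // p s = true} → PowState := fun s => (s.1.1, s.1.2.1 * (s.1.1.1 + 1),
    s.1.2.2.1 * s.1.1.1, s.1.2.1 / s.1.2.2.1 :: (s.1.2.1 + s.1.2.2.1 - 1) / s.1.2.2.1 :: s.1.2.2.2)
  obtain ⟨c, K, hc⟩ := exists_while (p := p) (f := f) (w := fun _ => 0) fp fp
  have hrun : ∀ (a : ℕ × ℕ) t j, j + t = powCount a.1 a.2 →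
      WhileRun p f (fun _ => 0) (powState a j) (powState a (powCount a.1 a.2)) t := by
    intro a t
    induction t with
    | zero =>
      rintro j hj
      rw [Nat.add_zero] at hj
      subst hj
      exact .done (decide_eq_false (not_le.2 (Nat.find_spec (exists_pow_lt a.1 a.2))))
    | succ t ih =>
      intro j hj
      have hj' : j < powCount a.1 a.2 := by omega
      have hp : p (powState a j) = true := _root_.decide_eq_true
        (not_lt.1 (Nat.find_min (exists_pow_lt a.1 a.2) hj'))
      have h1 := WhileRun.step (p := p) (f := f) (w := fun _ => 0) hp (b := powState a (powCount a.1 a.2))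
        (t := t) (ih (j + 1) (by omega))
      convert h1 using 1
      omega
  have h1 : TM (fun s : {s : PowState // ∃ a, s = powState a 0} =>
      powState s.1.1 (powCount s.1.1.1 s.1.1.2)) (fun s => powCount s.1.1.1 s.1.1.2) := by
    refine ⟨c, K, ?_⟩
    rintro ⟨s, a, rfl⟩
    exact hc _ _ _ (hrun a _ 0 (Nat.zero_add _))
  have h2 : TM (fun a : ℕ × ℕ => powState a (powCount a.1 a.2)) (fun a => powCount a.1 a.2) :=
    TM.comp' (f := fun a : ℕ × ℕ => (⟨powState a 0, a, rfl⟩ :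
      {s : PowState // ∃ a, s = powState a 0})) h1 (.subtypeMk (f := fun a : ℕ × ℕ => powState a 0)
      (.prodMk .id' (.const (1, 1, []))) fun a => ⟨a, rfl⟩) .refl
  exact h2.snd.snd.snd

def dedupList (L : List ℕ) : List ℕ :=
  L.foldl (fun s x => if (s.all fun y => !decide (y = x)) = true then x :: s else s) []

lemma dedupList_spec (L : List ℕ) : (dedupList L).Nodup ∧ ∀ x, x ∈ dedupList L ↔ x ∈ L := by
  suffices ∀ s : List ℕ, s.Nodup → (L.foldl (fun s x =>
      if (s.all fun y => !decide (y = x)) = true then x :: s else s) s).Nodup ∧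
      ∀ x, x ∈ L.foldl (fun s x =>
        if (s.all fun y => !decide (y = x)) = true then x :: s else s) s ↔ x ∈ L ∨ x ∈ s from
    ⟨(this [] nodup_nil).1, fun x => ((this [] nodup_nil).2 x).trans (by simp)⟩
  induction L with
  | nil => exact fun s hs => ⟨hs, by simp⟩
  | cons a L ih =>
    intro s hs
    have h := all_ne_iff id s a
    simp only [id, map_id] at h
    rw [foldl_cons]
    by_cases ha : a ∈ s
    · rw [if_neg (by rw [h]; simpa using ha)]
      refine ⟨(ih s hs).1, fun x => ?_⟩
      rw [(ih s hs).2, mem_cons]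
      constructor
      · tauto
      · rintro ((rfl | h1) | h1) <;> tauto
    · rw [if_pos (h.2 ha)]
      have hs' := nodup_cons.2 ⟨ha, hs⟩
      refine ⟨(ih _ hs').1, fun x => ?_⟩
      rw [(ih _ hs').2, mem_cons, mem_cons]
      tauto

lemma TMD.dedupList : TMD (fun _ : List ℕ => True) (fun L => dedupList L)
    (fun L => L.length * ((dedupList L).length + 1)) := by
  refine TMD.foldl (E := fun _ => True) (w := fun q => q.2.1.length) (l := fun L : List ℕ => L)
    (s₀ := fun _ => [])
    (g := fun (_ : List ℕ) s x => if (s.all fun y => !decide (y = x)) = true then x :: s else s)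
    (TM.on' (.ite (TM.decide_eq_true (TM.all (v := fun _ => 0)
      (p := fun (q : List ℕ × List ℕ × ℕ) (y : ℕ) => !decide (y = q.2.2)) fp fp
      (.of_le fun q => by simp))) (TM.cons.comp (.prodMk fp fp)) fp))
    TM.on₀ TM.on₀
    (fun L s => s.Nodup ∧ ∀ y ∈ s, y ∈ L) (fun L => (ApproxMSO.dedupList L).length)
    (fun L _ => by simp) (fun L _ s x hx hs => ⟨?_, trivial, ?_⟩) .refl
  · split_ifs with h
    · have := (all_ne_iff id s x).1 h
      simp only [map_id] at this
      exact ⟨nodup_cons.2 ⟨this, hs.1⟩, fun y hy => by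
        rcases mem_cons.1 hy with rfl | hy
        · exact hx
        · exact hs.2 y hy⟩
    · exact hs
  · exact (subperm_of_subset hs.1 fun y hy => ((dedupList_spec L).2 y).2 (hs.2 y hy)).length_le

/-- The numbers to which numerators of values up to `M` are rounded. -/
def gridList (b M : ℕ) : List ℕ :=
  if M ≤ b then range (M + 1)
  else dedupList (0 :: M :: (powList b (powCount b M)).filter fun e => decide (e ≤ M))

lemma mem_powList {b J x : ℕ} : x ∈ powList b J ↔ ∃ j < J, x = powFloor b j ∨ x = powCeil b j := by
  induction J with
  | zero => simp [powList]
  | succ J ih =>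
    simp only [powList, mem_cons, ih, Nat.lt_succ_iff_lt_or_eq]
    constructor
    · rintro (h | h | ⟨j, hj, h⟩)
      · exact ⟨J, by simp, Or.inl h⟩
      · exact ⟨J, by simp, Or.inr h⟩
      · exact ⟨j, Or.inl hj, h⟩
    · rintro ⟨j, hj | rfl, h⟩
      · exact Or.inr (Or.inr ⟨j, hj, h⟩)
      · tauto

def powBase (b : ℕ) : ℝ := 1 + 1 / (b : ℝ)

section Pow

variable {b : ℕ}

lemma one_lt_powBase (hb : 0 < b) : 1 < powBase b := by
  unfold powBase
  have : (0 : ℝ) < b := Nat.cast_pos.2 hb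
  have : (0 : ℝ) < 1 / (b : ℝ) := by positivity
  linarith

lemma powBase_pow (hb : 0 < b) (j : ℕ) : powBase b ^ j = ((b + 1) ^ j : ℕ) / (b ^ j : ℕ) := by
  have : (0 : ℝ) < b := Nat.cast_pos.2 hb
  rw [powBase, one_add_div this.ne', div_pow]
  push_cast
  ring

lemma powFloor_le (hb : 0 < b) (j : ℕ) : (powFloor b j : ℝ) ≤ powBase b ^ j := by
  rw [powBase_pow hb]
  exact Nat.cast_div_le

lemma lt_powFloor (hb : 0 < b) (j : ℕ) : powBase b ^ j < powFloor b j + 1 := by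
  have hq : 0 < b ^ j := by positivity
  rw [powBase_pow hb, div_lt_iff₀ (by exact_mod_cast hq)]
  have h := Nat.div_add_mod ((b + 1) ^ j) (b ^ j)
  have h2 := Nat.mod_lt ((b + 1) ^ j) hq
  have : (b + 1) ^ j < (powFloor b j + 1) * b ^ j := by
    unfold powFloor
    nlinarith
  exact_mod_cast this

lemma le_powCeil (hb : 0 < b) (j : ℕ) : powBase b ^ j ≤ powCeil b j := by
  have hq : 0 < b ^ j := by positivity
  rw [powBase_pow hb, div_le_iff₀ (by exact_mod_cast hq)]
  have h := Nat.div_add_mod ((b + 1) ^ j + b ^ j - 1) (b ^ j)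
  have h2 := Nat.mod_lt ((b + 1) ^ j + b ^ j - 1) hq
  have : (b + 1) ^ j ≤ powCeil b j * b ^ j := by
    unfold powCeil
    rw [mul_comm]
    omega
  exact_mod_cast this

lemma powCeil_lt (hb : 0 < b) (j : ℕ) : powCeil b j < powBase b ^ j + 1 := by
  have hq : 0 < b ^ j := by positivity
  rw [powBase_pow hb, div_add_one (by exact_mod_cast hq.ne'), lt_div_iff₀ (by exact_mod_cast hq)]
  have h := Nat.div_mul_le_self ((b + 1) ^ j + b ^ j - 1) (b ^ j)
  have : powCeil b j * b ^ j < (b + 1) ^ j + b ^ j := by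
    unfold powCeil
    have : 0 < (b + 1) ^ j := by positivity
    omega
  exact_mod_cast this

lemma powBase_pow_le_iff (hb : 0 < b) {M j : ℕ} : powBase b ^ j ≤ M ↔ j < powCount b M := by
  have key : ∀ j, powBase b ^ j ≤ M ↔ ¬ M * b ^ j < (b + 1) ^ j := fun j => by
    have hq : 0 < b ^ j := by positivity
    rw [powBase_pow hb, div_le_iff₀ (by exact_mod_cast hq), not_lt]
    exact_mod_cast Iff.rfl
  constructor
  · intro h
    by_contra hj
    have h1 := (not_congr (key _)).2 (not_not.2 (Nat.find_spec (exists_pow_lt b M)))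
    exact h1 ((pow_le_pow_right₀ (one_lt_powBase hb).le (not_lt.1 hj)).trans h)
  · exact fun h => (key j).2 (Nat.find_min (exists_pow_lt b M) h)

/-- Small numbers are lower roundings of powers. -/
lemma exists_powFloor_eq (hb : 0 < b) {e : ℕ} (he : 0 < e) (heb : e ≤ b) :
    ∃ j, e = powFloor b j := by
  obtain ⟨j, h1, h2⟩ := exists_nat_pow_near (x := (e : ℝ)) (y := powBase b)
    (by exact_mod_cast he) (one_lt_powBase hb)
  have hb' : (0 : ℝ) < b := Nat.cast_pos.2 hb
  have heb' : (e : ℝ) ≤ b := by exact_mod_cast heb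
  rcases h1.eq_or_lt with h | h
  · refine ⟨j, ?_⟩
    have h3 := powFloor_le hb j
    have h4 := lt_powFloor hb j
    rw [h] at h3 h4
    have h5 : powFloor b j ≤ e := by exact_mod_cast h3
    have h6 : e < powFloor b j + 1 := by exact_mod_cast h4
    omega
  · refine ⟨j + 1, ?_⟩
    have h3 := powFloor_le hb (j + 1)
    have h4 := lt_powFloor hb (j + 1)
    have h7 : powBase b ^ (j + 1) < e + 1 := by
      have h8 : (e : ℝ) * (1 / b) ≤ 1 := by
        rw [mul_one_div, div_le_one hb']; exact heb'
      calc powBase b ^ (j + 1) = powBase b ^ j * (1 + 1 / b) := by rw [pow_succ]; rfl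
        _ < e * (1 + 1 / b) := by gcongr
        _ = e + e * (1 / b) := by ring
        _ ≤ e + 1 := by linarith
    have h5 : powFloor b (j + 1) < e + 1 := by exact_mod_cast h3.trans_lt h7
    have h6 : e < powFloor b (j + 1) + 1 := by exact_mod_cast h2.trans h4
    omega

lemma mem_gridList (hb : 0 < b) {M e : ℕ} : e ∈ gridList b M ↔
    e = 0 ∨ e = M ∨ ∃ j, (e = powFloor b j ∨ e = powCeil b j) ∧ e ≤ M := by
  unfold gridList
  split_ifs with h
  · rw [mem_range]
    constructor
    · intro he
      rcases Nat.eq_zero_or_pos e with h0 | h0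
      · exact Or.inl h0
      · obtain ⟨j, hj⟩ := exists_powFloor_eq hb h0 (show e ≤ b by omega)
        exact Or.inr (Or.inr ⟨j, Or.inl hj, by omega⟩)
    · rintro (rfl | rfl | ⟨j, _, h1⟩) <;> omega
  · rw [(dedupList_spec _).2, mem_cons, mem_cons, mem_filter, mem_powList,
      decide_eq_true_iff]
    refine or_congr_right ?_
    constructor
    · rintro (h1 | ⟨⟨j, _, h1⟩, h2⟩)
      · exact Or.inl h1
      · exact Or.inr ⟨j, h1, h2⟩
    · rintro (h1 | ⟨j, h1, h2⟩)
      · exact Or.inl h1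
      · by_cases hj : j < powCount b M
        · exact Or.inr ⟨⟨j, hj, h1⟩, h2⟩
        · rw [← powBase_pow_le_iff hb, not_le] at hj
          left
          have h4 : M < e + 1 := by
            rcases h1 with rfl | rfl
            · exact_mod_cast hj.trans (lt_powFloor hb j)
            · exact Nat.lt_succ_of_lt (by exact_mod_cast hj.trans_le (le_powCeil hb j))
          omega

lemma le_of_mem_gridList (hb : 0 < b) {M e : ℕ} (h : e ∈ gridList b M) : e ≤ M := by
  rcases (mem_gridList hb).1 h with rfl | rfl | ⟨j, _, h⟩ <;> omega

lemma zero_mem_gridList (hb : 0 < b) (M : ℕ) : 0 ∈ gridList b M := (mem_gridList hb).2 (Or.inl rfl)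

lemma nodup_gridList (b M : ℕ) : (gridList b M).Nodup := by
  unfold gridList
  split_ifs
  · exact nodup_range
  · exact (dedupList_spec _).1

lemma two_le_length_gridList (hb : 0 < b) {M : ℕ} (hM : 0 < M) : 2 ≤ (gridList b M).length :=
  (subperm_of_subset (l₁ := [0, M]) (by simpa using hM.ne) fun e he => by
    simp only [mem_cons, not_mem_nil, or_false] at he
    exact (mem_gridList hb).2 (he.imp_right Or.inl)).length_le

lemma powCount_le (hb : 0 < b) {M : ℕ} (hM : b < M) :
    powCount b M ≤ (gridList b M).length ^ 2 + (gridList b M).length := by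
  have h1 : b + 1 ≤ (gridList b M).length := by
    have := (subperm_of_subset (l₁ := range (b + 1)) (l₂ := gridList b M)
      nodup_range fun e he => ?_).length_le
    · simpa using this
    · have he := mem_range.1 he
      rcases Nat.eq_zero_or_pos e with h0 | h0
      · exact (mem_gridList hb).2 (Or.inl h0)
      · obtain ⟨j, hj⟩ := exists_powFloor_eq hb h0 (show e ≤ b by omega)
        exact (mem_gridList hb).2 (Or.inr (Or.inr ⟨j, Or.inl hj, by omega⟩))
  have hb' : (0 : ℝ) < b := Nat.cast_pos.2 hb
  have h2 : (b : ℝ) ≤ powBase b ^ (b ^ 2) := by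
    have h3 : (2 : ℝ) ≤ powBase b ^ b := by
      have := one_add_mul_le_pow (a := 1 / (b : ℝ)) (by have : (0 : ℝ) ≤ 1 / b := by positivity
                                                        linarith) b
      rw [mul_one_div, div_self hb'.ne'] at this
      unfold powBase
      linarith
    calc (b : ℝ) ≤ (2 : ℝ) ^ b := by exact_mod_cast Nat.lt_two_pow_self.le
      _ ≤ (powBase b ^ b) ^ b := pow_le_pow_left₀ (by norm_num) h3 b
      _ = _ := by rw [← pow_mul, sq]
  have h4 : ∀ i j, i < j → powFloor b (b ^ 2 + i) < powFloor b (b ^ 2 + j) := fun i j hij => by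
    have h5 : powBase b ^ (b ^ 2 + i) + 1 ≤ powBase b ^ (b ^ 2 + j) := by
      have h6 : (b : ℝ) ≤ powBase b ^ (b ^ 2 + i) := h2.trans
        (pow_le_pow_right₀ (one_lt_powBase hb).le (Nat.le_add_right _ _))
      have h7 : powBase b ^ (b ^ 2 + i + 1) ≤ powBase b ^ (b ^ 2 + j) :=
        pow_le_pow_right₀ (one_lt_powBase hb).le (by omega)
      have h8 : powBase b ^ (b ^ 2 + i + 1) =
          powBase b ^ (b ^ 2 + i) + powBase b ^ (b ^ 2 + i) * (1 / b) := by
        rw [pow_succ]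
        nth_rw 2 [powBase]
        ring
      have h9 : 1 ≤ powBase b ^ (b ^ 2 + i) * (1 / b) := by
        rw [mul_one_div, one_le_div hb']; exact h6
      linarith
    have h10 := powFloor_le hb (b ^ 2 + i)
    have h11 := lt_powFloor hb (b ^ 2 + j)
    have : (powFloor b (b ^ 2 + i) : ℝ) < powFloor b (b ^ 2 + j) := by linarith
    exact_mod_cast this
  have h5 := (subperm_of_subset (l₁ := (range (powCount b M - b ^ 2)).map fun i =>
    powFloor b (b ^ 2 + i)) (l₂ := gridList b M) (nodup_range.map fun i j hij => ?_)
    fun e he => ?_).length_le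
  · rw [length_map, length_range] at h5
    have : b ^ 2 ≤ (gridList b M).length ^ 2 := Nat.pow_le_pow_left (by omega) 2
    omega
  · rcases lt_trichotomy i j with h | h | h
    · exact absurd hij (h4 i j h).ne
    · exact h
    · exact absurd hij.symm (h4 j i h).ne
  · obtain ⟨i, hi, rfl⟩ := mem_map.1 he
    have hi := mem_range.1 hi
    refine (mem_gridList hb).2 (Or.inr (Or.inr ⟨_, Or.inl rfl, ?_⟩))
    have h6 := (powFloor_le hb (b ^ 2 + i)).trans ((powBase_pow_le_iff hb (M := M)).2 (by omega))
    exact_mod_cast h6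

lemma TMD.gridList : TMD (fun p : ℕ × ℕ => 0 < p.1 ∧ 0 < p.2) (fun p => gridList p.1 p.2)
    (fun p => (gridList p.1 p.2).length ^ 3) := by
  unfold ApproxMSO.gridList
  refine .ite_of TM.on₀ (TM.on (TM.range (u := fun p : ℕ × ℕ => p.2 + 1)
    fp .refl) (.of_le fun p hp => ?_)) ?_
  · rw [if_pos hp.2, length_range]
    exact Nat.le_self_pow (by norm_num) _
  have key : ∀ p : ℕ × ℕ, ((0 < p.1 ∧ 0 < p.2) ∧ ¬ p.2 ≤ p.1) → ∃ n, 1 ≤ n ∧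
      powCount p.1 p.2 ≤ n ^ 2 + n ∧ (ApproxMSO.dedupList (0 :: p.2 ::
        (powList p.1 (powCount p.1 p.2)).filter fun e => decide (e ≤ p.2))).length = n ∧
      (if p.2 ≤ p.1 then range (p.2 + 1) else ApproxMSO.dedupList (0 :: p.2 ::
        (powList p.1 (powCount p.1 p.2)).filter fun e => decide (e ≤ p.2))).length = n := by
    intro p hp
    refine ⟨(ApproxMSO.gridList p.1 p.2).length, ?_, powCount_le hp.1.1 (not_le.1 hp.2), ?_, rfl⟩
    · exact (Nat.le_succ 1).trans (two_le_length_gridList hp.1.1 hp.1.2)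
    · rw [ApproxMSO.gridList, if_neg hp.2]
  have hlen : ∀ b J, (powList b J).length = 2 * J := by
    intro b J
    induction J with
    | zero => rfl
    | succ J ih => simp only [powList, length_cons, ih]; ring
  have h1 : TMD (fun p : ℕ × ℕ => (0 < p.1 ∧ 0 < p.2) ∧ ¬ p.2 ≤ p.1)
      (fun p => 0 :: p.2 :: (powList p.1 (powCount p.1 p.2)).filter fun e => decide (e ≤ p.2))
      (fun p => powCount p.1 p.2) := by
    refine .comp₀ (g := fun a : ℕ × List ℕ => 0 :: a.1 :: a.2) fp (.prodMk
      TM.on₀ (.filter (E := fun _ => True) (w := fun _ => 0) (p := fun (p : ℕ × ℕ) e =>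
        decide (e ≤ p.2)) (TM.on' fp) TM.powList.on' (fun _ => 0)
        (fun _ _ _ _ => ⟨trivial, le_rfl⟩) (.of_le_mul 2 fun p _ => ?_)))
    rw [hlen]
    omega
  refine TMD.dedupList.comp (f := fun p : ℕ × ℕ => 0 :: p.2 ::
    (powList p.1 (powCount p.1 p.2)).filter fun e => decide (e ≤ p.2))
    (h1.mono (.of_le_mul 2 fun p hp => ?_)) (fun _ _ => trivial) (.of_le_mul 20 fun p hp => ?_)
  · obtain ⟨n, h2, h3, -, h5⟩ := key p hp
    rw [h5]
    nlinarith [Nat.zero_le (n * n * (n - 1)), Nat.pow_le_pow_right h2 (show 2 ≤ 3 by omega),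
      Nat.pow_le_pow_right h2 (show 1 ≤ 3 by omega)]
  · obtain ⟨n, h2, h3, h4, h5⟩ := key p hp
    rw [h4, h5]
    have h6 : (0 :: p.2 :: (powList p.1 (powCount p.1 p.2)).filter fun e => decide (e ≤ p.2)).length ≤
        2 * (n ^ 2 + n) + 2 := by
      have := length_filter_le (fun e => decide (e ≤ p.2)) (powList p.1 (powCount p.1 p.2))
      rw [hlen] at this
      simp only [length_cons]
      omega
    have h7 := Nat.pow_le_pow_right h2 (show 2 ≤ 3 by omega)
    have h8 := Nat.pow_le_pow_right h2 (show 1 ≤ 3 by omega)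
    calc _ ≤ (2 * (n ^ 2 + n) + 2) * (n + 1) := Nat.mul_le_mul_right _ h6
      _ = 2 * n ^ 3 + 4 * n ^ 2 + 4 * n ^ 1 + 2 := by ring
      _ ≤ _ := by omega

lemma le_roundDown {R : List ℕ} {m e : ℕ} (he : e ∈ R) (hm : e ≤ m) : e ≤ roundDown R m := by
  suffices ∀ (L : List ℕ) r, (r ≤ L.foldl (fun r e => if e ≤ m ∧ r ≤ e then e else r) r) ∧
      (e ∈ L → e ≤ L.foldl (fun r e => if e ≤ m ∧ r ≤ e then e else r) r) from (this R 0).2 he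
  intro L
  induction L with
  | nil => simp
  | cons a L ih =>
    intro r
    rw [foldl_cons]
    obtain ⟨h1, h2⟩ := ih (if a ≤ m ∧ r ≤ a then a else r)
    refine ⟨le_trans ?_ h1, fun h => ?_⟩
    · split_ifs with h3
      · exact h3.2
      · exact le_rfl
    · rcases mem_cons.1 h with rfl | h
      · refine le_trans ?_ h1
        split_ifs with h3
        · exact le_rfl
        · by_contra h4
          exact h3 ⟨hm, by omega⟩
      · exact h2 h

lemma le_mul_roundDown (hb : 0 < b) {M m : ℕ} (hm : m ≤ M) :
    (m : ℝ) ≤ powBase b * roundDown (gridList b M) m := by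
  have h0 : 0 ≤ powBase b := by linarith [one_lt_powBase hb]
  rcases Nat.eq_zero_or_pos m with rfl | h
  · simpa using mul_nonneg h0 (Nat.cast_nonneg (roundDown (gridList b M) 0))
  obtain ⟨j, h1, h2⟩ := exists_nat_pow_near (x := (m : ℝ)) (y := powBase b)
    (by exact_mod_cast h) (one_lt_powBase hb)
  have h3 : powCeil b j < m + 1 := by
    exact_mod_cast (powCeil_lt hb j).trans_le (by linarith : powBase b ^ j + 1 ≤ (m : ℝ) + 1)
  have h4 := le_roundDown ((mem_gridList hb (M := M)).2 (Or.inr (Or.inr ⟨j, Or.inr rfl, by omega⟩)))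
    (Nat.lt_succ_iff.1 h3)
  have h5 : (powCeil b j : ℝ) ≤ roundDown (gridList b M) m := by exact_mod_cast h4
  calc (m : ℝ) ≤ powBase b ^ (j + 1) := h2.le
    _ = powBase b * powBase b ^ j := pow_succ' _ _
    _ ≤ _ := mul_le_mul_of_nonneg_left ((le_powCeil hb j).trans h5) h0

lemma length_gridList_le (hb : 0 < b) {M c : ℕ} (hc : 0 < c) :
    (gridList b M).length ≤ (gridList b (M * c)).length := by
  have hM : M ≤ M * c := Nat.le_mul_of_pos_right _ hc
  have := (subperm_of_subset (l₁ := (gridList b M).map fun e => if e = M then M * c else e)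
    (l₂ := gridList b (M * c)) ((nodup_map_iff_inj_on (nodup_gridList b M)).2 ?_)
    ?_).length_le
  · simpa using this
  · intro e he e' he' h
    have h1 := le_of_mem_gridList hb he
    have h2 := le_of_mem_gridList hb he'
    split_ifs at h <;> omega
  · intro e' he'
    obtain ⟨e, he, rfl⟩ := mem_map.1 he'
    split_ifs with h
    · exact (mem_gridList hb).2 (Or.inr (Or.inl rfl))
    · rcases (mem_gridList hb).1 he with rfl | rfl | ⟨j, h1, h2⟩
      · exact zero_mem_gridList hb _
      · exact absurd rfl h
      · exact (mem_gridList hb).2 (Or.inr (Or.inr ⟨j, h1, h2.trans hM⟩))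

lemma floor_powBase (hb : 0 < b) (j : ℕ) : ⌊powBase b ^ j⌋ = powFloor b j :=
  Int.floor_eq_iff.2 ⟨by exact_mod_cast powFloor_le hb j, by exact_mod_cast lt_powFloor hb j⟩

lemma ceil_powBase (hb : 0 < b) (j : ℕ) : ⌈powBase b ^ j⌉ = powCeil b j :=
  Int.ceil_eq_iff.2 ⟨by have := powCeil_lt hb j; push_cast; linarith,
    by exact_mod_cast le_powCeil hb j⟩

lemma mem_roundedN (hb : 0 < b) {N γ : ℕ} (hγ : 0 < γ) {x : ℝ} :
    x ∈ roundedN (1 + 1 / (b : ℝ)) N γ ↔ ∃ e ∈ gridList b (N * γ), x = (e : ℝ) / γ := by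
  have hγ' : (0 : ℝ) < γ := Nat.cast_pos.2 hγ
  have hle : ∀ e : ℕ, (e : ℝ) / γ ≤ N ↔ e ≤ N * γ := fun e => by
    rw [div_le_iff₀ hγ']; exact_mod_cast Iff.rfl
  have h0 : ∀ e : ℕ, (0 : ℝ) ≤ (e : ℝ) / γ := fun e => by positivity
  have hf : ∀ j, ((⌊(1 + 1 / (b : ℝ)) ^ j⌋ : ℤ) : ℝ) = powFloor b j := fun j => by
    have := floor_powBase hb j
    rw [powBase] at this
    rw [this]; rfl
  have hc : ∀ j, ((⌈(1 + 1 / (b : ℝ)) ^ j⌉ : ℤ) : ℝ) = powCeil b j := fun j => by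
    have := ceil_powBase hb j
    rw [powBase] at this
    rw [this]; rfl
  simp only [roundedN, Set.mem_union, Set.mem_inter_iff, Set.mem_Icc, Set.mem_range, hf, hc,
    Set.mem_insert_iff, Set.mem_singleton_iff]
  constructor
  · rintro ((⟨⟨h1, h2⟩, j, rfl⟩ | ⟨⟨h1, h2⟩, j, rfl⟩) | rfl | rfl)
    · exact ⟨_, (mem_gridList hb).2 (Or.inr (Or.inr ⟨j, Or.inr rfl, (hle _).1 h2⟩)), rfl⟩
    · exact ⟨_, (mem_gridList hb).2 (Or.inr (Or.inr ⟨j, Or.inl rfl, (hle _).1 h2⟩)), rfl⟩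
    · exact ⟨0, zero_mem_gridList hb _, by simp⟩
    · refine ⟨_, (mem_gridList hb).2 (Or.inr (Or.inl rfl)), ?_⟩
      rw [eq_div_iff hγ'.ne']
      push_cast
      rfl
  · rintro ⟨e, he, rfl⟩
    rcases (mem_gridList hb).1 he with rfl | rfl | ⟨j, rfl | rfl, h1⟩
    · right; left; simp
    · right; right
      rw [div_eq_iff hγ'.ne']
      push_cast
      rfl
    · exact Or.inl (Or.inr ⟨⟨h0 _, (hle _).2 h1⟩, j, rfl⟩)
    · exact Or.inl (Or.inl ⟨⟨h0 _, (hle _).2 h1⟩, j, rfl⟩)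

lemma ncard_roundedN (hb : 0 < b) {N γ : ℕ} (hγ : 0 < γ) :
    (roundedN (1 + 1 / (b : ℝ)) N γ).ncard = (gridList b (N * γ)).length := by
  have hγ' : (0 : ℝ) < γ := Nat.cast_pos.2 hγ
  have : roundedN (1 + 1 / (b : ℝ)) N γ =
      ((gridList b (N * γ)).toFinset.image fun e : ℕ => (e : ℝ) / γ : Finset ℝ) := by
    ext x
    rw [mem_roundedN hb hγ]
    simp [eq_comm]
  rw [this, Set.ncard_coe_finset, Finset.card_image_of_injective, toFinset_card_of_nodup
    (nodup_gridList _ _)]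
  intro e e' h
  have := (div_left_inj' hγ'.ne').1 h
  exact_mod_cast this

end Pow

/-! ### Evaluation of the root table -/

abbrev Bounds := List (ℕ × ℕ)

/-- Thresholds for some terms, and the entries that meet them, with their remaining values. -/
abbrev Config := Bounds × List (List ℕ × Entry)

def within (p : ℕ × ℕ) (lo hi : ℕ) : Bool := decide (p.2 ≤ lo) && decide (hi ≤ p.1)

def refineConfig (P : Bounds) (c : Config) (a : ℕ) : List Config :=
  P.map fun p => (p :: c.1, (c.2.filter fun e =>
    within p (a + e.1.headD 0) (a + e.1.headD 0)).map fun e => (e.1.tail, e.2))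

/-- All choices of thresholds for terms with the constants `as`, with the entries that meet them. -/
def configs (P : Bounds) (as : List ℕ) (T : Table) : List Config :=
  as.foldl (fun L a => L.flatMap fun c => refineConfig P c a) [([], T.map fun e => (e.2.1.1, e))]

def best (L : List Entry) : List Entry :=
  L.foldl (fun b e => if b.isEmpty = true ∨ (b.headD e).2.2.1 < e.2.2.1 then [e] else b) []

/-- The entry meets the thresholds for the terms of the second family. -/
def passes (p : Params) (rl as : List ℕ) (w : List Bounds) (e : Entry) : Bool :=
  e.2.1.2.all fun f => (zipWith (fun (a : ℕ × ℕ × ℕ) (r : Bounds) =>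
    (zipWith (fun b q => b || within q (a.1 + a.2.1) (a.1 + a.2.2)) (bits p rl f.1) r).all
      fun b => b) (as.zip f.2) w).all fun b => b

/-- The first `x` sets that are given by a tree. -/
def extract (x : ℕ) (r : Rope) : List (List ℕ) :=
  (range x).map fun i => (r.leaves.filter fun e => decide (bit e.2 i = 1)).map Prod.fst

def choose (x : ℕ) (L : List Entry) : Option (List (List ℕ)) :=
  if (best L).isEmpty = true then none
  else some (extract x ((best L).headD (0, ([], []), 0, Rope.leaf 0 0)).2.2.2)

abbrev Output := List ((Bounds × List Bounds) × Option (List (List ℕ)))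

def rootTable (E : Env) (rl as bs : List ℕ) (P : Bounds) (Ω : List (List Bounds)) (T : Table) :
    Output :=
  (configs P as T).flatMap fun c => Ω.map fun w =>
    ((c.1, w), choose E.numX ((c.2.map Prod.snd).filter (passes E.par rl bs w)))

lemma configs_append (P : Bounds) (as : List ℕ) (a : ℕ) (T : Table) :
    configs P (as ++ [a]) T = (configs P as T).flatMap fun c => refineConfig P c a := by
  rw [configs, foldl_append]
  rfl

lemma nodup_configs {P : Bounds} (hP : P.Nodup) (as : List ℕ) (T : Table) :
    ((configs P as T).map Prod.fst).Nodup := by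
  induction as using reverseRecOn with
  | nil => simp [configs]
  | append_singleton as a ih =>
    have : (configs P (as ++ [a]) T).map Prod.fst =
        pairsWith (fun l p => p :: l) ((configs P as T).map Prod.fst) P := by
      rw [configs_append, map_flatMap, pairsWith, flatMap_map]
      congr 1
      funext c
      simp [refineConfig, Function.comp_def]
    rw [this]
    exact nodup_pairsWith (fun a b a' b' h => by simpa [and_comm] using h) ih hP

lemma mem_configs {P : Bounds} {as : List ℕ} {T : Table} {w : Bounds} :
    w ∈ (configs P as T).map Prod.fst ↔ w.length = as.length ∧ ∀ p ∈ w, p ∈ P := by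
  induction as using reverseRecOn generalizing w with
  | nil =>
    simp only [configs, foldl_nil, map_cons, map_nil, mem_singleton,
      length_nil, length_eq_zero_iff]
    exact ⟨by rintro rfl; simp, fun h => h.1⟩
  | append_singleton as a ih =>
    have : (configs P (as ++ [a]) T).map Prod.fst =
        pairsWith (fun l p => p :: l) ((configs P as T).map Prod.fst) P := by
      rw [configs_append, map_flatMap, pairsWith, flatMap_map]
      congr 1
      funext c
      simp [refineConfig, Function.comp_def]
    rw [this, mem_pairsWith, length_append, length_singleton]
    constructor
    · rintro ⟨l, hl, p, hp, rfl⟩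
      obtain ⟨h1, h2⟩ := ih.1 hl
      exact ⟨by simp [h1], by simpa [hp] using h2⟩
    · rintro ⟨h1, h2⟩
      cases w with
      | nil => simp at h1
      | cons p w => exact ⟨w, ih.2 ⟨by simpa using h1, fun q hq => h2 q (by simp [hq])⟩, p,
          h2 p (by simp), rfl⟩

/-- The entry meets the thresholds for the terms of the first family. -/
def Meets (as : List ℕ) (w : Bounds) (e : Entry) : Prop := ∀ i < as.length,
  within (w.getD i 0) (as.getD (as.length - 1 - i) 0 + e.2.1.1.getD (as.length - 1 - i) 0)
    (as.getD (as.length - 1 - i) 0 + e.2.1.1.getD (as.length - 1 - i) 0) = true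

lemma meets_append {as : List ℕ} {a : ℕ} {p : ℕ × ℕ} {w : Bounds} {e : Entry} :
    Meets (as ++ [a]) (p :: w) e ↔ Meets as w e ∧
      within p (a + e.2.1.1.getD as.length 0) (a + e.2.1.1.getD as.length 0) = true := by
  unfold Meets
  rw [length_append, length_singleton, Nat.add_sub_cancel]
  constructor
  · intro h
    refine ⟨fun i hi => ?_, ?_⟩
    · have := h (i + 1) (by omega)
      rw [show as.length - (i + 1) = as.length - 1 - i by omega, getD_cons_succ,
        getD_append _ _ _ _ (by omega)] at this
      exact this
    · have := h 0 (by omega)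
      rw [Nat.sub_zero, getD_cons_zero, getD_append_right _ _ _ _ le_rfl] at this
      simpa using this
  · rintro ⟨h1, h2⟩ i hi
    cases i with
    | zero =>
      rw [Nat.sub_zero, getD_cons_zero, getD_append_right _ _ _ _ le_rfl]
      simpa using h2
    | succ i =>
      have := h1 i (by omega)
      rw [show as.length - (i + 1) = as.length - 1 - i by omega, getD_cons_succ,
        getD_append _ _ _ _ (by omega)]
      exact this

lemma mem_config {P : Bounds} {as : List ℕ} {T : Table} {c : Config} (hc : c ∈ configs P as T)
    {l : List ℕ} {e : Entry} : (l, e) ∈ c.2 ↔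
      l = e.2.1.1.drop as.length ∧ e ∈ T ∧ Meets as c.1 e := by
  induction as using reverseRecOn generalizing c l with
  | nil =>
    simp only [configs, foldl_nil, mem_singleton] at hc
    subst hc
    simp only [mem_map, Prod.mk.injEq, length_nil, drop_zero, Meets,
      not_lt_zero, false_implies, implies_true, and_true]
    constructor
    · rintro ⟨e', he', rfl, rfl⟩
      exact ⟨rfl, he'⟩
    · rintro ⟨rfl, he⟩
      exact ⟨e, he, rfl, rfl⟩
  | append_singleton as a ih =>
    rw [configs_append, mem_flatMap] at hc
    obtain ⟨c', hc', h⟩ := hc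
    obtain ⟨p, hp, rfl⟩ := mem_map.1 h
    have hd : ∀ e : Entry, (e.2.1.1.drop as.length).headD 0 = e.2.1.1.getD as.length 0 := fun e => by
      rw [headD_eq_head?_getD, head?_drop, getD_eq_getElem?_getD]
    rw [meets_append, length_append, length_singleton]
    rw [mem_map]
    constructor
    · rintro ⟨⟨l', e'⟩, h0, h5⟩
      obtain ⟨h1, h2⟩ := mem_filter.1 h0
      obtain ⟨h6, h7⟩ := Prod.mk.inj h5
      dsimp only at h2 h6 h7
      subst h6 h7
      obtain ⟨rfl, h3, h4⟩ := (ih hc').1 h1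
      simp only [hd] at h2
      exact ⟨tail_drop, h3, h4, h2⟩
    · rintro ⟨rfl, h1, h2, h3⟩
      refine ⟨(_, e), mem_filter.2 ⟨(ih hc').2 ⟨rfl, h1, h2⟩, ?_⟩, Prod.ext tail_drop rfl⟩
      rw [hd]
      exact h3

lemma best_spec (L : List Entry) : (L = [] ∧ best L = []) ∨
    ∃ e ∈ L, best L = [e] ∧ ∀ e' ∈ L, e'.2.2.1 ≤ e.2.2.1 := by
  induction L using reverseRecOn with
  | nil => exact Or.inl ⟨rfl, rfl⟩
  | append_singleton L a ih =>
    right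
    have hb : best (L ++ [a]) = if (best L).isEmpty = true ∨ ((best L).headD a).2.2.1 < a.2.2.1
        then [a] else best L := by
      rw [best, foldl_append]
      rfl
    rw [hb]
    rcases ih with ⟨rfl, h⟩ | ⟨e, he, h, h1⟩
    · refine ⟨a, by simp, ?_, by simp⟩
      rw [h]
      rfl
    · rw [h]
      by_cases h2 : e.2.2.1 < a.2.2.1
      · refine ⟨a, by simp, if_pos (Or.inr h2), fun e' he' => ?_⟩
        rcases mem_append.1 he' with h3 | h3
        · exact (h1 e' h3).trans h2.le
        · rw [mem_singleton.1 h3]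
      · refine ⟨e, by simp [he], if_neg (by simpa using h2), fun e' he' => ?_⟩
        rcases mem_append.1 he' with h3 | h3
        · exact h1 e' h3
        · rw [mem_singleton.1 h3]
          exact not_lt.1 h2

lemma choose_spec (x : ℕ) (L : List Entry) : (L = [] ∧ choose x L = none) ∨
    ∃ e ∈ L, choose x L = some (extract x e.2.2.2) ∧ ∀ e' ∈ L, e'.2.2.1 ≤ e.2.2.1 := by
  rcases best_spec L with ⟨h1, h2⟩ | ⟨e, he, h, h1⟩
  · exact Or.inl ⟨h1, by simp [choose, h2]⟩
  · exact Or.inr ⟨e, he, by simp [choose, h], h1⟩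

lemma passes_iff {p : Params} {rl as : List ℕ} {w : List Bounds} {e : Entry}
    (hw : w.length = as.length) (he : ∀ f ∈ e.2.1.2, f.2.length = as.length) :
    passes p rl as w e = true ↔ ∀ f ∈ e.2.1.2, ∀ t < as.length, ∀ i < (bits p rl f.1).length,
      i < (w.getD t []).length → (bits p rl f.1).getD i false = true ∨
        within ((w.getD t []).getD i 0) (as.getD t 0 + (f.2.getD t 0).1)
          (as.getD t 0 + (f.2.getD t 0).2) = true := by
  unfold passes
  have key : ∀ {γ δ : Type} (h : γ → δ → Bool) (l : List γ) (m : List δ) (c : γ) (d : δ),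
      ((zipWith h l m).all fun b => b) = true ↔
        ∀ i, i < l.length → i < m.length → h (l.getD i c) (m.getD i d) = true := by
    intro γ δ h l m c d
    rw [all_eq_true]
    constructor
    · intro H i hi hi'
      have hz : i < (zipWith h l m).length := by simp [hi, hi']
      have := H _ (getElem_mem hz)
      simpa [getD_eq_getElem?_getD, hi, hi'] using this
    · intro H b hb
      obtain ⟨i, hi, rfl⟩ := mem_iff_getElem.1 hb
      simp only [length_zipWith, lt_min_iff] at hi
      have := H i hi.1 hi.2
      simpa [getD_eq_getElem?_getD, hi.1, hi.2] using this
  rw [all_eq_true]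
  refine forall₂_congr fun f hf => ?_
  rw [key _ _ _ (0, 0, 0) []]
  have hl : (as.zip f.2).length = as.length := by simp [he f hf]
  rw [hl, hw]
  constructor
  · intro H t ht i hi hi'
    have h1 := (key _ _ _ false 0).1 (H t ht ht) i hi hi'
    rw [Bool.or_eq_true] at h1
    have h2 : t < f.2.length := by rw [he f hf]; exact ht
    simpa [getD_eq_getElem?_getD, ht, h2] using h1
  · intro H t ht _
    refine (key _ _ _ false 0).2 fun i hi hi' => ?_
    have h1 := H t ht i hi hi'
    have h2 : t < f.2.length := by rw [he f hf]; exact ht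
    rw [Bool.or_eq_true]
    simpa [getD_eq_getElem?_getD, ht, h2] using h1

lemma map_fst_rootTable (E : Env) (rl as bs : List ℕ) (P : Bounds) (Ω : List (List Bounds))
    (T : Table) : (rootTable E rl as bs P Ω T).map Prod.fst =
      pairsWith Prod.mk ((configs P as T).map Prod.fst) Ω := by
  rw [rootTable, map_flatMap, pairsWith, flatMap_map]
  congr 1
  funext c
  simp [Function.comp_def]

lemma mem_rootTable {E : Env} {rl as bs : List ℕ} {P : Bounds} {Ω : List (List Bounds)}
    {T : Table} {w : Bounds} {w' : List Bounds} {v : Option (List (List ℕ))}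
    (h : ((w, w'), v) ∈ rootTable E rl as bs P Ω T) : ∃ L : List Entry,
      (∀ e, e ∈ L ↔ e ∈ T ∧ Meets as w e ∧ passes E.par rl bs w' e = true) ∧ v = choose E.numX L := by
  obtain ⟨c, hc, h1⟩ := mem_flatMap.1 h
  obtain ⟨u, hu, h2⟩ := mem_map.1 h1
  simp only [Prod.mk.injEq] at h2
  obtain ⟨⟨rfl, rfl⟩, rfl⟩ := h2
  refine ⟨_, fun e => ?_, rfl⟩
  rw [mem_filter, mem_map]
  constructor
  · rintro ⟨⟨⟨l, e'⟩, h3, rfl⟩, h4⟩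
    exact ⟨((mem_config hc).1 h3).2.1, ((mem_config hc).1 h3).2.2, h4⟩
  · rintro ⟨h3, h4, h5⟩
    exact ⟨⟨(_, e), (mem_config hc).2 ⟨rfl, h3, h4⟩, rfl⟩, h5⟩

/-! ### Numerators of terms -/

section Terms

variable {p l n : ℕ}

def WTerm.coeffs {R : Type} (t : WTerm R p l) : List (List R) :=
  (finRange l).map fun j => (finRange p).map fun i => t.coeff i j

lemma WTerm.length_coeffs {R : Type} (t : WTerm R p l) : t.coeffs.length = l := by simp [coeffs]

lemma WTerm.listsLe_coeffs {R : Type} (t : WTerm R p l) : ListsLe t.coeffs p := by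
  intro c hc
  obtain ⟨j, _, rfl⟩ := mem_map.1 hc
  simp

lemma dot_map {K : Type} [Semiring K] (f : Fin p → K) (g : Fin p → ℕ) :
    dot ((finRange p).map f) ((finRange p).map g) = ∑ i, f i * (g i : K) := by
  have h : ∀ (L : List K) (s : K), L.foldl (· + ·) s = s + L.sum := by
    intro L
    induction L with
    | nil => simp
    | cons a L ih => intro s; rw [foldl_cons, ih, sum_cons, add_assoc]
  rw [dot, h, zero_add, zipWith_map, zipWith_self, Fin.sum_univ_def]

lemma WTerm.eval_eq {K : Type} [Semiring K] (t : WTerm K p l) (G : WGraph p n)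
    {W : Fin l → Finset (Fin n)} {Z : Sets n} (hZ : ∀ i : Fin l, Z i = W i) :
    t.eval G W = t.const + linSet (KExpr.weightList G) t.coeffs Z := by
  rw [WTerm.eval, linSet, length_coeffs, Finset.sum_range, Finset.sum_comm]
  refine congrArg _ (Finset.sum_congr rfl fun j _ => ?_)
  have : t.coeffs.getD j [] = (finRange p).map fun i => t.coeff i j := by
    simp [coeffs, getD_eq_getElem?_getD]
  rw [this, hZ]
  simp only [KExpr.weightList, dot_map]
  rw [Finset.sum_comm]
  refine Finset.sum_congr rfl fun i _ => ?_
  rw [Nat.cast_sum, Finset.mul_sum]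

/-- The numerator of a number over `γ`. -/
def num (γ : ℕ) (x : ℝ) : ℕ := ⌊x * γ⌋.toNat

variable {γ : ℕ}

lemma num_div (hγ : 0 < γ) (a : ℕ) : num γ (a / γ) = a := by
  have : (γ : ℝ) ≠ 0 := Nat.cast_ne_zero.2 hγ.ne'
  rw [num, div_mul_cancel₀ _ this, Int.floor_natCast, Int.toNat_natCast]

lemma num_cast (hγ : 0 < γ) {x : ℝ} (h : Granular γ x) : (num γ x : ℝ) = x * γ := by
  obtain ⟨a, rfl⟩ := h
  rw [num_div hγ, div_mul_cancel₀ _ (Nat.cast_ne_zero.2 hγ.ne')]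

lemma enc_num (hγ : 0 < γ) {x : ℝ} (h : Granular γ x) : enc (num γ x) = Val.ofGranular γ x := by
  obtain ⟨a, rfl⟩ := h
  rw [num_div hγ, Val.ofGranular, div_mul_cancel₀ _ (Nat.cast_ne_zero.2 hγ.ne'), Int.floor_natCast]
  rfl

def WTerm.numer (γ : ℕ) (t : WTerm ℝ p l) : WTerm ℕ p l :=
  ⟨num γ t.const, fun i j => num γ (t.coeff i j)⟩

lemma WTerm.eval_numer (hγ : 0 < γ) {t : WTerm ℝ p l} (ht : t.IsGranular γ) (G : WGraph p n)
    (W : Fin l → Finset (Fin n)) : (((t.numer γ).eval G W : ℕ) : ℝ) = t.eval G W * γ := by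
  simp only [eval, numer, Nat.cast_add, Nat.cast_sum, Nat.cast_mul, Nat.cast_id, num_cast hγ ht.1,
    num_cast hγ (ht.2 _ _), add_mul, Finset.sum_mul]
  congr 1
  exact Finset.sum_congr rfl fun i _ => Finset.sum_congr rfl fun j _ => by ring

end Terms

/-! ### The meaning of table formulas -/

namespace Formula

variable {p N : ℕ}

lemma tighten_conj {n m : ℕ} (A : ℝ) (L : List (Formula p n m)) :
    (conj L).tighten A = conj (L.map (tighten A)) := by
  induction L with
  | nil => rfl
  | cons a L ih => exact congrArg (Formula.and _) ih

lemma tighten_allSets {n m : ℕ} (A : ℝ) (y : ℕ) (φ : Formula p n (m + y)) :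
    (allSets y φ).tighten A = allSets y (φ.tighten A) := by
  induction y with
  | zero => rfl
  | succ y ih => exact ih (.allS φ)

lemma IsCMSO.tighten_eq {σ : Signature} (A : ℝ) {n m : ℕ} {φ : Formula p n m} (h : φ.IsCMSO σ) :
    φ.tighten A = φ := by
  induction φ with
  | cmp => exact h.elim
  | not _ ih | exV _ ih | allV _ ih | exS _ ih | allS _ ih => exact congrArg _ (ih h)
  | and _ _ h1 h2 | or _ _ h1 h2 => exact congrArg₂ _ (h1 h.1) (h2 h.2)
  | _ => rfl

lemma loosen_eq_tighten (A : ℝ) {n m : ℕ} (φ : Formula p n m) : φ.loosen A = φ.tighten (1 / A) := by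
  induction φ with
  | cmp c => cases c <;> simp only [loosen, tighten, one_div_one_div]
  | not | exV | allV | exS | allS => exact congrArg _ ‹_›
  | and | or => exact congrArg₂ _ ‹_› ‹_›
  | _ => rfl

lemma sat_allSets {n m : ℕ} (G : WGraph p N) (y : ℕ) (φ : Formula p n (m + y))
    (xs : Fin n → Fin N) (Xs : Fin m → Finset (Fin N)) : (allSets y φ).Sat G xs Xs ↔
      ∀ Zs : Fin (m + y) → Finset (Fin N), (∀ j, Zs (Fin.castAdd y j) = Xs j) → φ.Sat G xs Zs := by
  induction y with
  | zero =>
    refine ⟨fun h Zs hZ => ?_, fun h => h Xs fun j => rfl⟩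
    have : Zs = Xs := funext hZ
    rw [this]
    exact h
  | succ y ih =>
    rw [allSets, ih]
    constructor
    · intro h Zs hZ
      have := h (Fin.init (α := fun _ => Finset (Fin N)) Zs) hZ (Zs (Fin.last (m + y)))
      rwa [Fin.snoc_init_self] at this
    · intro h Zs hZ U
      refine h (Fin.snoc Zs U) fun j => ?_
      rw [← hZ j]
      exact Fin.snoc_castSucc (α := fun _ => Finset (Fin N)) U Zs (Fin.castAdd y j)

end Formula

section Table

variable {p l N : ℕ} (G : WGraph p N)

lemma WTerm.eval_scale (A : ℝ) (t : WTerm ℝ p l) (W : Fin l → Finset (Fin N)) :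
    (t.scale A).eval G W = A * t.eval G W := by
  simp only [eval, scale, mul_add, Finset.mul_sum, mul_assoc]

lemma WTerm.eval_ofConst (a : ℝ) (W : Fin l → Finset (Fin N)) :
    (WTerm.ofConst a : WTerm ℝ p l).eval G W = a := by
  simp [eval, ofConst]

variable {G} {σ : Signature} {q x y m₁ m₂ : ℕ} {τ₁ : Fin m₁ → WTerm ℝ p x}
  {τ₂ : Fin m₂ → WTerm ℝ p (x + y)} {ω : TableFormula p σ q x y m₁ m₂} {A : ℝ}
  {W : Fin x → Finset (Fin N)}

lemma oversat_toFormula : (ω.toFormula τ₁ τ₂).Oversat G A W ↔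
    (∀ i, A * (τ₁ i).eval G W ≤ 1 / A * ω.le₁ i ∧ A * ω.ge₁ i ≤ 1 / A * (τ₁ i).eval G W) ∧
    ∀ i ψ, ∀ Zs : Fin (x + y) → Finset (Fin N), (∀ j, Zs (Fin.castAdd y j) = W j) →
      ψ.1.Sat G Fin.elim0 Zs ∨ (A * (τ₂ i).eval G Zs ≤ 1 / A * ω.le₂ i ψ ∧
        A * ω.ge₂ i ψ ≤ 1 / A * (τ₂ i).eval G Zs) := by
  have h : ∀ ψ : {ψ : Formula p 0 (x + y) // ψ ∈ Formula.cmso σ q 0 (x + y)},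
      ψ.1.tighten A = ψ.1 := fun ψ => (Formula.cmso_sound σ q _ _ ψ.1 ψ.2).1.tighten_eq A
  simp only [Formula.Oversat, Formula.Models, TableFormula.toFormula, Formula.tighten, Formula.Sat,
    Formula.tighten_conj, Formula.sat_conj, map_map, map_flatMap, mem_map,
    mem_flatMap, mem_finRange, true_and, Function.comp_apply, forall_exists_index,
    forall_apply_eq_imp_iff, Formula.tighten_allSets, mem_attach,
    TableFormula.between, Cmp.holds, WTerm.eval_scale, WTerm.eval_ofConst, ge_iff_le, h]
  refine and_congr Iff.rfl ⟨fun H i ψ => ?_, ?_⟩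
  · simpa only [Formula.sat_allSets, Formula.Sat, Cmp.holds, WTerm.eval_scale, WTerm.eval_ofConst,
      ge_iff_le] using H _ i ψ rfl
  · rintro H _ i ψ rfl
    simpa only [Formula.sat_allSets, Formula.Sat, Cmp.holds, WTerm.eval_scale, WTerm.eval_ofConst,
      ge_iff_le] using H i ψ

lemma undersat_toFormula : (ω.toFormula τ₁ τ₂).Undersat G A W ↔
    (∀ i, 1 / A * (τ₁ i).eval G W ≤ A * ω.le₁ i ∧ 1 / A * ω.ge₁ i ≤ A * (τ₁ i).eval G W) ∧
    ∀ i ψ, ∀ Zs : Fin (x + y) → Finset (Fin N), (∀ j, Zs (Fin.castAdd y j) = W j) →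
      ψ.1.Sat G Fin.elim0 Zs ∨ (1 / A * (τ₂ i).eval G Zs ≤ A * ω.le₂ i ψ ∧
        1 / A * ω.ge₂ i ψ ≤ A * (τ₂ i).eval G Zs) := by
  simpa only [Formula.Undersat, Formula.Oversat, Formula.loosen_eq_tighten, one_div_one_div] using
    oversat_toFormula (A := 1 / A)

end Table

/-! ### Correctness of the root table -/

section Compare

variable {γ : ℕ} {A t g : ℝ} {T : ℕ}

lemma Granular.nonneg (hg : Granular γ g) : 0 ≤ g := by
  obtain ⟨a, rfl⟩ := hg
  positivity

lemma nonneg_of_cast (hγ : 0 < γ) (hT : (T : ℝ) = t * γ) : 0 ≤ t :=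
  nonneg_of_mul_nonneg_left (hT ▸ T.cast_nonneg) (Nat.cast_pos.2 hγ)

lemma one_div_mul_le (hA : 1 ≤ A) (ht : 0 ≤ t) : 1 / A * t ≤ t :=
  mul_le_of_le_one_left ht ((div_le_one (by linarith)).2 hA)

lemma le_num_of_tight (hγ : 0 < γ) (hA : 1 ≤ A) (hT : (T : ℝ) = t * γ) (hg : Granular γ g)
    (h : A * t ≤ 1 / A * g) : T ≤ num γ g := by
  rw [← Nat.cast_le (α := ℝ), hT, num_cast hγ hg]
  exact mul_le_mul_of_nonneg_right ((le_mul_of_one_le_left (nonneg_of_cast hγ hT) hA).trans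
    (h.trans (one_div_mul_le hA hg.nonneg))) γ.cast_nonneg

lemma num_mul_le_of_tight (hγ : 0 < γ) (hA : 1 ≤ A) (hT : (T : ℝ) = t * γ) (hg : Granular γ g)
    (h : A * g ≤ 1 / A * t) : A * (num γ g : ℝ) ≤ T := by
  rw [hT, num_cast hγ hg, ← mul_assoc]
  exact mul_le_mul_of_nonneg_right (h.trans (one_div_mul_le hA (nonneg_of_cast hγ hT)))
    γ.cast_nonneg

lemma loose_of_le (hγ : 0 < γ) (hA : 1 ≤ A) (hT : (T : ℝ) = t * γ) (hg : Granular γ g)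
    (h : (T : ℝ) ≤ A * num γ g) : 1 / A * t ≤ A * g := by
  rw [hT, num_cast hγ hg, ← mul_assoc] at h
  exact (one_div_mul_le hA (nonneg_of_cast hγ hT)).trans
    (le_of_mul_le_mul_right h (Nat.cast_pos.2 hγ))

lemma loose_of_ge (hγ : 0 < γ) (hA : 1 ≤ A) (hT : (T : ℝ) = t * γ) (hg : Granular γ g)
    (h : num γ g ≤ T) : 1 / A * g ≤ A * t := by
  rw [← Nat.cast_le (α := ℝ), hT, num_cast hγ hg] at h
  exact (one_div_mul_le hA hg.nonneg).trans ((le_of_mul_le_mul_right h (Nat.cast_pos.2 hγ)).trans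
    (le_mul_of_one_le_left (nonneg_of_cast hγ hT) hA))

end Compare

section Root

variable {p n k x y m₁ m₂ : ℕ} {σ : Signature} {q : ℕ}

local notation "𝓟" => (σ.size, k, q, x + y)
local notation "𝓕" => (Formula.cmso σ q 0 (x + y) : List (Formula p 0 (x + y)))

/-- The numerators of the thresholds of a table formula. -/
def TableFormula.bounds (γ : ℕ) (ω : TableFormula p σ q x y m₁ m₂) : Bounds × List Bounds :=
  ((finRange m₁).map fun i => (num γ (ω.le₁ i), num γ (ω.ge₁ i)),
    (finRange m₂).map fun i => (𝓕).attach.map fun ψ =>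
      (num γ (ω.le₂ i ψ), num γ (ω.ge₂ i ψ)))

def inputEnv (b N γ : ℕ) (σ : Signature) (q k : ℕ) (τ₁ : Fin m₁ → WTerm ℝ p x)
    (τ₂ : Fin m₂ → WTerm ℝ p (x + y)) (target : WTerm ℤ p x) : Env where
  par := (σ.size, k, q, x + y)
  grid := if m₁ + m₂ = 0 then [] else gridList b (N * γ)
  cap := N * γ + 1
  terms₁ := ((finRange m₁).map fun i => ((τ₁ i).numer γ).coeffs).reverse
  terms₂ := (finRange m₂).map fun i => ((τ₂ i).numer γ).coeffs
  target := target.coeffs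
  numX := x
  colors := σ.rels.map Rel.colorCode

def constants {m l : ℕ} (γ : ℕ) (τ : Fin m → WTerm ℝ p l) : List ℕ :=
  (finRange m).map fun i => num γ (τ i).const

lemma getD_map_finRange {γ : Type} {m : ℕ} (f : Fin m → γ) (i : Fin m) (d : γ) :
    ((finRange m).map f).getD i d = f i := by
  simp [getD_eq_getElem?_getD]

lemma getD_reverse_map_finRange {γ : Type} {m : ℕ} (f : Fin m → γ) (i : Fin m) (d : γ) :
    ((finRange m).map f).reverse.getD (m - 1 - i) d = f i := by
  have h1 : m - 1 - (i : ℕ) < ((finRange m).map f).length := by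
    simp only [length_map, length_finRange]
    omega
  rw [getD_eq_getElem?_getD, getElem?_reverse h1, length_map, length_finRange,
    show m - 1 - (m - 1 - (i : ℕ)) = i by omega]
  simp

variable {γ : ℕ} {ω : TableFormula p σ q x y m₁ m₂}

lemma within_iff {r : ℕ × ℕ} {a b : ℕ} : within r a b = true ↔ r.2 ≤ a ∧ b ≤ r.1 := by
  simp [within]

lemma meets_bounds {τ₁ : Fin m₁ → WTerm ℝ p x} {e : Entry} :
    Meets (constants γ τ₁).reverse (ω.bounds γ).1 e ↔ ∀ i : Fin m₁,
      num γ (ω.ge₁ i) ≤ num γ (τ₁ i).const + e.2.1.1.getD (m₁ - 1 - i) 0 ∧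
      num γ (τ₁ i).const + e.2.1.1.getD (m₁ - 1 - i) 0 ≤ num γ (ω.le₁ i) := by
  have hl : (constants γ τ₁).reverse.length = m₁ := by simp [constants]
  unfold Meets
  rw [hl]
  constructor
  · intro h i
    have := h i i.2
    rw [constants, getD_reverse_map_finRange, within_iff, TableFormula.bounds,
      getD_map_finRange] at this
    exact this
  · intro h i hi
    have := h ⟨i, hi⟩
    have h1 := getD_reverse_map_finRange (fun i => num γ (τ₁ i).const) ⟨i, hi⟩ 0
    have h2 := getD_map_finRange (fun i => (num γ (ω.le₁ i), num γ (ω.ge₁ i))) ⟨i, hi⟩ 0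
    simp only at h1 h2
    rw [constants, within_iff, TableFormula.bounds, h1, h2]
    exact this

lemma passes_bounds {P : Params} {rl : List ℕ} {τ₂ : Fin m₂ → WTerm ℝ p (x + y)} {e : Entry}
    (he : ∀ f ∈ e.2.1.2, f.2.length = m₂) (B : ℕ × Vec → Formula p 0 (x + y) → Bool)
    (hB : 0 < m₂ → ∀ f ∈ e.2.1.2, bits P rl f.1 = (𝓕).map (B f)) :
    passes P rl (constants γ τ₂) (ω.bounds γ).2 e = true ↔ ∀ f ∈ e.2.1.2, ∀ i : Fin m₂, ∀ ψ,
      B f ψ.1 = true ∨ (num γ (ω.ge₂ i ψ) ≤ num γ (τ₂ i).const + (f.2.getD i 0).1 ∧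
        num γ (τ₂ i).const + (f.2.getD i 0).2 ≤ num γ (ω.le₂ i ψ)) := by
  have hl : (constants γ τ₂).length = m₂ := by simp [constants]
  rw [passes_iff (by simp [TableFormula.bounds, hl]) fun f hf => (he f hf).trans hl.symm, hl]
  rcases Nat.eq_zero_or_pos m₂ with rfl | hm
  · exact iff_of_true (fun _ _ t ht => absurd ht t.not_lt_zero) fun _ _ i => i.elim0
  replace hB := hB hm
  refine forall₂_congr fun f hf => ?_
  have key : ∀ (i : Fin m₂) j (hj : j < (𝓕).length),
      (((bits P rl f.1).getD j false = true) ↔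
        B f 𝓕[j] = true) ∧
      ((ω.bounds γ).2.getD i []).getD j 0 =
        (num γ (ω.le₂ i ⟨_, getElem_mem hj⟩), num γ (ω.ge₂ i ⟨_, getElem_mem hj⟩)) := by
    intro i j hj
    rw [hB f hf, TableFormula.bounds, getD_map_finRange]
    simp [getD_eq_getElem?_getD, hj]
  have hlen : (bits P rl f.1).length = (𝓕).length := by
    rw [hB f hf, length_map]
  have hlen' : ∀ i : Fin m₂, ((ω.bounds γ).2.getD i []).length =
      (𝓕).length := fun i => by
    rw [TableFormula.bounds, getD_map_finRange, length_map, length_attach]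
  have hc : ∀ i : Fin m₂, (constants γ τ₂).getD i 0 = num γ (τ₂ i).const := fun i =>
    getD_map_finRange _ _ _
  constructor
  · rintro H i ⟨ψ, hψ⟩
    obtain ⟨j, hj, rfl⟩ := mem_iff_getElem.1 hψ
    have := H i i.2 j (hlen ▸ hj) (hlen' i ▸ hj)
    rw [(key i j hj).1, (key i j hj).2, within_iff, hc] at this
    exact this
  · intro H t ht j hj _
    have hj' := hlen ▸ hj
    have := H ⟨t, ht⟩ ⟨_, getElem_mem hj'⟩
    have h1 := key ⟨t, ht⟩ j hj'
    have h2 := hc ⟨t, ht⟩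
    simp only at h1 h2 this
    rw [h1.1, h1.2, within_iff, h2]
    exact this

/-- The first sets of a sequence, and empty sets. -/
def extend {l : ℕ} (W : Fin l → Finset (Fin n)) (j : ℕ) : Finset (Fin n) :=
  if h : j < l then W ⟨j, h⟩ else ∅

lemma extend_val {l : ℕ} (W : Fin l → Finset (Fin n)) (i : Fin l) : extend W i = W i := by
  simp [extend]

variable {b N : ℕ} {τ₁ : Fin m₁ → WTerm ℝ p x} {τ₂ : Fin m₂ → WTerm ℝ p (x + y)}
  {target : WTerm ℤ p x} {G : WGraph p n} {χ : KExpr k n}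

local notation "𝓔" => inputEnv b N γ σ q k τ₁ τ₂ target

lemma cast_terms₁ (hγ : 0 < γ) (h₁ : ∀ i, (τ₁ i).IsGranular γ) (i : Fin m₁)
    (Z : Sets n) : ((num γ (τ₁ i).const + linSet (KExpr.weightList G)
      ((𝓔).terms₁.getD (m₁ - 1 - i) []) Z : ℕ) : ℝ) =
      (τ₁ i).eval G (fun j => Z j) * γ := by
  rw [inputEnv, getD_reverse_map_finRange, ← WTerm.eval_numer hγ (h₁ i),
    WTerm.eval_eq _ G (Z := Z) fun _ => rfl]
  rfl

lemma cast_terms₂ (hγ : 0 < γ) (h₂ : ∀ i, (τ₂ i).IsGranular γ) (i : Fin m₂)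
    (Z : Sets n) : ((num γ (τ₂ i).const + linSet (KExpr.weightList G)
      ((𝓔).terms₂.getD i []) Z : ℕ) : ℝ) =
      (τ₂ i).eval G (fun j => Z j) * γ := by
  rw [inputEnv, getD_map_finRange, ← WTerm.eval_numer hγ (h₂ i),
    WTerm.eval_eq _ G (Z := Z) fun _ => rfl]
  rfl

lemma bits_tyOf (hχ : χ.Builds G.graph) (Z : Sets n) :
    bits 𝓟 (σ.rels.map Rel.code)
      (χ.toLGraph.tyOf 𝓟 (G.colorSet σ) Z) =
      (𝓕).map (Formula.tv G Fin.elim0 fun j : Fin (x + y) => Z j) :=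
  bits_ty (KExpr.presents hχ) rfl rfl fun i => by rw [Nat.add_sub_cancel_left]

/-- An entry for a tuple meets the thresholds if the tuple satisfies them with enough slack. -/
lemma meets_and_passes {A : ℝ} (hγ : 0 < γ) (hA : 1 ≤ A)
    (h₁ : ∀ i, (τ₁ i).IsGranular γ) (h₂ : ∀ i, (τ₂ i).IsGranular γ) (hχ : χ.Builds G.graph)
    (hω : ω.AllThresholds fun g => Granular γ g ∧ num γ g ≤ N * γ) {e : Entry}
    {W : Fin x → Finset (Fin n)}
    (he : StateGood 𝓔 (KExpr.weightList G) A χ.toLGraph.verts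
      (χ.toLGraph.tyOf 𝓟 (G.colorSet σ)) e.2.1 (extend W))
    (h : (ω.toFormula τ₁ τ₂).Oversat G A W) :
    Meets (constants γ τ₁).reverse (ω.bounds γ).1 e ∧ passes 𝓟
      (σ.rels.map Rel.code) (constants γ τ₂) (ω.bounds γ).2 e = true := by
  obtain ⟨H1, H2⟩ := oversat_toFormula.1 h
  have hW : (fun j : Fin x => extend W j) = W := funext (extend_val W)
  have hcap : (𝓔).cap = N * γ + 1 := rfl
  have hup : ∀ a s L g : ℕ, A * (g : ℝ) ≤ ((a + L : ℕ) : ℝ) → g ≤ N * γ →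
      UpTo 𝓔 A L s → g ≤ a + s := by
    intro a s L g h3 h4 h5
    rcases h5 with h5 | h5
    · omega
    · have : A * (g : ℝ) ≤ A * ((a + s : ℕ) : ℝ) := by
        refine h3.trans ?_
        push_cast
        rw [mul_add]
        exact add_le_add (le_mul_of_one_le_left (Nat.cast_nonneg a) hA) h5
      exact_mod_cast le_of_mul_le_mul_left this (by linarith)
  have hm₁ : (𝓔).terms₁.length = m₁ := by simp [inputEnv]
  have hm₂ : (𝓔).terms₂.length = m₂ := by simp [inputEnv]
  refine ⟨meets_bounds.2 fun i => ?_, ?_⟩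
  · have hT := cast_terms₁ (b := b) (N := N) (σ := σ) (q := q) (k := k) (τ₂ := τ₂)
      (target := target) (G := G) hγ h₁ i (extend W)
    rw [hW] at hT
    obtain ⟨h3, h4⟩ := he.fst (m₁ - 1 - i) (by rw [hm₁]; omega)
    have h5 := le_num_of_tight hγ hA hT (hω.1 i).1.1 (H1 i).1
    have h6 := num_mul_le_of_tight hγ hA hT (hω.1 i).2.1 (H1 i).2
    exact ⟨hup _ _ _ _ h6 (hω.1 i).2.2 h4, by omega⟩
  · have hex : 0 < m₂ → ∀ f ∈ e.2.1.2, ∃ Z,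
        χ.toLGraph.tyOf 𝓟 (G.colorSet σ) Z = f.1 := fun hm f hf =>
      let ⟨Z, _, _, h3, _⟩ := he.snd.lower f hf 0 (by rw [hm₂]; exact hm)
      ⟨Z, h3⟩
    let B : ℕ × Vec → Formula p 0 (x + y) → Bool := fun f => Formula.tv G Fin.elim0
      fun j : Fin (x + y) => (Classical.epsilon fun Z =>
        χ.toLGraph.tyOf 𝓟 (G.colorSet σ) Z = f.1) j
    have hB : ∀ f, ∀ Z, χ.toLGraph.tyOf 𝓟 (G.colorSet σ) Z = f.1 →
        bits 𝓟 (σ.rels.map Rel.code) f.1 =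
          (𝓕).map (B f) := fun f Z hZ => by
      have := Classical.epsilon_spec (p := fun Z =>
        χ.toLGraph.tyOf 𝓟 (G.colorSet σ) Z = f.1) ⟨Z, hZ⟩
      rw [← bits_tyOf hχ, this]
    have hB' : ∀ f, ∀ Z, χ.toLGraph.tyOf 𝓟 (G.colorSet σ) Z = f.1 →
        ∀ ψ ∈ 𝓕, Formula.tv G Fin.elim0 (fun j : Fin (x + y) => Z j) ψ =
          B f ψ := fun f Z hZ => by
      have h3 := hB f Z hZ
      rw [← hZ, bits_tyOf hχ] at h3
      exact map_inj_left.1 h3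
    refine (passes_bounds (fun f hf => (he.snd.len f hf).trans hm₂) B fun hm f hf =>
      (hex hm f hf).elim (hB f)).2 fun f hf i ψ => ?_
    have hi : (i : ℕ) < (𝓔).terms₂.length := by rw [hm₂]; exact i.2
    by_cases hψ : B f ψ.1 = true
    · exact Or.inl hψ
    right
    obtain ⟨Z, -, hZ, hθ, hlo⟩ := he.snd.lower f hf i hi
    obtain ⟨Z', -, hZ', hθ', hhi⟩ := he.snd.upper f hf i hi
    have hex2 : ∀ Z, (∀ i < x, Z i = extend W i) →
        χ.toLGraph.tyOf 𝓟 (G.colorSet σ) Z = f.1 →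
        A * (τ₂ i).eval G (fun j => Z j) ≤ 1 / A * ω.le₂ i ψ ∧
        A * ω.ge₂ i ψ ≤ 1 / A * (τ₂ i).eval G (fun j => Z j) := fun Z hZ hθ => by
      refine (H2 i ψ (fun j => Z j) fun j => ?_).resolve_left fun h3 => hψ ?_
      · exact (hZ j j.2).trans (extend_val W j)
      · rw [← hB' f Z hθ ψ.1 ψ.2]
        exact Formula.tv_iff.2 h3
    have hT := cast_terms₂ (b := b) (N := N) (σ := σ) (q := q) (k := k) (τ₁ := τ₁)
      (target := target) (G := G) hγ h₂ i
    have h5 := le_num_of_tight hγ hA (hT Z') (hω.2 i ψ).1.1 (hex2 Z' hZ' hθ').1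
    have h6 := num_mul_le_of_tight hγ hA (hT Z) (hω.2 i ψ).2.1 (hex2 Z hZ hθ).2
    exact ⟨hup _ _ _ _ h6 (hω.2 i ψ).2.2 hlo, by omega⟩

/-- A tuple satisfies the thresholds up to some slack if its entry meets them. -/
lemma undersat_of_meets {A : ℝ} (hγ : 0 < γ) (hA : 1 ≤ A)
    (h₁ : ∀ i, (τ₁ i).IsGranular γ) (h₂ : ∀ i, (τ₂ i).IsGranular γ) (hχ : χ.Builds G.graph)
    (hω : ω.AllThresholds fun g => Granular γ g ∧ num γ g ≤ N * γ) {e : Entry}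
    {W : Sets n}
    (he : StateGood 𝓔 (KExpr.weightList G) A χ.toLGraph.verts
      (χ.toLGraph.tyOf 𝓟 (G.colorSet σ)) e.2.1 W)
    (h : Meets (constants γ τ₁).reverse (ω.bounds γ).1 e) (h' : passes 𝓟
      (σ.rels.map Rel.code) (constants γ τ₂) (ω.bounds γ).2 e = true) :
    (ω.toFormula τ₁ τ₂).Undersat G A fun j => W j := by
  have hcap : (𝓔).cap = N * γ + 1 := rfl
  have hm₁ : (𝓔).terms₁.length = m₁ := by simp [inputEnv]
  have hm₂ : (𝓔).terms₂.length = m₂ := by simp [inputEnv]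
  have hup : ∀ a s L g : ℕ, a + s ≤ g → g ≤ N * γ →
      UpTo 𝓔 A L s → ((a + L : ℕ) : ℝ) ≤ A * g := by
    intro a s L g h3 h4 h5
    have h6 := h5.resolve_left (by omega)
    have h7 : ((a + s : ℕ) : ℝ) ≤ g := by exact_mod_cast h3
    push_cast at h7 ⊢
    calc (a : ℝ) + L ≤ A * a + A * s := add_le_add (le_mul_of_one_le_left (Nat.cast_nonneg a) hA) h6
      _ = A * (a + s) := by ring
      _ ≤ A * g := mul_le_mul_of_nonneg_left h7 (by linarith)
  refine undersat_toFormula.2 ⟨fun i => ?_, fun i ψ Zs hZs => ?_⟩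
  · obtain ⟨h3, h4⟩ := meets_bounds.1 h i
    have hT := cast_terms₁ (b := b) (N := N) (σ := σ) (q := q) (k := k) (τ₂ := τ₂)
      (target := target) (G := G) hγ h₁ i W
    obtain ⟨h5, h6⟩ := he.fst (m₁ - 1 - i) (by rw [hm₁]; omega)
    exact ⟨loose_of_le hγ hA hT (hω.1 i).1.1 (hup _ _ _ _ h4 (hω.1 i).1.2 h6),
      loose_of_ge hγ hA hT (hω.1 i).2.1 (by omega)⟩
  · have hi : (i : ℕ) < (𝓔).terms₂.length := by rw [hm₂]; exact i.2
    have hV : χ.toLGraph.verts = Finset.univ := (KExpr.presents (σ := σ) hχ).verts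
    obtain ⟨f, hf, hθ, hv⟩ := he.snd.cover (extend Zs) (fun j => by simp [hV]) fun j hj => by
      have h3 : (j : ℕ) < x := hj
      rw [← hZs ⟨j, h3⟩, ← extend_val Zs]
      rfl
    obtain ⟨h5, h6⟩ := hv i hi
    by_cases hψ : ψ.1.Sat G Fin.elim0 Zs
    · exact Or.inl hψ
    right
    have hW : (fun j : Fin (x + y) => extend Zs j) = Zs := funext (extend_val Zs)
    have hb := bits_tyOf (σ := σ) (q := q) (x := x) (y := y) hχ (extend Zs)
    rw [← hθ, hW] at hb
    have h7 := (passes_iff (by simp [TableFormula.bounds, constants]) fun f hf =>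
      (he.snd.len f hf).trans (by simp [hm₂, constants])).1 h' f hf i (by simp [constants])
    obtain ⟨j, hj, hjψ⟩ := mem_iff_getElem.1 ψ.2
    have h8 := h7 j (by rw [hb]; simpa using hj)
      (by rw [TableFormula.bounds, getD_map_finRange]; simpa using hj)
    have h9 : ((ω.bounds γ).2.getD i []).getD j 0 = (num γ (ω.le₂ i ψ), num γ (ω.ge₂ i ψ)) := by
      rw [TableFormula.bounds, getD_map_finRange]
      simp [getD_eq_getElem?_getD, hj, hjψ]
    have h10 : (bits 𝓟 (σ.rels.map Rel.code) f.1).getD j false =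
        Formula.tv G Fin.elim0 Zs ψ.1 := by
      rw [hb]
      simp [getD_eq_getElem?_getD, hj, hjψ]
    rw [h9, h10, within_iff, Formula.tv_iff, constants, getD_map_finRange] at h8
    obtain ⟨h3, h4⟩ := h8.resolve_left hψ
    have hT := cast_terms₂ (b := b) (N := N) (σ := σ) (q := q) (k := k) (τ₁ := τ₁)
      (target := target) (G := G) hγ h₂ i (extend Zs)
    rw [hW] at hT
    exact ⟨loose_of_le hγ hA hT (hω.2 i ψ).1.1 (hup _ _ _ _ h4 (hω.2 i ψ).1.2 h6),
      loose_of_ge hγ hA hT (hω.2 i ψ).2.1 (by omega)⟩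

end Root

/-! ### The value table -/

section Witness

variable {p n k x y m₁ m₂ : ℕ} {σ : Signature} {q b N γ : ℕ} {ω : TableFormula p σ q x y m₁ m₂}
  {τ₁ : Fin m₁ → WTerm ℝ p x} {τ₂ : Fin m₂ → WTerm ℝ p (x + y)} {target : WTerm ℤ p x}
  {G : WGraph p n} {χ : KExpr k n}

local notation "𝓟" => (σ.size, k, q, x + y)
local notation "𝓔" => inputEnv b N γ σ q k τ₁ τ₂ target

lemma enc_map {α β : Type} [Enc β] (f : α → β) (L : List α) :
    enc (L.map f) = Val.ofList (L.map fun a => enc (f a)) :=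
  congrArg Val.ofList (map_map ..)

lemma num_mem_gridList (hb : 0 < b) (hγ : 0 < γ) {g : ℝ}
    (h : g ∈ roundedN (1 + 1 / (b : ℝ)) N γ) : num γ g ∈ gridList b (N * γ) := by
  obtain ⟨e, he, rfl⟩ := (mem_roundedN hb hγ).1 h
  rwa [num_div hγ]

lemma roundOk_inputEnv (hb : 0 < b) : (𝓔).RoundOk (powBase b) := by
  intro h m hm
  have : ¬ m₁ + m₂ = 0 := by
    simp only [inputEnv, length_reverse, length_map, length_finRange] at h
    omega
  simp only [inputEnv, if_neg this] at hm ⊢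
  exact le_mul_roundDown hb (Nat.lt_succ_iff.1 hm)

lemma tableGood_inputEnv (hb : 0 < b) (hχ : χ.Builds G.graph) :
    TableGood 𝓔 (KExpr.weightList G)
      ((1 + 1 / (b : ℝ)) ^ χ.depth) χ.toLGraph.verts
      (χ.toLGraph.tyOf 𝓟 (G.colorSet σ))
      (treeTable 𝓔 (χ.toD σ G)) := by
  refine tableGood_treeTable rfl rfl (Nat.le_add_right x y) (fun cs hcs => ?_) (fun cs hcs => ?_)
    (WTerm.length_coeffs target).le (roundOk_inputEnv hb) (one_lt_powBase hb).le hχ.1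
  · obtain ⟨i, _, rfl⟩ := mem_map.1 (mem_reverse.1 hcs)
    exact (WTerm.length_coeffs _).le
  · obtain ⟨i, _, rfl⟩ := mem_map.1 hcs
    exact (WTerm.length_coeffs _).le

open Classical in
lemma exists_witness (hb : 0 < b) (hγ : 0 < γ) (h₁ : ∀ i, (τ₁ i).IsGranular γ)
    (h₂ : ∀ i, (τ₂ i).IsGranular γ) (hχ : χ.Builds G.graph)
    (hω : ω ∈ approxTable p (1 + 1 / (b : ℝ)) N γ σ q x y m₁ m₂) {L : List Entry}
    (hL : ∀ e, e ∈ L ↔ e ∈ treeTable 𝓔 (χ.toD σ G) ∧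
      Meets (constants γ τ₁).reverse (ω.bounds γ).1 e ∧ passes 𝓟
        (σ.rels.map Rel.code) (constants γ τ₂) (ω.bounds γ).2 e = true) :
    ∃ w : Option (Fin x → Finset (Fin n)), (enc (choose x L)).IsWitness w ∧
      oversatisfy G (ω.toFormula τ₁ τ₂) target ((1 + 1 / (b : ℝ)) ^ χ.depth) ≤
        targetValue G target w ∧
      ∀ W, w = some W → (ω.toFormula τ₁ τ₂).Undersat G ((1 + 1 / (b : ℝ)) ^ χ.depth) W := by
  have hA : 1 ≤ (1 + 1 / (b : ℝ)) ^ χ.depth := one_le_pow₀ (one_lt_powBase hb).le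
  have hT := tableGood_inputEnv (N := N) (γ := γ) (σ := σ) (q := q) (τ₁ := τ₁) (τ₂ := τ₂)
    (target := target) hb hχ
  have hle : ∀ g, g ∈ roundedN (1 + 1 / (b : ℝ)) N γ → num γ g ≤ N * γ := fun g hg =>
    le_of_mem_gridList hb (num_mem_gridList hb hγ hg)
  have hω' : ω.AllThresholds fun g => Granular γ g ∧ num γ g ≤ N * γ :=
    ⟨fun i => ⟨⟨(hω.1.1 i).1, hle _ (hω.2.1 i).1⟩, (hω.1.1 i).2, hle _ (hω.2.1 i).2⟩,
      fun i ψ => ⟨⟨(hω.1.2 i ψ).1, hle _ (hω.2.2 i ψ).1⟩, (hω.1.2 i ψ).2, hle _ (hω.2.2 i ψ).2⟩⟩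
  have hV : χ.toLGraph.verts = Finset.univ := (KExpr.presents (σ := σ) hχ).verts
  have htgt : ∀ (W : Fin x → Finset (Fin n)) (Z : Sets n), (∀ i : Fin x, Z i = W i) →
      target.eval G W = target.const + linSet (KExpr.weightList G) target.coeffs Z :=
    fun W Z h => target.eval_eq G h
  have hbest : ∀ W, (ω.toFormula τ₁ τ₂).Oversat G ((1 + 1 / (b : ℝ)) ^ χ.depth) W →
      ∃ e ∈ L, linSet (KExpr.weightList G) target.coeffs (extend W) ≤ e.2.2.1 := by
    intro W hW
    obtain ⟨e, he, h3, h4⟩ := hT.complete (extend W) (fun i => by simp [hV]) fun t ht => by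
      have ht' : t < m₁ := by simpa [inputEnv] using ht
      have h5 := cast_terms₁ (b := b) (N := N) (σ := σ) (q := q) (k := k) (τ₂ := τ₂)
        (target := target) (G := G) hγ h₁ ⟨m₁ - 1 - t, by omega⟩ (extend W)
      rw [show m₁ - 1 - ((⟨m₁ - 1 - t, by omega⟩ : Fin m₁) : ℕ) = t by dsimp only; omega,
        show (fun j : Fin x => extend W j) = W from funext (extend_val W)] at h5
      have h6 := le_num_of_tight hγ hA h5 (hω'.1 _).1.1 ((oversat_toFormula.1 hW).1 _).1
      have h7 := (hω'.1 ⟨m₁ - 1 - t, by omega⟩).1.2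
      have h8 : (𝓔).cap = N * γ + 1 := rfl
      omega
    obtain ⟨h5, h6⟩ := meets_and_passes hγ hA h₁ h₂ hχ hω' h3 hW
    exact ⟨e, (hL e).2 ⟨he, h5, h6⟩, h4⟩
  rcases choose_spec x L with ⟨rfl, h⟩ | ⟨e, he, h, hmax⟩
  · refine ⟨none, by rw [h]; rfl, Finset.sup_le fun W hW => ?_, fun W hW => by simp at hW⟩
    obtain ⟨e, he, _⟩ := hbest W (Finset.mem_filter.1 hW).2
    simp at he
  · obtain ⟨he1, he2, he3⟩ := (hL e).1 he
    obtain ⟨W, -, hS, hz, hR⟩ := hT.sound e he1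
    refine ⟨some fun i => W i, ?_, Finset.sup_le fun W' hW' => ?_, ?_⟩
    · choose! M hM1 hM2 hM3 using hR
      refine ⟨fun i => enc ((M i).map fun u : Fin n => (u : ℕ)), fun i =>
        ⟨M i, hM1 i i.2, hM2 i i.2, ?_⟩, ?_⟩
      · exact enc_map _ _
      · rw [h]
        refine congrArg (Val.pair (Val.num 1)) ?_
        rw [extract, enc_map]
        refine congrArg Val.ofList ?_
        rw [← map_coe_finRange_eq_range, map_map]
        refine map_congr_left fun i _ => ?_
        exact congrArg enc (hM3 i i.2)
    · obtain ⟨e', he', h3⟩ := hbest W' (Finset.mem_filter.1 hW').2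
      refine WithBot.coe_le_coe.2 ?_
      rw [htgt W' (extend W') (extend_val W'), htgt (fun i => W i) W fun _ => rfl]
      exact Int.add_le_add_left ((h3.trans (hmax e' he')).trans hz.le) _
    · rintro _ ⟨⟩
      exact undersat_of_meets hγ hA h₁ h₂ hχ hω' hS he2 he3

end Witness

section Table

variable {p n k x y m₁ m₂ : ℕ} {σ : Signature} {q b N γ : ℕ}
  {τ₁ : Fin m₁ → WTerm ℝ p x} {τ₂ : Fin m₂ → WTerm ℝ p (x + y)} {target : WTerm ℤ p x}
  {G : WGraph p n} {χ : KExpr k n}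

local notation "𝓟" => (σ.size, k, q, x + y)
local notation "𝓕" => (Formula.cmso σ q 0 (x + y) : List (Formula p 0 (x + y)))
local notation "𝓔" => inputEnv b N γ σ q k τ₁ τ₂ target

open Classical in
/-- The table formula with the given numerators of thresholds. -/
def TableFormula.ofBounds (γ : ℕ) (c : Bounds × List Bounds) : TableFormula p σ q x y m₁ m₂ where
  le₁ i := (c.1.getD i 0).1 / γ
  ge₁ i := (c.1.getD i 0).2 / γ
  le₂ i ψ := ((c.2.getD i []).getD ((𝓕).idxOf ψ.1) 0).1 / γ
  ge₂ i ψ := ((c.2.getD i []).getD ((𝓕).idxOf ψ.1) 0).2 / γ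

open Classical in
lemma TableFormula.ofBounds_bounds (hγ : 0 < γ) {ω : TableFormula p σ q x y m₁ m₂}
    (h : ω.AllThresholds (Granular γ)) : ofBounds γ (ω.bounds γ) = ω := by
  have hγ' : (γ : ℝ) ≠ 0 := Nat.cast_ne_zero.2 hγ.ne'
  have hn : ∀ g, Granular γ g → (num γ g : ℝ) / γ = g := fun g hg => by
    rw [num_cast hγ hg, mul_div_cancel_right₀ _ hγ']
  have hidx : ∀ (i : Fin m₂) ψ, (((ω.bounds γ).2.getD i []).getD
      ((𝓕).idxOf ψ.1) 0) = (num γ (ω.le₂ i ψ), num γ (ω.ge₂ i ψ)) := by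
    intro i ψ
    rw [bounds, getD_map_finRange]
    have := idxOf_lt_length_of_mem ψ.2
    simp [getD_eq_getElem?_getD, this]
  have e1 : (ofBounds γ (ω.bounds γ) : TableFormula p σ q x y m₁ m₂).le₂ = ω.le₂ :=
    funext₂ fun i ψ => by simp only [ofBounds, hidx, hn _ (h.2 i ψ).1]
  have e2 : (ofBounds γ (ω.bounds γ) : TableFormula p σ q x y m₁ m₂).ge₂ = ω.ge₂ :=
    funext₂ fun i ψ => by simp only [ofBounds, hidx, hn _ (h.2 i ψ).2]
  have e3 : (ofBounds γ (ω.bounds γ) : TableFormula p σ q x y m₁ m₂).le₁ = ω.le₁ :=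
    funext fun i => by simp only [ofBounds, bounds, getD_map_finRange, hn _ (h.1 i).1]
  have e4 : (ofBounds γ (ω.bounds γ) : TableFormula p σ q x y m₁ m₂).ge₁ = ω.ge₁ :=
    funext fun i => by simp only [ofBounds, bounds, getD_map_finRange, hn _ (h.1 i).2]
  generalize (ofBounds γ (ω.bounds γ) : TableFormula p σ q x y m₁ m₂) = ω' at e1 e2 e3 e4
  cases ω'
  cases ω
  simp only at e1 e2 e3 e4
  rw [e1, e2, e3, e4]

open Classical in
lemma TableFormula.bounds_ofBounds (hγ : 0 < γ) {c : Bounds × List Bounds} (h1 : c.1.length = m₁)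
    (h2 : c.2.length = m₂) (h3 : ∀ r ∈ c.2, r.length = (𝓕).length) :
    (ofBounds γ c : TableFormula p σ q x y m₁ m₂).bounds γ = c := by
  refine Prod.ext ?_ ?_
  · refine ext_getElem (by simp [bounds, h1]) fun i hi hi' => ?_
    simp [bounds, ofBounds, num_div hγ, getD_eq_getElem?_getD, hi']
  · refine ext_getElem (by simp [bounds, h2]) fun i hi hi' => ?_
    have hl := h3 _ (getElem_mem hi')
    refine ext_getElem (by simp [bounds, hl]) fun j hj hj' => ?_
    have : (𝓕).idxOf
        𝓕[j] = j := (Formula.nodup_cmso σ q 0 (x + y)).idxOf_getElem _ _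
    simp [bounds, ofBounds, num_div hγ, getD_eq_getElem?_getD, hi', this, hj']

lemma TableFormula.enc_bounds (hγ : 0 < γ) {ω : TableFormula p σ q x y m₁ m₂}
    (h : ω.AllThresholds (Granular γ)) : enc (ω.bounds γ) = Val.ofTableFormula γ ω := by
  refine congrArg₂ Val.pair ?_ ?_
  · rw [bounds, enc_map]
    refine congrArg _ (map_congr_left fun i _ => ?_)
    exact congrArg₂ Val.pair (enc_num hγ (h.1 i).1) (enc_num hγ (h.1 i).2)
  · rw [bounds, enc_map]
    refine congrArg _ (map_congr_left fun i _ => ?_)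
    rw [enc_map]
    refine congrArg _ (map_congr_left fun ψ _ => ?_)
    exact congrArg₂ Val.pair (enc_num hγ (h.2 i ψ).1) (enc_num hγ (h.2 i ψ).2)

lemma exists_isTable (hγ : 0 < γ) {S : Set (TableFormula p σ q x y m₁ m₂)}
    (hS : ∀ ω ∈ S, ω.AllThresholds (Granular γ)) {out : Output} (hn : (out.map Prod.fst).Nodup)
    (hmem : ∀ c, c ∈ out.map Prod.fst ↔ ∃ ω ∈ S, ω.bounds γ = c)
    {P : TableFormula p σ q x y m₁ m₂ → Option (Fin x → Finset (Fin n)) → Prop}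
    (hP : ∀ ω ∈ S, ∀ v, (ω.bounds γ, v) ∈ out → ∃ w, (enc v).IsWitness w ∧ P ω w) :
    ∃ witness : TableFormula p σ q x y m₁ m₂ → Option (Fin x → Finset (Fin n)),
      (∀ ω ∈ S, P ω (witness ω)) ∧ (enc out).IsTable γ S witness := by
  have h1 : ∀ ω : TableFormula p σ q x y m₁ m₂, ∃ v, ω ∈ S → (ω.bounds γ, v) ∈ out := fun ω => by
    by_cases hω : ω ∈ S
    · obtain ⟨⟨c, v⟩, h2, h3⟩ := mem_map.1 ((hmem _).2 ⟨ω, hω, rfl⟩)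
      obtain rfl : c = ω.bounds γ := h3
      exact ⟨v, fun _ => h2⟩
    · exact ⟨none, fun h => absurd h hω⟩
  choose v hv using h1
  have h2 : ∀ ω : TableFormula p σ q x y m₁ m₂, ∃ w : Option (Fin x → Finset (Fin n)), ω ∈ S →
      (enc (v ω)).IsWitness w ∧ P ω w := fun ω => by
    by_cases hω : ω ∈ S
    · obtain ⟨w, hw⟩ := hP ω hω _ (hv ω hω)
      exact ⟨w, fun _ => hw⟩
    · exact ⟨none, fun h => absurd h hω⟩
  choose w hw using h2
  have h3 : ∀ c ∈ out.map Prod.fst, (TableFormula.ofBounds γ c : TableFormula p σ q x y m₁ m₂) ∈ S ∧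
      (TableFormula.ofBounds γ c : TableFormula p σ q x y m₁ m₂).bounds γ = c := fun c hc => by
    obtain ⟨ω, hω, rfl⟩ := (hmem c).1 hc
    rw [TableFormula.ofBounds_bounds hγ (hS ω hω)]
    exact ⟨hω, rfl⟩
  refine ⟨w, fun ω hω => (hw ω hω).2, (out.map Prod.fst).map (TableFormula.ofBounds γ),
    fun ω => enc (v ω), ?_, fun ω => ⟨fun h => ?_, fun h => ?_⟩, fun ω hω => ?_, ?_⟩
  · refine (nodup_map_iff_inj_on hn).2 fun c hc c' hc' h => ?_
    rw [← (h3 c hc).2, ← (h3 c' hc').2, h]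
  · obtain ⟨c, hc, rfl⟩ := mem_map.1 h
    exact (h3 c hc).1
  · exact mem_map.2 ⟨_, (hmem _).2 ⟨ω, h, rfl⟩, TableFormula.ofBounds_bounds hγ (hS ω h)⟩
  · obtain ⟨c, hc, rfl⟩ := mem_map.1 hω
    exact (hw _ (h3 c hc).1).1
  · rw [map_map, map_map]
    refine congrArg Val.ofList (map_congr_left fun o ho => ?_)
    obtain ⟨h4, h5⟩ := h3 o.1 (mem_map_of_mem ho)
    have h6 := hv _ h4
    rw [h5] at h6
    have h7 : o = (o.1, v (TableFormula.ofBounds γ o.1)) :=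
      inj_on_of_nodup_map hn ho h6 rfl
    rw [Function.comp_apply, Function.comp_apply, ← TableFormula.enc_bounds hγ (hS _ h4), h5]
    exact congrArg enc h7

/-- All choices of thresholds for the terms of the second family. -/
def secondBounds (P : Bounds) (c m : ℕ) : List (List Bounds) :=
  if m = 0 then [[]] else tuples (tuples P c) m

lemma mem_secondBounds {P : Bounds} {c m : ℕ} {w : List Bounds} : w ∈ secondBounds P c m ↔
    w.length = m ∧ ∀ r ∈ w, r.length = c ∧ ∀ e ∈ r, e ∈ P := by
  unfold secondBounds
  split_ifs with h
  · subst h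
    rw [mem_singleton, length_eq_zero_iff]
    exact ⟨by rintro rfl; simp, fun h => h.1⟩
  · simp only [mem_tuples]

lemma nodup_secondBounds {P : Bounds} (hP : P.Nodup) (c m : ℕ) : (secondBounds P c m).Nodup := by
  unfold secondBounds
  split_ifs with h
  · simp
  · exact nodup_tuples (nodup_tuples hP c) m

open Classical in
lemma rootTable_correct (hb : 0 < b) (hγ : 0 < γ)
    (h₁ : ∀ i, (τ₁ i).IsGranular γ) (h₂ : ∀ i, (τ₂ i).IsGranular γ) (hχ : χ.Builds G.graph) :
    ∃ witness : TableFormula p σ q x y m₁ m₂ → Option (Fin x → Finset (Fin n)),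
      (∀ ω ∈ approxTable p (1 + 1 / (b : ℝ)) N γ σ q x y m₁ m₂,
        oversatisfy G (ω.toFormula τ₁ τ₂) target ((1 + 1 / (b : ℝ)) ^ χ.depth) ≤
          targetValue G target (witness ω) ∧
        ∀ W, witness ω = some W →
          (ω.toFormula τ₁ τ₂).Undersat G ((1 + 1 / (b : ℝ)) ^ χ.depth) W) ∧
      (enc (rootTable 𝓔 (σ.rels.map Rel.code)
        (constants γ τ₁).reverse (constants γ τ₂)
        (pairsWith Prod.mk (𝓔).grid
          (𝓔).grid)
        (secondBounds (pairsWith Prod.mk (𝓔).grid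
          (𝓔).grid)
          (numFormulas 𝓟 (σ.rels.map Rel.code)) m₂)
        (treeTable 𝓔 (χ.toD σ G)))).IsTable γ
        (approxTable p (1 + 1 / (b : ℝ)) N γ σ q x y m₁ m₂) witness := by
  have hR : (𝓔).grid.Nodup := by
    simp only [inputEnv]
    split_ifs
    · exact nodup_nil
    · exact nodup_gridList _ _
  have hmemR : 0 < m₁ + m₂ → ∀ e, e ∈ (𝓔).grid ↔
      e ∈ gridList b (N * γ) := fun h e => by
    simp only [inputEnv, if_neg h.ne']
  generalize (𝓔).grid = R at hR hmemR
  have hP : (pairsWith Prod.mk R R).Nodup := nodup_pairsWith (fun _ _ _ _ h => by simpa using h) hR hR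
  have hc : numFormulas 𝓟 (σ.rels.map Rel.code) =
      (𝓕).length := numFormulas_eq σ p rfl rfl
  have hPmem : 0 < m₁ + m₂ → ∀ g g', g ∈ roundedN (1 + 1 / (b : ℝ)) N γ →
      g' ∈ roundedN (1 + 1 / (b : ℝ)) N γ → (num γ g, num γ g') ∈ pairsWith Prod.mk R R :=
    fun h g g' hg hg' => mem_pairsWith.2 ⟨_, (hmemR h _).2 (num_mem_gridList hb hγ hg), _,
      (hmemR h _).2 (num_mem_gridList hb hγ hg'), rfl⟩
  have hPrnd : 0 < m₁ + m₂ → ∀ e ∈ pairsWith Prod.mk R R,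
      (Granular γ ((e.1 : ℝ) / γ) ∧ Granular γ ((e.2 : ℝ) / γ)) ∧
      (e.1 : ℝ) / γ ∈ roundedN (1 + 1 / (b : ℝ)) N γ ∧
        (e.2 : ℝ) / γ ∈ roundedN (1 + 1 / (b : ℝ)) N γ := by
    intro h e he
    obtain ⟨a, ha, a', ha', rfl⟩ := mem_pairsWith.1 he
    exact ⟨⟨⟨_, rfl⟩, _, rfl⟩, (mem_roundedN hb hγ).2 ⟨_, (hmemR h _).1 ha, rfl⟩,
      (mem_roundedN hb hγ).2 ⟨_, (hmemR h _).1 ha', rfl⟩⟩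
  refine exists_isTable (P := fun ω w => oversatisfy G (ω.toFormula τ₁ τ₂) target
    ((1 + 1 / (b : ℝ)) ^ χ.depth) ≤ targetValue G target w ∧ ∀ W, w = some W →
      (ω.toFormula τ₁ τ₂).Undersat G ((1 + 1 / (b : ℝ)) ^ χ.depth) W) hγ (fun ω hω => hω.1) ?_ (fun c => ?_) fun ω hω v hv => ?_
  · rw [map_fst_rootTable]
    exact nodup_pairsWith (fun _ _ _ _ h => by simpa using h) (nodup_configs hP _ _)
      (nodup_secondBounds hP _ _)
  · rw [map_fst_rootTable, mem_pairsWith]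
    constructor
    · rintro ⟨w, hw, w', hw', rfl⟩
      rw [mem_configs, length_reverse, constants, length_map, length_finRange] at hw
      rw [mem_secondBounds] at hw'
      have h3 : (TableFormula.ofBounds γ (w, w') : TableFormula p σ q x y m₁ m₂).bounds γ = (w, w') :=
        TableFormula.bounds_ofBounds hγ hw.1 hw'.1 fun r hr => (hw'.2 r hr).1.trans hc
      refine ⟨_, ?_, h3⟩
      have h4 : ∀ i : Fin m₁, w.getD i 0 ∈ pairsWith Prod.mk R R := fun i => by
        have hi : (i : ℕ) < w.length := by rw [hw.1]; exact i.2
        rw [getD_eq_getElem _ _ hi]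
        exact hw.2 _ (getElem_mem hi)
      have h5 : ∀ (i : Fin m₂) j, j < (𝓕).length → (w'.getD i []).getD j 0 ∈ pairsWith Prod.mk R R :=
        fun i j hj => by
          have hi : (i : ℕ) < w'.length := by rw [hw'.1]; exact i.2
          rw [getD_eq_getElem _ _ hi]
          obtain ⟨h6, h7⟩ := hw'.2 _ (getElem_mem hi)
          have hj' : j < w'[(i : ℕ)].length := by
            rw [hc] at h6
            exact h6.symm ▸ hj
          rw [getD_eq_getElem _ _ hj']
          exact h7 _ (getElem_mem hj')
      have e1 := fun i : Fin m₁ => hPrnd (by have := i.2; omega) _ (h4 i)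
      have e2 := fun (i : Fin m₂) (ψ : {ψ : Formula p 0 (x + y) // ψ ∈ 𝓕}) =>
        hPrnd (by have := i.2; omega) _ (h5 i _ (idxOf_lt_length_of_mem ψ.2))
      exact ⟨⟨fun i => (e1 i).1, fun i ψ => (e2 i ψ).1⟩, fun i => (e1 i).2, fun i ψ => (e2 i ψ).2⟩
    · rintro ⟨ω, hω, rfl⟩
      refine ⟨(ω.bounds γ).1, ?_, (ω.bounds γ).2, ?_, rfl⟩
      · rw [mem_configs]
        refine ⟨by simp [TableFormula.bounds, constants], fun e he => ?_⟩
        obtain ⟨i, _, rfl⟩ := mem_map.1 he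
        exact hPmem (by have := i.2; omega) _ _ (hω.2.1 i).1 (hω.2.1 i).2
      · rw [mem_secondBounds, hc]
        refine ⟨by simp [TableFormula.bounds], fun r hr => ?_⟩
        obtain ⟨i, _, rfl⟩ := mem_map.1 hr
        refine ⟨by simp, fun e he => ?_⟩
        obtain ⟨ψ, _, rfl⟩ := mem_map.1 he
        exact hPmem (by have := i.2; omega) _ _ (hω.2.2 i ψ).1 (hω.2.2 i ψ).2
  · obtain ⟨L, hL, rfl⟩ := mem_rootTable hv
    exact exists_witness hb hγ h₁ h₂ hχ hω hL

end Table

/-! ### Cost of the root table -/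

section RootCost

variable {α : Type} [Enc α] {D : α → Prop} {u : α → ℕ}

lemma TMD.tuples {γ : Type} [Enc γ] :
    TMD (fun a : List γ × ℕ => 2 ≤ a.1.length) (fun a => ApproxMSO.tuples a.1 a.2)
      (fun a => a.1.length ^ a.2) := by
  refine .foldl_geom (E := fun _ => True) (l := fun a : List γ × ℕ => range a.2)
    (g := fun a T _ => ApproxMSO.pairsWith (fun a l => a :: l) a.1 T) (s₀ := fun _ => [[]])
    (w := fun q => q.1.1.length * (q.2.1.length * (0 + 1) + 1))
    (.pairsWith (E := fun _ => True) (h := fun _ a l => a :: l) TM.on₀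
      (w := fun _ => 0) TM.on₀ TM.on₀ (fun _ => 0)
      (fun _ _ _ _ _ _ => ⟨trivial, le_rfl⟩) .refl)
    (TM.on (TM.range (u := fun a => a.2) fp .refl)
      (.of_le fun a ha => (Nat.lt_pow_self ha).le)) TM.on₀
    (fun _ m s => s.length ≤ m) (fun a => a.1.length) (fun _ => 2) (fun a ha => ⟨ha, by simp⟩)
    (fun a ha m hm s x hx hs => ⟨?_, trivial, ?_⟩) (.of_le_mul 3 fun a _ => ?_)
  · rw [length_pairsWith]
    exact Nat.mul_le_mul_left _ hs
  · dsimp only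
    nlinarith [Nat.mul_le_mul_left a.1.length hs, Nat.le_mul_of_pos_right a.1.length hm]
  · simp

lemma TMD.secondBounds :
    TMD (fun a : Bounds × ℕ × ℕ => 0 < a.2.2 → 2 ≤ a.1.length ∧ 0 < a.2.1)
      (fun a => ApproxMSO.secondBounds a.1 a.2.1 a.2.2)
      (fun a => a.1.length ^ (a.2.1 * a.2.2)) := by
  refine .ite_of TM.on₀ TM.on₀ (.restrict
    (D := fun a : Bounds × ℕ × ℕ => 0 < a.2.2 ∧ 2 ≤ a.1.length ∧ 0 < a.2.1) (TMD.tuples.comp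
    (f := fun a : Bounds × ℕ × ℕ => (ApproxMSO.tuples a.1 a.2.1, a.2.2))
    (.prodMk (TMD.tuples.app (fun a : Bounds × ℕ × ℕ => (a.1, a.2.1)) (fun a ha => ha.2.1) (.of_le fun a ⟨h, h1, _⟩ => Nat.pow_le_pow_right (by dsimp only; omega)
        (Nat.le_mul_of_pos_right _ h))) TM.on₀)
    (fun a ⟨_, h1, h2⟩ => ?_) (.of_le fun a ha => ?_)) fun a ⟨h, h'⟩ =>
      ⟨Nat.pos_of_ne_zero h', h (Nat.pos_of_ne_zero h')⟩)
  · rw [length_tuples]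
    exact h1.trans (Nat.le_self_pow h2.ne' _)
  · rw [length_tuples, pow_mul]

@[fun_prop] lemma TM.within {f : α → ℕ × ℕ} {g h : α → ℕ} (hf : TM f u) (hg : TM g u)
    (hh : TM h u) : TM (fun a => within (f a) (g a) (h a)) u := by
  unfold ApproxMSO.within
  fun_prop

lemma TMD.configs :
    TMD (fun a : Bounds × List ℕ × Table => a.2.1 = [] ∨ 2 ≤ a.1.length)
      (fun a => ApproxMSO.configs a.1 a.2.1 a.2.2)
      (fun a => (a.2.2.length + 1) * a.1.length ^ a.2.1.length) := by
  have h1 : TMD (fun _ : Bounds × Config × ℕ => True) (fun q => refineConfig q.1 q.2.1 q.2.2)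
      (fun q => q.1.length * (q.2.1.2.length + 1)) := by
    refine .map (E := fun _ => True) (l := fun q => q.1)
      (h := fun (q : Bounds × Config × ℕ) p => (p :: q.2.1.1,
        (q.2.1.2.filter fun e => within p (q.2.2 + e.1.headD 0) (q.2.2 + e.1.headD 0)).map
          fun e => (e.1.tail, e.2))) (w := fun q => q.1.2.1.2.length)
      (.prodMk (f := fun q : (Bounds × Config × ℕ) × ℕ × ℕ => q.2 :: q.1.2.1.1) TM.on₀
        (.map (E := fun _ => True) (w := fun _ => 0) (h := fun _ e => (e.1.tail, e.2))
          TM.on₀ (.filter (E := fun _ => True) (w := fun _ => 0)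
            (p := fun (q : (Bounds × Config × ℕ) × ℕ × ℕ) (e : List ℕ × Entry) =>
              within q.2 (q.1.2.2 + e.1.headD 0) (q.1.2.2 + e.1.headD 0))
            TM.on₀ TM.on₀ (fun _ => 0)
            (fun _ _ _ _ => ⟨trivial, le_rfl⟩) (.of_le fun q _ => by omega)) (fun _ => 0)
          (fun _ _ _ _ => ⟨trivial, le_rfl⟩) (.of_le fun q _ => ?_)))
      TM.on₀ (fun q => q.2.1.2.length) (fun _ _ _ _ => ⟨trivial, le_rfl⟩) .refl
    rw [zero_add, mul_one]
    exact length_filter_le _ _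
  have h2 : TMD (fun q : (Bounds × List ℕ × Table) × List Config × ℕ =>
        ∀ c ∈ q.2.1, c.2.length ≤ q.1.2.2.length)
      (fun q => q.2.1.flatMap fun c => refineConfig q.1.1 c q.2.2)
      (fun q => q.2.1.length * (q.1.1.length * (q.1.2.2.length + 1) + 1)) := by
    refine .flatMap (h := fun (q : (Bounds × List ℕ × Table) × List Config × ℕ) c =>
        refineConfig q.1.1 c q.2.2)
      (h1.comp (f := fun q : ((Bounds × List ℕ × Table) × List Config × ℕ) × Config =>
        (q.1.1.1, q.2, q.1.2.2)) (D := fun _ => True) TM.on₀ (fun _ _ => trivial)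
        .refl) TM.on₀ (fun q => q.1.1.length * (q.1.2.2.length + 1))
      (fun q hq c hc => ⟨trivial, Nat.mul_le_mul_left _ (Nat.succ_le_succ (hq c hc)), ?_⟩) .refl
    rw [refineConfig, length_map]
    exact Nat.le_mul_of_pos_right _ (by omega)
  have h3 : ∀ a : Bounds × List ℕ × Table, (a.2.1 = [] ∨ 2 ≤ a.1.length) →
      max 2 a.1.length ^ a.2.1.length = a.1.length ^ a.2.1.length := by
    rintro a (h | h)
    · simp [h]
    · rw [max_eq_right h]
  have h4 : ∀ a : Bounds × List ℕ × Table, (a.2.1 = [] ∨ 2 ≤ a.1.length) →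
      0 < a.1.length ^ a.2.1.length := fun a ha => by
    rw [← h3 a ha]
    positivity
  refine .foldl_geom (s₀ := fun a : Bounds × List ℕ × Table => [([], a.2.2.map fun e => (e.2.1.1, e))])
    h2 TM.on₀ (.comp₀ (g := fun L => [(([] : Bounds), L)]) fp
      (.map (E := fun _ => True) (w := fun _ => 0) (h := fun _ (e : Entry) => (e.2.1.1, e))
        TM.on₀ TM.on₀ (fun _ => 0)
        (fun _ _ _ _ => ⟨trivial, le_rfl⟩) (.of_le fun a ha => ?_)))
    (fun a m s => s.length ≤ m ∧ ∀ c ∈ s, c.2.length ≤ a.2.2.length) (fun a => max 2 a.1.length)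
    (fun a => a.2.2.length + 2) (fun a _ => ⟨le_max_left _ _, by simp⟩)
    (fun a _ m hm s x _ ⟨hs, hs'⟩ => ⟨⟨?_, fun c hc => ?_⟩, hs', ?_⟩) (.of_le_mul 3 fun a ha => ?_)
  · nlinarith [h4 a ha]
  · rw [length_flatMap]
    refine (sum_le_card_nsmul _ a.1.length fun y hy => ?_).trans ?_
    · obtain ⟨c, _, rfl⟩ := mem_map.1 hy
      rw [refineConfig, length_map]
    · rw [length_map, smul_eq_mul, mul_comm]
      exact Nat.mul_le_mul (le_max_right _ _) hs
  · obtain ⟨c', hc', h⟩ := mem_flatMap.1 hc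
    obtain ⟨p, _, rfl⟩ := mem_map.1 h
    rw [length_map]
    exact (length_filter_le _ _).trans (hs' c' hc')
  · have h5 : a.1.length ≤ max 2 a.1.length := le_max_right _ _
    have h6 : 2 ≤ max 2 a.1.length := le_max_left _ _
    calc _ ≤ m * (max 2 a.1.length * (a.2.2.length + 1) + max 2 a.1.length) :=
          Nat.mul_le_mul hs (Nat.add_le_add (Nat.mul_le_mul_right _ h5) (by omega))
      _ = _ := by ring
  · rw [h3 a ha]
    nlinarith [h4 a ha]

lemma TM.best : TM ApproxMSO.best List.length :=
  TM.foldl₁ fp fp fp .refl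

lemma best_subset (L : List Entry) : ∀ e ∈ best L, e ∈ L := by
  suffices ∀ M : List Entry, (∀ e ∈ M, e ∈ L) → ∀ b : List Entry, (∀ e ∈ b, e ∈ L) →
      ∀ e ∈ M.foldl (fun b e => if b.isEmpty = true ∨ (b.headD e).2.2.1 < e.2.2.1 then [e] else b) b,
        e ∈ L from this L (fun _ => id) [] (by simp)
  intro M
  induction M with
  | nil => exact fun _ _ h => h
  | cons x M ih =>
    refine fun hM b hb => ih (fun e he => hM e (by simp [he])) _ ?_
    beta_reduce
    split_ifs
    · simpa using hM x (by simp)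
    · exact hb

lemma TMD.extract : TMD (fun _ : ℕ × Rope => True) (fun a => ApproxMSO.extract a.1 a.2)
    (fun a => (a.1 + 1) ^ 2 * (a.2.size + 1)) := by
  refine .map (l := fun a : ℕ × Rope => range a.1) (w := fun q => (q.2 + 1) * (q.1.2.size + 1))
    (E := fun _ => True) (h := fun (a : ℕ × Rope) i =>
      (a.2.leaves.filter fun e => decide (bit e.2 i = 1)).map Prod.fst) ?_
    (TM.on (TM.range (u := fun a => a.1) fp .refl) (.of_le fun a _ => by nlinarith))
    (fun a => (a.1 + 1) * (a.2.size + 1))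
    (fun a _ i hi => ⟨trivial, Nat.mul_le_mul_right _ (by simp at hi; omega)⟩)
    (.of_le_mul 2 fun a _ => by
      rw [length_range]
      nlinarith [Nat.zero_le (a.1 * a.2.size), Nat.zero_le (a.1 * a.1 * a.2.size)])
  refine .map (E := fun _ => True) (w := fun _ => 0) (h := fun _ => Prod.fst) TM.on₀
    (.filter (E := fun _ => True) (w := fun q => q.1.2)
      (p := fun (q : (ℕ × Rope) × ℕ) (e : ℕ × ℕ) => decide (bit e.2 q.2 = 1))
      (.comp₀ (g := fun i => decide (i = 1)) fp (.comp (E := fun _ => True)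
        (f := fun p : ((ℕ × Rope) × ℕ) × ℕ × ℕ => (p.2.2, p.1.2)) TM.bit.on' TM.on₀
        (fun _ _ => trivial) .refl))
      (.comp (E := fun _ => True) (f := fun q : (ℕ × Rope) × ℕ => q.1.2) TM.ropeLeaves.on' TM.on₀
        (fun _ _ => trivial) (.of_le fun q _ => by nlinarith)) (fun q => q.2)
      (fun _ _ _ _ => ⟨trivial, le_rfl⟩) (.of_le fun q _ => ?_)) (fun _ => 0)
    (fun _ _ _ _ => ⟨trivial, le_rfl⟩) (.of_le fun q _ => ?_)
  · have := q.1.2.length_leaves_le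
    nlinarith
  · have := q.1.2.length_leaves_le
    have := length_filter_le (fun e => decide (bit e.2 q.2 = 1)) q.1.2.leaves
    nlinarith

/-- Here `S` bounds the sizes of the trees in the entries. -/
lemma TMD.choose {x : α → ℕ} {L : α → List Entry} (hx : TM x fun _ => 0) (hL : TMD D L u)
    (S : α → ℕ) (hS : ∀ a, D a → ∀ e ∈ L a, e.2.2.2.size ≤ S a)
    (hu : DomOn D (fun a => (L a).length + (x a + 1) ^ 2 * (S a + 2)) u) :
    TMD D (fun a => ApproxMSO.choose (x a) (L a)) u := by
  have hb : TMD D (fun a => best (L a)) u := TMD.comp (E := fun _ => True) TM.best.on' hL (fun _ _ => trivial)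
    (.trans (.of_le fun a _ => Nat.le_add_right _ _) hu)
  refine .ite (.comp₀ (g := fun L : List Entry => decide (L.isEmpty = true)) fp hb)
    TM.on₀ (.comp₀ (g := fun L => some L) fp (TMD.extract.comp
      (f := fun a => (x a, ((best (L a)).headD (0, ([], []), 0, Rope.leaf 0 0)).2.2.2))
      (.prodMk (TM.on₀ hx) (.comp₀ (g := fun L : List Entry =>
        (L.headD (0, ([], []), 0, Rope.leaf 0 0)).2.2.2) fp hb)) (fun _ _ => trivial)
      (.trans (.of_le fun a ha => le_trans (Nat.mul_le_mul_left _ (Nat.succ_le_succ ?_))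
        (Nat.le_add_left _ _)) hu)))
  have := best_subset (L a)
  cases h : best (L a) with
  | nil => simp [Rope.size]
  | cons e l => exact (hS a ha e (this e (by simp [h]))).trans (Nat.le_succ _)

abbrev Candidate := (Env × List ℕ × List ℕ) × List Bounds × Entry

lemma exists_passes : ∃ g : Params → ℕ, Primrec g ∧
    TMD (fun a : Candidate =>
        RelsOk a.1.1.par.1 a.1.2.1 ∧ AssocOk a.1.1 a.2.2.2.1.2)
      (fun a => passes a.1.1.par a.1.2.1 a.1.2.2 a.2.1 a.2.2)
      (fun a => g a.1.1.par * (a.1.2.2.length + 1)) := by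
  obtain ⟨g, h1, h2, h3⟩ := exists_bits
  refine ⟨fun p => (tyBound p p.2.2.1) * (2 * g p + 2), fp, ?_⟩
  have h4 : TMD (fun q : (Candidate × ℕ × Vec) × (ℕ × ℕ × ℕ) × Bounds =>
        RelsOk q.1.1.1.1.par.1 q.1.1.1.2.1 ∧ q.1.2.1 < q.1.1.1.1.tb)
      (fun q => (zipWith (fun b r => b || within r (q.2.1.1 + q.2.1.2.1) (q.2.1.1 + q.2.1.2.2))
        (bits q.1.1.1.1.par q.1.1.1.2.1 q.1.2.1) q.2.2).all fun b => b)
      (fun q => g q.1.1.1.1.par) := by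
    have h5 : TMD (fun q : (Candidate × ℕ × Vec) × (ℕ × ℕ × ℕ) × Bounds =>
        RelsOk q.1.1.1.1.par.1 q.1.1.1.2.1 ∧ q.1.2.1 < q.1.1.1.1.tb)
        (fun q => bits q.1.1.1.1.par q.1.1.1.2.1 q.1.2.1) (fun q => g q.1.1.1.1.par) :=
      h2.app (fun q : (Candidate × ℕ × Vec) × (ℕ × ℕ × ℕ) × Bounds =>
        ((q.1.1.1.1.par, q.1.1.1.2.1), q.1.2.1)) (fun _ h => h) .refl
    refine .all (p := fun _ b => b) (E := fun _ => True) (w := fun _ => 0) TM.on₀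
      (.zipWith (h := fun (q : (Candidate × ℕ × Vec) × (ℕ × ℕ × ℕ) × Bounds) b r =>
        b || within r (q.2.1.1 + q.2.1.2.1) (q.2.1.1 + q.2.1.2.2)) (E := fun _ => True) (w := fun _ => 0)
        TM.on₀ h5 TM.on₀ (fun _ => 0)
        (fun _ _ _ _ _ _ => ⟨trivial, le_rfl⟩) (.of_le fun q hq => ?_)) (fun _ => 0)
      (fun _ _ _ _ => ⟨trivial, le_rfl⟩) (.of_le fun q hq => ?_)
    · simpa using h3 _ _ _ hq.1 hq.2
    · simpa using Or.inl (h3 _ _ _ hq.1 hq.2)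
  refine .all (E := fun q : Candidate × ℕ × Vec => RelsOk q.1.1.1.par.1 q.1.1.2.1 ∧ q.2.1 < q.1.1.1.tb)
    (l := fun a : Candidate => a.2.2.2.1.2) (p := fun a f => (zipWith (fun (b : ℕ × ℕ × ℕ) (r : Bounds) =>
      (zipWith (fun c q => c || within q (b.1 + b.2.1) (b.1 + b.2.2))
        (bits a.1.1.par a.1.2.1 f.1) r).all fun b => b) (a.1.2.2.zip f.2) a.2.1).all fun b => b)
    (w := fun q => q.1.1.2.2.length * (g q.1.1.1.par + 1)) ?_ TM.on₀
    (fun a => a.1.2.2.length * (g a.1.1.par + 1))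
    (fun a ha f hf => ⟨⟨ha.1, ha.2.lt f hf⟩, le_rfl⟩) (.of_le fun a ha => ?_)
  · refine .all (p := fun _ b => b) (E := fun _ => True) (w := fun _ => 0) TM.on₀
      (.zipWith (h := fun (q : Candidate × ℕ × Vec) (b : ℕ × ℕ × ℕ) (r : Bounds) =>
        (zipWith (fun c q => c || within q (b.1 + b.2.1) (b.1 + b.2.2))
        (bits q.1.1.1.par q.1.1.2.1 q.2.1) r).all fun b => b) h4
        (TM.on (TM.zip (u := fun q => q.1.1.2.2.length) fp fp .refl)
          (.of_le fun q _ => Nat.le_mul_of_pos_right _ (by omega))) TM.on₀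
        (fun q => g q.1.1.1.par) (fun q hq _ _ _ _ => ⟨hq, le_rfl⟩) (.of_le fun q _ => ?_)) (fun _ => 0)
      (fun _ _ _ _ => ⟨trivial, le_rfl⟩) (.of_le fun q _ => ?_)
    · exact Nat.mul_le_mul_right _ (by simp)
    · rw [zero_add, mul_one, length_zipWith, length_zip]
      exact (min_le_left _ _).trans ((min_le_left _ _).trans (Nat.le_mul_of_pos_right _ (by omega)))
  · calc _ ≤ a.1.1.tb * (a.1.2.2.length * (g a.1.1.par + 1) + 1) := Nat.mul_le_mul_right _ ha.2.length_le
      _ ≤ a.1.1.tb * ((2 * g a.1.1.par + 2) * (a.1.2.2.length + 1)) :=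
        Nat.mul_le_mul_left _ (by nlinarith)
      _ = _ := (mul_assoc _ _ _).symm

lemma mem_foldl_insEntry {L T : List Entry} {e : Entry} (h : e ∈ L.foldl insEntry T) :
    e ∈ L ∨ e ∈ T := by
  induction L generalizing T with
  | nil => exact Or.inr h
  | cons x L ih =>
    rcases ih h with h | h
    · exact Or.inl (mem_cons_of_mem _ h)
    · rcases mem_insEntry h with rfl | h
      · exact Or.inl mem_cons_self
      · exact Or.inr h

lemma size_treeTable (E : Env) (e : DExpr) :
    ∀ i ∈ treeTable E e, i.2.2.2.size ≤ 3 * e.size := by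
  have hc : ∀ (c : ℕ × ℕ × ℕ) (S S' : Table) (a b : ℕ), (∀ i ∈ S, i.2.2.2.size ≤ a) →
      (∀ i ∈ S', i.2.2.2.size ≤ b) → ∀ i ∈ combTable E c S S', i.2.2.2.size ≤ a + b + 1 := by
    intro c S S' a b h h' i hi
    rcases mem_foldl_insEntry hi with hi | hi
    · obtain ⟨j, hj, j', hj', rfl⟩ := mem_pairsWith.1 (mem_of_mem_filter hi)
      exact Nat.succ_le_succ (Nat.add_le_add (h j hj) (h' j' hj'))
    · simp at hi
  induction e with
  | vertex r =>
    intro i hi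
    obtain ⟨m, _, rfl⟩ := mem_map.1 hi
    simp [mkEntry, Rope.size, DExpr.size]
  | union a b ha hb =>
    exact fun i hi => (hc _ _ _ _ _ ha hb i hi).trans (by simp only [DExpr.size]; omega)
  | op c a ha =>
    refine fun i hi => (hc c _ (trivialTable E) _ 1 ha (fun i hi => ?_) i hi).trans
      (by simp only [DExpr.size]; omega)
    rw [trivialTable, mem_singleton] at hi
    simp [hi, mkEntry, Rope.size]

/-- The data for the root table, and an expression that bounds the sizes of the trees. -/
abbrev RootData := (Env × List ℕ × List ℕ × List ℕ) × (Bounds × List (List Bounds) × Table) × DExpr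

structure RootOk (a : RootData) : Prop where
  rels : RelsOk a.1.1.par.1 a.1.2.1
  numX : a.1.1.numX ≤ a.1.1.par.2.2.2
  grid : a.1.2.2.1 = [] ∨ 2 ≤ a.2.1.1.length
  table : ∀ e ∈ a.2.1.2.2, AssocOk a.1.1 e.2.1.2 ∧ e.2.2.2.size ≤ 3 * a.2.2.size

lemma length_configs (P : Bounds) (as : List ℕ) (T : Table) :
    (configs P as T).length = P.length ^ as.length := by
  induction as using reverseRecOn with
  | nil => rfl
  | append_singleton as a ih => simp [configs_append, length_flatMap, refineConfig, ih, pow_succ]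

lemma configs_sub {P : Bounds} {as : List ℕ} {T : Table} {c : Config} (hc : c ∈ configs P as T) :
    c.2.length ≤ T.length ∧ ∀ e ∈ c.2, e.2 ∈ T := by
  induction as using reverseRecOn generalizing c with
  | nil =>
    rw [configs, foldl_nil, mem_singleton] at hc
    subst hc
    refine ⟨(length_map _).le, fun e he => ?_⟩
    obtain ⟨e', he', rfl⟩ := mem_map.1 he
    exact he'
  | append_singleton as a ih =>
    rw [configs_append, mem_flatMap] at hc
    obtain ⟨c', hc', h⟩ := hc
    obtain ⟨p, _, rfl⟩ := mem_map.1 h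
    rw [length_map]
    refine ⟨(length_filter_le _ _).trans (ih hc').1, fun e he => ?_⟩
    obtain ⟨e', he', rfl⟩ := mem_map.1 he
    exact (ih hc').2 e' (mem_of_mem_filter he')

lemma exists_rootTable : ∃ g : Params → ℕ, Primrec g ∧ TMD RootOk
    (fun a => rootTable a.1.1 a.1.2.1 a.1.2.2.1 a.1.2.2.2 a.2.1.1 a.2.1.2.1 a.2.1.2.2)
    (fun a => a.2.1.1.length ^ a.1.2.2.1.length * ((a.2.1.2.1.length + 1) *
      (g a.1.1.par * ((a.2.1.2.2.length + 1) * (a.1.2.2.2.length + 1) + a.2.2.size)))) := by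
  obtain ⟨g, h1, h2⟩ := exists_passes
  refine ⟨fun p => g p + 6 * ((p.2.2.2 + 1) * (p.2.2.2 + 1)) + 3, fp, ?_⟩
  let w : RootData → ℕ := fun a => (a.2.1.2.2.length + 1) * (g a.1.1.par * (a.1.2.2.2.length + 1) + 2) +
    (a.1.1.numX + 1) ^ 2 * (3 * a.2.2.size + 2)
  have hw : ∀ a : RootData, RootOk a → w a + 1 ≤ (g a.1.1.par + 6 * ((a.1.1.par.2.2.2 + 1) *
      (a.1.1.par.2.2.2 + 1)) + 3) * ((a.2.1.2.2.length + 1) * (a.1.2.2.2.length + 1) + a.2.2.size) := by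
    intro a ha
    have h3 : (a.1.1.numX + 1) ^ 2 ≤ (a.1.1.par.2.2.2 + 1) * (a.1.1.par.2.2.2 + 1) := by
      rw [sq]
      exact Nat.mul_le_mul (Nat.succ_le_succ ha.numX) (Nat.succ_le_succ ha.numX)
    have h4 : 1 ≤ a.2.2.size := by cases a.2.2 <;> simp [DExpr.size]
    dsimp only [w]
    generalize a.2.2.size = s at *
    generalize a.2.1.2.2.length = t
    generalize a.1.2.2.2.length = m
    generalize g a.1.1.par = G
    generalize (a.1.1.par.2.2.2 + 1) * (a.1.1.par.2.2.2 + 1) = l at *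
    have h5 := Nat.mul_le_mul_right (3 * s + 2) h3
    have h6 : l * (3 * s + 2) ≤ 6 * l * s := by nlinarith
    nlinarith [Nat.zero_le (t * m), Nat.zero_le (G * s), Nat.zero_le (l * ((t + 1) * (m + 1)))]
  have h3 : TMD (fun q : (RootData × Config) × List Bounds => RootOk q.1.1 ∧
        q.1.2.2.length ≤ q.1.1.2.1.2.2.length ∧ ∀ e ∈ q.1.2.2, e.2 ∈ q.1.1.2.1.2.2)
      (fun q => choose q.1.1.1.1.numX ((q.1.2.2.map Prod.snd).filter
        (passes q.1.1.1.1.par q.1.1.1.2.1 q.1.1.1.2.2.2 q.2))) (fun q => w q.1.1) := by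
    refine .choose fp (.filter (p := fun (q : (RootData × Config) × List Bounds) e =>
        passes q.1.1.1.1.par q.1.1.1.2.1 q.1.1.1.2.2.2 q.2 e) (h2.comp
        (f := fun r : ((RootData × Config) × List Bounds) × Entry =>
          ((r.1.1.1.1.1, r.1.1.1.1.2.1, r.1.1.1.1.2.2.2), r.1.2, r.2))
        (D := fun r => RelsOk r.1.1.1.1.1.par.1 r.1.1.1.1.2.1 ∧ AssocOk r.1.1.1.1.1 r.2.2.1.2)
        TM.on₀ (fun _ h => h) .refl)
      (.map (E := fun _ => True) (w := fun _ => 0) (h := fun _ => Prod.snd) TM.on₀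
        TM.on₀ (fun _ => 0) (fun _ _ _ _ => ⟨trivial, le_rfl⟩) (.of_le fun q hq => ?_))
      (fun q => g q.1.1.1.1.par * (q.1.1.1.2.2.2.length + 1)) (fun q hq e he => ⟨⟨hq.1.rels, ?_⟩, le_rfl⟩)
      (.of_le fun q hq => ?_)) (fun q => 3 * q.1.1.2.2.size) (fun q hq e he => ?_)
      (.of_le fun q hq => ?_)
    · have := hq.2.1
      dsimp only [w]
      nlinarith [Nat.zero_le (g q.1.1.1.1.par * (q.1.1.1.2.2.2.length + 1))]
    · obtain ⟨e', he', rfl⟩ := mem_map.1 he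
      exact (hq.1.table _ (hq.2.2 e' he')).1
    · rw [length_map]
      exact (Nat.mul_le_mul (hq.2.1.trans (Nat.le_succ _)) (Nat.le_succ _)).trans (Nat.le_add_right _ _)
    · obtain ⟨e', he', rfl⟩ := mem_map.1 (mem_of_mem_filter he)
      exact (hq.1.table _ (hq.2.2 e' he')).2
    · refine Nat.add_le_add_right ((length_filter_le _ _).trans ?_) _
      rw [length_map]
      nlinarith [hq.2.1, Nat.zero_le ((q.1.1.2.1.2.2.length + 1) *
        (g q.1.1.1.1.par * (q.1.1.1.2.2.2.length + 1)))]
  refine .flatMap (E := fun q : RootData × Config => RootOk q.1 ∧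
      q.2.2.length ≤ q.1.2.1.2.2.length ∧ ∀ e ∈ q.2.2, e.2 ∈ q.1.2.1.2.2)
    (h := fun a c => a.2.1.2.1.map fun v => ((c.1, v), choose a.1.1.numX ((c.2.map Prod.snd).filter
      (passes a.1.1.par a.1.2.1 a.1.2.2.2 v)))) (w := fun q => q.1.2.1.2.1.length * (w q.1 + 1))
    (.map (h := fun (q : RootData × Config) v => ((q.2.1, v), choose q.1.1.1.numX
      ((q.2.2.map Prod.snd).filter (passes q.1.1.1.par q.1.1.2.1 q.1.1.2.2.2 v))))
      (.prodMk (f := fun r : (RootData × Config) × List Bounds => (r.1.2.1, r.2))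
        TM.on₀ h3) TM.on₀
      (fun q => w q.1) (fun q hq v hv => ⟨hq, le_rfl⟩) .refl)
    (TMD.configs.app (fun a : RootData => (a.2.1.1, a.1.2.2.1, a.2.1.2.2)) (fun a ha => ha.grid) (.of_le fun a ha => ?_)) (fun a => a.2.1.2.1.length * (w a + 1))
    (fun a ha c hc => ⟨⟨ha, configs_sub hc⟩, le_rfl, ?_⟩) (.of_le fun a ha => ?_)
  · rw [mul_comm]
    refine Nat.mul_le_mul_left _ (le_trans ?_ (Nat.mul_le_mul_left _ (hw a ha)))
    dsimp only [w]
    nlinarith [Nat.zero_le (g a.1.1.par * (a.1.2.2.2.length + 1)), Nat.zero_le ((a.2.1.2.1.length) *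
      ((a.2.1.2.2.length + 1) * (g a.1.1.par * (a.1.2.2.2.length + 1) + 2) +
    (a.1.1.numX + 1) ^ 2 * (3 * a.2.2.size + 2))), Nat.zero_le ((a.2.1.2.2.length + 1) *
    (g a.1.1.par * (a.1.2.2.2.length + 1)))]
  · rw [length_map]
    exact Nat.le_mul_of_pos_right _ (by omega)
  · rw [length_configs]
    refine Nat.mul_le_mul_left _ (le_trans ?_ (Nat.mul_le_mul_left _ (hw a ha)))
    rw [Nat.succ_mul]
    omega

end RootCost

/-! ### The input of the program -/

instance : Enc Rel := ⟨Val.ofRel⟩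

lemma TM.relCases {β : Type} [Enc β] {f : Rel → β} (h₁ : TM (fun c => f (.color c)) fun _ => 0)
    (h₂ : TM (fun a : ℕ × ℕ => f (.card a.1 a.2)) fun _ => 0) : TM f fun _ => 0 := by
  obtain ⟨c₀, K₀, h₀⟩ := TM.exists_const (enc (f .edge))
  obtain ⟨c₁, K₁, h₁⟩ := h₁
  obtain ⟨c₂, K₂, h₂⟩ := h₂
  refine .of_run (.ite (.prim .fst) (.ite (.comp (.prim .le) (.pair (.prim .fst) (.prim (.const 1))))
    (.comp c₁ (.prim .snd)) (.comp c₂ (.prim .snd))) c₀) (K₀ + K₁ + K₂ + 20) fun r => ?_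
  cases r with
  | edge =>
    obtain ⟨s, hs, h⟩ := h₀ (enc Rel.edge)
    exact ⟨1 + s + 1, by omega, fun μ => .iteFalse (.prim .fst _) (h μ)⟩
  | color c =>
    obtain ⟨s, hs, h⟩ := h₁ c
    simp only [zero_add, mul_one] at hs
    exact ⟨_, by omega, fun μ => .iteTrue (.prim .fst _) (by simp [enc, Val.ofRel, Prim.eval]) (.iteTrue
      (.comp (.pair (.prim .fst _) (.prim (.const 1) _)) (.prim .le _))
      (by simp [enc, Val.ofRel, Prim.eval]) (.comp (.prim .snd _) (h μ)))⟩
  | card a r =>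
    obtain ⟨s, hs, h⟩ := h₂ (a, r)
    simp only [zero_add, mul_one] at hs
    exact ⟨_, by omega, fun μ => .iteTrue (.prim .fst _) (by simp [enc, Val.ofRel, Prim.eval]) (.iteFalse
      (.comp (.pair (.prim .fst _) (.prim (.const 1) _)) (.prim .le _)) (.comp (.prim .snd _) (h μ)))⟩

@[fun_prop] lemma TM.relCode : TM Rel.code fun _ => 0 :=
  .relCases (.const 1) (by unfold Rel.code; fun_prop)

@[fun_prop] lemma TM.relColorCode : TM Rel.colorCode fun _ => 0 :=
  .relCases (by unfold Rel.colorCode; fun_prop) (.const 0)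

@[fun_prop] lemma TM.relSize : TM Rel.size fun _ => 0 :=
  .relCases (.const 1) (by unfold Rel.size; fun_prop)

/-- The input, where a weight term is given by its constant and the other coefficients. -/
structure Input where
  b : ℕ
  N : ℕ
  γ : ℕ
  p : ℕ
  q : ℕ
  x : ℕ
  y : ℕ
  k : ℕ
  rels : List Rel
  τ₁ : List (ℕ × List (List ℕ))
  τ₂ : List (ℕ × List (List ℕ))
  target : ℤ × List (List ℤ)
  expr : {e : DExpr // e.Ok}

namespace Input

def toProd (a : Input) : ℕ × ℕ × ℕ × ℕ × ℕ × ℕ × ℕ × ℕ × List Rel × List (ℕ × List (List ℕ)) ×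
    List (ℕ × List (List ℕ)) × (ℤ × List (List ℤ)) × {e : DExpr // e.Ok} × ℕ :=
  (a.b, a.N, a.γ, a.p, a.q, a.x, a.y, a.k, a.rels, a.τ₁, a.τ₂, a.target, a.expr, 0)

instance : Enc Input := ⟨fun a => enc a.toProd⟩

section Access

variable {α : Type} [Enc α] {u : α → ℕ} {f : α → Input}

lemma tm (h : TM f u) : TM (fun a => (f a).toProd) u := h.transfer id (fun _ => rfl) fun _ => rfl

@[fun_prop] lemma tm_b (h : TM f u) : TM (fun a => (f a).b) u := (tm h).fst
@[fun_prop] lemma tm_N (h : TM f u) : TM (fun a => (f a).N) u := (tm h).snd.fst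
@[fun_prop] lemma tm_γ (h : TM f u) : TM (fun a => (f a).γ) u := (tm h).snd.snd.fst
@[fun_prop] lemma tm_q (h : TM f u) : TM (fun a => (f a).q) u := (tm h).snd.snd.snd.snd.fst
@[fun_prop] lemma tm_x (h : TM f u) : TM (fun a => (f a).x) u := (tm h).snd.snd.snd.snd.snd.fst
@[fun_prop] lemma tm_y (h : TM f u) : TM (fun a => (f a).y) u :=
  (tm h).snd.snd.snd.snd.snd.snd.fst
@[fun_prop] lemma tm_k (h : TM f u) : TM (fun a => (f a).k) u :=
  (tm h).snd.snd.snd.snd.snd.snd.snd.fst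
@[fun_prop] lemma tm_rels (h : TM f u) : TM (fun a => (f a).rels) u :=
  (tm h).snd.snd.snd.snd.snd.snd.snd.snd.fst
@[fun_prop] lemma tm_τ₁ (h : TM f u) : TM (fun a => (f a).τ₁) u :=
  (tm h).snd.snd.snd.snd.snd.snd.snd.snd.snd.fst
@[fun_prop] lemma tm_τ₂ (h : TM f u) : TM (fun a => (f a).τ₂) u :=
  (tm h).snd.snd.snd.snd.snd.snd.snd.snd.snd.snd.fst
@[fun_prop] lemma tm_target (h : TM f u) : TM (fun a => (f a).target) u :=
  (tm h).snd.snd.snd.snd.snd.snd.snd.snd.snd.snd.snd.fst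
@[fun_prop] lemma tm_expr (h : TM f u) : TM (fun a => (f a).expr) u :=
  (tm h).snd.snd.snd.snd.snd.snd.snd.snd.snd.snd.snd.snd.fst

end Access

def par (a : Input) : Params := (a.rels.foldl (fun s r => s + r.size) 0, a.k, a.q, a.x + a.y)

def env (a : Input) : Env where
  par := a.par
  grid := if a.τ₁.length + a.τ₂.length = 0 then [] else gridList a.b (a.N * a.γ)
  cap := a.N * a.γ + 1
  terms₁ := (a.τ₁.map Prod.snd).reverse
  terms₂ := a.τ₂.map Prod.snd
  target := a.target.2
  numX := a.x
  colors := a.rels.map Rel.colorCode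

def firstBounds (a : Input) : Bounds := pairsWith Prod.mk a.env.grid a.env.grid

def rootData (a : Input) : RootData :=
  ((a.env, a.rels.map Rel.code, (a.τ₁.map Prod.fst).reverse, a.τ₂.map Prod.fst),
    (a.firstBounds, secondBounds a.firstBounds (numFormulas a.par (a.rels.map Rel.code)) a.τ₂.length,
      treeTable a.env a.expr.1), a.expr.1)

/-- The cost of the program, where `K` bounds parts that only depend on the parameters. -/
def budget (a : Input) (K : ℕ) : ℕ := a.expr.1.size *
  (K * (gridList a.b (a.N * a.γ)).length ^ (3 * a.τ₁.length + a.τ₂.length * K))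

structure Valid (a : Input) : Prop where
  b_pos : 0 < a.b
  pos : 0 < a.N * a.γ
  rels : RelsOk a.par.1 (a.rels.map Rel.code)
  env : EnvOk a.env
  bounded : a.expr.1.Bounded a.par
  numFormulas_pos : 0 < numFormulas a.par (a.rels.map Rel.code)

variable {a : Input} {K i e A v : ℕ}

lemma one_le_size (a : Input) : 1 ≤ a.expr.1.size := by cases a.expr.1 <;> simp [DExpr.size]

lemma Valid.two_le (ha : a.Valid) : 2 ≤ (gridList a.b (a.N * a.γ)).length :=
  two_le_length_gridList ha.b_pos ha.pos

lemma le_budget (ha : a.Valid) (hi : i ≤ 3) (he : e ≤ K) (hA : A ≤ K)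
    (hv : v ≤ a.expr.1.size * (A * (gridList a.b (a.N * a.γ)).length ^
      (i * a.τ₁.length + a.τ₂.length * e))) : v ≤ a.budget K :=
  hv.trans (Nat.mul_le_mul_left _ (Nat.mul_le_mul hA (Nat.pow_le_pow_right
    (by have := ha.two_le; omega) (Nat.add_le_add (Nat.mul_le_mul_right _ hi)
      (Nat.mul_le_mul_left _ he)))))

lemma le_budget' (ha : a.Valid) (hi : i ≤ 3) (he : e ≤ K) (hA : A ≤ K)
    (hv : v ≤ A * (gridList a.b (a.N * a.γ)).length ^ (i * a.τ₁.length + a.τ₂.length * e)) :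
    v ≤ a.budget K :=
  le_budget ha hi he hA (hv.trans (Nat.le_mul_of_pos_left _ a.one_le_size))

def Feasible {β : Type} [Enc β] (f : Input → β) : Prop :=
  ∃ K : Params → ℕ, Primrec K ∧ TMD Valid f fun a => a.budget (K a.par)

section Feasible

variable {β δ : Type} [Enc β] [Enc δ] {f : Input → β}

lemma budget_mono (ha : a.Valid) {K' : ℕ} (h : K ≤ K') : a.budget K ≤ a.budget K' :=
  le_budget ha le_rfl h h le_rfl

lemma Feasible.of_tm {u : Input → ℕ} (h : TM f u) {K : Params → ℕ} (hK : Primrec K)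
    (hu : ∀ a, a.Valid → u a ≤ a.budget (K a.par)) : Feasible f := ⟨K, hK, h.on (.of_le hu)⟩

lemma Feasible.of₀ (h : TM f fun _ => 0) : Feasible f :=
  .of_tm h (Primrec.const 0) fun _ _ => Nat.zero_le _

lemma Feasible.comp {g : β → δ} {E : β → Prop} {w : β → ℕ} (hf : Feasible f) (hg : TMD E g w)
    (hE : ∀ a, a.Valid → E (f a)) {K : Params → ℕ} (hK : Primrec K)
    (hw : ∀ a, a.Valid → w (f a) ≤ a.budget (K a.par)) : Feasible fun a => g (f a) := by
  obtain ⟨K', hK', hf⟩ := hf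
  exact ⟨fun p => K p + K' p, fp, hg.comp (hf.mono (.of_le fun a ha =>
    budget_mono ha (Nat.le_add_left _ _))) hE (.of_le fun a ha => (hw a ha).trans
      (budget_mono ha (Nat.le_add_right _ _)))⟩

lemma Feasible.prodMk {g : Input → δ} (hf : Feasible f) (hg : Feasible g) :
    Feasible fun a => (f a, g a) := by
  obtain ⟨K, hK, hf⟩ := hf
  obtain ⟨K', hK', hg⟩ := hg
  exact ⟨fun p => K p + K' p, fp, .prodMk (hf.mono (.of_le fun a ha =>
    budget_mono ha (Nat.le_add_right _ _))) (hg.mono (.of_le fun a ha =>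
      budget_mono ha (Nat.le_add_left _ _)))⟩

end Feasible

lemma length_grid_le (a : Input) : a.env.grid.length ≤ (gridList a.b (a.N * a.γ)).length := by
  dsimp only [env]
  split_ifs
  · exact Nat.zero_le _
  · exact le_rfl

lemma length_rels_le (ha : a.Valid) : a.rels.length ≤ a.par.1 := by simpa using ha.rels.1

lemma length_terms_le (ha : a.Valid) (hK : 3 ≤ K) :
    a.τ₁.length + a.τ₂.length ≤ a.budget K := by
  refine le_budget' ha (i := 1) (e := 1) (A := 1) (by omega) (by omega) (by omega) ?_
  rw [one_mul, one_mul, mul_one]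
  exact (Nat.lt_pow_self ha.two_le).le

lemma cube_le_budget (ha : a.Valid) (h : a.τ₁.length + a.τ₂.length ≠ 0) (hK : 3 ≤ K) :
    (gridList a.b (a.N * a.γ)).length ^ 3 ≤ a.budget K := by
  refine le_budget' ha (i := 3) (e := 3) (A := 1) le_rfl hK (by omega) ?_
  rw [one_mul]
  have := ha.two_le
  exact Nat.pow_le_pow_right (by omega) (by omega)

lemma feasible_rels {β : Type} [Enc β] {g : Rel → β} (hg : TM g fun _ => 0) :
    Feasible fun a => a.rels.map g :=
  .of_tm (u := fun a => a.rels.length) (.map₁ fp fp .refl) (K := fun p => p.1)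
    fp fun a ha => le_budget' ha (Nat.zero_le 3) (Nat.zero_le _) le_rfl
      (by simpa using length_rels_le ha)

lemma feasible_terms₁ {β : Type} [Enc β] {g : ℕ × List (List ℕ) → β} (hg : TM g fun _ => 0) :
    Feasible fun a => (a.τ₁.map g).reverse :=
  .of_tm (u := fun a => a.τ₁.length) (.reverse (.map₁ fp fp .refl)
    (.of_le fun a => by simp)) (K := fun _ => 3) fp fun a ha =>
      (Nat.le_add_right _ _).trans (length_terms_le ha le_rfl)

lemma feasible_terms₂ {β : Type} [Enc β] {g : ℕ × List (List ℕ) → β} (hg : TM g fun _ => 0) :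
    Feasible fun a => a.τ₂.map g :=
  .of_tm (u := fun a => a.τ₂.length) (.map₁ fp fp .refl) (K := fun _ => 3)
    fp fun a ha => (Nat.le_add_left _ _).trans (length_terms_le ha le_rfl)

lemma feasible_par : Feasible par := by
  refine .of_tm (u := fun a => a.rels.length) (.prodMk (TM.foldl₁ fp fp
    fp .refl) fp) (K := fun p => p.1) fp fun a ha => ?_
  exact le_budget' ha (Nat.zero_le 3) (Nat.zero_le _) le_rfl (by simpa using length_rels_le ha)

lemma feasible_grid : Feasible fun a => a.env.grid := by
  refine ⟨fun _ => 3, fp, .ite_of (.comp₀ (g := fun m => decide (m = 0)) fp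
    (TM.on (v := fun a => a.τ₁.length + a.τ₂.length) (TM.natAdd.comp (.prodMk (.length fp
      (.of_le fun a => by simp)) (.length fp (.of_le fun a => by simp))))
        (.of_le fun a ha => length_terms_le ha le_rfl)))
      TM.on₀ (TMD.gridList.app (fun a : Input => (a.b, a.N * a.γ)) (fun a ha => ⟨ha.1.b_pos, ha.1.pos⟩) (.of_le fun a ha => ?_))⟩
  exact cube_le_budget ha.1 ha.2 le_rfl

lemma feasible_env : Feasible env := by
  obtain ⟨K, hK, v, h, h'⟩ := feasible_par.prodMk (feasible_grid.prodMk (.prodMk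
    (f := fun a : Input => a.N * a.γ + 1) (.of₀ fp)
    ((feasible_terms₁ (g := Prod.snd) fp).prodMk
    ((feasible_terms₂ (g := Prod.snd) fp).prodMk (.prodMk
      (f := fun a : Input => a.target.2) (.of₀ fp) (.prodMk (f := fun a : Input => a.x)
        (.of₀ fp) (feasible_rels TM.relColorCode)))))))
  exact ⟨K, hK, v, h.transfer id (fun _ => rfl) fun _ => rfl, h'⟩

lemma length_firstBounds (a : Input) : a.firstBounds.length = a.env.grid.length ^ 2 := by
  rw [firstBounds, length_pairsWith, sq]

lemma feasible_firstBounds : Feasible firstBounds := by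
  refine feasible_grid.comp (E := fun _ => True) (w := fun l => l.length * (l.length * (0 + 1) + 1))
    (g := fun l => pairsWith Prod.mk l l) (.pairsWith (E := fun _ => True) (h := fun _ => Prod.mk)
      (w := fun _ => 0) TM.on₀ TM.on₀ TM.on₀
      (fun _ => 0) (fun _ _ _ _ _ _ => ⟨trivial, le_rfl⟩) .refl) (fun _ _ => trivial)
    (K := fun _ => 3) fp fun a ha => ?_
  by_cases h : a.τ₁.length + a.τ₂.length = 0
  · simp [env, h]
  · refine le_trans ?_ (cube_le_budget ha h le_rfl)
    have h1 := a.length_grid_le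
    have h2 := ha.two_le
    calc _ ≤ _ := Nat.mul_le_mul h1 (Nat.succ_le_succ (Nat.mul_le_mul_right _ h1))
      _ ≤ _ := by
        rw [zero_add, mul_one, pow_succ']
        exact Nat.mul_le_mul_left _ (by nlinarith)

lemma exists_numFormulas_le : ∃ g : Params → ℕ, Primrec g ∧
    Feasible (fun a => numFormulas a.par (a.rels.map Rel.code)) ∧
      ∀ a : Input, a.Valid → numFormulas a.par (a.rels.map Rel.code) ≤ g a.par := by
  obtain ⟨g, h1, h2, h3⟩ := exists_numFormulas
  exact ⟨g, h1, (feasible_par.prodMk (feasible_rels TM.relCode)).comp h2 (fun a ha => ha.rels) h1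
    fun a ha => le_budget' ha (Nat.zero_le 3) (Nat.zero_le _) le_rfl (by simp),
    fun a ha => h3 _ _ ha.rels⟩

lemma length_secondBounds (P : Bounds) (c m : ℕ) : (secondBounds P c m).length = P.length ^ (c * m) := by
  rw [secondBounds]
  split_ifs with h
  · simp [h]
  · rw [length_tuples, length_tuples, pow_mul]

lemma length_secondBounds_le (ha : a.Valid) {c g : ℕ} (hc : c ≤ g) (m : ℕ) :
    (secondBounds a.firstBounds c m).length ≤ (gridList a.b (a.N * a.γ)).length ^ (m * (2 * g)) := by
  rw [length_secondBounds, length_firstBounds, ← pow_mul]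
  refine (Nat.pow_le_pow_left a.length_grid_le _).trans (Nat.pow_le_pow_right
    (by have := ha.two_le; omega) ?_)
  nlinarith [Nat.mul_le_mul_left m hc]

lemma two_le_length_firstBounds (ha : a.Valid) (h : a.τ₁.length + a.τ₂.length ≠ 0) :
    2 ≤ a.firstBounds.length := by
  rw [length_firstBounds, env]
  simp only [h, if_false]
  nlinarith [ha.two_le]

lemma feasible_secondBounds : Feasible fun a => secondBounds a.firstBounds
    (numFormulas a.par (a.rels.map Rel.code)) a.τ₂.length := by
  obtain ⟨g, h1, h2, h3⟩ := exists_numFormulas_le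
  refine (feasible_firstBounds.prodMk (h2.prodMk (.of_tm (f := fun a => a.τ₂.length)
    (u := fun a => a.τ₂.length) (.length fp .refl) (K := fun _ => 3) fp
    fun a ha => (Nat.le_add_left _ _).trans (length_terms_le ha le_rfl)))).comp TMD.secondBounds
    (fun a ha h => ⟨two_le_length_firstBounds ha (by dsimp only at h; omega), ha.numFormulas_pos⟩)
    (K := fun p => 2 * g p + 1) fp fun a ha => ?_
  refine le_budget' ha (i := 0) (e := 2 * g a.par) (A := 1) (by omega) (by omega) (by omega) ?_
  rw [← length_secondBounds, one_mul, zero_mul, zero_add]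
  exact length_secondBounds_le ha (h3 a ha) _

/-- The part of the number of states that only depends on the parameters. -/
def statesConst (p : Params) : ℕ :=
  2 ^ p.2.2.2 + (tyBound p p.2.2.1 + 1) * tyBound p p.2.2.1 ^ tyBound p p.2.2.1

lemma primrec_statesConst : Primrec statesConst := by
  unfold statesConst
  fun_prop

lemma maxStates_le (ha : a.Valid) : a.env.maxStates ≤ statesConst a.par *
    (gridList a.b (a.N * a.γ)).length ^ (a.τ₁.length + a.τ₂.length * (4 * tyBound a.par a.q)) := by
  have h1 := a.length_grid_le
  have h2 := ha.two_le
  have e1 : a.env.terms₁.length = a.τ₁.length := by simp [env]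
  have e2 : a.env.terms₂.length = a.τ₂.length := by simp [env]
  have e3 : a.env.tb = tyBound a.par a.q := rfl
  rw [Env.maxStates, e1, e2, e3, statesConst]
  change 2 ^ a.x + _ ≤ (2 ^ (a.x + a.y) + (tyBound a.par a.q + 1) * tyBound a.par a.q ^ tyBound a.par a.q) * _
  generalize tyBound a.par a.q = t
  generalize (gridList a.b (a.N * a.γ)).length = n at *
  have h3 : (a.env.grid.length + 1) ^ 2 ≤ n ^ 4 := by
    rw [show n ^ 4 = (n ^ 2) ^ 2 by ring]
    exact Nat.pow_le_pow_left (by nlinarith) 2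
  rw [add_mul (2 ^ (a.x + a.y))]
  have h4 : 0 < n := by omega
  refine Nat.add_le_add ((Nat.pow_le_pow_right two_pos (Nat.le_add_right _ _)).trans
    (Nat.le_mul_of_pos_right _ (Nat.pow_pos h4))) ?_
  calc _ ≤ n ^ a.τ₁.length * ((t + 1) * (t * (n ^ 4) ^ a.τ₂.length) ^ t) := by gcongr
    _ = _ := by
      rw [mul_pow, ← pow_mul, ← pow_mul, pow_add]
      ring_nf

lemma quota_le (ha : a.Valid) : a.env.quota ≤
    3 * (gridList a.b (a.N * a.γ)).length ^ (a.τ₁.length + a.τ₂.length) := by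
  have h1 := a.length_grid_le
  have h2 := ha.two_le
  have e1 : a.env.terms₁.length = a.τ₁.length := by simp [env]
  have e2 : a.env.terms₂.length = a.τ₂.length := by simp [env]
  rw [Env.quota, e1, e2]
  generalize (gridList a.b (a.N * a.γ)).length = n at *
  rcases a.τ₁.length + a.τ₂.length with _ | m
  · simp
  · have h3 : m + 1 ≤ n ^ m := Nat.lt_pow_self h2
    rw [pow_succ]
    nlinarith [Nat.mul_le_mul h3 (show a.env.grid.length + 1 ≤ 2 * n by omega)]

lemma opTime_le (ha : a.Valid) (g : ℕ) : a.env.opTime g ≤ statesConst a.par * statesConst a.par *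
    (3 * g + statesConst a.par) * (gridList a.b (a.N * a.γ)).length ^
      (3 * a.τ₁.length + a.τ₂.length * (12 * tyBound a.par a.q + 1)) := by
  have h1 := maxStates_le ha
  have h2 := quota_le ha
  have h3 := ha.two_le
  rw [Env.opTime]
  generalize statesConst a.par = M at *
  generalize tyBound a.par a.q = t at *
  generalize (gridList a.b (a.N * a.γ)).length = n at *
  have h4 : g * a.env.quota + a.env.maxStates ≤
      (3 * g + M) * n ^ (a.τ₁.length + a.τ₂.length * (4 * t + 1)) := by
    rw [add_mul]
    refine Nat.add_le_add ((Nat.mul_le_mul_left g h2).trans ?_) (h1.trans (Nat.mul_le_mul_left _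
      (Nat.pow_le_pow_right (by omega) (by nlinarith))))
    rw [mul_left_comm, mul_assoc]
    exact Nat.mul_le_mul_left _ (Nat.mul_le_mul_left _ (Nat.pow_le_pow_right (by omega) (by nlinarith)))
  calc _ ≤ _ := Nat.mul_le_mul (Nat.mul_le_mul h1 h1) h4
    _ = _ := by
      rw [show 3 * a.τ₁.length + a.τ₂.length * (12 * t + 1) = (a.τ₁.length + a.τ₂.length * (4 * t)) +
        (a.τ₁.length + a.τ₂.length * (4 * t)) + (a.τ₁.length + a.τ₂.length * (4 * t + 1)) by ring,
        pow_add, pow_add]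
      ring

lemma feasible_treeTable : Feasible fun a => treeTable a.env a.expr.1 := by
  obtain ⟨g, h1, h2⟩ := exists_treeTable
  have h3 : Feasible fun a => (⟨(a.env, a.expr.1), a.expr.2⟩ : {p : Env × DExpr // p.2.Ok}) := by
    obtain ⟨K, hK, v, h, h'⟩ := feasible_env.prodMk (.of₀ (f := fun a : Input => a.expr.1) fp)
    exact ⟨K, hK, v, h.transfer id (fun _ => rfl) fun _ => rfl, h'⟩
  refine h3.comp h2 (fun a ha => ⟨ha.env, ha.bounded⟩) (K := fun p => statesConst p * statesConst p *
    (3 * g p + statesConst p) + 1 + (12 * tyBound p p.2.2.1 + 1))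
    (by have := primrec_statesConst; fun_prop) fun a ha => ?_
  refine le_budget ha le_rfl (Nat.le_add_left _ _) (Nat.le_add_right _ _) (Nat.mul_le_mul_left _ ?_)
  rw [add_mul]
  have := ha.two_le
  exact Nat.add_le_add (opTime_le ha _) (Nat.mul_pos one_pos (by positivity))

lemma feasible_rootData : Feasible rootData :=
  .prodMk (feasible_env.prodMk ((feasible_rels TM.relCode).prodMk ((feasible_terms₁ fp).prodMk
    (feasible_terms₂ fp)))) (.prodMk (feasible_firstBounds.prodMk
      (feasible_secondBounds.prodMk feasible_treeTable)) (.of₀ fp))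

def output (a : Input) : Output :=
  rootTable a.env (a.rels.map Rel.code) (a.τ₁.map Prod.fst).reverse (a.τ₂.map Prod.fst) a.firstBounds
    (secondBounds a.firstBounds (numFormulas a.par (a.rels.map Rel.code)) a.τ₂.length)
    (treeTable a.env a.expr.1)

lemma rootOk (ha : a.Valid) : RootOk a.rootData where
  rels := ha.rels
  numX := Nat.le_add_right _ _
  grid := by
    by_cases h : a.τ₁ = []
    · exact Or.inl (by simp [rootData, h])
    · exact Or.inr (two_le_length_firstBounds ha (by have := length_pos_iff.2 h; omega))
  table e he := ⟨((tableOk_treeTable ha.bounded ha.env.zero_mem).state e he).assoc,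
    size_treeTable _ _ e he⟩

lemma feasible_output : Feasible output := by
  obtain ⟨g, h1, h2⟩ := exists_rootTable
  obtain ⟨g', h3, h4, h5⟩ := exists_numFormulas_le
  refine feasible_rootData.comp h2 (fun a => rootOk) (K := fun p => 2 * g p * (statesConst p + 2) +
    (2 * g' p + 4 * tyBound p p.2.2.1 + 1)) (by have := primrec_statesConst; fun_prop) fun a ha => ?_
  refine le_budget ha le_rfl (Nat.le_add_left _ _) (Nat.le_add_right _ _) ?_
  have h6 := (tableOk_treeTable ha.bounded ha.env.zero_mem).len.trans (maxStates_le ha)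
  have h7 := length_secondBounds_le ha (h5 a ha) a.τ₂.length
  have h8 := a.length_firstBounds.le.trans (Nat.pow_le_pow_left a.length_grid_le 2)
  have h9 := ha.two_le
  have h10 := a.one_le_size
  simp only [rootData, length_map, length_reverse]
  change _ * (_ * (g a.par * _)) ≤ _
  generalize statesConst a.par = M at *
  generalize g a.par = G at *
  generalize g' a.par = c at *
  rw [show tyBound a.par a.par.2.2.1 = tyBound a.par a.q from rfl]
  generalize tyBound a.par a.q = t at *
  generalize (gridList a.b (a.N * a.γ)).length = n at *
  generalize (treeTable a.env a.expr.1).length = T at *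
  generalize (secondBounds _ _ _).length = S at *
  generalize a.firstBounds.length = F at *
  generalize a.expr.1.size = s at *
  generalize a.τ₁.length = m at *
  generalize a.τ₂.length = r at *
  have hn : 0 < n := by omega
  have i1 : S + 1 ≤ 2 * n ^ (r * (2 * c)) := by have := Nat.pow_pos (n := r * (2 * c)) hn; omega
  have i2 : (T + 1) * (r + 1) + s ≤ s * ((M + 2) * n ^ (m + r * (4 * t + 1))) := by
    have i3 : T + 1 ≤ (M + 1) * n ^ (m + r * (4 * t)) := by
      have := Nat.pow_pos (n := m + r * (4 * t)) hn
      nlinarith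
    have i4 : (T + 1) * (r + 1) ≤ (M + 1) * n ^ (m + r * (4 * t + 1)) := by
      refine (Nat.mul_le_mul i3 (Nat.lt_pow_self h9)).trans_eq ?_
      rw [mul_assoc, ← pow_add]
      ring_nf
    have i5 := Nat.pow_pos (n := m + r * (4 * t + 1)) hn
    generalize n ^ (m + r * (4 * t + 1)) = X at *
    have i6 := Nat.mul_le_mul h10 i4
    nlinarith [Nat.mul_le_mul_left s i5]
  calc _ ≤ (n ^ 2) ^ m * (2 * n ^ (r * (2 * c)) * (G * (s * ((M + 2) * n ^ (m + r * (4 * t + 1)))))) := by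
        gcongr
    _ = s * (2 * G * (M + 2) * n ^ (3 * m + r * (2 * c + 4 * t + 1))) := by
      rw [← pow_mul, show 3 * m + r * (2 * c + 4 * t + 1) = 2 * m + r * (2 * c) + (m + r * (4 * t + 1)) by ring,
        pow_add n (2 * m + r * (2 * c)), pow_add n (2 * m)]
      ring
    _ ≤ _ := Nat.mul_le_mul_left _ (Nat.mul_le_mul_left _ (Nat.pow_le_pow_right hn (by rfl)))

end Input

section Main

variable {p x y m₁ m₂ k n : ℕ} {b N γ : ℕ} {σ : Signature} {q : ℕ} {τ₁ : Fin m₁ → WTerm ℝ p x}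
  {τ₂ : Fin m₂ → WTerm ℝ p (x + y)} {target : WTerm ℤ p x} {G : WGraph p n} {χ : KExpr k n}

local notation "𝓟" => (σ.size, k, q, x + y)
local notation "𝓔" => inputEnv b N γ σ q k τ₁ τ₂ target

def inputTerms {m l : ℕ} (γ : ℕ) (τ : Fin m → WTerm ℝ p l) : List (ℕ × List (List ℕ)) :=
  (finRange m).map fun i => (num γ (τ i).const, ((τ i).numer γ).coeffs)

def toInput (b N γ : ℕ) (σ : Signature) (q : ℕ) (τ₁ : Fin m₁ → WTerm ℝ p x)
    (τ₂ : Fin m₂ → WTerm ℝ p (x + y)) (target : WTerm ℤ p x) (G : WGraph p n) (χ : KExpr k n) :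
    Input where
  b := b
  N := N
  γ := γ
  p := p
  q := q
  x := x
  y := y
  k := k
  rels := σ.rels
  τ₁ := inputTerms γ τ₁
  τ₂ := inputTerms γ τ₂
  target := (target.const, target.coeffs)
  expr := ⟨χ.toD σ G, χ.toD_ok σ G⟩

local notation "𝓘" => toInput b N γ σ q τ₁ τ₂ target G χ

lemma enc_coeffs {R : Type} [Enc R] {l : ℕ} (t : WTerm R p l) :
    Val.pair (enc t.const) (enc t.coeffs) = Val.ofTerm enc t := by
  simp [WTerm.coeffs, enc_map, Val.ofTerm]

lemma enc_inputTerms {m l : ℕ} (hγ : 0 < γ) {τ : Fin m → WTerm ℝ p l}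
    (h : ∀ i, (τ i).IsGranular γ) : enc (inputTerms γ τ) =
      Val.ofList ((finRange m).map fun i => Val.ofTerm (Val.ofGranular γ) (τ i)) := by
  rw [inputTerms, enc_map]
  congr 1
  refine map_congr_left fun i _ => ?_
  refine (enc_coeffs ((τ i).numer γ)).trans ?_
  simp only [Val.ofTerm, WTerm.numer, enc_num hγ (h i).1, enc_num hγ ((h i).2 _ _)]

lemma enc_toInput (hγ : 0 < γ) (h₁ : ∀ i, (τ₁ i).IsGranular γ) (h₂ : ∀ i, (τ₂ i).IsGranular γ) :
    enc 𝓘 = Val.ofInput b N γ σ q τ₁ τ₂ target G χ := by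
  rw [Val.ofInput, ← enc_inputTerms hγ h₁, ← enc_inputTerms hγ h₂, ← KExpr.enc_toD,
    show Val.ofTerm .num target = Val.ofTerm enc target from rfl, ← enc_coeffs]
  rfl

lemma par_toInput : (𝓘).par = 𝓟 := by
  simp only [Input.par, toInput, Signature.size, sum_eq_foldl_nat, foldl_map]

lemma env_toInput : (𝓘).env = 𝓔 := by
  rw [Input.env, par_toInput]
  simp [toInput, inputEnv, inputTerms, Function.comp_def]

lemma output_toInput : (𝓘).output =
    rootTable 𝓔 (σ.rels.map Rel.code)
        (constants γ τ₁).reverse (constants γ τ₂)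
        (pairsWith Prod.mk (𝓔).grid
          (𝓔).grid)
        (secondBounds (pairsWith Prod.mk (𝓔).grid
          (𝓔).grid)
          (numFormulas 𝓟 (σ.rels.map Rel.code)) m₂)
        (treeTable 𝓔 (χ.toD σ G)) := by
  rw [Input.output, Input.firstBounds, env_toInput, par_toInput]
  simp [toInput, inputTerms, constants, Function.comp_def]

lemma valid_toInput (hb : 0 < b) (hN : 0 < N) (hγ : 0 < γ) (hp : p ≤ x + y) :
    (𝓘).Valid where
  b_pos := hb
  pos := Nat.mul_pos hN hγ
  rels := by
    rw [par_toInput]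
    refine ⟨(length_map _).trans_le σ.length_le_size, fun r hr => ?_⟩
    obtain ⟨r, hm, rfl⟩ := mem_map.1 hr
    change r ∈ σ.rels at hm
    cases r with
    | edge => simp [Rel.code]
    | color c => simp [Rel.code]
    | card a r =>
      have h1 := σ.le_size hm
      have h2 := (σ.valid a r hm).1
      have := pair_le_pair (h2.le.trans h1) h1
      simp only [Rel.code]
      omega
  env := by
    rw [env_toInput]
    have hl : ∀ {R : Type} {l : ℕ} (t : WTerm R p l), l ≤ x + y →
        t.coeffs.length ≤ x + y ∧ ListsLe t.coeffs (x + y) := fun t h =>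
      ⟨t.length_coeffs.trans_le h, fun c hc => (t.listsLe_coeffs c hc).trans hp⟩
    refine ⟨fun h => ?_, Nat.le_add_right _ _, (length_map _).trans_le σ.length_le_size,
      fun cs h => ?_, fun cs h => ?_, hl _ (Nat.le_add_right _ _)⟩
    · rw [inputEnv, if_neg (by simp [inputEnv] at h; omega)]
      exact zero_mem_gridList hb _
    · obtain ⟨i, _, rfl⟩ := mem_map.1 (mem_reverse.1 h)
      exact hl _ (Nat.le_add_right _ _)
    · obtain ⟨i, _, rfl⟩ := mem_map.1 h
      exact hl _ le_rfl
  bounded := by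
    rw [par_toInput]
    exact χ.bounded_toD σ G _ _
  numFormulas_pos := by
    rw [par_toInput, show (𝓘).rels = σ.rels from rfl,
      numFormulas_eq σ p rfl rfl]
    obtain ⟨ψ, hψ, _⟩ := Formula.cmso_complete σ (.verum : Formula p 0 (x + y)) q trivial
      (Nat.zero_le _)
    exact length_pos_of_mem hψ

lemma budget_toInput_le (hb : 0 < b) (hN : 0 < N) (hγ : 0 < γ) {K F c : ℕ} (L C : ℕ) (hc : 0 < c)
    (hF : F = (L + 1) * (2 * C + 1) * (K + 1)) :
    L * (C * ((𝓘).budget K + 1) + 1) ≤ χ.size * F *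
      (roundedN (1 + 1 / (b : ℝ)) N (γ * c)).ncard ^ (3 * m₁ + m₂ * F) := by
  have h1 := length_gridList_le hb (M := N * γ) hc
  have h2 := two_le_length_gridList hb (Nat.mul_pos hN hγ)
  have h3 : K ≤ F := by rw [hF]; nlinarith [Nat.zero_le (L * C * (K + 1)), Nat.zero_le (L * (K + 1))]
  have h4 : 1 ≤ χ.size := by cases χ <;> simp [KExpr.size]
  have h5 : (𝓘).budget K ≤ χ.size * (K *
      (roundedN (1 + 1 / (b : ℝ)) N (γ * c)).ncard ^ (3 * m₁ + m₂ * F)) := by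
    rw [ncard_roundedN hb (Nat.mul_pos hγ hc), ← mul_assoc N γ c, Input.budget,
      show (𝓘).expr.1.size = χ.size from χ.size_toD σ G]
    refine Nat.mul_le_mul_left _ (Nat.mul_le_mul_left _ ((Nat.pow_le_pow_left h1 _).trans
      (Nat.pow_le_pow_right (by omega) ?_)))
    simpa [toInput, inputTerms] using Nat.mul_le_mul_left m₂ h3
  have h6 : 1 ≤ (roundedN (1 + 1 / (b : ℝ)) N (γ * c)).ncard ^ (3 * m₁ + m₂ * F) := by
    rw [ncard_roundedN hb (Nat.mul_pos hγ hc), ← mul_assoc N γ c]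
    exact Nat.pow_pos (by omega)
  generalize (roundedN (1 + 1 / (b : ℝ)) N (γ * c)).ncard ^ (3 * m₁ + m₂ * F) = X at *
  generalize (𝓘).budget K = B at *
  have h7 : B + 1 ≤ (K + 1) * (χ.size * X) := by nlinarith [Nat.mul_le_mul h4 h6]
  calc _ ≤ (L + 1) * ((2 * C + 1) * (B + 1)) := Nat.mul_le_mul (by omega) (by nlinarith)
    _ ≤ (L + 1) * ((2 * C + 1) * ((K + 1) * (χ.size * X))) := by gcongr
    _ = _ := by rw [hF]; ring

end Main

end ApproxMSO

end

open ApproxMSO in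
theorem theorem8p1 :
    ∃ (prog : Code) (f : ℕ × ℕ × ℕ × ℕ → ℕ), Computable f ∧
      ∀ (b N γ : ℕ), 0 < b → 0 < N → 0 < γ →
      ∀ (σ : Signature) (q p x y m₁ m₂ : ℕ), p ≤ x + y →
      ∀ (τ₁ : Fin m₁ → WTerm ℝ p x) (τ₂ : Fin m₂ → WTerm ℝ p (x + y)),
        (∀ i, (τ₁ i).IsGranular γ) → (∀ i, (τ₂ i).IsGranular γ) →
      ∀ (target : WTerm ℤ p x) (n k : ℕ) (G : WGraph p n) (χ : KExpr k n), χ.Builds G.graph →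
      ∃ witness : TableFormula p σ q x y m₁ m₂ → Option (Fin x → Finset (Fin n)),
        (∀ ω ∈ approxTable p (1 + 1 / (b : ℝ)) N γ σ q x y m₁ m₂,
          oversatisfy G (ω.toFormula τ₁ τ₂) target ((1 + 1 / (b : ℝ)) ^ χ.depth) ≤
            targetValue G target (witness ω) ∧
          ∀ W, witness ω = some W →
            (ω.toFormula τ₁ τ₂).Undersat G ((1 + 1 / (b : ℝ)) ^ χ.depth) W) ∧
        ∃ (out : Val) (steps : ℕ),
          prog.HaltsWith (Val.ofInput b N γ σ q τ₁ τ₂ target G χ) out steps ∧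
          out.IsTable γ (approxTable p (1 + 1 / (b : ℝ)) N γ σ q x y m₁ m₂) witness ∧
          steps ≤ χ.size * f (σ.size, k, q, x + y) *
            (roundedN (1 + 1 / (b : ℝ)) N
              (γ * (b * (b + 1)) ^ (4 * χ.depth ^ 2 + 4 * χ.depth))).ncard ^
            (3 * m₁ + m₂ * f (σ.size, k, q, x + y)) := by
  obtain ⟨K, hK, v, ⟨c, L, hc⟩, C, hC⟩ := Input.feasible_output
  refine ⟨c, fun p => (L + 1) * (2 * C + 1) * (K p + 1), Primrec.to_comp (by fun_prop), ?_⟩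
  intro b N γ hb hN hγ σ q p x y m₁ m₂ hp τ₁ τ₂ h₁ h₂ target n k G χ hχ
  obtain ⟨witness, h3, h4⟩ := rootTable_correct (q := q) (target := target) hb hγ h₁ h₂ hχ
  obtain ⟨s, hs, h⟩ := hc (toInput b N γ σ q τ₁ τ₂ target G χ)
  rw [enc_toInput hγ h₁ h₂, output_toInput] at h
  refine ⟨witness, h3, _, s, h c, h4, hs.trans ((Nat.mul_le_mul_left L (Nat.succ_le_succ (hC _
    (valid_toInput hb hN hγ hp)))).trans ?_)⟩
  beta_reduce
  rw [par_toInput]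
  exact budget_toInput_le hb hN hγ L C (by positivity) rfl
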